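/- Let $K$ be a number field with set of places $M_K$. For $v\in M_K$ let $\mathbb{C}_v$ be the completion of an algebraic closure of the completion $K_v$, with the absolute value $|\cdot|_v$ that extends the usual real or $p$-adic absolute value of $\mathbb{Q}$, let $r_v=[K_v:\mathbb{Q}_v]/[K:\mathbb{Q}]$, and let $\mathbf{P}^1_v$ be the Berkovich projective line over $\mathbb{C}_v$ (the Riemann sphere if $v$ is archimedean). Let $\|x,y\|_v$ be the chordal metric $\frac{|x-y|}{\sqrt{1+|x|^2}\sqrt{1+|y|^2}}$ (extended to $\infty$) if $v$ is archimedean, and the spherical kernel on $\mathbf{P}^1_v$, i.e. the standard extension of the chordal metric $\frac{|x-y|_v}{\max(1,|x|_v)\max(1,|y|_v)}$ of $\mathbb{P}^1(\mathbb{C}_v)$, if $v$ is non-archimedean. Let $\zeta_{\mathrm{Gauss}}$ be the Gauss point. Let $\mathcal{A}_K$ be the complex vector space of the families $\mu=(\mu_v)_{v\in M_K}$ such that * each $\mu_v$ is a complex Radon measure (of finite total variation) on $\mathbf{P}^1_v$, and there is $c_\mu\in\mathbb{C}$ with $\mu_v(\mathbf{P}^1_v)=c_\mu$ for all $v$; *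 $\mu_v=c_\mu\,\delta_{\zeta_{\mathrm{Gauss}}}$ for all but finitely many places $v$; * for every $v$ and every $x\in\mathbf{P}^1_v$ the function $y\mapsto\log\frac{1}{\|x,y\|_v}$ is $|\mu_v|$-integrable, and the potential $U_{\mu,v}(x)=\int\log\frac{1}{\|x,y\|_v}\,d\mu_v(y)$ is continuous on $\mathbf{P}^1_v$. For $\mu,\nu\in\mathcal{A}_K$ put $$\langle\mu_v,\nu_v\rangle_v=\int_{\mathbf{P}^1_v}\int_{\mathbf{P}^1_v}\log\frac{1}{\|x,y\|_v}\,d\mu_v(x)\,d\overline{\nu_v}(y),\qquad \langle\mu,\nu\rangle=\sum_{v\in M_K}r_v\langle\mu_v,\nu_v\rangle_v,\qquad \|\mu\|=\sqrt{\langle\mu,\mu\rangle}.$$ Let $\mathrm{BDV}_v$ be the space of functions $f:\mathbf{P}^1_v\to\mathbb{R}$ of bounded differential variation: for archimedean $v$, those whose distributional Laplacian is a signed Radon measure; for non-archimedean $v$ (Baker--Rumely), those whose directional derivatives exist on every finite subgraph $\Gamma$ of $\mathbf{P}^1_v\setminus\mathbb{P}^1(\mathbb{C}_v)$ and whose Laplacians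 on the finite metrized graphs $\Gamma$ are measures of total variation bounded independently of $\Gamma$. **Theorem.** Only finitely many terms of the sum $\langle\mu,\nu\rangle$ are non-zero, and $(\mu,\nu)\mapsto\langle\mu,\nu\rangle$ is a (positive definite, Hermitian) inner product on $\mathcal{A}_K$, linear in $\mu$. Moreover, let $\mu_n,\mu\in\mathcal{A}_K$ with $\|\mu_n-\mu\|\to0$, and let $v\in M_K$. 1. $\int f\,d\mu_{n,v}\to\int f\,d\mu_v$ for every continuous $f\in\mathrm{BDV}_v$. 2. If in addition $\sup_n|\mu_{n,v}|(\mathbf{P}^1_v)<\infty$, then $\mu_{n,v}\to\mu_v$ weakly, i.e. $\int f\,d\mu_{n,v}\to\int f\,d\mu_v$ for every continuous $f:\mathbf{P}^1_v\to\mathbb{C}$. -/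

import Mathlib

open MeasureTheory Filter Topology Set NumberField IsDedekindDomain
open scoped Polynomial ContDiff InnerProductSpace

noncomputable section

/-! ### The Berkovich affine line over a non-archimedean field -/

namespace Berkovich

variable (C : Type*) [NormedField C]

/-- The Berkovich affine line over `C`: the multiplicative seminorms on `C[T]` that extend the
absolute value of `C`. -/
def AffineLine : Type _ :=
  {x : MulRingSeminorm C[X] // ∀ c : C, x (Polynomial.C c) = ‖c‖}

/-- The topology of pointwise convergence of seminorms. -/
instance : TopologicalSpace (AffineLine C) :=
  TopologicalSpace.induced (fun x (f : C[X]) => x.1 f) inferInstance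

variable {C}

theorem AffineLine.isEmbedding :
    IsEmbedding (fun (x : AffineLine C) (f : C[X]) => x.1 f) :=
  ⟨⟨rfl⟩, fun _ _ h => Subtype.ext (DFunLike.coe_injective h)⟩

instance : T2Space (AffineLine C) := AffineLine.isEmbedding.t2Space

theorem AffineLine.apply_le (x : AffineLine C) {R : ℝ} (hR : x.1 Polynomial.X ≤ R) (f : C[X]) :
    x.1 f ≤ ∑ i ∈ f.support, ‖f.coeff i‖ * R ^ i := by
  conv_lhs => rw [f.as_sum_support_C_mul_X_pow]
  refine (Finset.le_sum_of_subadditive x.1 (map_zero x.1).le (map_add_le_add x.1) _ _).trans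
    (Finset.sum_le_sum fun i _ => ?_)
  rw [map_mul, x.2, map_pow]
  have := apply_nonneg x.1 (Polynomial.X : C[X])
  gcongr

theorem AffineLine.isCompact_le (R : ℝ) :
    IsCompact {x : AffineLine C | x.1 Polynomial.X ≤ R} := by
  rw [AffineLine.isEmbedding.isCompact_iff]
  have hK : IsCompact (Set.univ.pi fun f : C[X] =>
      Set.Icc (0 : ℝ) (∑ i ∈ f.support, ‖f.coeff i‖ * R ^ i)) :=
    isCompact_univ_pi fun f => isCompact_Icc
  refine hK.of_isClosed_subset (s := _) ?_ ?_
  · have : (fun (x : AffineLine C) (f : C[X]) => x.1 f) '' {x | x.1 Polynomial.X ≤ R} =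
        {g : C[X] → ℝ | (∀ a b, g (a + b) ≤ g a + g b) ∧ (∀ a, g (-a) = g a) ∧
          (∀ a b, g (a * b) = g a * g b) ∧ (∀ c, g (Polynomial.C c) = ‖c‖) ∧
          g Polynomial.X ≤ R} := by
      ext g
      constructor
      · rintro ⟨x, hx, rfl⟩
        exact ⟨map_add_le_add x.1, map_neg_eq_map x.1, map_mul x.1, x.2, hx⟩
      · rintro ⟨h1, h2, h3, h4, h5⟩
        have h6 : g 0 = 0 := by simpa using h4 0
        have h7 : g 1 = 1 := by simpa using h4 1
        exact ⟨⟨MulRingSeminorm.mk ⟨g, h6, h1, h2⟩ h7 h3, h4⟩, h5, rfl⟩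
    rw [this]
    simp only [Set.ofPred_and, Set.ofPred_forall]
    refine IsClosed.inter ?_ (IsClosed.inter ?_ (IsClosed.inter ?_ (IsClosed.inter ?_ ?_)))
    · exact isClosed_iInter fun a => isClosed_iInter fun b =>
        isClosed_le (by fun_prop) (by fun_prop)
    · exact isClosed_iInter fun a => isClosed_eq (by fun_prop) (by fun_prop)
    · exact isClosed_iInter fun a => isClosed_iInter fun b =>
        isClosed_eq (by fun_prop) (by fun_prop)
    · exact isClosed_iInter fun a => isClosed_eq (by fun_prop) (by fun_prop)
    · exact isClosed_le (by fun_prop) (by fun_prop)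
  · rintro _ ⟨x, hx, rfl⟩ f -
    exact ⟨apply_nonneg x.1 f, x.apply_le hx f⟩

theorem AffineLine.continuous_apply (f : C[X]) : Continuous fun x : AffineLine C => x.1 f :=
  (_root_.continuous_apply f).comp AffineLine.isEmbedding.continuous

instance : WeaklyLocallyCompactSpace (AffineLine C) where
  exists_compact_mem_nhds x :=
    ⟨_, AffineLine.isCompact_le (x.1 Polynomial.X + 1),
      (AffineLine.continuous_apply Polynomial.X).continuousAt.eventually_le_const (by simp)⟩

/-- The Gauss point: the seminorm `∑ aᵢ Tⁱ ↦ max |aᵢ|`. -/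
def gaussPoint [IsUltrametricDist C] : AffineLine C :=
  have hna : IsNonarchimedean (NormedField.toAbsoluteValue C) :=
    fun x y => IsUltrametricDist.norm_add_le_max x y
  ⟨{ toFun := fun f => f.gaussNorm (NormedField.toAbsoluteValue C) 1
     map_zero' := Polynomial.gaussNorm_zero _ _
     map_one' := by
       rw [← Polynomial.C_1, Polynomial.gaussNorm_C]; simp
     add_le' := fun f g =>
       (Polynomial.isNonarchimedean_gaussNorm _ hna zero_le_one f g).trans
         (max_le_add_of_nonneg (Polynomial.gaussNorm_nonneg _ _ zero_le_one)
           (Polynomial.gaussNorm_nonneg _ _ zero_le_one))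
     neg' := fun f => by
       have := Polynomial.gaussNorm_isAbsoluteValue hna zero_lt_one
       exact IsAbsoluteValue.abv_neg _ f
     map_mul' := fun f g => Polynomial.gaussNorm_mul hna zero_lt_one f g },
   fun c => Polynomial.gaussNorm_C _ _ c⟩

/-- The Hsia kernel `δ(x, y)`: the diameter of the smallest closed disc containing `x` and `y`,
that is the infimum over the centres `a` of `max |T - a|_x |T - a|_y`. It extends `|x - y|`. -/
def hsia (x y : AffineLine C) : ℝ :=
  ⨅ a : C, max (x.1 (Polynomial.X - Polynomial.C a)) (y.1 (Polynomial.X - Polynomial.C a))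

/-- The spherical kernel `‖x, y‖` on the Berkovich projective line, which is the one-point
compactification of the affine line:  `‖x, y‖ = δ(x, y) ‖x, ∞‖ ‖y, ∞‖` with
`‖x, ∞‖ = 1 / max(1, |T|_x)`. -/
def sphericalKernel : OnePoint (AffineLine C) → OnePoint (AffineLine C) → ℝ
  | OnePoint.infty, OnePoint.infty => 0
  | OnePoint.infty, OnePoint.some y => 1 / max 1 (y.1 Polynomial.X)
  | OnePoint.some x, OnePoint.infty => 1 / max 1 (x.1 Polynomial.X)
  | OnePoint.some x, OnePoint.some y =>
      hsia x y * (1 / max 1 (x.1 Polynomial.X)) * (1 / max 1 (y.1 Polynomial.X))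

/-! ### Functions of bounded differential variation -/

variable (C) in
/-- Hyperbolic space: the points of the Berkovich projective line that are not in `ℙ¹(C)`, i.e.
the points of positive diameter. -/
def Hyp : Type _ := {x : AffineLine C // 0 < hsia x x}

/-- The path distance `ρ(x, y) = 2 log diam (x ∨ y) - log diam x - log diam y`, which makes
hyperbolic space an `ℝ`-tree. -/
def pathDist (x y : Hyp C) : ℝ :=
  2 * Real.log (hsia x.1 y.1) - Real.log (hsia x.1 x.1) - Real.log (hsia y.1 y.1)

/-- The segment `[p, q]` of the tree. -/
def segment (p q : Hyp C) : Set (Hyp C) :=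
  {z | pathDist p z + pathDist z q = pathDist p q}

/-- `s` is the one-sided derivative of `f` at `p` in the direction of `q`: the limit of
`(f z - f p) / ρ(p, z)` as `z` tends to `p` along the segment `[p, q]`. -/
def HasDirDeriv (f : Hyp C → ℝ) (p q : Hyp C) (s : ℝ) : Prop :=
  Tendsto (fun z => (f z - f p) / pathDist p z)
    (comap (pathDist p) (𝓝[>] 0) ⊓ 𝓟 (segment p q)) (𝓝 s)

/-- `V` is a vertex set of the finite subgraph `Γ` spanned by `V` (the union of the segments
`[p, q]` with `p, q ∈ V`): it contains the branch points of `Γ`, so that `Γ \ V` is a disjoint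
union of open segments. Every finite subgraph of hyperbolic space is spanned by such a set. -/
def IsVertexSet (V : Finset (Hyp C)) : Prop :=
  ∀ p ∈ V, ∀ q ∈ V, ∀ r ∈ V, ∃ m ∈ V, m ∈ segment p q ∧ m ∈ segment q r ∧ m ∈ segment p r

open Classical in
/-- The other endpoints of the edges at `p` of the graph with vertex set `V`. These edges are the
tangent directions of the graph at `p`. -/
def neighbours (V : Finset (Hyp C)) (p : Hyp C) : Finset (Hyp C) :=
  {q ∈ V | q ≠ p ∧ ∀ z ∈ V, z ∈ segment p q → z = p ∨ z = q}

/-- Let `d p q` be the derivative of `f` at `p` in the direction of `q`. The Laplacian of `f` on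
the graph `Γ` with vertex set `V` gives the mass `-∑ d p q` (sum over the edges `[p, q]` at `p`)
to a vertex `p`, and the mass `d p q + d q p` to an open edge `(p, q)`. This is the sum of the
absolute values of the masses of the vertices and of the open edges (each edge occurs as `(p, q)`
and as `(q, p)`, whence the factor `1 / 2`). The supremum over the vertex sets `V` of a graph `Γ`
is the total variation of the Laplacian of `f` on `Γ`. -/
def graphVariation (d : Hyp C → Hyp C → ℝ) (V : Finset (Hyp C)) : ℝ :=
  ∑ p ∈ V, |-∑ q ∈ neighbours V p, d p q| +
    1 / 2 * ∑ p ∈ V, ∑ q ∈ neighbours V p, |d p q + d q p|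

/-- `f` is of bounded differential variation on the Berkovich projective line: on every finite
subgraph all directional derivatives of `f` exist, and the total variations of the Laplacians of
`f` on the finite subgraphs are bounded by a common constant. -/
def IsBDV (f : OnePoint (AffineLine C) → ℝ) : Prop :=
  ∃ d : Hyp C → Hyp C → ℝ,
    (∀ p q, p ≠ q → HasDirDeriv (fun z => f (z.1 : AffineLine C)) p q (d p q)) ∧
    ∃ B : ℝ, ∀ V : Finset (Hyp C), IsVertexSet V → graphVariation d V ≤ B

end Berkovich

/-! ### Radon measures -/

instance OnePoint.borelMeasurableSpace (X : Type*) [TopologicalSpace X] :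
    MeasurableSpace (OnePoint X) := borel _

instance OnePoint.borelSpace (X : Type*) [TopologicalSpace X] : BorelSpace (OnePoint X) := ⟨rfl⟩

/-- A signed or complex Borel measure is Radon if its total variation is finite and regular. -/
def IsRadon {X E : Type*} [TopologicalSpace X] [MeasurableSpace X] [NormedAddCommGroup E]
    (μ : VectorMeasure X E) : Prop :=
  IsFiniteMeasure μ.variation ∧ μ.variation.Regular

theorem IsRadon.of_le {X E : Type*} [TopologicalSpace X] [T2Space X] [MeasurableSpace X]
    [BorelSpace X] [NormedAddCommGroup E] {μ : VectorMeasure X E} {m : Measure X}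
    [IsFiniteMeasure m] [m.InnerRegular] (h : μ.variation ≤ m) : IsRadon μ := by
  have hfin : IsFiniteMeasure μ.variation := isFiniteMeasure_of_le m h
  refine ⟨hfin, ?_⟩
  have : μ.variation.InnerRegular := by
    refine ⟨fun A hA r hr => ?_⟩
    obtain ⟨F, hFA, hF, hlt⟩ := hA.exists_isCompact_sdiff_lt (μ := m) (measure_ne_top m A)
      (tsub_pos_of_lt hr).ne'
    refine ⟨F, hFA, hF, ?_⟩
    have h1 : μ.variation A ≤ μ.variation F + μ.variation (A \ F) := by
      rw [← measure_inter_add_sdiff A hF.measurableSet]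
      gcongr
      exact inter_subset_right
    have h2 : μ.variation (A \ F) < μ.variation A - r := (h _).trans_lt hlt
    by_contra hcon
    have h3 : μ.variation F ≤ r := not_lt.mp hcon
    have h4 : μ.variation A < r + (μ.variation A - r) :=
      (h1.trans (by gcongr)).trans_lt (ENNReal.add_lt_add_left (hr.trans_le le_top).ne h2)
    rw [add_tsub_cancel_of_le hr.le] at h4
    exact lt_irrefl _ h4
  infer_instance

theorem IsRadon.add {X E : Type*} [TopologicalSpace X] [T2Space X] [MeasurableSpace X]
    [BorelSpace X] [NormedAddCommGroup E] {μ ν : VectorMeasure X E} (hμ : IsRadon μ)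
    (hν : IsRadon ν) : IsRadon (μ + ν) := by
  have := hμ.1; have := hμ.2; have := hν.1; have := hν.2
  exact IsRadon.of_le (m := μ.variation + ν.variation) VectorMeasure.variation_add_le

theorem IsRadon.smul {X : Type*} [TopologicalSpace X] [T2Space X] [MeasurableSpace X]
    [BorelSpace X] {μ : ComplexMeasure X} (c : ℂ) (hμ : IsRadon μ) : IsRadon (c • μ) := by
  have := hμ.1; have := hμ.2
  refine IsRadon.of_le (m := ‖c‖₊ • μ.variation) ?_
  rw [VectorMeasure.variation_smul]

theorem IsRadon.zero {X : Type*} [TopologicalSpace X] [T2Space X] [MeasurableSpace X]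
    [BorelSpace X] : IsRadon (0 : ComplexMeasure X) :=
  IsRadon.of_le (m := 0) (by simp)

/-! ### The Riemann sphere -/

namespace RiemannSphere

/-- The chordal metric on `ℙ¹(ℂ) = ℂ ∪ {∞}`. -/
def chordal : OnePoint ℂ → OnePoint ℂ → ℝ
  | OnePoint.infty, OnePoint.infty => 0
  | OnePoint.infty, OnePoint.some w => 1 / √(1 + ‖w‖ ^ 2)
  | OnePoint.some z, OnePoint.infty => 1 / √(1 + ‖z‖ ^ 2)
  | OnePoint.some z, OnePoint.some w => ‖z - w‖ / (√(1 + ‖z‖ ^ 2) * √(1 + ‖w‖ ^ 2))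

/-- The chart `w ↦ 1 / w` at infinity. -/
def chartAtInfty (w : ℂ) : OnePoint ℂ := if w = 0 then OnePoint.infty else ((w⁻¹ : ℂ) : OnePoint ℂ)

/-- Smooth functions on the Riemann sphere, through the two standard charts. -/
def IsSmooth (φ : OnePoint ℂ → ℝ) : Prop :=
  ContDiff ℝ ∞ (fun z : ℂ => φ z) ∧ ContDiff ℝ ∞ (fun w : ℂ => φ (chartAtInfty w))

/-- The distributional Laplacian of `f` is a signed Radon measure `σ`; the Laplacian of a smooth
function `φ` is `-(2π)⁻¹ (∂ₓₓ + ∂ᵧᵧ) φ dx dy`. -/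
def IsBDV (f : OnePoint ℂ → ℝ) : Prop :=
  ∃ σ : SignedMeasure (OnePoint ℂ), IsRadon σ ∧ ∀ φ : OnePoint ℂ → ℝ, IsSmooth φ →
    ∫ z : ℂ, f z * (-1 / (2 * Real.pi) * Laplacian.laplacian (fun z : ℂ => φ z) z) =
      ∫ᵛ x, φ x ∂•σ

end RiemannSphere

/-! ### Places of a number field -/

namespace Adelic

variable (K : Type*) [Field K] [NumberField K]

/-- The places of `K`: archimedean places, and non-archimedean places given by the maximal ideals
of the ring of integers. -/
abbrev Place : Type _ := InfinitePlace K ⊕ HeightOneSpectrum (𝓞 K)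

variable {K}

/-- The residue characteristic of a non-archimedean place. -/
def residueChar (v : HeightOneSpectrum (𝓞 K)) : ℕ := ringChar (𝓞 K ⧸ v.asIdeal)

instance residueChar_prime (v : HeightOneSpectrum (𝓞 K)) : Fact (residueChar v).Prime := by
  have : Finite (𝓞 K ⧸ v.asIdeal) := Ideal.finiteQuotientOfFreeOfNeBot _ v.ne_bot
  have := v.isPrime
  exact ⟨CharP.char_is_prime (𝓞 K ⧸ v.asIdeal) _⟩

/-- The local degree `[K_v : ℚ_v]`, where `ℚ_v` is the closure of `ℚ` in `K_v`. For archimedean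
places this is `1` if `v` is real and `2` if `v` is complex. -/
def localDegree : Place K → ℕ
  | .inl w => w.mult
  | .inr v => Module.finrank (algebraMap ℚ (v.adicCompletion K)).fieldRange.topologicalClosure
      (v.adicCompletion K)

/-- The ratio `r_v = [K_v : ℚ_v] / [K : ℚ]`. -/
def weight (v : Place K) : ℝ := localDegree v / Module.finrank ℚ K

/-- The Berkovich affine line over `ℂ_v`, which is `ℂ` if `v` is archimedean. If `v` lies over
`p`, then `K_v` is a finite extension of `ℚ_p`, so that the completion `ℂ_v` of an algebraic
closure of `K_v`, with the absolute value that extends the `p`-adic one, is `ℂ_p`. -/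
def AffLine : Place K → Type
  | .inl _ => ℂ
  | .inr v => Berkovich.AffineLine ℂ_[residueChar v]

instance : (v : Place K) → TopologicalSpace (AffLine v)
  | .inl _ => inferInstanceAs (TopologicalSpace ℂ)
  | .inr v => inferInstanceAs (TopologicalSpace (Berkovich.AffineLine ℂ_[residueChar v]))

instance : (v : Place K) → T2Space (AffLine v)
  | .inl _ => inferInstanceAs (T2Space ℂ)
  | .inr v => inferInstanceAs (T2Space (Berkovich.AffineLine ℂ_[residueChar v]))

instance : (v : Place K) → WeaklyLocallyCompactSpace (AffLine v)
  | .inl _ => inferInstanceAs (WeaklyLocallyCompactSpace ℂ)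
  | .inr v =>
    inferInstanceAs (WeaklyLocallyCompactSpace (Berkovich.AffineLine ℂ_[residueChar v]))

/-- The Berkovich projective line over `ℂ_v`, the one-point compactification of the affine line.
It is the Riemann sphere if `v` is archimedean. -/
abbrev ProjLine (v : Place K) : Type := OnePoint (AffLine v)

/-- The kernel `‖x, y‖_v`. -/
def kernel : (v : Place K) → ProjLine v → ProjLine v → ℝ
  | .inl _ => RiemannSphere.chordal
  | .inr v => Berkovich.sphericalKernel (C := ℂ_[residueChar v])

/-- The Gauss point of the Berkovich projective line at a non-archimedean place. -/
def gauss (v : HeightOneSpectrum (𝓞 K)) : ProjLine (.inr v : Place K) :=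
  OnePoint.some (Berkovich.gaussPoint (C := ℂ_[residueChar v]))

/-- Functions of bounded differential variation on the projective line at `v`. -/
def IsBDV : (v : Place K) → (ProjLine v → ℝ) → Prop
  | .inl _ => RiemannSphere.IsBDV
  | .inr v => Berkovich.IsBDV (C := ℂ_[residueChar v])

/-! ### Potentials and adelic measures -/

/-- The local potential `U_μ(x) = ∫ log (1 / ‖x, y‖_v) dμ(y)`. -/
def potential (v : Place K) (μ : ComplexMeasure (ProjLine v)) (x : ProjLine v) : ℂ :=
  ∫ᵛ y, Real.log (1 / kernel v x y) ∂•μ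

/-- The function `y ↦ log (1 / ‖x, y‖_v)`, with value `+∞` where `‖x, y‖_v = 0`, is integrable with
respect to `|μ|` for every `x`, and the potential of `μ` is continuous. -/
structure HasContinuousPotential (v : Place K) (μ : ComplexMeasure (ProjLine v)) : Prop where
  ae_ne_zero : ∀ x, ∀ᵐ y ∂μ.variation, kernel v x y ≠ 0
  integrable : ∀ x, Integrable (fun y => Real.log (1 / kernel v x y)) μ.variation
  continuous : Continuous (potential v μ)

/-- Complex adelic measures: families of complex Radon measures of constant total mass. -/
structure IsAdelicMeasure (μ : ∀ v : Place K, ComplexMeasure (ProjLine v)) : Prop where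
  isRadon : ∀ v, IsRadon (μ v)
  mass : ∃ c : ℂ, ∀ v, μ v univ = c

/-- An adelic measure `μ` of total mass `c` is proper if `μ_v` is `c` times the point mass at the
Gauss point for all but finitely many places `v`. (There are only finitely many archimedean
places.) -/
def IsProper (μ : ∀ v : Place K, ComplexMeasure (ProjLine v)) : Prop :=
  {v : HeightOneSpectrum (𝓞 K) |
    μ (.inr v) ≠ VectorMeasure.dirac (gauss v) (μ (.inr v) univ)}.Finite

theorem integral_complex_smul {X : Type*} [MeasurableSpace X] (c : ℂ) (μ : ComplexMeasure X)
    (f : X → ℝ) (hf : Integrable f μ.variation) :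
    ∫ᵛ x, f x ∂•(c • μ) = c * ∫ᵛ x, f x ∂•μ := by
  have hvar : (c • μ).variation ≤ ‖c‖₊ • μ.variation := by rw [VectorMeasure.variation_smul]
  have hint : ∀ g : X → ℝ, Integrable g μ.variation → Integrable g (c • μ).variation :=
    fun g hg => (hg.smul_measure_nnreal (c := ‖c‖₊)).mono_measure hvar
  have hdom := (dominatedFinMeasAdditive_cbmApplyMeasure (c • μ)
    (ContinuousLinearMap.lsmul ℝ ℝ)).of_measure_le_smul (c := ‖c‖₊) ENNReal.coe_ne_top hvar
    (ContinuousLinearMap.opNorm_nonneg _)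
  refine Integrable.induction
    (P := fun f => ∫ᵛ x, f x ∂•(c • μ) = c * ∫ᵛ x, f x ∂•μ) ?_ ?_ ?_ ?_ hf
  · intro r s hs hfin
    have hfin' : (c • μ).variation s ≠ ⊤ :=
      ((hvar s).trans_lt (ENNReal.mul_lt_top ENNReal.coe_lt_top hfin)).ne
    rw [VectorMeasure.integral_eq_setToFun, VectorMeasure.integral_eq_setToFun,
      setToFun_indicator_const _ hs hfin', setToFun_indicator_const _ hs hfin.ne]
    simp only [transpose_eq_cbmApplyMeasure, cbmApplyMeasure_apply]
    simp
    ring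
  · intro f g _ hf hg h1 h2
    simp only [Pi.add_apply]
    rw [VectorMeasure.integral_fun_add (hint f hf) (hint g hg),
      VectorMeasure.integral_fun_add hf hg, h1, h2, mul_add]
  · refine isClosed_eq ?_ (continuous_const.mul VectorMeasure.continuous_integral)
    convert continuous_setToFun hdom using 2 with f
    exact (setToFun_congr_measure_of_integrable _ ENNReal.coe_ne_top hvar hdom _ _
      (L1.integrable_coeFn f)).symm
  · intro f g hfg hf h
    have hac : (c • μ).variation ≪ μ.variation := Measure.absolutelyContinuous_of_le_smul hvar
    rw [← VectorMeasure.integral_congr_ae hfg,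
      ← VectorMeasure.integral_congr_ae (hac.ae_le hfg), h]

theorem HasContinuousPotential.add {v : Place K} {μ ν : ComplexMeasure (ProjLine v)}
    (hμ : HasContinuousPotential v μ) (hν : HasContinuousPotential v ν) :
    HasContinuousPotential v (μ + ν) where
  ae_ne_zero x := by
    have h : ∀ᵐ y ∂(μ.variation + ν.variation), kernel v x y ≠ 0 :=
      ae_add_measure_iff.2 ⟨hμ.ae_ne_zero x, hν.ae_ne_zero x⟩
    exact (Measure.absolutelyContinuous_of_le VectorMeasure.variation_add_le).ae_le h
  integrable x := ((hμ.integrable x).add_measure (hν.integrable x)).mono_measure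
    VectorMeasure.variation_add_le
  continuous := by
    have : potential v (μ + ν) = potential v μ + potential v ν := by
      ext x
      exact VectorMeasure.integral_add_vectorMeasure (hμ.integrable x) (hν.integrable x)
    rw [this]
    exact hμ.continuous.add hν.continuous

theorem HasContinuousPotential.smul {v : Place K} {μ : ComplexMeasure (ProjLine v)} (c : ℂ)
    (hμ : HasContinuousPotential v μ) : HasContinuousPotential v (c • μ) where
  ae_ne_zero x := by
    have hac : (c • μ).variation ≪ μ.variation :=
      Measure.absolutelyContinuous_of_le_smul (c := ‖c‖₊) (by rw [VectorMeasure.variation_smul]; rfl)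
    exact hac.ae_le (hμ.ae_ne_zero x)
  integrable x := by
    rw [VectorMeasure.variation_smul]
    exact (hμ.integrable x).smul_measure_nnreal
  continuous := by
    have : potential v (c • μ) = fun x => c * potential v μ x := by
      ext x
      exact integral_complex_smul c μ _ (hμ.integrable x)
    rw [this]
    exact continuous_const.mul hμ.continuous

/-- The complex vector space `𝒜_K` of proper log-continuous complex adelic measures. -/
def space (K : Type*) [Field K] [NumberField K] :
    Submodule ℂ (∀ v : Place K, ComplexMeasure (ProjLine v)) where
  carrier := {μ | IsAdelicMeasure μ ∧ IsProper μ ∧ ∀ v, HasContinuousPotential v (μ v)}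
  zero_mem' := by
    refine ⟨⟨fun v => ?_, 0, fun v => rfl⟩, ?_, fun v => ⟨fun x => ?_, fun x => ?_, ?_⟩⟩
    · exact IsRadon.zero
    · simp [IsProper]
    · simp
    · simp
    · have : potential v (0 : ComplexMeasure (ProjLine v)) = 0 := by
        ext x
        exact VectorMeasure.integral_zero_vectorMeasure
      exact this ▸ continuous_const
  add_mem' := by
    rintro μ ν ⟨⟨hμ, c, hc⟩, hμp, hμU⟩ ⟨⟨hν, d, hd⟩, hνp, hνU⟩
    refine ⟨⟨fun v => (hμ v).add (hν v), c + d, fun v => by simp [hc, hd]⟩, ?_, fun v => ?_⟩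
    · refine (hμp.union hνp).subset fun v hv => ?_
      by_contra hcon
      simp only [mem_union, mem_ofPred_eq, not_or, not_not] at hcon
      apply hv
      rw [Pi.add_apply]
      ext s hs
      by_cases hg : gauss v ∈ s
      · rw [VectorMeasure.dirac_apply_of_mem hs hg, add_apply, hcon.1, hcon.2]
        simp [VectorMeasure.dirac_apply_of_mem hs hg]
      · rw [VectorMeasure.dirac_apply_of_notMem hg, add_apply, hcon.1, hcon.2]
        simp [VectorMeasure.dirac_apply_of_notMem hg]
    · exact (hμU v).add (hνU v)
  smul_mem' := by
    rintro c μ ⟨⟨hμ, d, hd⟩, hμp, hμU⟩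
    refine ⟨⟨fun v => (hμ v).smul c, c * d, fun v => by simp [hd]⟩, ?_, fun v => (hμU v).smul c⟩
    refine hμp.subset fun v hv hcon => hv ?_
    rw [Pi.smul_apply]
    ext s hs
    by_cases hg : gauss v ∈ s
    · rw [VectorMeasure.dirac_apply_of_mem hs hg, smul_apply, hcon]
      simp [VectorMeasure.dirac_apply_of_mem hs hg]
    · rw [VectorMeasure.dirac_apply_of_notMem hg, smul_apply, hcon]
      simp [VectorMeasure.dirac_apply_of_notMem hg]

/-- The conjugate measure. -/
def conjMeasure {X : Type*} [MeasurableSpace X] (ν : ComplexMeasure X) : ComplexMeasure X :=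
  ν.mapRange (starRingEnd ℂ).toAddMonoidHom Complex.continuous_conj

/-- The local pairing `⟨μ, ν⟩_v = ∬ log (1 / ‖x, y‖_v) dμ(x) dν̄(y)`. -/
def localPairing (v : Place K) (μ ν : ComplexMeasure (ProjLine v)) : ℂ :=
  ∫ᵛ y, (∫ᵛ x, Real.log (1 / kernel v x y) ∂•μ) ∂[ContinuousLinearMap.mul ℝ ℂ; conjMeasure ν]

/-- The pairing `⟨μ, ν⟩ = ∑ r_v ⟨μ_v, ν_v⟩_v`. -/
def pairing (μ ν : space K) : ℂ := ∑ᶠ v : Place K, weight v * localPairing v (μ.1 v) (ν.1 v)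

/-- The norm `‖μ‖ = ⟨μ, μ⟩ ^ (1/2)`. -/
def adelicNorm (μ : space K) : ℝ := √(pairing μ μ).re

end Adelic

end

/-! The pairing is a sum, with weights r_v > 0, of local energy forms ∬ k_v dμ_v dν̄_v with k_v =
−log ‖x, y‖_v. A multiple of the point mass at the Gauss point has potential zero, since the kernel
against that point is 1; so the sum is finite. Each local form is positive semidefinite, hence each
weighted local energy is at most the total one, and everything reduces to local estimates for
measures with continuous potential.

The kernel k_v is unbounded. Positivity, Hermitian symmetry and Cauchy–Schwarz are obtained from
bounded kernels that are limits of sums of kernels φ(x) φ(y) (`IsPSDKernel`). The passage to the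
limit (`EnergyForm.IsRegularization`) is dominated convergence. It needs a bound, uniform in the
approximation, for the regularized potentials, and this holds because they are averages or values of
the original continuous potential, up to a bounded multiple of the mass.

Archimedean places: on the unit sphere k = ½ log 2 − ½ log(1 − x·y), regularized by replacing x·y
with r x·y. The power series has nonnegative coefficients and (x·y)ⁿ is a sum of products of
monomials, so the energy controls the mass and all moments; Stone–Weierstrass gives definiteness and
weak convergence. By Jensen's formula the regularization is, up to a function of x, an average over
an affine image of the Fubini–Study measure (`RiemannSphere.integral_logKernel_affine`). The
function −½ log(1 − r x·y) is also a smooth test function: it shows that the Poisson average of a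
function f of bounded differential variation is, up to a constant, the regularized potential of Δf.
The energy of Δf is bounded, so Cauchy–Schwarz controls ∫ f dμ.

Non-archimedean places: the spherical kernel is that of a compact real tree rooted at the Gauss
point (`Berkovich.isTreeKernel_sphericalKernel`), and −log κ(x, y) is the length of the common part
of the paths from the root. Truncated at a positive level it is a limit of kernels of finite trees,
which are sums over edges of the length times a product of two indicators; separability of ℂ_p makes
sequences of finite trees sufficient. Cauchy–Schwarz with a point mass controls the potential of μ
at each point of positive diameter, and the functions −log κ(p, ·) span, together with the
constants, a dense space of continuous functions (`IsTreeKernel.potSpan_eq_top`). For f of bounded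
differential variation, Cauchy–Schwarz over the edges bounds ∫ f dμ by the Dirichlet energy of f on
finite trees, which summation by parts bounds by sup |f| times the variation of the Laplacian
(`Berkovich.dirichlet_hypKernel_le`).

The energy at a non-archimedean place does not see the mass. But the mass is the same at all places,
and the term ½ log 2 of the archimedean kernel controls it. This gives definiteness globally, and
convergence at every place. -/

noncomputable section

/-! ### Complex measures and densities -/

namespace MeasureTheory

variable {X : Type*} [MeasurableSpace X]

section

variable {E F G : Type*} [NormedAddCommGroup E] [NormedSpace ℝ E] [NormedAddCommGroup F]
  [NormedSpace ℝ F] [NormedAddCommGroup G] [NormedSpace ℝ G]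

omit [NormedSpace ℝ F] in
theorem integrable_of_bounded_density {m : Measure X} [IsFiniteMeasure m] {h : X → F}
    (hm : StronglyMeasurable h) {c : ℝ} (hc : ∀ x, ‖h x‖ ≤ c) : Integrable h m :=
  Integrable.of_bound hm.aestronglyMeasurable c (Eventually.of_forall hc)

/-- The variation is the least measure that dominates the norms of the values on sets, so it
suffices to estimate ∫ₛ h. -/
theorem variation_withDensityᵥ_le [CompleteSpace F] {m : Measure X} [IsFiniteMeasure m] {h : X → F}
    (hm : StronglyMeasurable h) {c : NNReal} (hc : ∀ x, ‖h x‖ ≤ c) :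
    (m.withDensityᵥ h).variation ≤ c • m := by
  refine VectorMeasure.variation_le_of_forall_enorm_le fun s hs => ?_
  rw [withDensityᵥ_apply (integrable_of_bounded_density hm hc) hs]
  refine (enorm_integral_le_lintegral_enorm _).trans ?_
  refine (lintegral_mono (g := fun _ => (c : ENNReal)) fun x => ?_).trans ?_
  · change (‖h x‖₊ : ENNReal) ≤ c
    exact_mod_cast hc x
  · simp [Measure.smul_apply]

theorem integrable_bilin {m : Measure X} {h : X → F} (hm : StronglyMeasurable h) {c : NNReal}
    (hc : ∀ x, ‖h x‖ ≤ c) (B : E →L[ℝ] F →L[ℝ] G) {g : X → E} (hg : Integrable g m) :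
    Integrable (fun x => B (g x) (h x)) m := by
  refine Integrable.mono' (g := fun x => ‖B‖ * c * ‖g x‖) (hg.norm.const_mul _) ?_ ?_
  · exact B.aestronglyMeasurable_comp₂ hg.aestronglyMeasurable hm.aestronglyMeasurable
  · refine Eventually.of_forall fun x => (B.le_opNorm₂ _ _).trans ?_
    rw [mul_right_comm]
    have := hc x
    gcongr

/-- Lipschitz on L¹(m). This is the closedness needed to extend the density formula from indicator
functions to all integrable functions. -/
theorem continuous_integral_bilin {m : Measure X} {h : X → F} (hm : StronglyMeasurable h)
    {c : NNReal} (hc : ∀ x, ‖h x‖ ≤ c) (B : E →L[ℝ] F →L[ℝ] G) :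
    Continuous fun f : X →₁[m] E => ∫ x, B (f x) (h x) ∂m := by
  refine (LipschitzWith.of_dist_le_mul (K := ‖B‖₊ * c) fun g f => ?_).continuous
  have hg := L1.integrable_coeFn g
  have hf := L1.integrable_coeFn f
  rw [dist_eq_norm, ← integral_sub (integrable_bilin hm hc B hg) (integrable_bilin hm hc B hf),
    L1.dist_eq_integral_dist, ← integral_const_mul]
  refine norm_integral_le_of_norm_le ?_ (Eventually.of_forall fun x => ?_)
  · simp_rw [dist_eq_norm]
    exact (hg.sub hf).norm.const_mul _
  · rw [← sub_apply, ← map_sub, dist_eq_norm]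
    refine (B.le_opNorm₂ _ _).trans ?_
    rw [mul_right_comm]
    have := hc x
    push_cast
    gcongr

/-- Integration against a measure with bounded density. -/
theorem integral_withDensityᵥ [CompleteSpace F] [CompleteSpace G] {m : Measure X}
    [IsFiniteMeasure m] {h : X → F} (hm : StronglyMeasurable h) {c : NNReal}
    (hc : ∀ x, ‖h x‖ ≤ c) (B : E →L[ℝ] F →L[ℝ] G) {f : X → E} (hf : Integrable f m) :
    ∫ᵛ x, f x ∂[B; m.withDensityᵥ h] = ∫ x, B (f x) (h x) ∂m := by
  have hvar := variation_withDensityᵥ_le (m := m) hm hc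
  have hint : ∀ g : X → E, Integrable g m → Integrable g (m.withDensityᵥ h).variation :=
    fun g hg => (hg.smul_measure_nnreal (c := c)).mono_measure hvar
  have hint' := fun g (hg : Integrable g m) => integrable_bilin hm hc B hg
  -- The vector integral is built from the variation, which is at most `c • m`. Viewed as an
  -- extension dominated by `m`, it is continuous on L¹(m).
  have hdom := (dominatedFinMeasAdditive_cbmApplyMeasure (m.withDensityᵥ h)
    B).of_measure_le_smul (c := c) ENNReal.coe_ne_top hvar
    (ContinuousLinearMap.opNorm_nonneg _)
  have hh := integrable_of_bounded_density (m := m) hm hc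
  refine Integrable.induction
    (P := fun f => ∫ᵛ x, f x ∂[B; m.withDensityᵥ h] = ∫ x, B (f x) (h x) ∂m) ?_ ?_ ?_ ?_ hf
  · intro r s hs hfin
    have hfin' : (m.withDensityᵥ h).variation s ≠ ⊤ :=
      ((hvar s).trans_lt (ENNReal.mul_lt_top ENNReal.coe_lt_top hfin)).ne
    rw [VectorMeasure.integral_eq_setToFun, setToFun_indicator_const _ hs hfin']
    simp only [transpose_eq_cbmApplyMeasure, cbmApplyMeasure_apply]
    rw [withDensityᵥ_apply hh hs, ← ContinuousLinearMap.integral_comp_comm _ hh.integrableOn,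
      ← integral_indicator hs]
    congr with x
    by_cases hx : x ∈ s <;> simp [hx]
  · intro f g _ hf hg h1 h2
    simp only [Pi.add_apply]
    rw [VectorMeasure.integral_fun_add (hint f hf) (hint g hg), h1, h2,
      ← integral_add (hint' f hf) (hint' g hg)]
    simp
  · have h1 : Continuous fun f : X →₁[m] E => ∫ᵛ x, f x ∂[B; m.withDensityᵥ h] := by
      convert continuous_setToFun hdom using 2 with f
      exact (setToFun_congr_measure_of_integrable _ ENNReal.coe_ne_top hvar hdom _ _
        (L1.integrable_coeFn f)).symm
    exact isClosed_eq h1 (continuous_integral_bilin hm hc B)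
  · intro f g hfg hf he
    have hac : (m.withDensityᵥ h).variation ≪ m :=
      fun s hs => le_antisymm ((hvar s).trans (by simp [hs])) zero_le
    rw [← VectorMeasure.integral_congr_ae (hac.ae_le hfg), he]
    exact integral_congr_ae (hfg.mono fun x hx => by simp [hx])

end

/-- Radon–Nikodym: the bound forces absolute continuity, and a derivative whose integral over each A
is at most m(A) in absolute value lies in [−1, 1] almost everywhere. Clipping makes this hold
everywhere. -/
theorem SignedMeasure.exists_density (s : SignedMeasure X) (m : Measure X) [IsFiniteMeasure m]
    (h : ∀ A, MeasurableSet A → ‖s A‖ₑ ≤ m A) :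
    ∃ g : X → ℝ, Measurable g ∧ (∀ x, |g x| ≤ 1) ∧ s = m.withDensityᵥ g := by
  have hac : s ≪ᵥ m.toENNRealVectorMeasure := by
    refine VectorMeasure.AbsolutelyContinuous.mk fun A hA h0 => ?_
    rw [Measure.toENNRealVectorMeasure_apply_measurable hA] at h0
    have := h A hA
    rw [h0] at this
    simpa using this
  have h1 := SignedMeasure.withDensityᵥ_rnDeriv_eq s m hac
  have hint := SignedMeasure.integrable_rnDeriv s m
  have key : ∀ A, MeasurableSet A → |∫ x in A, s.rnDeriv m x ∂m| ≤ m.real A := by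
    intro A hA
    rw [← withDensityᵥ_apply hint hA, h1]
    have h2 := ENNReal.toReal_mono (measure_ne_top m A) (h A hA)
    rwa [toReal_enorm] at h2
  have hle : ∀ᵐ x ∂m, s.rnDeriv m x ≤ 1 := by
    refine ae_le_of_forall_setIntegral_le hint (integrable_const 1) fun A hA _ => ?_
    simpa using (le_abs_self _).trans (key A hA)
  have hge : ∀ᵐ x ∂m, -1 ≤ s.rnDeriv m x := by
    refine ae_le_of_forall_setIntegral_le (integrable_const (-1)) hint fun A hA _ => ?_
    simpa using neg_le_of_abs_le (key A hA)
  refine ⟨fun x => max (-1) (min 1 (s.rnDeriv m x)), ?_, ?_, ?_⟩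
  · exact measurable_const.max (measurable_const.min (SignedMeasure.measurable_rnDeriv s m))
  · intro x
    rw [abs_le]
    exact ⟨le_max_left _ _, max_le (by norm_num) (min_le_left _ _)⟩
  · conv_lhs => rw [← h1]
    refine WithDensityᵥEq.congr_ae ?_
    filter_upwards [hle, hge] with x h2 h3
    rw [min_eq_right h2, max_eq_right h3]

/-- Real and imaginary parts are both dominated by the variation and have densities in [−1, 1]. The
resulting bound 2 is not sharp, but only boundedness matters. -/
theorem ComplexMeasure.exists_density (μ : ComplexMeasure X) [IsFiniteMeasure μ.variation] :
    ∃ h : X → ℂ, Measurable h ∧ (∀ x, ‖h x‖ ≤ (2 : NNReal)) ∧ μ = μ.variation.withDensityᵥ h := by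
  obtain ⟨g1, hg1, hb1, he1⟩ := SignedMeasure.exists_density (ComplexMeasure.re μ) μ.variation
    (fun A hA => by
      refine le_trans ?_ (VectorMeasure.enorm_measure_le_variation μ A)
      rw [← ofReal_norm, ← ofReal_norm]
      exact ENNReal.ofReal_le_ofReal (Complex.abs_re_le_norm (μ A)))
  obtain ⟨g2, hg2, hb2, he2⟩ := SignedMeasure.exists_density (ComplexMeasure.im μ) μ.variation
    (fun A hA => by
      refine le_trans ?_ (VectorMeasure.enorm_measure_le_variation μ A)
      rw [← ofReal_norm, ← ofReal_norm]
      exact ENNReal.ofReal_le_ofReal (Complex.abs_im_le_norm (μ A)))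
  have hm : Measurable fun x => (g1 x + g2 x * Complex.I : ℂ) := by fun_prop
  have hb : ∀ x, ‖(g1 x + g2 x * Complex.I : ℂ)‖ ≤ (2 : NNReal) := by
    intro x
    refine (norm_add_le _ _).trans ?_
    have := hb1 x; have := hb2 x
    simp only [norm_mul, Complex.norm_I, Complex.norm_real, Real.norm_eq_abs]
    push_cast
    linarith
  refine ⟨_, hm, hb, ?_⟩
  have hi1 : Integrable g1 μ.variation :=
    integrable_of_bounded_density hg1.stronglyMeasurable hb1
  have hi2 : Integrable g2 μ.variation :=
    integrable_of_bounded_density hg2.stronglyMeasurable hb2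
  have hi := integrable_of_bounded_density (m := μ.variation) hm.stronglyMeasurable hb
  ext A hA
  have h1 : ∫ x in A, (g1 x + g2 x * Complex.I : ℂ) ∂μ.variation =
      ∫ x in A, (g1 x : ℂ) ∂μ.variation + ∫ x in A, (g2 x * Complex.I : ℂ) ∂μ.variation :=
    integral_add (hi1.ofReal.restrict) ((hi2.ofReal.mul_const _).restrict)
  rw [withDensityᵥ_apply hi hA, h1, integral_mul_const, integral_complex_ofReal, integral_complex_ofReal,
    ← withDensityᵥ_apply hi1 hA, ← withDensityᵥ_apply hi2 hA, ← he1, ← he2]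
  exact (Complex.re_add_im (μ A)).symm

end MeasureTheory
end

noncomputable section

/-! ### Energy forms of kernels -/

namespace EnergyForm

open Adelic ComplexConjugate

variable {X : Type*} [MeasurableSpace X]

theorem conjMeasure_withDensityᵥ {m : Measure X} [IsFiniteMeasure m] {h : X → ℂ}
    (hi : Integrable h m) :
    conjMeasure (m.withDensityᵥ h) = m.withDensityᵥ fun x => conj (h x) := by
  ext s hs
  have hi' : Integrable (fun x => conj (h x)) m := Complex.conjCLE.integrable_comp_iff.2 hi
  rw [withDensityᵥ_apply hi' hs, integral_conj]
  simp [conjMeasure, VectorMeasure.mapRange_apply, withDensityᵥ_apply hi hs]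

theorem variation_conjMeasure (ν : ComplexMeasure X) :
    (conjMeasure ν).variation = ν.variation := by
  have h : ∀ A, ‖conjMeasure ν A‖ₑ = ‖ν A‖ₑ := fun A => by
    rw [← ofReal_norm, ← ofReal_norm]
    simp [conjMeasure, VectorMeasure.mapRange_apply]
  refine le_antisymm ?_ ?_
  · exact VectorMeasure.variation_le_of_forall_enorm_le fun A _ =>
      (h A).trans_le (VectorMeasure.enorm_measure_le_variation ν A)
  · exact VectorMeasure.variation_le_of_forall_enorm_le fun A _ =>
      (h A).symm.trans_le (VectorMeasure.enorm_measure_le_variation _ A)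

/-- Integrals against a complex measure in terms of a bounded density. -/
theorem exists_integral_eq (μ : ComplexMeasure X) [IsFiniteMeasure μ.variation] :
    ∃ h : X → ℂ, Measurable h ∧ (∀ x, ‖h x‖ ≤ 2) ∧ (μ univ = ∫ x, h x ∂μ.variation) ∧
      (∀ f : X → ℝ, Integrable f μ.variation → ∫ᵛ x, f x ∂•μ = ∫ x, f x * h x ∂μ.variation) ∧
      (∀ f : X → ℂ, Integrable f μ.variation →
        ∫ᵛ x, f x ∂[ContinuousLinearMap.mul ℝ ℂ; μ] = ∫ x, f x * h x ∂μ.variation) ∧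
      (∀ f : X → ℂ, Integrable f μ.variation →
        ∫ᵛ x, f x ∂[ContinuousLinearMap.mul ℝ ℂ; conjMeasure μ] =
          ∫ x, f x * conj (h x) ∂μ.variation) := by
  obtain ⟨h, hm, hb, he⟩ := ComplexMeasure.exists_density μ
  have hi := integrable_of_bounded_density (m := μ.variation) hm.stronglyMeasurable hb
  refine ⟨h, hm, hb, ?_, ?_, ?_, ?_⟩
  · conv_lhs => rw [he]
    rw [withDensityᵥ_apply hi MeasurableSet.univ, setIntegral_univ]
  · intro f hf
    have := integral_withDensityᵥ hm.stronglyMeasurable hb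
      (ContinuousLinearMap.lsmul ℝ ℝ : ℝ →L[ℝ] ℂ →L[ℝ] ℂ) hf
    rw [← he] at this
    simpa using this
  · intro f hf
    have := integral_withDensityᵥ hm.stronglyMeasurable hb (ContinuousLinearMap.mul ℝ ℂ) hf
    rw [← he] at this
    simpa using this
  · intro f hf
    have hb' : ∀ x, ‖conj (h x)‖ ≤ (2 : NNReal) := fun x => by simpa using hb x
    have := integral_withDensityᵥ (Complex.continuous_conj.measurable.comp hm).stronglyMeasurable
      hb' (ContinuousLinearMap.mul ℝ ℂ) hf
    simp only [Function.comp_def] at this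
    rw [← conjMeasure_withDensityᵥ hi, ← he] at this
    simpa using this

theorem integral_mul_smul (c : ℂ) (μ : ComplexMeasure X) [IsFiniteMeasure μ.variation] {f : X → ℂ}
    (hf : Integrable f μ.variation) :
    ∫ᵛ x, c * f x ∂[ContinuousLinearMap.mul ℝ ℂ; μ] =
      c * ∫ᵛ x, f x ∂[ContinuousLinearMap.mul ℝ ℂ; μ] := by
  obtain ⟨h, -, -, -, -, h2, -⟩ := exists_integral_eq μ
  rw [h2 _ (hf.const_mul c), h2 _ hf, ← integral_const_mul]
  simp [mul_assoc]

theorem integral_ofReal_mul (μ : ComplexMeasure X) [IsFiniteMeasure μ.variation] {f : X → ℝ}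
    (hf : Integrable f μ.variation) :
    ∫ᵛ x, (f x : ℂ) ∂[ContinuousLinearMap.mul ℝ ℂ; μ] = ∫ᵛ x, f x ∂•μ := by
  obtain ⟨h, -, -, -, h1, h2, -⟩ := exists_integral_eq μ
  rw [h2 (fun x => (f x : ℂ)) hf.ofReal, h1 _ hf]

/-- The potential of `μ` with respect to the kernel `k`. -/
def pot (k : X → X → ℝ) (μ : ComplexMeasure X) (y : X) : ℂ := ∫ᵛ x, k x y ∂•μ

/-- The sesquilinear form `∬ k(x, y) dμ(x) dν̄(y)`. -/
def form (k : X → X → ℝ) (μ ν : ComplexMeasure X) : ℂ :=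
  ∫ᵛ y, pot k μ y ∂[ContinuousLinearMap.mul ℝ ℂ; conjMeasure ν]

/-- Measures of finite total variation whose potential exists and is bounded. -/
structure IsGood (k : X → X → ℝ) (μ : ComplexMeasure X) : Prop where
  fin : IsFiniteMeasure μ.variation
  integrable : ∀ y, Integrable (fun x => k x y) μ.variation
  measurable : Measurable (pot k μ)
  bdd : ∃ C, ∀ y, ‖pot k μ y‖ ≤ C

variable {k : X → X → ℝ} {μ ν ρ : ComplexMeasure X}

theorem IsGood.integrable_pot (hμ : IsGood k μ) (m : Measure X) [IsFiniteMeasure m] :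
    Integrable (pot k μ) m := by
  obtain ⟨C, hC⟩ := hμ.bdd
  exact Integrable.of_bound hμ.measurable.aestronglyMeasurable C (Eventually.of_forall hC)

theorem pot_add (hμ : IsGood k μ) (hν : IsGood k ν) : pot k (μ + ν) = pot k μ + pot k ν := by
  ext y
  exact VectorMeasure.integral_add_vectorMeasure (hμ.integrable y) (hν.integrable y)

theorem pot_smul (c : ℂ) (hμ : IsGood k μ) : pot k (c • μ) = fun y => c * pot k μ y := by
  ext y
  exact integral_complex_smul c μ _ (hμ.integrable y)

theorem form_add_left (hμ : IsGood k μ) (hν : IsGood k ν) (hρ : IsFiniteMeasure ρ.variation) :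
    form k (μ + ν) ρ = form k μ ρ + form k ν ρ := by
  have : IsFiniteMeasure (conjMeasure ρ).variation := by rwa [variation_conjMeasure]
  rw [form, pot_add hμ hν]
  exact VectorMeasure.integral_fun_add (hμ.integrable_pot _) (hν.integrable_pot _)

theorem form_smul_left (c : ℂ) (hμ : IsGood k μ) (hρ : IsFiniteMeasure ρ.variation) :
    form k (c • μ) ρ = c * form k μ ρ := by
  have : IsFiniteMeasure (conjMeasure ρ).variation := by rwa [variation_conjMeasure]
  rw [form, pot_smul c hμ]
  exact integral_mul_smul c _ (hμ.integrable_pot _)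

/-- The Cauchy–Schwarz inequality for a positive semidefinite energy form. -/
theorem norm_form_sq_le (S : Submodule ℂ (ComplexMeasure X)) (hS : ∀ μ ∈ S, IsGood k μ)
    (herm : ∀ μ ∈ S, ∀ ν ∈ S, conj (form k ν μ) = form k μ ν)
    (psd : ∀ μ ∈ S, 0 ≤ (form k μ μ).re) (hμ : μ ∈ S) (hν : ν ∈ S) :
    ‖form k μ ν‖ ^ 2 ≤ (form k μ μ).re * (form k ν ν).re := by
  -- The arguments are exchanged because inner products of the library are conjugate-linear in the
  -- first one. Cauchy–Schwarz needs no definiteness.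
  let core : PreInnerProductSpace.Core ℂ S :=
    { inner := fun a b => form k b.1 a.1
      conj_inner_symm := fun a b => herm _ b.2 _ a.2
      re_inner_nonneg := fun a => psd _ a.2
      add_left := fun a b c => by
        rw [← herm c.1 c.2 _ (a + b).2]
        change conj (form k (a.1 + b.1) c.1) = _
        rw [form_add_left (hS _ a.2) (hS _ b.2) (hS _ c.2).fin, map_add, herm _ c.2 _ a.2,
          herm _ c.2 _ b.2]
      smul_left := fun a b r => by
        rw [← herm b.1 b.2 _ (r • a).2]
        change conj (form k (r • a.1) b.1) = _
        rw [form_smul_left _ (hS _ a.2) (hS _ b.2).fin, map_mul, herm _ b.2 _ a.2] }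
  have h := @InnerProductSpace.Core.inner_mul_inner_self_le ℂ S _ _ _ core ⟨μ, hμ⟩ ⟨ν, hν⟩
  change ‖form k ν μ‖ * ‖form k μ ν‖ ≤ _ at h
  have h2 : ‖form k ν μ‖ = ‖form k μ ν‖ := by
    rw [← herm μ hμ ν hν, RCLike.norm_conj]
  rw [h2, ← sq] at h
  exact h

/-- Bounded symmetric measurable kernels that are positive semidefinite. -/
structure IsPSDKernel (k : X → X → ℝ) : Prop where
  measurable : Measurable (Function.uncurry k)
  symm : ∀ x y, k x y = k y x
  bdd : ∃ C, ∀ x y, |k x y| ≤ C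
  nonneg : ∀ (m : Measure X) [IsFiniteMeasure m] (h : X → ℂ), Measurable h →
    (∃ C, ∀ x, ‖h x‖ ≤ C) →
    0 ≤ (∫ p : X × X, k p.1 p.2 * (h p.1 * conj (h p.2)) ∂m.prod m).re

theorem integrable_kernel {k : X → X → ℝ} (hk : Measurable (Function.uncurry k)) {C : ℝ}
    (hC : ∀ x y, |k x y| ≤ C) (m m' : Measure X) [IsFiniteMeasure m] [IsFiniteMeasure m']
    {h h' : X → ℂ} (hh : Measurable h) (hh' : Measurable h') {D D' : ℝ} (hD : ∀ x, ‖h x‖ ≤ D)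
    (hD' : ∀ x, ‖h' x‖ ≤ D') :
    Integrable (fun p : X × X => (k p.1 p.2 : ℂ) * (h p.1 * conj (h' p.2))) (m.prod m') := by
  refine Integrable.of_bound (C := C * (D * D')) ?_ (Eventually.of_forall fun p => ?_)
  · have h1 : Measurable fun p : X × X => (k p.1 p.2 : ℂ) := Complex.measurable_ofReal.comp hk
    have h2 : Measurable fun p : X × X => conj (h' p.2) :=
      Complex.continuous_conj.measurable.comp (hh'.comp measurable_snd)
    exact (h1.mul ((hh.comp measurable_fst).mul h2)).aestronglyMeasurable
  · have hD0 : 0 ≤ D := (norm_nonneg _).trans (hD p.1)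
    have hC0 : 0 ≤ C := (abs_nonneg _).trans (hC p.1 p.1)
    simp only [norm_mul, Complex.norm_real, RCLike.norm_conj, Real.norm_eq_abs]
    have := hC p.1 p.2
    have := hD p.1
    have := hD' p.2
    gcongr

theorem IsPSDKernel.add {k l : X → X → ℝ} (hk : IsPSDKernel k) (hl : IsPSDKernel l) :
    IsPSDKernel fun x y => k x y + l x y where
  measurable := hk.measurable.add hl.measurable
  symm x y := by rw [hk.symm, hl.symm]
  bdd := by
    obtain ⟨C, hC⟩ := hk.bdd
    obtain ⟨D, hD⟩ := hl.bdd
    exact ⟨C + D, fun x y => (abs_add_le _ _).trans (add_le_add (hC x y) (hD x y))⟩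
  nonneg m _ h hm hb := by
    obtain ⟨C, hC⟩ := hk.bdd
    obtain ⟨D, hD⟩ := hl.bdd
    have h1 := hk.nonneg m h hm hb
    have h2 := hl.nonneg m h hm hb
    obtain ⟨B, hB⟩ := hb
    push_cast
    simp_rw [add_mul]
    rw [integral_add (integrable_kernel hk.measurable hC m m hm hm hB hB)
      (integrable_kernel hl.measurable hD m m hm hm hB hB), Complex.add_re]
    exact add_nonneg h1 h2

theorem IsPSDKernel.const_mul {k : X → X → ℝ} (hk : IsPSDKernel k) {c : ℝ} (hc : 0 ≤ c) :
    IsPSDKernel fun x y => c * k x y where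
  measurable := hk.measurable.const_mul c
  symm x y := by rw [hk.symm]
  bdd := by
    obtain ⟨C, hC⟩ := hk.bdd
    refine ⟨c * C, fun x y => ?_⟩
    rw [abs_mul, abs_of_nonneg hc]
    exact mul_le_mul_of_nonneg_left (hC x y) hc
  nonneg m _ h hm hb := by
    have h1 := hk.nonneg m h hm hb
    push_cast
    simp_rw [mul_assoc]
    rw [integral_const_mul, Complex.re_ofReal_mul]
    exact mul_nonneg hc h1

/-- The double integral factors as |∫ φ h dm|². The positive semidefinite kernels used below are
sums and limits of such kernels. -/
theorem isPSDKernel_mul {φ : X → ℝ} (hφ : Measurable φ) {C : ℝ} (hC : ∀ x, |φ x| ≤ C) :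
    IsPSDKernel fun x y => φ x * φ y where
  measurable := (hφ.comp measurable_fst).mul (hφ.comp measurable_snd)
  symm x y := mul_comm _ _
  bdd := ⟨C * C, fun x y => by
    rw [abs_mul]
    exact mul_le_mul (hC x) (hC y) (abs_nonneg _) ((abs_nonneg _).trans (hC x))⟩
  nonneg m _ h _ _ := by
    have : ∀ p : X × X, ((φ p.1 * φ p.2 : ℝ) : ℂ) * (h p.1 * conj (h p.2)) =
        (φ p.1 * h p.1) * conj (φ p.2 * h p.2) := by
      intro p
      simp only [map_mul, Complex.conj_ofReal]
      push_cast
      ring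
    simp_rw [this]
    rw [integral_prod_mul (fun x => (φ x : ℂ) * h x) (fun x => conj (φ x * h x)), integral_conj,
      Complex.mul_conj, Complex.ofReal_re]
    exact Complex.normSq_nonneg _

theorem isPSDKernel_zero : IsPSDKernel fun _ _ : X => (0 : ℝ) := by
  simpa using isPSDKernel_mul (φ := fun _ : X => (0 : ℝ)) measurable_const (C := 0) (by simp)

theorem IsPSDKernel.sum {ι : Type*} (s : Finset ι) {k : ι → X → X → ℝ}
    (hk : ∀ i ∈ s, IsPSDKernel (k i)) : IsPSDKernel fun x y => ∑ i ∈ s, k i x y := by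
  classical
  induction s using Finset.induction_on with
  | empty => simpa using isPSDKernel_zero
  | insert i s hi ih =>
    simp only [Finset.sum_insert hi]
    exact (hk i (by simp)).add (ih fun j hj => hk j (by simp [hj]))

/-- Dominated convergence; the uniform bound is integrable because the product measure is finite. -/
theorem IsPSDKernel.of_tendsto {k : ℕ → X → X → ℝ} {l : X → X → ℝ} (hk : ∀ n, IsPSDKernel (k n))
    {C : ℝ} (hC : ∀ n x y, |k n x y| ≤ C)
    (hlim : ∀ x y, Tendsto (fun n => k n x y) atTop (𝓝 (l x y))) : IsPSDKernel l where
  measurable := measurable_of_tendsto_metrizable (fun n => (hk n).measurable)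
    (tendsto_pi_nhds.2 fun p => hlim p.1 p.2)
  symm x y := tendsto_nhds_unique (hlim x y) (by simpa only [(hk _).symm x y] using hlim y x)
  bdd := ⟨C, fun x y => le_of_tendsto (hlim x y).abs (Eventually.of_forall fun n => hC n x y)⟩
  nonneg m _ h hm hb := by
    obtain ⟨B, hB⟩ := hb
    have hlim' : Tendsto (fun n => ∫ p : X × X, (k n p.1 p.2 : ℂ) * (h p.1 * conj (h p.2))
        ∂m.prod m) atTop (𝓝 (∫ p : X × X, (l p.1 p.2 : ℂ) * (h p.1 * conj (h p.2)) ∂m.prod m)) := by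
      refine tendsto_integral_of_dominated_convergence (fun _ => C * (B * B)) ?_
        (integrable_const _) ?_ ?_
      · exact fun n => (integrable_kernel (hk n).measurable (hC n) m m hm hm hB hB).1
      · refine fun n => Eventually.of_forall fun p => ?_
        have hB0 : 0 ≤ B := (norm_nonneg _).trans (hB p.1)
        have hC0 : 0 ≤ C := (abs_nonneg _).trans (hC 0 p.1 p.1)
        simp only [norm_mul, Complex.norm_real, RCLike.norm_conj, Real.norm_eq_abs]
        have := hC n p.1 p.2
        have := hB p.1
        have := hB p.2
        gcongr
      · refine Eventually.of_forall fun p => ?_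
        exact ((Complex.continuous_ofReal.tendsto _).comp (hlim p.1 p.2)).mul_const _
    exact ge_of_tendsto ((Complex.continuous_re.tendsto _).comp hlim')
      (Eventually.of_forall fun n => (hk n).nonneg m h hm ⟨B, hB⟩)

section Bounded

variable (hk : Measurable (Function.uncurry k)) {C : ℝ} (hC : ∀ x y, |k x y| ≤ C)

include hk hC

theorem isGood_of_bounded (hμ : IsFiniteMeasure μ.variation) : IsGood k μ := by
  obtain ⟨h, hm, hb, -, h1, -, -⟩ := exists_integral_eq μ
  have hi : ∀ y, Integrable (fun x => k x y) μ.variation := fun y =>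
    Integrable.of_bound (hk.comp (measurable_id.prodMk measurable_const)).aestronglyMeasurable C
      (Eventually.of_forall fun x => hC x y)
  have hp : pot k μ = fun y => ∫ x, k x y * h x ∂μ.variation := by
    ext y
    exact h1 _ (hi y)
  refine ⟨hμ, hi, ?_, C * 2 * μ.variation.real univ, fun y => ?_⟩
  · rw [hp]
    have : Measurable fun p : X × X => (k p.1 p.2 : ℂ) * h p.1 :=
      (Complex.measurable_ofReal.comp hk).mul (hm.comp measurable_fst)
    exact (StronglyMeasurable.integral_prod_left' this.stronglyMeasurable).measurable
  · rw [hp]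
    refine norm_integral_le_of_norm_le_const (Eventually.of_forall fun x => ?_)
    have hC0 : 0 ≤ C := (abs_nonneg _).trans (hC x x)
    rw [norm_mul, Complex.norm_real, Real.norm_eq_abs]
    exact mul_le_mul (hC x y) (hb x) (norm_nonneg _) hC0

/-- For a bounded kernel Fubini turns the iterated vector integrals into integrals over a product,
with one common choice of densities. Symmetry and positivity can then be read off. -/
theorem form_eq_integral_prod (hμ : IsFiniteMeasure μ.variation)
    (hν : IsFiniteMeasure ν.variation) : ∃ h h' : X → ℂ, Measurable h ∧ Measurable h' ∧
      (∀ x, ‖h x‖ ≤ 2) ∧ (∀ x, ‖h' x‖ ≤ 2) ∧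
      form k μ ν = ∫ p : X × X, (k p.1 p.2 : ℂ) * (h p.1 * conj (h' p.2))
        ∂(μ.variation.prod ν.variation) ∧
      form k ν μ = ∫ p : X × X, (k p.1 p.2 : ℂ) * (h' p.1 * conj (h p.2))
        ∂(ν.variation.prod μ.variation) ∧
      form k μ μ = ∫ p : X × X, (k p.1 p.2 : ℂ) * (h p.1 * conj (h p.2))
        ∂(μ.variation.prod μ.variation) := by
  obtain ⟨h, hm, hb, -, h1, -, h3⟩ := exists_integral_eq μ
  obtain ⟨h', hm', hb', -, h1', -, h3'⟩ := exists_integral_eq ν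
  have hgμ := isGood_of_bounded hk hC hμ
  have hgν := isGood_of_bounded hk hC hν
  have aux : ∀ (m m' : Measure X) [IsFiniteMeasure m] [IsFiniteMeasure m'] (u u' : X → ℂ),
      Measurable u → Measurable u' → (∀ x, ‖u x‖ ≤ 2) → (∀ x, ‖u' x‖ ≤ 2) →
      ∫ y, (∫ x, k x y * u x ∂m) * conj (u' y) ∂m' =
        ∫ p : X × X, (k p.1 p.2 : ℂ) * (u p.1 * conj (u' p.2)) ∂(m.prod m') := by
    intro m m' _ _ u u' hu hu' hub hub'
    rw [integral_prod_symm _ (integrable_kernel hk hC m m' hu hu' hub hub')]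
    congr with y
    rw [← integral_mul_const]
    simp [mul_assoc]
  refine ⟨h, h', hm, hm', hb, hb', ?_, ?_, ?_⟩
  · rw [← aux _ _ h h' hm hm' hb hb', form, h3' _ (hgμ.integrable_pot _)]
    congr with y
    rw [pot, h1 _ (hgμ.integrable y)]
  · rw [← aux _ _ h' h hm' hm hb' hb, form, h3 _ (hgν.integrable_pot _)]
    congr with y
    rw [pot, h1' _ (hgν.integrable y)]
  · rw [← aux _ _ h h hm hm hb hb, form, h3 _ (hgμ.integrable_pot _)]
    congr with y
    rw [pot, h1 _ (hgμ.integrable y)]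

/-- Conjugation exchanges the roles of the two densities; swapping the variables and the symmetry of
the kernel restore the integrand. -/
theorem conj_form_of_bounded (hsymm : ∀ x y, k x y = k y x) (hμ : IsFiniteMeasure μ.variation)
    (hν : IsFiniteMeasure ν.variation) : conj (form k ν μ) = form k μ ν := by
  obtain ⟨h, h', hm, hm', hb, hb', h1, h2, -⟩ := form_eq_integral_prod hk hC hμ hν
  rw [h1, h2, ← integral_conj, ← integral_prod_swap]
  congr with p
  simp only [Prod.fst_swap, Prod.snd_swap, map_mul, Complex.conj_ofReal, Complex.conj_conj]
  rw [hsymm, mul_comm (conj _)]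

end Bounded

theorem IsPSDKernel.form_nonneg (hk : IsPSDKernel k) (hμ : IsFiniteMeasure μ.variation) :
    0 ≤ (form k μ μ).re := by
  obtain ⟨C, hC⟩ := hk.bdd
  obtain ⟨h, -, hm, -, hb, -, -, -, h3⟩ := form_eq_integral_prod hk.measurable hC hμ hμ
  rw [h3]
  exact hk.nonneg _ _ hm ⟨2, hb⟩

theorem IsPSDKernel.conj_form (hk : IsPSDKernel k) (hμ : IsFiniteMeasure μ.variation)
    (hν : IsFiniteMeasure ν.variation) : conj (form k ν μ) = form k μ ν := by
  obtain ⟨C, hC⟩ := hk.bdd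
  exact conj_form_of_bounded hk.measurable hC hk.symm hμ hν

theorem IsPSDKernel.isGood (hk : IsPSDKernel k) (hμ : IsFiniteMeasure μ.variation) :
    IsGood k μ := by
  obtain ⟨C, hC⟩ := hk.bdd
  exact isGood_of_bounded hk.measurable hC hμ

variable (X) in
/-- The complex measures of finite total variation. -/
def finiteVariation : Submodule ℂ (ComplexMeasure X) where
  carrier := {μ | IsFiniteMeasure μ.variation}
  zero_mem' := by simp only [mem_ofPred_eq, VectorMeasure.variation_zero]; infer_instance
  add_mem' {μ ν} hμ hν := by
    have : IsFiniteMeasure μ.variation := hμ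
    have : IsFiniteMeasure ν.variation := hν
    exact isFiniteMeasure_of_le (μ.variation + ν.variation) VectorMeasure.variation_add_le
  smul_mem' c μ hμ := by
    have : IsFiniteMeasure μ.variation := hμ
    simp only [mem_ofPred_eq, VectorMeasure.variation_smul]
    infer_instance

theorem IsPSDKernel.norm_form_sq_le (hk : IsPSDKernel k) (hμ : IsFiniteMeasure μ.variation)
    (hν : IsFiniteMeasure ν.variation) :
    ‖form k μ ν‖ ^ 2 ≤ (form k μ μ).re * (form k ν ν).re :=
  EnergyForm.norm_form_sq_le (finiteVariation X) (fun _ h => hk.isGood h)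
    (fun _ h _ h' => hk.conj_form h h') (fun _ h => hk.form_nonneg h) hμ hν

/-- If the potentials of `μ` with respect to kernels `kₙ` are uniformly bounded and the `kₙ`
approximate `k`, then the energy forms converge. -/
theorem tendsto_form {kn : ℕ → X → X → ℝ} (hμ : IsGood k μ) (hν : IsFiniteMeasure ν.variation)
    (hkn : ∀ n, IsGood (kn n) μ) {C : ℝ}
    (hC : ∀ n y, ∀ᵐ x ∂μ.variation, |kn n x y| ≤ |k x y| + C)
    (hlim : ∀ y, ∀ᵐ x ∂μ.variation, Tendsto (fun n => kn n x y) atTop (𝓝 (k x y))) {D : ℝ}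
    (hD : ∀ n y, ‖pot (kn n) μ y‖ ≤ D) :
    Tendsto (fun n => form (kn n) μ ν) atTop (𝓝 (form k μ ν)) := by
  have := hμ.fin
  have : IsFiniteMeasure (conjMeasure ν).variation := by rwa [variation_conjMeasure]
  -- Two nested dominated convergences: the potentials are bounded by `D`, and for fixed `y` the
  -- kernels are bounded by the integrable function |k| + C. No joint integrability of `k` is used.
  refine VectorMeasure.tendsto_integral_of_dominated_convergence (fun _ => D) ?_
    (integrable_const _) ?_ ?_
  · exact fun n => (hkn n).measurable.aestronglyMeasurable
  · exact fun n => Eventually.of_forall (hD n)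
  · refine Eventually.of_forall fun y => ?_
    refine VectorMeasure.tendsto_integral_of_dominated_convergence (fun x => |k x y| + C) ?_
      ((hμ.integrable y).abs.add (integrable_const _)) ?_ (hlim y)
    · exact fun n => ((hkn n).integrable y).1
    · exact fun n => hC n y

end EnergyForm
end

/-! ### Weak limits, admissible measures and regularization of logarithmic kernels -/

noncomputable section

set_option linter.unusedSectionVars false

namespace EnergyForm

open Adelic ComplexConjugate

variable {X : Type*} [TopologicalSpace X] [CompactSpace X] [MeasurableSpace X] [BorelSpace X]

theorem integrable_of_continuous {E : Type*} [NormedAddCommGroup E] [SecondCountableTopology E]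
    [MeasurableSpace E] [BorelSpace E] {f : X → E} (hf : Continuous f)
    (m : Measure X) [IsFiniteMeasure m] : Integrable f m := by
  obtain ⟨C, hC⟩ := (isCompact_range hf).isBounded.exists_norm_le
  exact Integrable.of_bound hf.measurable.aestronglyMeasurable C
    (Eventually.of_forall fun x => hC _ ⟨x, rfl⟩)

/-- A complex measure that annihilates the continuous functions is zero. -/
theorem eq_zero_of_forall_integral_eq_zero [HasOuterApproxClosed X] {μ : ComplexMeasure X}
    [IsFiniteMeasure μ.variation] (h0 : ∀ f : X → ℝ, Continuous f → ∫ᵛ x, f x ∂•μ = 0) :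
    μ = 0 := by
  obtain ⟨h, hm, hb, he⟩ := ComplexMeasure.exists_density μ
  set m := μ.variation with hmdef
  have hi := integrable_of_bounded_density (m := m) hm.stronglyMeasurable hb
  -- Uniqueness is available for finite positive measures only. Adding 2 makes the density
  -- nonnegative, and (g + 2) m is compared with 2 m.
  have key : ∀ g : X → ℝ, Measurable g → (∀ x, |g x| ≤ 2) →
      (∀ f : X → ℝ, Continuous f → ∫ x, f x * g x ∂m = 0) → g =ᵐ[m] 0 := by
    intro g hg hgb hg0
    have hmeas : Measurable fun x => ENNReal.ofReal (g x + 2) :=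
      (hg.add_const 2).ennreal_ofReal
    have hgi : Integrable g m := integrable_of_bounded_density hg.stronglyMeasurable hgb
    have hfin1 : IsFiniteMeasure (m.withDensity fun x => ENNReal.ofReal (g x + 2)) :=
      isFiniteMeasure_withDensity_ofReal (hgi.add (integrable_const 2)).2
    have hfin2 : IsFiniteMeasure (m.withDensity fun _ => ENNReal.ofReal 2) :=
      isFiniteMeasure_withDensity_ofReal (integrable_const (2 : ℝ)).2
    have heq : (m.withDensity fun x => ENNReal.ofReal (g x + 2)) =
        m.withDensity fun _ => ENNReal.ofReal 2 := by
      refine ext_of_forall_integral_eq_of_IsFiniteMeasure fun f => ?_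
      rw [integral_withDensity_eq_integral_toReal_smul hmeas (by simp),
        integral_withDensity_eq_integral_toReal_smul measurable_const (by simp)]
      have hf : Integrable f m := integrable_of_continuous f.continuous m
      have h1 : ∀ x, (ENNReal.ofReal (g x + 2)).toReal • f x = f x * g x + 2 * f x := by
        intro x
        rw [ENNReal.toReal_ofReal (by linarith [neg_le_of_abs_le (hgb x)]), smul_eq_mul]
        ring
      have h2 : ∀ x, (ENNReal.ofReal 2).toReal • f x = 2 * f x := by
        intro x
        rw [ENNReal.toReal_ofReal (by norm_num), smul_eq_mul]
      simp_rw [h1, h2]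
      rw [integral_add _ (hf.const_mul 2), hg0 f f.continuous, zero_add]
      exact hf.mul_bdd (c := 2) hg.aestronglyMeasurable (Eventually.of_forall hgb)
    have h3 := (withDensity_eq_iff_of_sigmaFinite hmeas.aemeasurable
      measurable_const.aemeasurable).1 heq
    filter_upwards [h3] with x hx
    have h4 := congrArg ENNReal.toReal hx
    rw [ENNReal.toReal_ofReal (by linarith [neg_le_of_abs_le (hgb x)]),
      ENNReal.toReal_ofReal (by norm_num)] at h4
    simpa using h4
  have hval : ∀ f : X → ℝ, Continuous f → ∫ x, f x * h x ∂m = 0 := by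
    intro f hf
    have := integral_withDensityᵥ hm.stronglyMeasurable hb
      (ContinuousLinearMap.lsmul ℝ ℝ : ℝ →L[ℝ] ℂ →L[ℝ] ℂ) (integrable_of_continuous hf m)
    rw [← he, h0 f hf] at this
    simpa using this.symm
  have hfi : ∀ f : X → ℝ, Continuous f → Integrable (fun x => (f x : ℂ) * h x) m := by
    intro f hf
    exact ((integrable_of_continuous hf m).ofReal).mul_bdd (c := 2) hm.aestronglyMeasurable
      (Eventually.of_forall hb)
  have hre : (fun x => (h x).re) =ᵐ[m] 0 := by
    refine key _ (Complex.measurable_re.comp hm)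
      (fun x => (Complex.abs_re_le_norm _).trans (hb x)) fun f hf => ?_
    have h5 := congrArg Complex.re (hval f hf)
    have h6 := Complex.reCLM.integral_comp_comm (hfi f hf)
    simpa [h5] using h6
  have him : (fun x => (h x).im) =ᵐ[m] 0 := by
    refine key _ (Complex.measurable_im.comp hm)
      (fun x => (Complex.abs_im_le_norm _).trans (hb x)) fun f hf => ?_
    have h5 := congrArg Complex.im (hval f hf)
    have h6 := Complex.imCLM.integral_comp_comm (hfi f hf)
    simpa [h5] using h6
  have hh : h =ᵐ[m] 0 := by
    filter_upwards [hre, him] with x h1 h2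
    exact Complex.ext h1 h2
  rw [he, WithDensityᵥEq.congr_ae hh, withDensityᵥ_zero]

section Weak

variable (μs : ℕ → ComplexMeasure X)

/-- The continuous functions whose integrals against the measures `μₙ` tend to zero. -/
def nullFunctions (hfin : ∀ n, IsFiniteMeasure (μs n).variation) : Submodule ℝ C(X, ℝ) where
  carrier := {f | Tendsto (fun n => ∫ᵛ x, f x ∂•(μs n)) atTop (𝓝 0)}
  zero_mem' := by simp
  add_mem' {f g} hf hg := by
    have : ∀ n, ∫ᵛ x, (f + g) x ∂•(μs n) = ∫ᵛ x, f x ∂•(μs n) + ∫ᵛ x, g x ∂•(μs n) := fun n =>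
      VectorMeasure.integral_fun_add (integrable_of_continuous f.continuous _)
        (integrable_of_continuous g.continuous _)
    simp only [mem_ofPred_eq, this]
    simpa using Tendsto.add hf hg
  smul_mem' c f hf := by
    have : ∀ n, ∫ᵛ x, (c • f) x ∂•(μs n) = c • ∫ᵛ x, f x ∂•(μs n) := fun n =>
      VectorMeasure.integral_fun_smul (μs n) _ c f
    simp only [mem_ofPred_eq, this]
    simpa using Tendsto.const_smul hf c

/-- A common bound for the total variations makes the functionals equicontinuous, so convergence to
zero survives uniform limits. This is where bounded total variation enters the weak convergence
statement. -/
theorem isClosed_nullFunctions (hfin : ∀ n, IsFiniteMeasure (μs n).variation) {V : ℝ}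
    (hV : ∀ n, (μs n).variation.real univ ≤ V) :
    IsClosed (nullFunctions μs hfin : Set C(X, ℝ)) := by
  have hV0 : 0 ≤ V := measureReal_nonneg.trans (hV 0)
  refine isClosed_of_closure_subset fun f hf => ?_
  change Tendsto (fun n => ∫ᵛ x, f x ∂•(μs n)) atTop (𝓝 0)
  rw [Metric.tendsto_atTop]
  intro ε hε
  -- `V + 1` keeps the denominator positive when `V = 0`.
  obtain ⟨g, hg, hfg⟩ := Metric.mem_closure_iff.1 hf (ε / (2 * (V + 1))) (by positivity)
  obtain ⟨N, hN⟩ := Metric.tendsto_atTop.1 hg (ε / 2) (by positivity)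
  refine ⟨N, fun n hn => ?_⟩
  have h1 := hN n hn
  rw [dist_zero_right] at h1 ⊢
  have h2 : ∫ᵛ x, f x ∂•(μs n) = ∫ᵛ x, (f x - g x) ∂•(μs n) + ∫ᵛ x, g x ∂•(μs n) := by
    rw [VectorMeasure.integral_fun_sub (integrable_of_continuous f.continuous _)
      (integrable_of_continuous g.continuous _)]
    abel
  have h3 : ‖∫ᵛ x, (f x - g x) ∂•(μs n)‖ ≤ ε / (2 * (V + 1)) * (μs n).variation.real univ := by
    refine (VectorMeasure.norm_integral_le_of_norm_le_const (C := ε / (2 * (V + 1)))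
      (Eventually.of_forall fun x => ?_)).trans ?_
    · rw [← dist_eq_norm]
      exact (ContinuousMap.dist_apply_le_dist x).trans hfg.le
    · have : ‖(ContinuousLinearMap.lsmul ℝ ℝ : ℝ →L[ℝ] ℂ →L[ℝ] ℂ)‖ ≤ 1 :=
        ContinuousLinearMap.opNorm_lsmul_le
      calc _ ≤ ε / (2 * (V + 1)) * 1 * (μs n).variation.real univ := by gcongr
        _ = _ := by ring
  rw [h2]
  calc _ ≤ ε / (2 * (V + 1)) * (μs n).variation.real univ + ‖∫ᵛ x, g x ∂•(μs n)‖ :=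
        (norm_add_le _ _).trans (by gcongr)
    _ < ε / (2 * (V + 1)) * (V + 1) + ε / 2 := by
        have := hV n
        gcongr
        linarith
    _ = ε := by field_simp; norm_num

theorem tendsto_integral_mul (hfin : ∀ n, IsFiniteMeasure (μs n).variation)
    (htop : nullFunctions μs hfin = ⊤) {f : X → ℂ} (hf : Continuous f) :
    Tendsto (fun n => ∫ᵛ x, f x ∂[ContinuousLinearMap.mul ℝ ℂ; μs n]) atTop (𝓝 0) := by
  have hre : Continuous fun x => (f x).re := Complex.continuous_re.comp hf
  have him : Continuous fun x => (f x).im := Complex.continuous_im.comp hf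
  have h1 : Tendsto (fun n => ∫ᵛ x, (f x).re ∂•(μs n)) atTop (𝓝 0) := by
    have : (⟨_, hre⟩ : C(X, ℝ)) ∈ nullFunctions μs hfin := htop ▸ Submodule.mem_top
    exact this
  have h2 : Tendsto (fun n => ∫ᵛ x, (f x).im ∂•(μs n)) atTop (𝓝 0) := by
    have : (⟨_, him⟩ : C(X, ℝ)) ∈ nullFunctions μs hfin := htop ▸ Submodule.mem_top
    exact this
  have h3 : ∀ n, ∫ᵛ x, f x ∂[ContinuousLinearMap.mul ℝ ℂ; μs n] =
      ∫ᵛ x, (f x).re ∂•(μs n) + Complex.I * ∫ᵛ x, (f x).im ∂•(μs n) := by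
    intro n
    have hir := integrable_of_continuous hre (μs n).variation
    have hii := integrable_of_continuous him (μs n).variation
    have hir' : Integrable (fun x => ((f x).re : ℂ)) (μs n).variation := hir.ofReal
    have hii' : Integrable (fun x => ((f x).im : ℂ)) (μs n).variation := hii.ofReal
    rw [← integral_ofReal_mul _ hir, ← integral_ofReal_mul _ hii,
      ← integral_mul_smul _ _ hii',
      ← VectorMeasure.integral_fun_add hir' (hii'.const_mul _)]
    congr with x
    change f x = (f x).re + Complex.I * (f x).im
    rw [mul_comm, Complex.re_add_im]
  simp_rw [h3]
  simpa using h1.add (h2.const_mul Complex.I)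

end Weak

/-- Measures of finite total variation with a continuous logarithmic potential. -/
structure IsAdmissible (κ : X → X → ℝ) (μ : ComplexMeasure X) : Prop where
  fin : IsFiniteMeasure μ.variation
  ae_ne_zero : ∀ x, ∀ᵐ y ∂μ.variation, κ x y ≠ 0
  integrable : ∀ x, Integrable (fun y => Real.log (1 / κ x y)) μ.variation
  continuous : Continuous fun x => ∫ᵛ y, Real.log (1 / κ x y) ∂•μ

/-- The logarithmic kernel. -/
def logKernel (κ : X → X → ℝ) (x y : X) : ℝ := Real.log (1 / κ x y)

variable {κ : X → X → ℝ} {μ ν : ComplexMeasure X}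

omit [TopologicalSpace X] [CompactSpace X] [BorelSpace X] in
theorem pot_logKernel (hκ : ∀ x y, κ x y = κ y x) :
    pot (logKernel κ) μ = fun x => ∫ᵛ y, Real.log (1 / κ x y) ∂•μ := by
  ext y
  rw [pot]
  congr with x
  rw [logKernel, hκ]

/-- A continuous potential on a compact space is measurable and bounded, which is all that the
energy form needs. -/
theorem IsAdmissible.isGood (hκ : ∀ x y, κ x y = κ y x) (hμ : IsAdmissible κ μ) :
    IsGood (logKernel κ) μ where
  fin := hμ.fin
  integrable y := by simpa only [logKernel, hκ _ y] using hμ.integrable y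
  measurable := by rw [pot_logKernel hκ]; exact hμ.continuous.measurable
  bdd := by
    rw [pot_logKernel hκ]
    obtain ⟨C, hC⟩ := (isCompact_range hμ.continuous).isBounded.exists_norm_le
    exact ⟨C, fun x => hC _ ⟨x, rfl⟩⟩

theorem IsAdmissible.add (hμ : IsAdmissible κ μ) (hν : IsAdmissible κ ν) :
    IsAdmissible κ (μ + ν) where
  fin := (finiteVariation X).add_mem hμ.fin hν.fin
  ae_ne_zero x := by
    have h : ∀ᵐ y ∂(μ.variation + ν.variation), κ x y ≠ 0 :=
      ae_add_measure_iff.2 ⟨hμ.ae_ne_zero x, hν.ae_ne_zero x⟩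
    exact (Measure.absolutelyContinuous_of_le VectorMeasure.variation_add_le).ae_le h
  integrable x := ((hμ.integrable x).add_measure (hν.integrable x)).mono_measure
    VectorMeasure.variation_add_le
  continuous := by
    have : (fun x => ∫ᵛ y, Real.log (1 / κ x y) ∂•(μ + ν)) = fun x =>
        ∫ᵛ y, Real.log (1 / κ x y) ∂•μ + ∫ᵛ y, Real.log (1 / κ x y) ∂•ν := by
      ext x
      exact VectorMeasure.integral_add_vectorMeasure (hμ.integrable x) (hν.integrable x)
    rw [this]
    exact hμ.continuous.add hν.continuous

theorem IsAdmissible.smul (c : ℂ) (hμ : IsAdmissible κ μ) : IsAdmissible κ (c • μ) where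
  fin := (finiteVariation X).smul_mem c hμ.fin
  ae_ne_zero x := by
    have hac : (c • μ).variation ≪ μ.variation :=
      Measure.absolutelyContinuous_of_le_smul (c := ‖c‖₊)
        (by rw [VectorMeasure.variation_smul]; rfl)
    exact hac.ae_le (hμ.ae_ne_zero x)
  integrable x := by
    rw [VectorMeasure.variation_smul]
    exact (hμ.integrable x).smul_measure_nnreal
  continuous := by
    have : (fun x => ∫ᵛ y, Real.log (1 / κ x y) ∂•(c • μ)) = fun x =>
        c * ∫ᵛ y, Real.log (1 / κ x y) ∂•μ := by
      ext x
      exact integral_complex_smul c μ _ (hμ.integrable x)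
    rw [this]
    exact continuous_const.mul hμ.continuous

theorem isAdmissible_zero : IsAdmissible κ (0 : ComplexMeasure X) where
  fin := (finiteVariation X).zero_mem
  ae_ne_zero x := by simp
  integrable x := by simp
  continuous := by simpa using continuous_const

/-- The space of admissible measures. -/
def admissible (κ : X → X → ℝ) : Submodule ℂ (ComplexMeasure X) where
  carrier := {μ | IsAdmissible κ μ}
  zero_mem' := isAdmissible_zero
  add_mem' := IsAdmissible.add
  smul_mem' c _ := IsAdmissible.smul c

/-- An approximation of the logarithmic kernel by bounded positive semidefinite kernels, with
uniform bounds for the potentials of admissible measures. -/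
structure IsRegularization (κ : X → X → ℝ) (kn : ℕ → X → X → ℝ) : Prop where
  symm : ∀ x y, κ x y = κ y x
  psd : ∀ n, IsPSDKernel (kn n)
  le : ∃ C, ∀ n x y, κ x y ≠ 0 → |kn n x y| ≤ |logKernel κ x y| + C
  lim : ∀ x y, κ x y ≠ 0 → Tendsto (fun n => kn n x y) atTop (𝓝 (logKernel κ x y))
  bdd : ∀ μ, IsAdmissible κ μ → ∃ D, ∀ n y, ‖pot (kn n) μ y‖ ≤ D

namespace IsRegularization

variable {kn : ℕ → X → X → ℝ} (h : IsRegularization κ kn)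

include h

/-- The uniform bound on the regularized potentials feeds the double dominated convergence. That κ ≠
0 almost everywhere is essential: `Real.log (1 / 0) = 0` need not be the limit of the regularized
kernels. -/
theorem tendsto_form (hμ : IsAdmissible κ μ) (hν : IsFiniteMeasure ν.variation) :
    Tendsto (fun n => form (kn n) μ ν) atTop (𝓝 (form (logKernel κ) μ ν)) := by
  obtain ⟨C, hC⟩ := h.le
  obtain ⟨D, hD⟩ := h.bdd μ hμ
  refine EnergyForm.tendsto_form (C := C) (hμ.isGood h.symm) hν (fun n => (h.psd n).isGood hμ.fin)
    (fun n y => ?_) (fun y => ?_) hD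
  · filter_upwards [hμ.ae_ne_zero y] with x hx
    exact hC n x y (by rwa [h.symm])
  filter_upwards [hμ.ae_ne_zero y] with x hx
  exact h.lim x y (by rwa [h.symm])

theorem conj_form (hμ : IsAdmissible κ μ) (hν : IsAdmissible κ ν) :
    conj (form (logKernel κ) ν μ) = form (logKernel κ) μ ν := by
  refine tendsto_nhds_unique ?_ (h.tendsto_form hμ hν.fin)
  have := (Complex.continuous_conj.tendsto _).comp (h.tendsto_form hν hμ.fin)
  refine this.congr fun n => ?_
  exact (h.psd n).conj_form hμ.fin hν.fin

theorem tendsto_form_re (hμ : IsAdmissible κ μ) :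
    Tendsto (fun n => (form (kn n) μ μ).re) atTop (𝓝 (form (logKernel κ) μ μ).re) :=
  (Complex.continuous_re.tendsto _).comp (h.tendsto_form hμ hμ.fin)

theorem form_nonneg (hμ : IsAdmissible κ μ) : 0 ≤ (form (logKernel κ) μ μ).re :=
  ge_of_tendsto (h.tendsto_form_re hμ)
    (Eventually.of_forall fun n => (h.psd n).form_nonneg hμ.fin)

theorem norm_form_sq_le (hμ : IsAdmissible κ μ) (hν : IsAdmissible κ ν) :
    ‖form (logKernel κ) μ ν‖ ^ 2 ≤ (form (logKernel κ) μ μ).re * (form (logKernel κ) ν ν).re :=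
  EnergyForm.norm_form_sq_le (admissible κ) (fun _ hρ => IsAdmissible.isGood h.symm hρ)
    (fun _ h1 _ h2 => h.conj_form h1 h2) (fun _ h1 => h.form_nonneg h1) hμ hν

end IsRegularization

end EnergyForm
end

/-! ### Lower bounds for energies, and the Riemann sphere as the unit sphere of ℝ³ -/

noncomputable section

namespace EnergyForm

open Adelic ComplexConjugate

variable {X : Type*} [MeasurableSpace X]

/-- If `k - c φ ⊗ φ` is positive semidefinite, then the energy of `μ` controls `∫ φ dμ`. -/
theorem mul_norm_integral_sq_le {k : X → X → ℝ} {φ : X → ℝ} (hφ : Measurable φ) {B : ℝ}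
    (hB : ∀ x, |φ x| ≤ B) {c : ℝ} (hk : IsPSDKernel fun x y => k x y - c * (φ x * φ y))
    {μ : ComplexMeasure X} (hμ : IsFiniteMeasure μ.variation) :
    c * ‖∫ᵛ x, φ x ∂•μ‖ ^ 2 ≤ (form k μ μ).re := by
  obtain ⟨h, hm, hb, -, h1, -, h3⟩ := exists_integral_eq μ
  obtain ⟨C, hC⟩ := hk.bdd
  set l : X → X → ℝ := fun x y => k x y - c * (φ x * φ y) with hl
  have hφ2 := isPSDKernel_mul hφ hB
  obtain ⟨D, hD⟩ := hφ2.bdd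
  have hkl : ∀ x y, k x y = l x y + c * (φ x * φ y) := fun x y => by simp [hl]
  have hkm : Measurable (Function.uncurry k) := by
    have : Function.uncurry k = fun p => Function.uncurry l p + c * (φ p.1 * φ p.2) := by
      ext p; exact hkl _ _
    rw [this]
    exact hk.measurable.add (hφ2.measurable.const_mul c)
  have hkb : ∀ x y, |k x y| ≤ C + |c| * D := fun x y => by
    rw [hkl]
    refine (abs_add_le _ _).trans (add_le_add (hC x y) ?_)
    rw [abs_mul]
    exact mul_le_mul_of_nonneg_left (hD x y) (abs_nonneg _)
  have hg := isGood_of_bounded hkm hkb hμ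
  have hform : form k μ μ = ∫ p : X × X, (k p.1 p.2 : ℂ) * (h p.1 * conj (h p.2))
      ∂(μ.variation.prod μ.variation) := by
    rw [form, h3 _ (hg.integrable_pot _),
      integral_prod_symm _ (integrable_kernel hkm hkb _ _ hm hm hb hb)]
    congr with y
    rw [pot, h1 _ (hg.integrable y), ← integral_mul_const]
    simp [mul_assoc]
  have hφi : Integrable φ μ.variation :=
    Integrable.of_bound hφ.aestronglyMeasurable B (Eventually.of_forall hB)
  have h4 : (∫ p : X × X, ((φ p.1 * φ p.2 : ℝ) : ℂ) * (h p.1 * conj (h p.2))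
      ∂(μ.variation.prod μ.variation)) = ((‖∫ᵛ x, φ x ∂•μ‖ ^ 2 : ℝ) : ℂ) := by
    have : ∀ p : X × X, ((φ p.1 * φ p.2 : ℝ) : ℂ) * (h p.1 * conj (h p.2)) =
        (φ p.1 * h p.1) * conj (φ p.2 * h p.2) := by
      intro p
      simp only [map_mul, Complex.conj_ofReal]
      push_cast
      ring
    simp_rw [this]
    rw [integral_prod_mul (fun x => (φ x : ℂ) * h x) (fun x => conj (φ x * h x)), integral_conj,
      Complex.mul_conj, h1 _ hφi, Complex.normSq_eq_norm_sq]
  have h5 := hk.nonneg μ.variation h hm ⟨2, hb⟩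
  have h6 : form k μ μ = (∫ p : X × X, (l p.1 p.2 : ℂ) * (h p.1 * conj (h p.2))
      ∂(μ.variation.prod μ.variation)) + c * ((‖∫ᵛ x, φ x ∂•μ‖ ^ 2 : ℝ) : ℂ) := by
    rw [hform, ← h4, ← integral_const_mul, ← integral_add
      (integrable_kernel hk.measurable hC _ _ hm hm hb hb)
      ((integrable_kernel hφ2.measurable hD _ _ hm hm hb hb).const_mul _)]
    congr with p
    rw [hkl]
    push_cast
    ring
  rw [h6, Complex.add_re, ← Complex.ofReal_mul, Complex.ofReal_re]
  linarith

/-- The partial sums are bounded by ∑ b, so positivity passes to their pointwise limit. -/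
theorem IsPSDKernel.of_hasSum {t : ℕ → X → X → ℝ} {l : X → X → ℝ} (ht : ∀ n, IsPSDKernel (t n))
    {b : ℕ → ℝ} (hb : Summable b) (htb : ∀ n x y, |t n x y| ≤ b n)
    (hl : ∀ x y, HasSum (fun n => t n x y) (l x y)) : IsPSDKernel l := by
  refine IsPSDKernel.of_tendsto (k := fun N x y => ∑ n ∈ Finset.range N, t n x y) (C := ∑' n, b n)
    (fun N => IsPSDKernel.sum _ fun n _ => ht n) (fun N x y => ?_)
    fun x y => (hl x y).tendsto_sum_nat
  refine (Finset.abs_sum_le_sum_abs _ _).trans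
    ((Finset.sum_le_sum fun n _ => htb n x y).trans (hb.sum_le_tsum _ fun n _ => ?_))
  exact (abs_nonneg _).trans (htb n x x)

end EnergyForm

namespace RiemannSphere

open EnergyForm

/-- The inverse stereographic projection onto the unit sphere. -/
def coord : OnePoint ℂ → Fin 3 → ℝ
  | OnePoint.infty => ![0, 0, 1]
  | OnePoint.some z =>
    ![2 * z.re / (1 + ‖z‖ ^ 2), 2 * z.im / (1 + ‖z‖ ^ 2), (‖z‖ ^ 2 - 1) / (1 + ‖z‖ ^ 2)]

/-- The inner product of the corresponding points of the unit sphere. -/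
def dot (x y : OnePoint ℂ) : ℝ := ∑ i, coord x i * coord y i

theorem coord_coe_zero (z : ℂ) : coord z 0 = 2 * z.re / (1 + ‖z‖ ^ 2) := rfl

theorem coord_coe_one (z : ℂ) : coord z 1 = 2 * z.im / (1 + ‖z‖ ^ 2) := rfl

theorem coord_coe_two (z : ℂ) : coord z 2 = (‖z‖ ^ 2 - 1) / (1 + ‖z‖ ^ 2) := rfl

theorem coord_infty_zero : coord OnePoint.infty 0 = 0 := rfl

theorem coord_infty_one : coord OnePoint.infty 1 = 0 := rfl

theorem coord_infty_two : coord OnePoint.infty 2 = 1 := rfl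

theorem norm_sq_eq (z : ℂ) : ‖z‖ ^ 2 = z.re ^ 2 + z.im ^ 2 := by
  rw [← Complex.normSq_eq_norm_sq, Complex.normSq_apply]; ring

theorem dot_comm (x y : OnePoint ℂ) : dot x y = dot y x := by
  simp only [dot, mul_comm]

theorem dot_self (x : OnePoint ℂ) : dot x x = 1 := by
  induction x using OnePoint.rec with
  | infty => simp [dot, Fin.sum_univ_three, coord_infty_zero, coord_infty_one, coord_infty_two]
  | coe z =>
    have h : 1 + ‖z‖ ^ 2 ≠ 0 := by positivity
    simp only [dot, Fin.sum_univ_three, coord_coe_zero, coord_coe_one, coord_coe_two]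
    field_simp
    have := norm_sq_eq z
    rw [this]
    ring

theorem abs_dot_le (x y : OnePoint ℂ) : |dot x y| ≤ 1 := by
  have h := Finset.sum_mul_sq_le_sq_mul_sq Finset.univ (coord x) (coord y)
  have hx := dot_self x
  have hy := dot_self y
  simp only [dot, ← sq] at hx hy
  rw [hx, hy, one_mul] at h
  exact abs_le_one_iff_mul_self_le_one.2 (by rw [← sq]; exact h)

theorem abs_coord_le (x : OnePoint ℂ) (i : Fin 3) : |coord x i| ≤ 1 := by
  have hx := dot_self x
  simp only [dot, ← sq] at hx
  have h : coord x i ^ 2 ≤ 1 := hx ▸ Finset.single_le_sum (f := fun i => coord x i ^ 2)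
    (fun j _ => sq_nonneg _) (Finset.mem_univ i)
  exact abs_le_one_iff_mul_self_le_one.2 (by rw [← sq]; exact h)

theorem chordal_comm (x y : OnePoint ℂ) : chordal x y = chordal y x := by
  induction x using OnePoint.rec <;> induction y using OnePoint.rec <;>
    simp [chordal, norm_sub_rev, mul_comm]

theorem chordal_coe_infty (z : ℂ) :
    chordal (z : OnePoint ℂ) OnePoint.infty = 1 / √(1 + ‖z‖ ^ 2) := rfl

theorem chordal_coe_coe (z w : ℂ) : chordal (z : OnePoint ℂ) (w : OnePoint ℂ) =
    ‖z - w‖ / (√(1 + ‖z‖ ^ 2) * √(1 + ‖w‖ ^ 2)) := rfl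

/-- The chordal metric is half the Euclidean distance on the unit sphere, and |x − y|² = 2 − 2 x·y
there. The archimedean kernel becomes a function of x·y. -/
theorem chordal_sq (x y : OnePoint ℂ) : chordal x y ^ 2 = (1 - dot x y) / 2 := by
  have key : ∀ z : ℂ, chordal (z : OnePoint ℂ) OnePoint.infty ^ 2 =
      (1 - dot z OnePoint.infty) / 2 := by
    intro z
    have h : 0 < 1 + ‖z‖ ^ 2 := by positivity
    rw [chordal_coe_infty, div_pow, Real.sq_sqrt h.le]
    simp only [dot, Fin.sum_univ_three, coord_coe_zero, coord_coe_one, coord_coe_two,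
      coord_infty_zero, coord_infty_one, coord_infty_two]
    field_simp
    ring
  induction x using OnePoint.rec with
  | infty =>
    induction y using OnePoint.rec with
    | infty => simp [chordal, dot_self]
    | coe w => rw [chordal_comm, dot_comm, key]
  | coe z =>
    induction y using OnePoint.rec with
    | infty => exact key z
    | coe w =>
      have h : 0 < 1 + ‖z‖ ^ 2 := by positivity
      have h' : 0 < 1 + ‖w‖ ^ 2 := by positivity
      rw [chordal_coe_coe, div_pow, mul_pow, Real.sq_sqrt h.le, Real.sq_sqrt h'.le]
      simp only [dot, Fin.sum_univ_three, coord_coe_zero, coord_coe_one, coord_coe_two]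
      field_simp
      simp only [norm_sq_eq, Complex.sub_re, Complex.sub_im]
      ring

theorem chordal_eq_zero_iff (x y : OnePoint ℂ) : chordal x y = 0 ↔ dot x y = 1 := by
  rw [← sq_eq_zero_iff, chordal_sq]
  constructor <;> intro h <;> linarith

theorem logKernel_chordal (x y : OnePoint ℂ) :
    logKernel chordal x y = -(1 / 2) * Real.log ((1 - dot x y) / 2) := by
  rw [logKernel, one_div, Real.log_inv, ← chordal_sq, Real.log_pow]
  push_cast
  ring

/-- On the diagonal the two sides differ by ½ log 2, because `Real.log 0 = 0`. -/
theorem logKernel_chordal_of_ne {x y : OnePoint ℂ} (h : chordal x y ≠ 0) :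
    logKernel chordal x y = 1 / 2 * Real.log 2 - 1 / 2 * Real.log (1 - dot x y) := by
  have h1 : 1 - dot x y ≠ 0 := fun h' => h ((chordal_eq_zero_iff x y).2 (by linarith))
  rw [logKernel_chordal, Real.log_div h1 two_ne_zero]
  ring

/-- At infinity the first two coordinates are bounded by 2 / ‖z‖, and the third is 1 − 2 / (1 +
‖z‖²). -/
theorem continuous_coord (i : Fin 3) : Continuous fun x => coord x i := by
  have hn : Tendsto (fun z : ℂ => ‖z‖) (cocompact ℂ) atTop := tendsto_norm_cocompact_atTop
  have h1 : Tendsto (fun z : ℂ => 2 / ‖z‖) (cocompact ℂ) (𝓝 0) := hn.const_div_atTop 2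
  have h2 : Tendsto (fun z : ℂ => 2 / (1 + ‖z‖ ^ 2)) (cocompact ℂ) (𝓝 0) :=
    (tendsto_atTop_add_const_left _ _
      ((tendsto_pow_atTop two_ne_zero).comp hn)).const_div_atTop 2
  have hb : ∀ (z : ℂ) (a : ℝ), |a| ≤ ‖z‖ → |2 * a / (1 + ‖z‖ ^ 2)| ≤ 2 / ‖z‖ := by
    intro z a ha
    have hp : 0 < 1 + ‖z‖ ^ 2 := by positivity
    rcases (norm_nonneg z).eq_or_lt with h0 | h0
    · rw [← h0] at ha
      have : a = 0 := abs_eq_zero.1 (le_antisymm ha (abs_nonneg _))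
      simp [this, ← h0]
    · rw [abs_div, abs_of_pos hp, abs_mul, abs_two, div_le_div_iff₀ hp h0]
      nlinarith
  rw [OnePoint.continuous_iff]
  rw [coclosedCompact_eq_cocompact]
  have hpos : ∀ z : ℂ, 1 + ‖z‖ ^ 2 ≠ 0 := fun z => by positivity
  fin_cases i
  · constructor
    · refine squeeze_zero_norm (fun z => ?_) h1
      exact hb z z.re (Complex.abs_re_le_norm z)
    · exact Continuous.div (by fun_prop) (by fun_prop) hpos
  · constructor
    · refine squeeze_zero_norm (fun z => ?_) h1
      exact hb z z.im (Complex.abs_im_le_norm z)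
    · exact Continuous.div (by fun_prop) (by fun_prop) hpos
  · constructor
    · have h3 : ∀ z : ℂ, 1 - 2 / (1 + ‖z‖ ^ 2) = (‖z‖ ^ 2 - 1) / (1 + ‖z‖ ^ 2) := fun z => by
        have := hpos z
        field_simp
        ring
      have h4 : Tendsto (fun z : ℂ => 1 - 2 / (1 + ‖z‖ ^ 2)) (cocompact ℂ) (𝓝 (1 - 0)) :=
        (h2.const_sub 1)
      rw [sub_zero] at h4
      exact h4.congr h3
    · exact Continuous.div (by fun_prop) (by fun_prop) hpos

end RiemannSphere
end

/-! ### Power series of the regularized kernel of the sphere -/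

noncomputable section

namespace RiemannSphere

open EnergyForm

theorem measurable_coord (i : Fin 3) : Measurable fun x => coord x i :=
  (continuous_coord i).measurable

/-- The monomials in the coordinates of the unit sphere. -/
def monomial {n : ℕ} (I : Fin n → Fin 3) (x : OnePoint ℂ) : ℝ := ∏ j, coord x (I j)

theorem continuous_monomial {n : ℕ} (I : Fin n → Fin 3) : Continuous (monomial I) :=
  continuous_finsetProd _ fun j _ => continuous_coord (I j)

theorem abs_monomial_le {n : ℕ} (I : Fin n → Fin 3) (x : OnePoint ℂ) : |monomial I x| ≤ 1 := by
  rw [monomial, Finset.abs_prod]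
  exact Finset.prod_le_one (fun _ _ => abs_nonneg _) fun j _ => abs_coord_le x (I j)

/-- Multinomial expansion over words of length n. Equal monomials are not collected, so that all
coefficients are 1. -/
theorem dot_pow (n : ℕ) (x y : OnePoint ℂ) :
    dot x y ^ n = ∑ I : Fin n → Fin 3, monomial I x * monomial I y := by
  rw [dot, Fintype.sum_pow]
  simp [monomial, Finset.prod_mul_distrib]

theorem isPSDKernel_monomial {n : ℕ} (I : Fin n → Fin 3) :
    IsPSDKernel fun x y => monomial I x * monomial I y :=
  isPSDKernel_mul (continuous_monomial I).measurable (abs_monomial_le I)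

theorem isPSDKernel_dot_pow (n : ℕ) : IsPSDKernel fun x y => dot x y ^ n := by
  simp_rw [dot_pow]
  exact IsPSDKernel.sum _ fun I _ => isPSDKernel_monomial I

/-- Dropping one word from the expansion leaves a sum of rank-one kernels; this isolates a single
moment of a measure. -/
theorem isPSDKernel_dot_pow_sub {n : ℕ} (I : Fin n → Fin 3) :
    IsPSDKernel fun x y => dot x y ^ n - monomial I x * monomial I y := by
  classical
  have : ∀ x y, dot x y ^ n - monomial I x * monomial I y =
      ∑ J ∈ Finset.univ.erase I, monomial J x * monomial J y := by
    intro x y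
    rw [dot_pow, ← Finset.add_sum_erase _ _ (Finset.mem_univ I)]
    ring
  simp_rw [this]
  exact IsPSDKernel.sum _ fun J _ => isPSDKernel_monomial J

/-- The regularized logarithmic kernel. -/
def regKernel (r : ℝ) (x y : OnePoint ℂ) : ℝ :=
  1 / 2 * Real.log 2 - 1 / 2 * Real.log (1 - r * dot x y)

section

variable {r : ℝ} (h0 : 0 ≤ r) (h1 : r < 1)

include h0 h1

theorem abs_mul_dot_lt (x y : OnePoint ℂ) : |r * dot x y| < 1 := by
  rw [abs_mul, abs_of_nonneg h0]
  exact (mul_le_of_le_one_right h0 (abs_dot_le x y)).trans_lt h1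

theorem one_sub_mul_dot_pos (x y : OnePoint ℂ) : 0 < 1 - r * dot x y := by
  linarith [(abs_lt.1 (abs_mul_dot_lt h0 h1 x y)).2]

/-- Taylor series of −log(1 − t) at t = r x·y. Its nonnegative coefficients are the source of
positivity at archimedean places, and r < 1 makes the convergence uniform. -/
theorem hasSum_regKernel (x y : OnePoint ℂ) :
    HasSum (fun n : ℕ => r ^ (n + 1) / (2 * (n + 1)) * dot x y ^ (n + 1))
      (regKernel r x y - 1 / 2 * Real.log 2) := by
  have h := (Real.hasSum_pow_div_log_of_abs_lt_one (abs_mul_dot_lt h0 h1 x y)).mul_left (1 / 2)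
  have h2 : ∀ n : ℕ, 1 / 2 * ((r * dot x y) ^ (n + 1) / (n + 1)) =
      r ^ (n + 1) / (2 * (n + 1)) * dot x y ^ (n + 1) := fun n => by
    rw [mul_pow]
    field_simp
  have h3 : 1 / 2 * -Real.log (1 - r * dot x y) = regKernel r x y - 1 / 2 * Real.log 2 := by
    rw [regKernel]; ring
  simp_rw [h2] at h
  rwa [h3] at h

theorem coeff_le (n : ℕ) : r ^ (n + 1) / (2 * (n + 1)) ≤ r ^ n := by
  rw [div_le_iff₀ (by positivity), pow_succ]
  have : (0 : ℝ) ≤ r ^ n := by positivity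
  have hn : (0 : ℝ) ≤ n := Nat.cast_nonneg n
  nlinarith

/-- The factor `1 * 1` gives the constant the shape c φ(x) φ(y) with φ = 1 that
`mul_norm_integral_sq_le` expects. -/
theorem isPSDKernel_regKernel_sub_const :
    IsPSDKernel fun x y => regKernel r x y - 1 / 2 * Real.log 2 * ((1 : ℝ) * 1) := by
  simp only [mul_one]
  refine IsPSDKernel.of_hasSum (fun n => (isPSDKernel_dot_pow (n + 1)).const_mul
    (c := r ^ (n + 1) / (2 * (n + 1))) (by positivity)) (b := fun n => r ^ n)
    (summable_geometric_of_lt_one h0 h1) (fun n x y => ?_) (hasSum_regKernel h0 h1)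
  rw [abs_mul, abs_of_nonneg (by positivity : 0 ≤ r ^ (n + 1) / (2 * ((n : ℝ) + 1))), abs_pow]
  have h2 := pow_le_one₀ (n := n + 1) (abs_nonneg _) (abs_dot_le x y)
  exact (mul_le_of_le_one_right (by positivity) h2).trans (coeff_le h0 h1 n)

theorem isPSDKernel_regKernel : IsPSDKernel (regKernel r) := by
  have h2 : IsPSDKernel fun _ _ : OnePoint ℂ => 1 / 2 * Real.log 2 := by
    have := (isPSDKernel_mul (X := OnePoint ℂ) (φ := fun _ => 1) measurable_const (C := 1)
      (by simp)).const_mul (c := 1 / 2 * Real.log 2) (by positivity)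
    simpa using this
  simpa using (isPSDKernel_regKernel_sub_const h0 h1).add h2

theorem isPSDKernel_regKernel_sub_monomial {n : ℕ} (I : Fin (n + 1) → Fin 3) :
    IsPSDKernel fun x y =>
      regKernel r x y - r ^ (n + 1) / (2 * (n + 1)) * (monomial I x * monomial I y) := by
  have h2 : IsPSDKernel fun _ _ : OnePoint ℂ => 1 / 2 * Real.log 2 := by
    have := (isPSDKernel_mul (X := OnePoint ℂ) (φ := fun _ => 1) measurable_const (C := 1)
      (by simp)).const_mul (c := 1 / 2 * Real.log 2) (by positivity)
    simpa using this
  have h3 : IsPSDKernel fun x y => (regKernel r x y - 1 / 2 * Real.log 2) -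
      r ^ (n + 1) / (2 * (n + 1)) * (monomial I x * monomial I y) := by
    -- The monomial is subtracted from the term of its own degree n + 1, the one of index `k = n`;
    -- all other terms are left alone.
    refine IsPSDKernel.of_hasSum (t := fun k x y =>
      r ^ (k + 1) / (2 * (k + 1)) * dot x y ^ (k + 1) - if k = n then
        r ^ (n + 1) / (2 * (n + 1)) * (monomial I x * monomial I y) else 0) (fun k => ?_)
      (b := fun k => r ^ k + if k = n then r ^ (n + 1) / (2 * ((n : ℝ) + 1)) else 0)
      ((summable_geometric_of_lt_one h0 h1).add (hasSum_ite_eq n _).summable)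
      (fun k x y => ?_) fun x y => (hasSum_regKernel h0 h1 x y).sub (hasSum_ite_eq n _)
    · by_cases hk : k = n
      · subst hk
        simp only [if_true, ← mul_sub]
        exact (isPSDKernel_dot_pow_sub I).const_mul (by positivity)
      · simp only [hk, if_false, sub_zero]
        exact (isPSDKernel_dot_pow (k + 1)).const_mul (by positivity)
    · refine (abs_sub _ _).trans (add_le_add ?_ ?_)
      · rw [abs_mul, abs_of_nonneg (by positivity : 0 ≤ r ^ (k + 1) / (2 * ((k : ℝ) + 1))), abs_pow]
        have h2 := pow_le_one₀ (n := k + 1) (abs_nonneg _) (abs_dot_le x y)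
        exact (mul_le_of_le_one_right (by positivity) h2).trans (coeff_le h0 h1 k)
      · split_ifs
        · rw [abs_mul, abs_of_nonneg (by positivity : 0 ≤ r ^ (n + 1) / (2 * ((n : ℝ) + 1))),
            abs_mul]
          exact mul_le_of_le_one_right (by positivity)
            (mul_le_one₀ (abs_monomial_le I x) (abs_nonneg _) (abs_monomial_le I y))
        · simp
  have h4 := h3.add h2
  refine (funext₂ fun x y => ?_ : (fun x y => _) = _) ▸ h4
  ring

/-- If x·y ≥ 0 the right side is at least 1 − x·y, otherwise at least 1. This dominates the
regularized kernels by the logarithmic one, uniformly in r. -/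
theorem half_one_sub_dot_le (x y : OnePoint ℂ) : (1 - dot x y) / 2 ≤ 1 - r * dot x y := by
  have h := abs_le.1 (abs_dot_le x y)
  rcases le_or_gt 0 (dot x y) with h2 | h2
  · nlinarith [h.1, h.2]
  · nlinarith [h.1, h.2, mul_nonneg h0 (neg_nonneg.2 h2.le)]

theorem abs_regKernel_le (x y : OnePoint ℂ) (hxy : dot x y ≠ 1) :
    |regKernel r x y| ≤ |logKernel chordal x y| + Real.log 2 := by
  have hd := abs_le.1 (abs_dot_le x y)
  have hlt : 0 < (1 - dot x y) / 2 := by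
    have : dot x y < 1 := lt_of_le_of_ne hd.2 hxy
    linarith
  have hl2 : 0 ≤ Real.log 2 := Real.log_nonneg (by norm_num)
  have h3 := Real.log_le_log hlt (half_one_sub_dot_le h0 h1 x y)
  have h4 : Real.log (1 - r * dot x y) ≤ Real.log 2 := by
    refine Real.log_le_log (one_sub_mul_dot_pos h0 h1 x y) ?_
    linarith [(abs_lt.1 (abs_mul_dot_lt h0 h1 x y)).1]
  rw [regKernel, abs_of_nonneg (by linarith)]
  have h5 := le_abs_self (logKernel chordal x y)
  rw [logKernel_chordal] at h5 ⊢
  linarith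

end

theorem coord_injective : Function.Injective coord := by
  intro x y h
  have h1 : dot x y = 1 := by
    rw [← dot_self x, dot, dot, h]
  induction x using OnePoint.rec with
  | infty =>
    induction y using OnePoint.rec with
    | infty => rfl
    | coe w =>
      exfalso
      have := (chordal_eq_zero_iff _ _).2 h1
      rw [chordal_comm, chordal_coe_infty] at this
      have h2 : (0 : ℝ) < 1 / √(1 + ‖w‖ ^ 2) := by positivity
      exact h2.ne' this
  | coe z =>
    induction y using OnePoint.rec with
    | infty =>
      exfalso
      have := (chordal_eq_zero_iff _ _).2 h1
      rw [chordal_coe_infty] at this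
      have h2 : (0 : ℝ) < 1 / √(1 + ‖z‖ ^ 2) := by positivity
      exact h2.ne' this
    | coe w =>
      have := (chordal_eq_zero_iff _ _).2 h1
      rw [chordal_coe_coe, div_eq_zero_iff] at this
      rcases this with h2 | h2
      · rw [sub_eq_zero.1 (norm_eq_zero.1 h2)]
      · have : (0 : ℝ) < √(1 + ‖z‖ ^ 2) * √(1 + ‖w‖ ^ 2) := by positivity
        exact absurd h2 this.ne'

/-- Comes from the closed embedding in ℝ³, and is needed for measures to be determined by integrals
of continuous functions. -/
instance : TopologicalSpace.MetrizableSpace (OnePoint ℂ) :=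
  ((continuous_pi fun i => continuous_coord i).isClosedEmbedding
    coord_injective).isEmbedding.metrizableSpace

end RiemannSphere
end

noncomputable section

namespace RiemannSphere

open EnergyForm Real

/-! ### The Fubini–Study measure -/

/-- Integration in polar coordinates, in terms of circle averages. -/
theorem integral_eq_integral_circleAverage {f : ℂ → ℝ} (hfm : Measurable f) (hf : Integrable f) :
    ∫ z, f z = ∫ r in Ioi (0 : ℝ), 2 * π * r * circleAverage f 0 r := by
  have hmeas : Measurable fun p : ℝ × ℝ => p.1 • f (Complex.polarCoord.symm p) := by
    have : Measurable fun p : ℝ × ℝ => Complex.polarCoord.symm p := by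
      simp only [Complex.polarCoord_symm_apply]
      fun_prop
    exact measurable_fst.smul (hfm.comp this)
  have hint : IntegrableOn (fun p : ℝ × ℝ => p.1 • f (Complex.polarCoord.symm p))
      (Ioi 0 ×ˢ Ioo (-π) π) (volume.prod volume) := by
    refine ⟨hmeas.aestronglyMeasurable, ?_⟩
    rw [hasFiniteIntegral_iff_enorm]
    have h1 := Complex.lintegral_comp_polarCoord_symm fun z => ‖f z‖ₑ
    rw [polarCoord_target] at h1
    refine lt_of_eq_of_lt ?_ (h1.trans_lt hf.2)
    rw [Measure.volume_eq_prod]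
    refine setLIntegral_congr_fun (measurableSet_Ioi.prod measurableSet_Ioo) fun p hp => ?_
    simp only [smul_eq_mul, enorm_mul]
    rw [Real.enorm_of_nonneg (le_of_lt hp.1)]
  rw [← Complex.integral_comp_polarCoord_symm, polarCoord_target, Measure.volume_eq_prod,
    setIntegral_prod _ hint]
  refine setIntegral_congr_fun measurableSet_Ioi fun r hr => ?_
  simp only [smul_eq_mul]
  rw [integral_const_mul, circleAverage_eq_integral_add (-π), smul_eq_mul,
    intervalIntegral.integral_comp_add_right (fun θ => f (circleMap 0 r θ))]
  rw [zero_add, show 2 * π + -π = π by ring, intervalIntegral.integral_of_le (by linarith [pi_pos]),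
    integral_Ioc_eq_integral_Ioo]
  have : ∀ θ : ℝ, Complex.polarCoord.symm (r, θ) = circleMap 0 r θ := by
    intro θ
    rw [Complex.polarCoord_symm_apply, circleMap_zero, Complex.exp_mul_I]
    simp
  simp_rw [this]
  field_simp

/-- The density of the Fubini–Study measure. -/
def density (z : ℂ) : ℝ := 1 / (π * (1 + ‖z‖ ^ 2) ^ 2)

theorem continuous_density : Continuous density := by
  unfold density
  refine continuous_const.div (by fun_prop) fun z => ?_
  have := pi_pos
  positivity

theorem density_pos (z : ℂ) : 0 < density z := by
  have := pi_pos
  rw [density]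
  positivity

theorem density_le (z : ℂ) : density z ≤ 1 := by
  rw [density, div_le_one (by have := pi_pos; positivity)]
  nlinarith [pi_gt_three, sq_nonneg ‖z‖, sq_nonneg (‖z‖ ^ 2)]

theorem integrable_norm_mul_density : Integrable fun z : ℂ => ‖z‖ * density z := by
  have h := (integrable_fun_norm_addHaar (volume : Measure ℂ)
    (f := fun r : ℝ => r * (1 / (π * (1 + r ^ 2) ^ 2)))).2 ?_
  · exact h
  · rw [Complex.finrank_real_complex]
    refine Integrable.mono' (g := fun r : ℝ => (1 + r ^ 2)⁻¹) integrable_inv_one_add_sq.integrableOn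
      ?_ (Eventually.of_forall fun r => ?_)
    · exact Measurable.aestronglyMeasurable (by fun_prop)
    · have hp : 0 < (1 + r ^ 2) := by positivity
      have h3 := pi_gt_three
      rw [smul_eq_mul, norm_mul, norm_mul, Real.norm_eq_abs, Real.norm_eq_abs, Real.norm_eq_abs,
        abs_of_pos (by positivity : 0 < 1 / (π * (1 + r ^ 2) ^ 2)), show 2 - 1 = 1 from rfl, pow_one,
        ← mul_assoc, abs_mul_abs_self, mul_one_div, inv_eq_one_div, div_le_div_iff₀ (by positivity) hp]
      nlinarith [sq_nonneg r, mul_nonneg (sq_nonneg r) (sq_nonneg r)]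

theorem integrable_density : Integrable density := by
  have h := (integrable_fun_norm_addHaar (volume : Measure ℂ)
    (f := fun r : ℝ => (1 / (π * (1 + r ^ 2) ^ 2)))).2 ?_
  · exact h
  · rw [Complex.finrank_real_complex]
    refine Integrable.mono' (g := fun r : ℝ => (1 + r ^ 2)⁻¹) integrable_inv_one_add_sq.integrableOn
      ?_ (Eventually.of_forall fun r => ?_)
    · exact Measurable.aestronglyMeasurable (by fun_prop)
    · have hp : 0 < (1 + r ^ 2) := by positivity
      have h3 := pi_gt_three
      have h4 : |r| ≤ 1 + r ^ 2 := by
        rw [abs_le]; constructor <;> nlinarith [sq_nonneg (r + 1), sq_nonneg (r - 1)]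
      rw [smul_eq_mul, norm_mul, Real.norm_eq_abs, Real.norm_eq_abs,
        abs_of_pos (by positivity : 0 < 1 / (π * (1 + r ^ 2) ^ 2)), show 2 - 1 = 1 from rfl, pow_one,
        mul_one_div, inv_eq_one_div, div_le_div_iff₀ (by positivity) hp]
      nlinarith [sq_nonneg r, mul_nonneg (sq_nonneg r) (sq_nonneg r)]

/-- In polar coordinates the singularity becomes r |log r|, which is bounded by 1 on (0, 1). -/
theorem integrable_indicator_log_norm :
    Integrable fun z : ℂ => (Iio (1 : ℝ)).indicator (fun r => |log r|) ‖z‖ := by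
  refine (integrable_fun_norm_addHaar (volume : Measure ℂ)
    (f := (Iio (1 : ℝ)).indicator fun r => |log r|)).2 ?_
  rw [Complex.finrank_real_complex]
  refine Integrable.mono' (g := (Ioo (0 : ℝ) 1).indicator fun _ => 1) ?_ ?_ ?_
  · exact (integrable_indicator_iff measurableSet_Ioo).2 (by simp) |>.integrableOn
  · exact ((measurable_id.pow_const _).smul
      ((Real.measurable_log.abs).indicator measurableSet_Iio)).aestronglyMeasurable
  · refine (ae_restrict_mem measurableSet_Ioi).mono fun r hr => ?_
    have hr0 : 0 < r := hr
    by_cases h1 : r < 1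
    · have h2 := Real.abs_log_mul_self_lt r hr0 h1.le
      rw [abs_mul, abs_of_pos hr0] at h2
      simp only [mem_Iio, h1, indicator_of_mem, smul_eq_mul, mem_Ioo, hr0, and_self]
      rw [norm_mul, Real.norm_eq_abs, Real.norm_eq_abs, abs_abs, show 2 - 1 = 1 from rfl, pow_one,
        abs_of_pos hr0, mul_comm]
      exact h2.le
    · simp [h1]

/-- Within distance 1 of a the logarithm is integrable and the density at most 1; farther away log t
≤ t leaves a first moment of the density. -/
theorem integrable_log_norm_sub_mul_density (a : ℂ) :
    Integrable fun z : ℂ => log ‖z - a‖ * density z := by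
  have h1 : Integrable fun z : ℂ => (Iio (1 : ℝ)).indicator (fun r => |log r|) ‖z - a‖ :=
    integrable_indicator_log_norm.comp_sub_right a
  refine Integrable.mono' (g := fun z => (Iio (1 : ℝ)).indicator (fun r => |log r|) ‖z - a‖ +
    (‖z‖ * density z + ‖a‖ * density z))
    (h1.add (integrable_norm_mul_density.add (integrable_density.const_mul _))) ?_ ?_
  · refine Measurable.aestronglyMeasurable (Measurable.mul ?_ continuous_density.measurable)
    fun_prop
  · refine Eventually.of_forall fun z => ?_
    rw [norm_mul, Real.norm_eq_abs, Real.norm_eq_abs, abs_of_pos (density_pos z)]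
    have hd := density_pos z
    by_cases h2 : ‖z - a‖ < 1
    · have : (Iio (1 : ℝ)).indicator (fun r => |log r|) ‖z - a‖ = |log ‖z - a‖| :=
        indicator_of_mem (mem_Iio.2 h2) _
      rw [this]
      have h3 := mul_le_of_le_one_right (abs_nonneg (log ‖z - a‖)) (density_le z)
      have : 0 ≤ ‖z‖ * density z + ‖a‖ * density z := by positivity
      linarith
    · have : (Iio (1 : ℝ)).indicator (fun r => |log r|) ‖z - a‖ = 0 := 
        indicator_of_notMem (by simpa using h2) _
      rw [this, zero_add, ← add_mul]
      refine mul_le_mul_of_nonneg_right ?_ hd.le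
      rw [abs_of_nonneg (log_nonneg (not_lt.1 h2))]
      refine (Real.log_le_self (norm_nonneg _)).trans ?_
      exact norm_sub_le _ _

theorem integral_Ioi_density_radial :
    ∫ r in Ioi (0 : ℝ), 2 * r / (1 + r ^ 2) ^ 2 = 1 := by
  have hd : ∀ r ∈ Ici (0 : ℝ), HasDerivAt (fun r : ℝ => -(1 + r ^ 2)⁻¹)
      (2 * r / (1 + r ^ 2) ^ 2) r := by
    intro r _
    have hp : (1 + r ^ 2) ≠ 0 := by positivity
    have := (((hasDerivAt_pow 2 r).const_add 1).inv hp).neg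
    exact this.congr_deriv (by simp; ring)
  have hlim : Tendsto (fun r : ℝ => -(1 + r ^ 2)⁻¹) atTop (𝓝 0) := by
    have : Tendsto (fun r : ℝ => 1 + r ^ 2) atTop atTop :=
      tendsto_atTop_add_const_left _ _ (tendsto_pow_atTop two_ne_zero)
    simpa using this.inv_tendsto_atTop.neg
  rw [integral_Ioi_of_hasDerivAt_of_nonneg' hd (fun r hr => ?_) hlim]
  · simp
  · have : 0 < r := hr
    positivity

theorem circleAverage_mul_density (f : ℂ → ℝ) (r : ℝ) :
    2 * π * r * circleAverage (fun z => f z * density z) 0 r =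
      2 * r / (1 + r ^ 2) ^ 2 * circleAverage f 0 r := by
  have h : ∀ θ : ℝ, f (circleMap 0 r θ) * density (circleMap 0 r θ) =
      f (circleMap 0 r θ) * (1 / (π * (1 + r ^ 2) ^ 2)) := by
    intro θ
    rw [density, norm_circleMap_zero, sq_abs]
  rw [circleAverage_def, circleAverage_def]
  simp_rw [h]
  rw [intervalIntegral.integral_mul_const, smul_eq_mul, smul_eq_mul]
  have := pi_pos.ne'
  have hp : (1 + r ^ 2) ≠ 0 := by positivity
  field_simp

theorem integral_density : ∫ z, density z = 1 := by
  rw [integral_eq_integral_circleAverage continuous_density.measurable integrable_density,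
    ← integral_Ioi_density_radial]
  refine setIntegral_congr_fun measurableSet_Ioi fun r _ => ?_
  have := circleAverage_mul_density (fun _ => 1) r
  simp only [one_mul] at this
  rw [this, circleAverage_const, mul_one]

/-- An antiderivative of `2 r log r / (1 + r²)²`. -/
def logPrimitive (r : ℝ) : ℝ := r * (r * log r) / (1 + r ^ 2) - 1 / 2 * log (1 + r ^ 2)

/-- The product r log r is kept together because it extends continuously to 0; this covers the lower
limit 0 in the radial integral. -/
theorem continuous_logPrimitive : Continuous logPrimitive := by
  unfold logPrimitive
  have hp : ∀ r : ℝ, 1 + r ^ 2 ≠ 0 := fun r => by positivity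
  refine Continuous.sub ?_ ?_
  · exact (continuous_id.mul continuous_mul_log).div (by fun_prop) hp
  · exact continuous_const.mul (Continuous.log (by fun_prop) hp)

theorem hasDerivAt_logPrimitive {r : ℝ} (hr : 0 < r) :
    HasDerivAt logPrimitive (2 * r / (1 + r ^ 2) ^ 2 * log r) r := by
  have hp : 1 + r ^ 2 ≠ 0 := by positivity
  have h1 := (hasDerivAt_id r).mul ((hasDerivAt_id r).mul (hasDerivAt_log hr.ne'))
  have h2 : HasDerivAt (fun r : ℝ => 1 + r ^ 2) (2 * r) r := by
    simpa using (hasDerivAt_pow 2 r).const_add 1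
  have h3 := (h1.div h2 hp).sub ((h2.log hp).const_mul (1 / 2))
  refine h3.congr_deriv ?_
  simp only [id_eq, Pi.mul_apply]
  field_simp
  ring

/-- For r > 0 the primitive equals −log r / (1 + r²) − ½ log(1 + r⁻²). -/
theorem tendsto_logPrimitive : Tendsto logPrimitive atTop (𝓝 0) := by
  have h1 : Tendsto (fun r : ℝ => log r / (1 + r ^ 2)) atTop (𝓝 0) := by
    refine squeeze_zero' (g := fun r : ℝ => r⁻¹) ?_ ?_ tendsto_inv_atTop_zero
    · filter_upwards [eventually_ge_atTop 1] with r hr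
      exact div_nonneg (log_nonneg hr) (by positivity)
    · filter_upwards [eventually_ge_atTop 1] with r hr
      have hr0 : 0 < r := by linarith
      rw [div_le_iff₀ (by positivity), ← div_eq_inv_mul, le_div_iff₀ hr0]
      nlinarith [log_le_self hr0.le]
  have h2 : Tendsto (fun r : ℝ => 1 / 2 * log (1 + (r ^ 2)⁻¹)) atTop (𝓝 0) := by
    have h3 : Tendsto (fun r : ℝ => 1 + (r ^ 2)⁻¹) atTop (𝓝 (1 + 0)) :=
      (tendsto_pow_atTop two_ne_zero).inv_tendsto_atTop.const_add 1
    have h4 := (h3.log (by norm_num)).const_mul (1 / 2)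
    simpa using h4
  have h5 := h1.neg.sub h2
  simp only [neg_zero, sub_zero] at h5
  refine h5.congr' ?_
  filter_upwards [eventually_gt_atTop 0] with r hr
  have hp : 1 + r ^ 2 ≠ 0 := by positivity
  have h6 : 1 + (r ^ 2)⁻¹ = (1 + r ^ 2) / r ^ 2 := by field_simp; ring
  rw [h6, log_div hp (by positivity), log_pow, logPrimitive]
  field_simp
  push_cast
  ring

theorem integrableOn_radial_log :
    IntegrableOn (fun r : ℝ => 2 * r / (1 + r ^ 2) ^ 2 * log r) (Ioi 0) := by
  refine Integrable.mono' (g := fun r : ℝ => 2 * (1 + r ^ 2)⁻¹)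
    (integrable_inv_one_add_sq.const_mul 2).integrableOn ?_ ?_
  · exact Measurable.aestronglyMeasurable (by fun_prop)
  · refine (ae_restrict_mem measurableSet_Ioi).mono fun r hr => ?_
    have hr0 : 0 < r := hr
    have hp : 0 < 1 + r ^ 2 := by positivity
    have h1 : r * |log r| ≤ 1 + r ^ 2 := by
      rcases le_or_gt 1 r with h | h
      · rw [abs_of_nonneg (log_nonneg h)]
        nlinarith [log_le_self hr0.le]
      · have h2 := Real.abs_log_mul_self_lt r hr0 h.le
        rw [abs_mul, abs_of_pos hr0] at h2
        nlinarith
    rw [norm_mul, Real.norm_eq_abs, Real.norm_eq_abs, abs_of_pos (by positivity)]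
    calc 2 * r / (1 + r ^ 2) ^ 2 * |log r| = 2 * (r * |log r|) / (1 + r ^ 2) ^ 2 := by ring
      _ ≤ 2 * (1 + r ^ 2) / (1 + r ^ 2) ^ 2 := by gcongr
      _ = 2 * (1 + r ^ 2)⁻¹ := by field_simp

/-- The bracket is log max(r, s). Below s the integrand is a constant times the radial density,
above s it has the primitive `logPrimitive`. -/
theorem integral_radial_log {s : ℝ} (hs : 0 ≤ s) :
    ∫ r in Ioi (0 : ℝ), 2 * r / (1 + r ^ 2) ^ 2 * (log r + log⁺ (r⁻¹ * s)) =
      1 / 2 * log (1 + s ^ 2) := by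
  have hsplit : Ioi (0 : ℝ) = Ioc 0 s ∪ Ioi s := (Ioc_union_Ioi_eq_Ioi hs).symm
  have hd : ∀ r ∈ uIcc 0 s, HasDerivAt (fun r : ℝ => -(1 + r ^ 2)⁻¹ * log s)
      (2 * r / (1 + r ^ 2) ^ 2 * log s) r := by
    intro r _
    have hp : (1 + r ^ 2) ≠ 0 := by positivity
    have := ((((hasDerivAt_pow 2 r).const_add 1).inv hp).neg).mul_const (log s)
    exact this.congr_deriv (by simp; ring)
  have hci : IntervalIntegrable (fun r : ℝ => 2 * r / (1 + r ^ 2) ^ 2 * log s) volume 0 s := by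
    refine Continuous.intervalIntegrable ?_ _ _
    have hp : ∀ r : ℝ, (1 + r ^ 2) ^ 2 ≠ 0 := fun r => by positivity
    exact (Continuous.div (by fun_prop) (by fun_prop) hp).mul continuous_const
  have e1 : EqOn (fun r : ℝ => 2 * r / (1 + r ^ 2) ^ 2 * (log r + log⁺ (r⁻¹ * s)))
      (fun r => 2 * r / (1 + r ^ 2) ^ 2 * log s) (Ioc 0 s) := by
    intro r hr
    have hr0 : 0 < r := hr.1
    have : 1 ≤ |r⁻¹ * s| := by
      rw [abs_of_nonneg (by positivity), ← div_eq_inv_mul, one_le_div hr0]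
      exact hr.2
    have hs0 : 0 < s := hr0.trans_le hr.2
    simp only
    rw [posLog_eq_log this, log_mul (inv_ne_zero hr0.ne') hs0.ne', log_inv]
    ring
  have e2 : EqOn (fun r : ℝ => 2 * r / (1 + r ^ 2) ^ 2 * (log r + log⁺ (r⁻¹ * s)))
      (fun r => 2 * r / (1 + r ^ 2) ^ 2 * log r) (Ioi s) := by
    intro r hr
    have hr0 : 0 < r := hs.trans_lt hr
    have : |r⁻¹ * s| ≤ 1 := by
      rw [abs_of_nonneg (by positivity), ← div_eq_inv_mul, div_le_one hr0]
      exact (mem_Ioi.1 hr).le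
    simp only
    rw [(posLog_eq_zero_iff _).2 this, add_zero]
  have i1 : IntegrableOn (fun r : ℝ => 2 * r / (1 + r ^ 2) ^ 2 * log s) (Ioc 0 s) :=
    (intervalIntegrable_iff_integrableOn_Ioc_of_le hs).1 hci
  have i2 : IntegrableOn (fun r : ℝ => 2 * r / (1 + r ^ 2) ^ 2 * log r) (Ioi s) :=
    integrableOn_radial_log.mono_set (Ioi_subset_Ioi hs)
  rw [hsplit, setIntegral_union (Ioc_disjoint_Ioi le_rfl) measurableSet_Ioi
    (i1.congr_fun e1.symm measurableSet_Ioc) (i2.congr_fun e2.symm measurableSet_Ioi),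
    setIntegral_congr_fun measurableSet_Ioc e1, setIntegral_congr_fun measurableSet_Ioi e2,
    ← intervalIntegral.integral_of_le hs, intervalIntegral.integral_eq_sub_of_hasDerivAt hd hci,
    integral_Ioi_of_hasDerivAt_of_tendsto continuous_logPrimitive.continuousWithinAt
      (fun r hr => hasDerivAt_logPrimitive (hs.trans_lt hr)) i2 tendsto_logPrimitive, logPrimitive]
  have hp : 1 + s ^ 2 ≠ 0 := by positivity
  field_simp
  ring

/-- By Jensen's formula the average of log |z − a| over a circle of radius r is log max(r, |a|);
only a radial integral remains. -/
theorem integral_log_norm_sub_mul_density (a : ℂ) :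
    ∫ z, log ‖z - a‖ * density z = 1 / 2 * log (1 + ‖a‖ ^ 2) := by
  have hm : Measurable fun z : ℂ => log ‖z - a‖ * density z :=
    Measurable.mul (by fun_prop) continuous_density.measurable
  rw [integral_eq_integral_circleAverage hm (integrable_log_norm_sub_mul_density a),
    ← integral_radial_log (norm_nonneg a)]
  refine setIntegral_congr_fun measurableSet_Ioi fun r hr => ?_
  rw [circleAverage_mul_density, circleAverage_log_norm_sub_const_eq_log_radius_add_posLog
    (ne_of_gt hr), zero_sub, norm_neg]

end RiemannSphere
end

noncomputable section

namespace RiemannSphere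

open EnergyForm Real

/-! ### Poisson averages on the sphere -/

section Affine

/-- The quantity `1 - r x₃`. -/
def height (r : ℝ) (x : OnePoint ℂ) : ℝ := 1 - r * coord x 2

/-- The centre of the affine map whose image of the Fubini–Study measure is the Poisson kernel. -/
def centre (r : ℝ) (x : OnePoint ℂ) : ℂ :=
  ⟨r * coord x 0 / height r x, r * coord x 1 / height r x⟩

/-- The dilation factor of this affine map. -/
def dilation (r : ℝ) (x : OnePoint ℂ) : ℝ := √(1 - r ^ 2) / height r x

/-- The affine map whose image of the Fubini–Study measure is the Poisson kernel. -/
def affine (r : ℝ) (x : OnePoint ℂ) (z : ℂ) : ℂ := centre r x + dilation r x * z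

variable {r : ℝ} (h0 : 0 ≤ r) (h1 : r < 1) (x : OnePoint ℂ)

theorem coord_sq_sum : coord x 0 ^ 2 + coord x 1 ^ 2 + coord x 2 ^ 2 = 1 := by
  have := dot_self x
  simpa [dot, Fin.sum_univ_three, sq] using this

theorem continuous_affine : Continuous (affine r x) := by
  unfold affine; fun_prop

include h0 h1

theorem height_pos : 0 < height r x := by
  have h := abs_le.1 (abs_coord_le x 2)
  rw [height]
  nlinarith [h.1, h.2]

theorem dilation_pos : 0 < dilation r x :=
  div_pos (sqrt_pos.2 (by nlinarith)) (height_pos h0 h1 x)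

/-- An expansion that uses only that x has unit length. It says that 1 − r x·w comes from |w|² + 1
by an affine change of coordinate, which is why affine images of the Fubini–Study measure act as
Poisson kernels. -/
theorem height_mul_add (w : ℂ) :
    height r x * (‖w - centre r x‖ ^ 2 + dilation r x ^ 2) = (1 + ‖w‖ ^ 2) * (1 - r * dot x w) := by
  have hA := (height_pos h0 h1 x).ne'
  have hs := coord_sq_sum x
  have hp : 1 + ‖w‖ ^ 2 ≠ 0 := by positivity
  have hdot : (1 + ‖w‖ ^ 2) * dot x w =
      coord x 0 * (2 * w.re) + coord x 1 * (2 * w.im) + coord x 2 * (‖w‖ ^ 2 - 1) := by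
    simp only [dot, Fin.sum_univ_three, coord_coe_zero, coord_coe_one, coord_coe_two]
    field_simp
  have hR : (1 + ‖w‖ ^ 2) * (1 - r * dot x w) = 1 + ‖w‖ ^ 2 - r * ((1 + ‖w‖ ^ 2) * dot x w) := by
    ring
  rw [hR, hdot, norm_sq_eq, norm_sq_eq, dilation, div_pow, sq_sqrt (by nlinarith), Complex.sub_re,
    Complex.sub_im]
  simp only [centre]
  field_simp
  have hc : coord x 0 ^ 2 = 1 - coord x 1 ^ 2 - coord x 2 ^ 2 := by linarith
  simp only [height]
  linear_combination (r ^ 2) * hs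

/-- The case w = 0 of the previous identity, used to bound `centre` and `dilation` in terms of
`height`. -/
theorem height_mul_one_add : height r x * (1 + ‖centre r x‖ ^ 2 + dilation r x ^ 2) = 2 := by
  have h := height_mul_add h0 h1 x 0
  simp only [zero_sub, norm_neg, norm_zero] at h
  have hd : dot x ((0 : ℂ) : OnePoint ℂ) = -coord x 2 := by
    simp [dot, Fin.sum_univ_three, coord_coe_zero, coord_coe_one, coord_coe_two]
  rw [hd] at h
  have h2 : height r x = 1 - r * coord x 2 := rfl
  rw [add_assoc, mul_add, h, h2]
  ring

theorem integrable_log_norm_affine_sub (w : ℂ) :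
    Integrable fun z : ℂ => log ‖affine r x z - w‖ * density z := by
  have hb := dilation_pos h0 h1 x
  have h2 : ∀ᵐ z : ℂ, log (dilation r x) * density z +
      log ‖z - (w - centre r x) / dilation r x‖ * density z =
      log ‖affine r x z - w‖ * density z := by
    filter_upwards [compl_mem_ae_iff.2 (measure_singleton ((w - centre r x) / dilation r x))] with
      z hz
    have hz' : z - (w - centre r x) / dilation r x ≠ 0 := sub_ne_zero.2 hz
    have hbc : (dilation r x : ℂ) ≠ 0 := by exact_mod_cast hb.ne'
    have e : affine r x z - w = dilation r x * (z - (w - centre r x) / dilation r x) := by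
      rw [affine]; field_simp; ring
    rw [e, norm_mul, log_mul (by simpa using hb.ne') (by simpa using hz'), Complex.norm_real,
      norm_eq_abs, abs_of_pos hb]
    ring
  exact ((integrable_density.const_mul _).add (integrable_log_norm_sub_mul_density _)).congr h2

/-- Off one point, affine z − w is the dilation factor times z − (w − centre) / dilation, so the
Fubini–Study potential applies. -/
theorem integral_log_norm_affine_sub (w : ℂ) :
    ∫ z : ℂ, log ‖affine r x z - w‖ * density z =
      1 / 2 * log (‖w - centre r x‖ ^ 2 + dilation r x ^ 2) := by
  have hb := dilation_pos h0 h1 x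
  have h2 : ∀ᵐ z : ℂ, log ‖affine r x z - w‖ * density z = log (dilation r x) * density z +
      log ‖z - (w - centre r x) / dilation r x‖ * density z := by
    filter_upwards [compl_mem_ae_iff.2 (measure_singleton ((w - centre r x) / dilation r x))] with
      z hz
    have hz' : z - (w - centre r x) / dilation r x ≠ 0 := sub_ne_zero.2 hz
    have hbc : (dilation r x : ℂ) ≠ 0 := by exact_mod_cast hb.ne'
    have e : affine r x z - w = dilation r x * (z - (w - centre r x) / dilation r x) := by
      rw [affine]; field_simp; ring
    rw [e, norm_mul, log_mul (by simpa using hb.ne') (by simpa using hz'), Complex.norm_real,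
      norm_eq_abs, abs_of_pos hb]
    ring
  rw [integral_congr_ae h2, integral_add (integrable_density.const_mul _)
    (integrable_log_norm_sub_mul_density _), integral_const_mul, integral_density,
    integral_log_norm_sub_mul_density, norm_div, Complex.norm_real, norm_eq_abs, abs_of_pos hb]
  have e : ‖w - centre r x‖ ^ 2 + dilation r x ^ 2 =
      dilation r x ^ 2 * (1 + (‖w - centre r x‖ / dilation r x) ^ 2) := by
    field_simp; ring
  rw [e, log_mul (by positivity) (by positivity), log_pow]
  push_cast
  ring

omit h0 h1 in
theorem log_one_add_sq_le (t : ℝ) (ht : 0 ≤ t) : log (1 + t ^ 2) ≤ 2 * t := by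
  have h : log (1 + t ^ 2) ≤ log ((1 + t) ^ 2) := log_le_log (by positivity) (by nlinarith)
  rw [log_pow] at h
  have h2 := log_le_sub_one_of_pos (by linarith : 0 < 1 + t)
  push_cast at h
  linarith

omit h0 h1 in
theorem integrable_log_one_add_affine :
    Integrable fun z : ℂ => log (1 + ‖affine r x z‖ ^ 2) * density z := by
  refine Integrable.mono' (g := fun z => 2 * ‖centre r x‖ * density z +
    2 * |dilation r x| * (‖z‖ * density z)) ((integrable_density.const_mul _).add
      (integrable_norm_mul_density.const_mul _)) ?_ (Eventually.of_forall fun z => ?_)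
  · have := (continuous_affine (r := r) x).measurable
    exact Measurable.aestronglyMeasurable
      (Measurable.mul (by fun_prop) continuous_density.measurable)
  · have hd := density_pos z
    have h2 : 0 ≤ log (1 + ‖affine r x z‖ ^ 2) := log_nonneg (by nlinarith [norm_nonneg (affine r x z)])
    have h3 : ‖affine r x z‖ ≤ ‖centre r x‖ + |dilation r x| * ‖z‖ := by
      refine (norm_add_le _ _).trans ?_
      rw [norm_mul, Complex.norm_real, norm_eq_abs]
    rw [norm_mul, norm_eq_abs, norm_eq_abs, abs_of_pos hd, abs_of_nonneg h2]
    calc log (1 + ‖affine r x z‖ ^ 2) * density z ≤ (2 * ‖affine r x z‖) * density z := by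
          gcongr; exact log_one_add_sq_le _ (norm_nonneg _)
      _ ≤ (2 * (‖centre r x‖ + |dilation r x| * ‖z‖)) * density z := by gcongr
      _ = _ := by ring

/-- The normalizing constant of the Poisson average of the logarithmic kernel. -/
def poissonConst (r : ℝ) (x : OnePoint ℂ) : ℝ :=
  1 / 2 * log (height r x) + 1 / 2 * ∫ z, log (1 + ‖affine r x z‖ ^ 2) * density z

omit h0 h1 in
theorem logKernel_coe_infty (z : ℂ) :
    logKernel chordal z OnePoint.infty = 1 / 2 * log (1 + ‖z‖ ^ 2) := by
  rw [logKernel, chordal_coe_infty, one_div_one_div, Real.log_sqrt (by positivity)]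
  ring

omit h0 h1 in
theorem logKernel_coe_coe {z w : ℂ} (h : z ≠ w) :
    logKernel chordal z w =
      1 / 2 * log (1 + ‖z‖ ^ 2) + 1 / 2 * log (1 + ‖w‖ ^ 2) - log ‖z - w‖ := by
  have h2 : ‖z - w‖ ≠ 0 := norm_ne_zero_iff.2 (sub_ne_zero.2 h)
  rw [logKernel, chordal_coe_coe, one_div_div, log_div (by positivity) h2,
    log_mul (by positivity) (by positivity), Real.log_sqrt (by positivity),
    Real.log_sqrt (by positivity)]
  ring

theorem ae_logKernel_affine (w : ℂ) :
    ∀ᵐ z : ℂ, logKernel chordal (affine r x z) w * density z =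
      1 / 2 * (log (1 + ‖affine r x z‖ ^ 2) * density z) +
        1 / 2 * log (1 + ‖w‖ ^ 2) * density z - log ‖affine r x z - w‖ * density z := by
  have hb := dilation_pos h0 h1 x
  filter_upwards [compl_mem_ae_iff.2 (measure_singleton ((w - centre r x) / dilation r x))] with
    z hz
  have hbc : (dilation r x : ℂ) ≠ 0 := by exact_mod_cast hb.ne'
  have hne : affine r x z ≠ w := by
    intro he
    apply hz
    rw [mem_singleton_iff, eq_div_iff hbc, ← he, affine]
    ring
  rw [logKernel_coe_coe hne]
  ring

theorem integrable_logKernel_affine (y : OnePoint ℂ) :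
    Integrable fun z : ℂ => logKernel chordal (affine r x z) y * density z := by
  have hi := (integrable_log_one_add_affine (r := r) x).const_mul (1 / 2)
  induction y using OnePoint.rec with
  | infty =>
    refine hi.congr (Eventually.of_forall fun z => ?_)
    simp only [logKernel_coe_infty]
    ring
  | coe w =>
    refine ((hi.add (integrable_density.const_mul (1 / 2 * log (1 + ‖w‖ ^ 2)))).sub
      (integrable_log_norm_affine_sub h0 h1 x w)).congr ?_
    filter_upwards [ae_logKernel_affine h0 h1 x w] with z hz
    rw [hz]
    rfl

/-- The potential of the affine image and `height_mul_add` combine. The point is that the error term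
depends on x alone: regularizing the kernel is averaging it, which later bounds the regularized
potentials. -/
theorem integral_logKernel_affine (y : OnePoint ℂ) :
    ∫ z : ℂ, logKernel chordal (affine r x z) y * density z =
      -(1 / 2) * log (1 - r * dot x y) + poissonConst r x := by
  have hi := (integrable_log_one_add_affine (r := r) x).const_mul (1 / 2)
  have hA := height_pos h0 h1 x
  induction y using OnePoint.rec with
  | infty =>
    have hd : dot x OnePoint.infty = coord x 2 := by
      simp [dot, Fin.sum_univ_three, coord_infty_zero, coord_infty_one, coord_infty_two]
    have h2 : ∀ z : ℂ, logKernel chordal (affine r x z) OnePoint.infty * density z =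
        1 / 2 * (log (1 + ‖affine r x z‖ ^ 2) * density z) := by
      intro z
      rw [logKernel_coe_infty]
      ring
    simp_rw [h2]
    rw [integral_const_mul, hd, poissonConst, height]
    ring
  | coe w =>
    have hpos := one_sub_mul_dot_pos h0 h1 x w
    have h3 : log (‖w - centre r x‖ ^ 2 + dilation r x ^ 2) =
        log (1 + ‖w‖ ^ 2) + log (1 - r * dot x w) - log (height r x) := by
      rw [← log_mul (by positivity) hpos.ne', ← height_mul_add h0 h1 x w,
        log_mul hA.ne' (by have := dilation_pos h0 h1 x; positivity)]
      ring
    have hs : Integrable (fun z => 1 / 2 * (log (1 + ‖affine r x z‖ ^ 2) * density z) +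
        1 / 2 * log (1 + ‖w‖ ^ 2) * density z) := hi.add (integrable_density.const_mul _)
    rw [integral_congr_ae (ae_logKernel_affine h0 h1 x w), integral_sub
      hs (integrable_log_norm_affine_sub h0 h1 x w),
      integral_add hi (integrable_density.const_mul _), integral_const_mul, integral_const_mul,
      integral_density, integral_log_norm_affine_sub h0 h1, h3, poissonConst]
    ring

omit h0 h1 in
theorem logKernel_nonneg (x y : OnePoint ℂ) : 0 ≤ logKernel chordal x y := by
  rw [logKernel_chordal]
  have h := abs_le.1 (abs_dot_le x y)
  have : log ((1 - dot x y) / 2) ≤ 0 := log_nonpos (by linarith) (by linarith)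
  linarith

/-- One of the points 0 and ∞ has x·y ≤ 0. There −½ log(1 − r x·y) ≤ 0, while the average of the
nonnegative kernel is nonnegative. -/
theorem poissonConst_nonneg : 0 ≤ poissonConst r x := by
  obtain ⟨y, hy⟩ : ∃ y, dot x y ≤ 0 := by
    have e1 : dot x OnePoint.infty = coord x 2 := by
      simp [dot, Fin.sum_univ_three, coord_infty_zero, coord_infty_one, coord_infty_two]
    have e2 : dot x ((0 : ℂ) : OnePoint ℂ) = -coord x 2 := by
      simp [dot, Fin.sum_univ_three, coord_coe_zero, coord_coe_one, coord_coe_two]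
    rcases le_total (coord x 2) 0 with h | h
    · exact ⟨_, e1.trans_le h⟩
    · exact ⟨((0 : ℂ) : OnePoint ℂ), by rw [e2]; linarith⟩
  have h2 := integral_logKernel_affine h0 h1 x y
  have h3 : 0 ≤ ∫ z : ℂ, logKernel chordal (affine r x z) y * density z :=
    integral_nonneg fun z => mul_nonneg (logKernel_nonneg _ _) (density_pos z).le
  have h4 : 0 ≤ log (1 - r * dot x y) := log_nonneg (by nlinarith)
  linarith

/-- By `height_mul_one_add`, height · (1 + |affine z|²) ≤ 4 (1 + |z|²): the growth of the affine
maps as r → 1 is compensated by `height`, and the bound is independent of r and x. -/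
theorem poissonConst_le :
    poissonConst r x ≤ 1 / 2 * (log 4 + ∫ z : ℂ, 2 * (‖z‖ * density z)) := by
  have hA := height_pos h0 h1 x
  have hb := dilation_pos h0 h1 x
  have h2 := height_mul_one_add h0 h1 x
  have hint := integrable_log_one_add_affine (r := r) x
  have key : ∀ z : ℂ, log (height r x) * density z + log (1 + ‖affine r x z‖ ^ 2) * density z ≤
      log 4 * density z + 2 * (‖z‖ * density z) := by
    intro z
    have hd := density_pos z
    rw [← add_mul, ← mul_assoc, ← add_mul]
    refine mul_le_mul_of_nonneg_right ?_ hd.le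
    rw [← log_mul hA.ne' (by positivity)]
    have h3 : ‖affine r x z‖ ≤ ‖centre r x‖ + dilation r x * ‖z‖ := by
      refine (norm_add_le _ _).trans ?_
      rw [norm_mul, Complex.norm_real, norm_eq_abs, abs_of_pos hb]
    have h4 : ‖affine r x z‖ ^ 2 ≤ 2 * ‖centre r x‖ ^ 2 + 2 * (dilation r x * ‖z‖) ^ 2 := by
      have := pow_le_pow_left₀ (norm_nonneg _) h3 2
      nlinarith [sq_nonneg (‖centre r x‖ - dilation r x * ‖z‖)]
    have h5 : height r x * (1 + ‖affine r x z‖ ^ 2) ≤ 4 * (1 + ‖z‖ ^ 2) := by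
      calc height r x * (1 + ‖affine r x z‖ ^ 2)
          ≤ height r x * (2 * (1 + ‖centre r x‖ ^ 2 + dilation r x ^ 2) * (1 + ‖z‖ ^ 2)) := by
            gcongr
            nlinarith [sq_nonneg ‖centre r x‖, sq_nonneg ‖z‖, sq_nonneg (dilation r x),
              mul_nonneg (sq_nonneg ‖centre r x‖) (sq_nonneg ‖z‖)]
        _ = 2 * (height r x * (1 + ‖centre r x‖ ^ 2 + dilation r x ^ 2)) * (1 + ‖z‖ ^ 2) := by ring
        _ = _ := by rw [h2]; ring
    refine (log_le_log (by positivity) h5).trans ?_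
    rw [log_mul (by norm_num) (by positivity)]
    have := log_one_add_sq_le ‖z‖ (norm_nonneg z)
    linarith
  have h6 : ∫ z, (log (height r x) * density z + log (1 + ‖affine r x z‖ ^ 2) * density z) ≤
      ∫ z, (log 4 * density z + 2 * (‖z‖ * density z)) := integral_mono ((integrable_density.const_mul (log (height r x))).add hint)
    ((integrable_density.const_mul (log 4)).add (integrable_norm_mul_density.const_mul 2)) key
  rw [integral_add (integrable_density.const_mul _) hint, integral_const_mul, integral_density,
    integral_add (integrable_density.const_mul _) (integrable_norm_mul_density.const_mul 2),
    integral_const_mul, integral_density] at h6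
  rw [poissonConst]
  linarith

end Affine

end RiemannSphere
end

noncomputable section

namespace RiemannSphere

open EnergyForm Real

/-! ### Regularization of the logarithmic kernel of the sphere -/

section Regularization

variable {r : ℝ} (h0 : 0 ≤ r) (h1 : r < 1) {μ : ComplexMeasure (OnePoint ℂ)}

theorem measurable_dot_comp {α : Type*} [MeasurableSpace α] {f g : α → OnePoint ℂ}
    (hf : Measurable f) (hg : Measurable g) : Measurable fun a => dot (f a) (g a) :=
  Finset.measurable_fun_sum _ fun i _ =>
    ((measurable_coord i).comp hf).mul ((measurable_coord i).comp hg)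

theorem measurable_coe : Measurable fun z : ℂ => (z : OnePoint ℂ) :=
  OnePoint.continuous_coe.measurable

theorem measurable_logKernel_comp {α : Type*} [MeasurableSpace α] {f g : α → OnePoint ℂ}
    (hf : Measurable f) (hg : Measurable g) :
    Measurable fun a => logKernel chordal (f a) (g a) := by
  simp_rw [logKernel_chordal]
  have := measurable_dot_comp hf hg
  fun_prop

include h0 h1

/-- The regularized kernel is an average of the logarithmic one in one variable, and Fubini moves
this average outside the integral against μ. -/
theorem pot_regKernel (hμ : IsAdmissible chordal μ) (x : OnePoint ℂ) :
    pot (regKernel r) μ x =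
      (∫ z : ℂ, (density z : ℂ) * pot (logKernel chordal) μ (affine r x z : ℂ)) +
        ((1 / 2 * log 2 - poissonConst r x : ℝ) : ℂ) * μ univ := by
  have := hμ.fin
  obtain ⟨h, hm, hb, hu, hf, -⟩ := exists_integral_eq μ
  have hG := hμ.isGood chordal_comm
  have hR := (isPSDKernel_regKernel h0 h1).isGood hμ.fin
  have hdi : ∀ {g : OnePoint ℂ → ℝ}, Integrable g μ.variation →
      Integrable (fun y => (g y : ℂ) * h y) μ.variation := fun {g} hg =>
    hg.ofReal.mul_bdd (c := 2) hm.aestronglyMeasurable (Eventually.of_forall hb)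
  have hreg : ∀ y, regKernel r y x = (∫ z : ℂ, logKernel chordal (affine r x z) y * density z) +
      (1 / 2 * log 2 - poissonConst r x) := by
    intro y
    rw [integral_logKernel_affine h0 h1, regKernel, dot_comm]
    ring
  have hI : Integrable (fun y => ∫ z : ℂ, logKernel chordal (affine r x z) y * density z)
      μ.variation := by
    have := (hR.integrable x).sub (integrable_const (1 / 2 * log 2 - poissonConst r x))
    refine this.congr (Eventually.of_forall fun y => ?_)
    simp [hreg]
  -- The kernel is nonnegative, so its norm integrated over z is the regularized kernel up to a
  -- constant, hence integrable in y. This replaces a joint bound.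
  have hprod : Integrable (fun p : OnePoint ℂ × ℂ =>
      ((logKernel chordal (affine r x p.2) p.1 * density p.2 : ℝ) : ℂ) * h p.1)
      (μ.variation.prod volume) := by
    have hmeas : Measurable fun p : OnePoint ℂ × ℂ =>
        logKernel chordal (affine r x p.2) p.1 * density p.2 :=
      (measurable_logKernel_comp (measurable_coe.comp
        ((continuous_affine x).measurable.comp measurable_snd)) measurable_fst).mul
        (continuous_density.measurable.comp measurable_snd)
    refine Integrable.mul_bdd (c := 2) ?_ (hm.comp measurable_fst).aestronglyMeasurable
      (Eventually.of_forall fun p => hb p.1)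
    have : Integrable (fun p : OnePoint ℂ × ℂ =>
        logKernel chordal (affine r x p.2) p.1 * density p.2) (μ.variation.prod volume) := by
      refine (integrable_prod_iff hmeas.aestronglyMeasurable).2
        ⟨Eventually.of_forall fun y => integrable_logKernel_affine h0 h1 x y, ?_⟩
      refine hI.congr (Eventually.of_forall fun y => integral_congr_ae
        (Eventually.of_forall fun z => ?_))
      exact (norm_of_nonneg (mul_nonneg (logKernel_nonneg _ _) (density_pos z).le)).symm
    exact this.ofReal
  rw [pot, hf _ (hR.integrable x), hu]
  have e1 : ∀ y, ((regKernel r y x : ℝ) : ℂ) * h y =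
      ((∫ z : ℂ, logKernel chordal (affine r x z) y * density z : ℝ) : ℂ) * h y +
        ((1 / 2 * log 2 - poissonConst r x : ℝ) : ℂ) * h y := by
    intro y
    rw [hreg, Complex.ofReal_add, add_mul]
  have hhi : Integrable h μ.variation :=
    Integrable.of_bound hm.aestronglyMeasurable 2 (Eventually.of_forall hb)
  simp_rw [e1]
  rw [integral_add (hdi hI) (hhi.const_mul _), integral_const_mul]
  congr 1
  have e2 : ∀ y, ((∫ z : ℂ, logKernel chordal (affine r x z) y * density z : ℝ) : ℂ) * h y =
      ∫ z : ℂ, ((logKernel chordal (affine r x z) y * density z : ℝ) : ℂ) * h y := by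
    intro y
    rw [integral_mul_const, integral_complex_ofReal]
  simp_rw [e2]
  rw [integral_integral_swap hprod]
  refine integral_congr_ae (Eventually.of_forall fun z => ?_)
  change _ = (density z : ℂ) * pot (logKernel chordal) μ (affine r x z)
  rw [pot, hf _ (hG.integrable _), ← integral_const_mul]
  refine integral_congr_ae (Eventually.of_forall fun y => ?_)
  simp only [Complex.ofReal_mul]
  rw [show logKernel chordal y (affine r x z) = logKernel chordal (affine r x z) y by
    rw [logKernel, chordal_comm, logKernel]]
  ring

theorem norm_pot_regKernel_le (hμ : IsAdmissible chordal μ) {D : ℝ}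
    (hD : ∀ x, ‖pot (logKernel chordal) μ x‖ ≤ D) (x : OnePoint ℂ) :
    ‖pot (regKernel r) μ x‖ ≤
      D + (1 / 2 * log 2 + 1 / 2 * (log 4 + ∫ z : ℂ, 2 * (‖z‖ * density z))) * ‖μ univ‖ := by
  rw [pot_regKernel h0 h1 hμ]
  refine (norm_add_le _ _).trans ?_
  gcongr
  · refine (norm_integral_le_of_norm_le (integrable_density.mul_const D)
      (Eventually.of_forall fun z => ?_)).trans ?_
    · rw [norm_mul, Complex.norm_real, norm_of_nonneg (density_pos z).le]
      exact mul_le_mul_of_nonneg_left (hD _) (density_pos z).le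
    · rw [integral_mul_const, integral_density, one_mul]
  · rw [norm_mul, Complex.norm_real]
    refine mul_le_mul_of_nonneg_right ?_ (norm_nonneg _)
    have h2 := poissonConst_nonneg h0 h1 x
    have h3 := poissonConst_le h0 h1 x
    have h4 : 0 ≤ log 2 := log_nonneg (by norm_num)
    rw [norm_eq_abs, abs_le]
    constructor <;> linarith

end Regularization

/-- The radii `1 - 1 / (n + 2)`. -/
def radius (n : ℕ) : ℝ := 1 - 1 / (n + 2)

theorem radius_nonneg (n : ℕ) : 0 ≤ radius n := by
  have : (1 : ℝ) / (n + 2) ≤ 1 := by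
    rw [div_le_one (by positivity)]
    have : (0 : ℝ) ≤ n := n.cast_nonneg
    linarith
  rw [radius]
  linarith

theorem radius_lt_one (n : ℕ) : radius n < 1 := by
  have : (0 : ℝ) < 1 / (n + 2) := by positivity
  rw [radius]
  linarith

theorem tendsto_radius : Tendsto radius atTop (𝓝 1) := by
  have : Tendsto (fun n : ℕ => (1 : ℝ) / (n + 2)) atTop (𝓝 0) :=
    (tendsto_natCast_atTop_atTop.atTop_add tendsto_const_nhds).const_div_atTop 1
  have h2 : Tendsto (fun n : ℕ => (1 : ℝ) - 1 / (n + 2)) atTop (𝓝 (1 - 0)) :=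
    tendsto_const_nhds.sub this
  rwa [sub_zero] at h2

/-- The substantial field is `bdd`, which rests on the Poisson averaging. -/
theorem isRegularization : IsRegularization chordal fun n => regKernel (radius n) where
  symm := chordal_comm
  psd n := isPSDKernel_regKernel (radius_nonneg n) (radius_lt_one n)
  le := ⟨log 2, fun n x y h => abs_regKernel_le (radius_nonneg n) (radius_lt_one n) x y
    fun h' => h ((chordal_eq_zero_iff x y).2 h')⟩
  lim x y h := by
    rw [logKernel_chordal_of_ne h]
    have h2 : 1 - 1 * dot x y ≠ 0 := fun h' => h ((chordal_eq_zero_iff x y).2 (by linarith))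
    have := ((tendsto_const_nhds (x := (1 : ℝ))).sub (tendsto_radius.mul_const (dot x y))).log h2
    rw [one_mul] at this
    exact tendsto_const_nhds.sub (this.const_mul _)
  bdd μ hμ := by
    obtain ⟨D, hD⟩ := (hμ.isGood chordal_comm).bdd
    exact ⟨_, fun n y => norm_pot_regKernel_le (radius_nonneg n) (radius_lt_one n) hμ hD y⟩

variable {μ : ComplexMeasure (OnePoint ℂ)}

/-- The constant term ½ log 2 of the power series is positive and the other terms are positive
semidefinite. Non-archimedean places offer no such control, since the Gauss point has energy zero.
-/
theorem mul_norm_mass_sq_le (hμ : IsAdmissible chordal μ) :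
    1 / 2 * log 2 * ‖μ univ‖ ^ 2 ≤ (form (logKernel chordal) μ μ).re := by
  have := hμ.fin
  refine ge_of_tendsto (isRegularization.tendsto_form_re hμ) (Eventually.of_forall fun n => ?_)
  have := mul_norm_integral_sq_le (φ := fun _ => 1) measurable_const (B := 1) (by simp)
    (isPSDKernel_regKernel_sub_const (radius_nonneg n) (radius_lt_one n)) hμ.fin
  simpa [VectorMeasure.integral_const] using this

/-- One monomial is split off the regularized kernel; its coefficient stays positive as r → 1. -/
theorem mul_norm_moment_sq_le (hμ : IsAdmissible chordal μ) {n : ℕ} (I : Fin (n + 1) → Fin 3) :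
    1 / (2 * (n + 1)) * ‖∫ᵛ x, monomial I x ∂•μ‖ ^ 2 ≤ (form (logKernel chordal) μ μ).re := by
  have h1 : Tendsto (fun m => radius m ^ (n + 1) / (2 * (n + 1)) * ‖∫ᵛ x, monomial I x ∂•μ‖ ^ 2)
      atTop (𝓝 (1 ^ (n + 1) / (2 * (n + 1)) * ‖∫ᵛ x, monomial I x ∂•μ‖ ^ 2)) :=
    ((tendsto_radius.pow _).div_const _).mul_const _
  rw [one_pow] at h1
  refine le_of_tendsto_of_tendsto' h1 (isRegularization.tendsto_form_re hμ) fun m => ?_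
  exact mul_norm_integral_sq_le (continuous_monomial I).measurable (abs_monomial_le I)
    (isPSDKernel_regKernel_sub_monomial (radius_nonneg m) (radius_lt_one m) I) hμ.fin

/-- The coordinate functions as continuous maps. -/
def coordMap (i : Fin 3) : C(OnePoint ℂ, ℝ) := ⟨_, continuous_coord i⟩

/-- Stone–Weierstrass: the coordinates separate the points of the sphere. -/
theorem closure_adjoin_coord :
    (Algebra.adjoin ℝ (range coordMap)).topologicalClosure = ⊤ := by
  refine ContinuousMap.subalgebra_topologicalClosure_eq_top_of_separatesPoints _ ?_
  intro x y hxy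
  obtain ⟨i, hi⟩ := Function.ne_iff.1 (coord_injective.ne hxy)
  exact ⟨_, ⟨coordMap i, Algebra.subset_adjoin ⟨i, rfl⟩, rfl⟩, hi⟩

theorem coe_prod_coordMap (l : List (Fin 3)) :
    ((l.map coordMap).prod : OnePoint ℂ → ℝ) = monomial l.get := by
  ext x
  rw [monomial, ← List.prod_ofFn]
  induction l with
  | nil => simp
  | cons a l ih => simp [ih, coordMap]

/-- If the energies tend to zero, then so do the integrals of continuous functions. -/
theorem nullFunctions_eq_top {μs : ℕ → ComplexMeasure (OnePoint ℂ)}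
    (h : ∀ n, IsAdmissible chordal (μs n)) {V : ℝ} (hV : ∀ n, (μs n).variation.real univ ≤ V)
    (hE : Tendsto (fun n => (form (logKernel chordal) (μs n) (μs n)).re) atTop (𝓝 0)) :
    nullFunctions μs (fun n => (h n).fin) = ⊤ := by
  have hsub : Subalgebra.toSubmodule (Algebra.adjoin ℝ (range coordMap)) ≤
      nullFunctions μs (fun n => (h n).fin) := by
    rw [Algebra.adjoin_eq_span, Submodule.span_le]
    intro f hf
    obtain ⟨l, hl, rfl⟩ := Submonoid.exists_list_of_mem_closure hf
    obtain ⟨l, rfl⟩ : ∃ l' : List (Fin 3), l'.map coordMap = l := by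
      rw [← Set.mem_range, Set.range_list_map]
      exact hl
    have key : ∀ (c : ℝ) (g : OnePoint ℂ → ℝ), 0 < c → (∀ n, c * ‖∫ᵛ x, g x ∂•(μs n)‖ ^ 2 ≤
        (form (logKernel chordal) (μs n) (μs n)).re) →
        Tendsto (fun n => ∫ᵛ x, g x ∂•(μs n)) atTop (𝓝 0) := by
      intro c g hc hg
      have h2 : Tendsto (fun n => ‖∫ᵛ x, g x ∂•(μs n)‖ ^ 2) atTop (𝓝 0) := by
        refine squeeze_zero (fun n => by positivity)
          (fun n => (le_div_iff₀' hc).2 (hg n)) ?_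
        simpa using hE.div_const c
      rw [tendsto_zero_iff_norm_tendsto_zero]
      simpa using h2.sqrt
    change Tendsto (fun n => ∫ᵛ x, (l.map coordMap).prod x ∂•(μs n)) atTop (𝓝 0)
    rw [coe_prod_coordMap]
    -- The empty word is the constant function, controlled by the mass estimate; nonempty words have
    -- length n + 1 and fall under the moment estimate.
    rcases l with _ | ⟨a, l⟩
    · refine key (1 / 2 * log 2) _ (by positivity) fun n => ?_
      have hm : monomial ([] : List (Fin 3)).get = fun _ => 1 := by ext; simp [monomial]
      have := (h n).fin
      simpa [hm, VectorMeasure.integral_const] using mul_norm_mass_sq_le (h n)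
    · exact key (1 / (2 * (l.length + 1))) _ (by positivity) fun n =>
        mul_norm_moment_sq_le (h n) (n := l.length) (a :: l).get
  have hcl := isClosed_nullFunctions μs (fun n => (h n).fin) hV
  refine top_le_iff.1 fun f _ => ?_
  have hf : f ∈ (Algebra.adjoin ℝ (range coordMap)).topologicalClosure := by
    rw [closure_adjoin_coord]; trivial
  exact closure_minimal hsub hcl hf

/-- For the constant sequence μ, convergence to zero of the integrals means that they vanish. -/
theorem eq_zero_of_form_eq_zero (hμ : IsAdmissible chordal μ)
    (hE : (form (logKernel chordal) μ μ).re = 0) : μ = 0 := by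
  have := hμ.fin
  refine eq_zero_of_forall_integral_eq_zero fun f hf => ?_
  have h := nullFunctions_eq_top (μs := fun _ => μ) (fun _ => hμ) (fun _ => le_rfl)
    (by rw [hE]; exact tendsto_const_nhds)
  have h2 : (⟨f, hf⟩ : C(OnePoint ℂ, ℝ)) ∈ nullFunctions (fun _ : ℕ => μ) (fun _ => hμ.fin) :=
    h ▸ Submodule.mem_top
  exact tendsto_nhds_unique tendsto_const_nhds h2

end RiemannSphere
end

noncomputable section

namespace RiemannSphere

open EnergyForm Real

/-! ### Functions of bounded differential variation on the sphere -/

section Laplacian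

variable {b : ℝ} (hb : 0 < b) (a : ℂ)

theorem hasFDerivAt_norm_sub_sq_add (z : ℂ) :
    HasFDerivAt (fun z : ℂ => ‖z - a‖ ^ 2 + b) ((2 : ℝ) • innerSL ℝ (z - a)) z := by
  have h := ((hasFDerivAt_id (𝕜 := ℝ) z).sub_const a).norm_sq.add_const b
  refine h.congr_fderiv ?_
  ext v
  simp

include hb in
theorem hasFDerivAt_log_norm_sub_sq_add (z : ℂ) :
    HasFDerivAt (fun z : ℂ => log (‖z - a‖ ^ 2 + b))
      ((2 * (‖z - a‖ ^ 2 + b)⁻¹) • innerSL ℝ (z - a)) z := by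
  refine ((hasFDerivAt_norm_sub_sq_add (b := b) a z).log (by positivity)).congr_fderiv ?_
  rw [smul_smul, mul_comm]

include hb in
-- The Hessian on (e, e) is summed over the orthonormal basis 1, i. Up to normalization the result
-- is the density of an affine image of the Fubini–Study measure.
theorem laplacian_log_norm_sub_sq_add (z : ℂ) :
    Laplacian.laplacian (fun z : ℂ => log (‖z - a‖ ^ 2 + b)) z =
      4 * b / (‖z - a‖ ^ 2 + b) ^ 2 := by
  have hq : ‖z - a‖ ^ 2 + b ≠ 0 := by positivity
  have hf : fderiv ℝ (fun z : ℂ => log (‖z - a‖ ^ 2 + b)) =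
      fun z => (2 * (‖z - a‖ ^ 2 + b)⁻¹) • innerSL ℝ (z - a) :=
    funext fun z => (hasFDerivAt_log_norm_sub_sq_add hb a z).fderiv
  have h1 : HasFDerivAt (fun z : ℂ => innerSL ℝ (z - a)) (innerSL ℝ : ℂ →L[ℝ] ℂ →L[ℝ] ℝ) z :=
    (innerSL ℝ : ℂ →L[ℝ] ℂ →L[ℝ] ℝ).hasFDerivAt.comp z ((hasFDerivAt_id (𝕜 := ℝ) z).sub_const a)
  have h2 := ((hasDerivAt_inv hq).comp_hasFDerivAt z
    (hasFDerivAt_norm_sub_sq_add (b := b) a z)).const_mul 2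
  have h3 := h2.smul h1
  have h4 : ∀ e : ℂ, fderiv ℝ (fderiv ℝ (fun z : ℂ => log (‖z - a‖ ^ 2 + b))) z e e =
      2 * (‖z - a‖ ^ 2 + b)⁻¹ * ‖e‖ ^ 2 -
        4 * ((‖z - a‖ ^ 2 + b) ^ 2)⁻¹ * (inner ℝ (z - a) e) ^ 2 := by
    intro e
    rw [hf]
    erw [h3.fderiv]
    change 2 * (‖z - a‖ ^ 2 + b)⁻¹ * (inner ℝ e e : ℝ) +
      (2 * (-((‖z - a‖ ^ 2 + b) ^ 2)⁻¹ * (2 * (inner ℝ (z - a) e : ℝ)))) *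
        (inner ℝ (z - a) e : ℝ) = _
    rw [real_inner_self_eq_norm_sq]
    ring
  rw [InnerProductSpace.laplacian_eq_iteratedFDeriv_complexPlane]
  simp only [iteratedFDeriv_two_apply, Matrix.cons_val_zero, Matrix.cons_val_one, h4]
  have h5 : (inner ℝ (z - a) 1 : ℝ) ^ 2 + (inner ℝ (z - a) Complex.I : ℝ) ^ 2 = ‖z - a‖ ^ 2 := by
    rw [norm_sq_eq]
    simp [Complex.inner]
    ring
  have h6 : ‖z - a‖ ^ 2 = (‖z - a‖ ^ 2 + b) - b := by ring
  have h7 : (inner ℝ (z - a) Complex.I : ℝ) ^ 2 =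
      (‖z - a‖ ^ 2 + b) - b - (inner ℝ (z - a) 1 : ℝ) ^ 2 := by linarith
  rw [h7]
  simp only [norm_one, Complex.norm_I]
  field_simp
  ring

include hb in
theorem contDiff_log_norm_sub_sq_add {n : ℕ∞ω} :
    ContDiff ℝ n (fun z : ℂ => log (‖z - a‖ ^ 2 + b)) :=
  (((contDiff_id.sub contDiff_const).norm_sq ℝ).add contDiff_const).log fun z => by
    simp only [id]
    positivity

end Laplacian

section TestFunction

/-- The Green function of the Poisson kernel. -/
def green (r : ℝ) (x y : OnePoint ℂ) : ℝ := -(1 / 2) * log (1 - r * dot x y)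

theorem contDiff_coord (i : Fin 3) : ContDiff ℝ ∞ fun z : ℂ => coord z i := by
  have h1 : ContDiff ℝ ∞ fun z : ℂ => 1 + ‖z‖ ^ 2 := contDiff_const.add (contDiff_id.norm_sq ℝ)
  have h2 : ∀ z : ℂ, 1 + ‖z‖ ^ 2 ≠ 0 := fun z => by positivity
  fin_cases i
  · exact (contDiff_const.mul Complex.reCLM.contDiff).div h1 h2
  · exact (contDiff_const.mul Complex.imCLM.contDiff).div h1 h2
  · exact ((contDiff_id.norm_sq ℝ).sub contDiff_const).div h1 h2

/-- On the sphere, z ↦ 1/z is the rotation that reverses the second and third coordinates. Hence the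
coordinates are smooth in the chart at infinity too. -/
theorem coord_chartAtInfty (w : ℂ) : coord (chartAtInfty w) =
    ![2 * w.re / (1 + ‖w‖ ^ 2), -(2 * w.im / (1 + ‖w‖ ^ 2)),
      (1 - ‖w‖ ^ 2) / (1 + ‖w‖ ^ 2)] := by
  by_cases hw : w = 0
  · ext i
    fin_cases i
    · simp [chartAtInfty, hw, coord_infty_zero]
    · simp [chartAtInfty, hw, coord_infty_one]
    · simp [chartAtInfty, hw, coord_infty_two]
  · have h2 : ‖w‖ ≠ 0 := norm_ne_zero_iff.2 hw
    have h3 : 1 + ‖w‖ ^ 2 ≠ 0 := by positivity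
    have h4 : ‖w‖ ^ 2 + 1 ≠ 0 := by positivity
    have h5 : chartAtInfty w = ((w⁻¹ : ℂ) : OnePoint ℂ) := by simp [chartAtInfty, hw]
    rw [h5]
    ext i
    fin_cases i
    · change coord ((w⁻¹ : ℂ) : OnePoint ℂ) 0 = 2 * w.re / (1 + ‖w‖ ^ 2)
      rw [coord_coe_zero, Complex.inv_re, Complex.normSq_eq_norm_sq, norm_inv]
      field_simp
      ring
    · change coord ((w⁻¹ : ℂ) : OnePoint ℂ) 1 = -(2 * w.im / (1 + ‖w‖ ^ 2))
      rw [coord_coe_one, Complex.inv_im, Complex.normSq_eq_norm_sq, norm_inv]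
      field_simp
      ring
    · change coord ((w⁻¹ : ℂ) : OnePoint ℂ) 2 = (1 - ‖w‖ ^ 2) / (1 + ‖w‖ ^ 2)
      rw [coord_coe_two, norm_inv]
      field_simp
      ring

theorem contDiff_coord_chartAtInfty (i : Fin 3) :
    ContDiff ℝ ∞ fun w : ℂ => coord (chartAtInfty w) i := by
  simp_rw [coord_chartAtInfty]
  have h1 : ContDiff ℝ ∞ fun z : ℂ => 1 + ‖z‖ ^ 2 := contDiff_const.add (contDiff_id.norm_sq ℝ)
  have h2 : ∀ z : ℂ, 1 + ‖z‖ ^ 2 ≠ 0 := fun z => by positivity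
  fin_cases i
  · exact (contDiff_const.mul Complex.reCLM.contDiff).div h1 h2
  · exact ((contDiff_const.mul Complex.imCLM.contDiff).div h1 h2).neg
  · exact (contDiff_const.sub (contDiff_id.norm_sq ℝ)).div h1 h2

variable {r : ℝ} (h0 : 0 ≤ r) (h1 : r < 1) (x : OnePoint ℂ)

include h0 h1

theorem isSmooth_green : IsSmooth (green r x) := by
  have key : ∀ c : ℂ → OnePoint ℂ, (∀ i, ContDiff ℝ ∞ fun z => coord (c z) i) →
      ContDiff ℝ ∞ fun z => green r x (c z) := by
    intro c hc
    have hd : ContDiff ℝ ∞ fun z => dot x (c z) :=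
      ContDiff.sum fun i _ => contDiff_const.mul (hc i)
    exact contDiff_const.mul ((contDiff_const.sub (contDiff_const.mul hd)).log
      fun z => (one_sub_mul_dot_pos h0 h1 x (c z)).ne')
  exact ⟨key _ contDiff_coord, key _ contDiff_coord_chartAtInfty⟩

/-- The logarithm of `height_mul_add`: in the affine chart the Green function is a constant plus a
difference of two functions with known Laplacians. -/
theorem green_coe (z : ℂ) : green r x z = -(1 / 2) * log (height r x) +
    (1 / 2 * log (‖z - 0‖ ^ 2 + 1) - 1 / 2 * log (‖z - centre r x‖ ^ 2 + dilation r x ^ 2)) := by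
  have hA := height_pos h0 h1 x
  have hb := dilation_pos h0 h1 x
  have hp := one_sub_mul_dot_pos h0 h1 x z
  have h := congrArg log (height_mul_add h0 h1 x z)
  rw [log_mul hA.ne' (by positivity), log_mul (by positivity) hp.ne'] at h
  rw [green, sub_zero, add_comm (‖z‖ ^ 2)]
  linarith

theorem laplacian_green (z : ℂ) :
    -1 / (2 * π) * Laplacian.laplacian (fun z : ℂ => green r x z) z =
      (dilation r x ^ 2)⁻¹ * density ((z - centre r x) / dilation r x) - density z := by
  have hb := dilation_pos h0 h1 x
  set l : ℂ → ℝ := fun z => log (‖z - centre r x‖ ^ 2 + dilation r x ^ 2) with hl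
  set l' : ℂ → ℝ := fun z => log (‖z - 0‖ ^ 2 + 1) with hl'
  have cl : ContDiffAt ℝ 2 l z := (contDiff_log_norm_sub_sq_add (by positivity) _).contDiffAt
  have cl' : ContDiffAt ℝ 2 l' z := (contDiff_log_norm_sub_sq_add one_pos _).contDiffAt
  have e : (fun z : ℂ => green r x z) =
      (fun _ => -(1 / 2) * log (height r x)) + ((1 / 2 : ℝ) • l' - (1 / 2 : ℝ) • l) := by
    ext z
    rw [green_coe h0 h1]
    rfl
  have d1 : ContDiffAt ℝ 2 ((1 / 2 : ℝ) • l) z := cl.const_smul (1 / 2 : ℝ)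
  have d2 : ContDiffAt ℝ 2 ((1 / 2 : ℝ) • l') z := cl'.const_smul (1 / 2 : ℝ)
  have d3 : ContDiffAt ℝ 2 ((1 / 2 : ℝ) • l' - (1 / 2 : ℝ) • l) z := d2.sub d1
  rw [e, ContDiffAt.laplacian_add contDiffAt_const d3, ContDiffAt.laplacian_sub d2 d1,
    InnerProductSpace.laplacian_smul _ cl', InnerProductSpace.laplacian_smul _ cl,
    InnerProductSpace.laplacian_const, hl, hl',
    laplacian_log_norm_sub_sq_add (b := dilation r x ^ 2) (by positivity),
    laplacian_log_norm_sub_sq_add one_pos, density, density, norm_div, Complex.norm_real,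
    norm_of_nonneg hb.le]
  have hpi := pi_pos
  simp only [sub_zero, smul_eq_mul, Pi.zero_apply]
  have h2 : ‖z - centre r x‖ ^ 2 + dilation r x ^ 2 ≠ 0 := by positivity
  have h3 : dilation r x ^ 2 + ‖z - centre r x‖ ^ 2 ≠ 0 := by positivity
  have h4 : ‖z‖ ^ 2 + 1 ≠ 0 := by positivity
  have h5 : 1 + ‖z‖ ^ 2 ≠ 0 := by positivity
  have e1 : (1 + (‖z - centre r x‖ / dilation r x) ^ 2) =
      (‖z - centre r x‖ ^ 2 + dilation r x ^ 2) / dilation r x ^ 2 := by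
    field_simp
    ring
  rw [e1, add_comm 1 (‖z‖ ^ 2)]
  field_simp
  ring

/-- Change of variables in the Poisson average. -/
theorem integral_affine_mul_density (g : ℂ → ℝ) :
    ∫ z, g z * ((dilation r x ^ 2)⁻¹ * density ((z - centre r x) / dilation r x)) =
      ∫ z, g (affine r x z) * density z := by
  have hb := dilation_pos h0 h1 x
  have hbc : (dilation r x : ℂ) ≠ 0 := by exact_mod_cast hb.ne'
  rw [← integral_add_left_eq_self _ (centre r x)]
  have := Measure.integral_comp_smul (volume : Measure ℂ) (fun z => g (centre r x + z) *
    ((dilation r x ^ 2)⁻¹ * density ((centre r x + z - centre r x) / dilation r x)))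
    (dilation r x)
  rw [Complex.finrank_real_complex] at this
  have h2 : ∀ z : ℂ, g (centre r x + dilation r x • z) * ((dilation r x ^ 2)⁻¹ *
      density ((centre r x + dilation r x • z - centre r x) / dilation r x)) =
      (dilation r x ^ 2)⁻¹ * (g (affine r x z) * density z) := by
    intro z
    have : (centre r x + dilation r x • z - centre r x) / dilation r x = z := by
      rw [add_sub_cancel_left, Complex.real_smul, mul_div_cancel_left₀ _ hbc]
    rw [this, affine, Complex.real_smul]
    ring
  simp_rw [h2] at this
  rw [integral_const_mul, smul_eq_mul, abs_of_pos (by positivity)] at this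
  exact (mul_left_cancel₀ (by positivity) this).symm

/-- The Poisson average of a function. -/
def poisson (f : OnePoint ℂ → ℝ) (r : ℝ) (x : OnePoint ℂ) : ℝ :=
  ∫ z : ℂ, f (affine r x z : ℂ) * density z

variable {f : OnePoint ℂ → ℝ} (hf : Continuous f) {M : ℝ} (hM : ∀ x, |f x| ≤ M)

include hf hM

omit h0 h1 in
theorem integrable_comp_mul_density {c : ℂ → ℂ} (hc : Continuous c) :
    Integrable fun z : ℂ => f (c z) * density z := by
  refine integrable_density.bdd_mul (c := M)
    (hf.comp (OnePoint.continuous_coe.comp hc)).aestronglyMeasurable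
    (Eventually.of_forall fun z => hM _)

omit h0 h1 hf in
theorem abs_poisson_le : |poisson f r x| ≤ M := by
  rw [poisson, ← norm_eq_abs]
  refine (norm_integral_le_of_norm_le (integrable_density.const_mul M)
    (Eventually.of_forall fun z => ?_)).trans ?_
  · rw [norm_mul, norm_of_nonneg (density_pos z).le]
    exact mul_le_mul_of_nonneg_right (hM _) (density_pos z).le
  · rw [integral_const_mul, integral_density, mul_one]

theorem integral_mul_laplacian_green :
    ∫ z : ℂ, f z * (-1 / (2 * π) * Laplacian.laplacian (fun z : ℂ => green r x z) z) =
      poisson f r x - ∫ z : ℂ, f z * density z := by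
  have hb := dilation_pos h0 h1 x
  simp_rw [laplacian_green h0 h1, mul_sub]
  rw [integral_sub, integral_affine_mul_density h0 h1 x (fun z : ℂ => f z), poisson]
  · have hi : Integrable fun z : ℂ => density ((z - centre r x) / dilation r x) := by
      have h2 := (integrable_density.comp_smul (R := (dilation r x)⁻¹) (by positivity)).comp_sub_right
        (centre r x)
      refine h2.congr (Eventually.of_forall fun z => ?_)
      simp only [Complex.real_smul, Complex.ofReal_inv]
      rw [div_eq_inv_mul]
    exact (hi.const_mul _).bdd_mul (c := M) (hf.comp OnePoint.continuous_coe).aestronglyMeasurable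
      (Eventually.of_forall fun z => hM _)
  · exact integrable_comp_mul_density hf hM continuous_id

end TestFunction

/-- For finite x the centre tends to x and the dilation to 0. For x = ∞ the centre is 0 and the
dilation tends to infinity, which is why z = 0 is excluded. -/
theorem tendsto_affine_radius (x : OnePoint ℂ) {z : ℂ} (hz : z ≠ 0) :
    Tendsto (fun n => (affine (radius n) x z : OnePoint ℂ)) atTop (𝓝 x) := by
  have hs : Tendsto (fun n => √(1 - radius n ^ 2)) atTop (𝓝 0) := by
    have := (tendsto_const_nhds (x := (1 : ℝ)).sub (tendsto_radius.pow 2)).sqrt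
    simpa using this
  induction x using OnePoint.rec with
  | coe w =>
    refine (OnePoint.continuous_coe.tendsto w).comp ?_
    have hp : 1 + ‖w‖ ^ 2 ≠ 0 := by positivity
    have hh : Tendsto (fun n => height (radius n) w) atTop (𝓝 (1 - 1 * coord w 2)) :=
      tendsto_const_nhds.sub (tendsto_radius.mul_const _)
    have e : 1 - 1 * coord w 2 = 2 / (1 + ‖w‖ ^ 2) := by
      rw [coord_coe_two]
      field_simp
      ring
    rw [e] at hh
    have hne : 2 / (1 + ‖w‖ ^ 2) ≠ 0 := by positivity
    have hd : Tendsto (fun n => dilation (radius n) w) atTop (𝓝 (0 / (2 / (1 + ‖w‖ ^ 2)))) :=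
      hs.div hh hne
    have h0 := ((tendsto_radius.mul_const (coord w 0)).div hh hne)
    have h1 := ((tendsto_radius.mul_const (coord w 1)).div hh hne)
    have e0 : 1 * coord w 0 / (2 / (1 + ‖w‖ ^ 2)) = w.re := by
      rw [coord_coe_zero]; field_simp
    have e1 : 1 * coord w 1 / (2 / (1 + ‖w‖ ^ 2)) = w.im := by
      rw [coord_coe_one]; field_simp
    rw [e0] at h0
    rw [e1] at h1
    rw [zero_div] at hd
    have hc : Tendsto (fun n => centre (radius n) w) atTop (𝓝 w) := by
      have := ((Complex.continuous_ofReal.tendsto _).comp h0).add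
        (((Complex.continuous_ofReal.tendsto _).comp h1).mul_const Complex.I)
      rw [Complex.re_add_im] at this
      refine this.congr fun n => ?_
      simp only [Function.comp_apply, Pi.div_apply]
      exact Complex.re_add_im (centre (radius n) w)
    have := hc.add (((Complex.continuous_ofReal.tendsto _).comp hd).mul_const z)
    simpa [affine, Function.comp_def] using this
  | infty =>
    have hd : ∀ n, dilation (radius n) OnePoint.infty = √(1 + radius n) / √(1 - radius n) := by
      intro n
      have h2 : 0 < 1 - radius n := by linarith [radius_lt_one n]
      have h3 : 0 ≤ 1 + radius n := by linarith [radius_nonneg n]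
      rw [dilation, height, coord_infty_two, mul_one,
        show 1 - radius n ^ 2 = (1 + radius n) * (1 - radius n) by ring, sqrt_mul h3]
      nth_rewrite 2 [← mul_self_sqrt h2.le]
      have : √(1 - radius n) ≠ 0 := (sqrt_pos.2 h2).ne'
      field_simp
    have hc : ∀ n, centre (radius n) OnePoint.infty = 0 := by
      intro n
      simp [centre, coord_infty_zero, coord_infty_one, Complex.ext_iff]
    have h4 : Tendsto (fun n => √(1 - radius n)) atTop (𝓝[>] 0) := by
      refine tendsto_nhdsWithin_iff.2 ⟨?_, Eventually.of_forall fun n =>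
        sqrt_pos.2 (by linarith [radius_lt_one n])⟩
      have := (tendsto_const_nhds (x := (1 : ℝ)).sub tendsto_radius).sqrt
      simpa using this
    have h5 : Tendsto (fun n => dilation (radius n) OnePoint.infty) atTop atTop := by
      simp_rw [hd, div_eq_mul_inv]
      refine Tendsto.pos_mul_atTop (C := √(1 + 1)) (by positivity)
        (tendsto_const_nhds.add tendsto_radius).sqrt (tendsto_inv_nhdsGT_zero.comp h4)
    have h6 : Tendsto (fun n => affine (radius n) OnePoint.infty z) atTop (cocompact ℂ) := by
      rw [← Metric.cobounded_eq_cocompact, ← tendsto_norm_atTop_iff_cobounded]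
      refine (h5.atTop_mul_const (norm_pos_iff.2 hz)).congr fun n => ?_
      rw [affine, hc, zero_add, norm_mul, Complex.norm_real, norm_of_nonneg
        (dilation_pos (radius_nonneg n) (radius_lt_one n) _).le]
    rw [← coclosedCompact_eq_cocompact, ← OnePoint.comap_coe_nhds_infty] at h6
    exact tendsto_comap_iff.1 h6

theorem tendsto_poisson {f : OnePoint ℂ → ℝ} (hf : Continuous f) {M : ℝ} (hM : ∀ x, |f x| ≤ M)
    (x : OnePoint ℂ) : Tendsto (fun n => poisson f (radius n) x) atTop (𝓝 (f x)) := by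
  have : f x = ∫ z : ℂ, f x * density z := by
    rw [integral_const_mul, integral_density, mul_one]
  rw [this]
  refine tendsto_integral_of_dominated_convergence (fun z => M * density z)
    (fun n => (integrable_comp_mul_density hf hM (continuous_affine x)).aestronglyMeasurable)
    (integrable_density.const_mul M) (fun n => Eventually.of_forall fun z => ?_) ?_
  · rw [norm_mul, norm_of_nonneg (density_pos z).le]
    exact mul_le_mul_of_nonneg_right (hM _) (density_pos z).le
  · filter_upwards [compl_mem_ae_iff.2 (measure_singleton (0 : ℂ))] with z hz
    exact ((hf.tendsto x).comp (tendsto_affine_radius x hz)).mul_const _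

/-- A continuous function of bounded differential variation is controlled by the energy. -/
theorem IsBDV.exists_bound {f : OnePoint ℂ → ℝ} (hf : Continuous f) (hB : IsBDV f) :
    ∃ C D : ℝ, ∀ μ : ComplexMeasure (OnePoint ℂ), IsAdmissible chordal μ →
      ‖∫ᵛ x, f x ∂•μ - C * μ univ‖ ^ 2 ≤ D * (form (logKernel chordal) μ μ).re := by
  obtain ⟨M, hM⟩ := (isCompact_range hf).isBounded.exists_norm_le
  replace hM : ∀ x, |f x| ≤ M := fun x => hM _ ⟨x, rfl⟩
  have hM0 : 0 ≤ M := (abs_nonneg _).trans (hM OnePoint.infty)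
  obtain ⟨σ, hσ, htest⟩ := hB
  have := hσ.1
  set m := σ.variation with hm
  -- A bounded density turns the signed Laplacian into a complex measure `σc`, to which the energy
  -- forms apply.
  obtain ⟨g, hgm, hg1, hg⟩ := SignedMeasure.exists_density σ m
    fun A _ => VectorMeasure.enorm_measure_le_variation σ A
  set gc : OnePoint ℂ → ℂ := fun x => (g x : ℂ) with hgc
  have hgcm : Measurable gc := Complex.measurable_ofReal.comp hgm
  have hgc1 : ∀ x, ‖gc x‖ ≤ (1 : NNReal) := fun x => by simpa [hgc] using hg1 x
  set σc : ComplexMeasure (OnePoint ℂ) := m.withDensityᵥ gc with hσc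
  have hσv : σc.variation ≤ (1 : NNReal) • m :=
    variation_withDensityᵥ_le hgcm.stronglyMeasurable hgc1
  have hσf : IsFiniteMeasure σc.variation := isFiniteMeasure_of_le _ hσv
  have hreal : ∀ u : OnePoint ℂ → ℝ, Integrable u m → ∫ᵛ x, u x ∂•σ = ∫ x, u x * g x ∂m := by
    intro u hu
    have := integral_withDensityᵥ (m := m) hgm.stronglyMeasurable (c := 1) hg1
      (ContinuousLinearMap.lsmul ℝ ℝ : ℝ →L[ℝ] ℝ →L[ℝ] ℝ) hu
    rw [← hg] at this
    simpa using this
  have hcplx : ∀ u : OnePoint ℂ → ℝ, Integrable u m →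
      ∫ᵛ x, u x ∂•σc = ((∫ x, u x * g x ∂m : ℝ) : ℂ) := by
    intro u hu
    have := integral_withDensityᵥ (m := m) hgcm.stronglyMeasurable hgc1
      (ContinuousLinearMap.lsmul ℝ ℝ : ℝ →L[ℝ] ℂ →L[ℝ] ℂ) hu
    rw [← integral_complex_ofReal]
    simpa [hgc] using this
  -- Forced by testing with the Green function: the Fubini–Study mean of f, corrected by the
  -- constant ½ log 2 between `regKernel` and `green`.
  set C : ℝ := (∫ z : ℂ, f z * density z) - 1 / 2 * log 2 * ∫ x, g x ∂m with hC
  have hpot : ∀ n x, pot (regKernel (radius n)) σc x = ((poisson f (radius n) x - C : ℝ) : ℂ) := by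
    intro n x
    have hP := isPSDKernel_regKernel (radius_nonneg n) (radius_lt_one n)
    have hri : Integrable (fun y => regKernel (radius n) y x) m := by
      obtain ⟨B, hB⟩ := hP.bdd
      exact Integrable.of_bound (hP.measurable.comp
        (measurable_id.prodMk measurable_const)).aestronglyMeasurable B
        (Eventually.of_forall fun y => hB y x)
    have he : ∀ y, green (radius n) x y = regKernel (radius n) y x - 1 / 2 * log 2 := by
      intro y
      rw [green, regKernel, dot_comm]
      ring
    have hgi : Integrable (green (radius n) x) m := by
      rw [funext he]
      exact hri.sub (integrable_const _)
    have h2 := htest _ (isSmooth_green (radius_nonneg n) (radius_lt_one n) x)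
    rw [integral_mul_laplacian_green (radius_nonneg n) (radius_lt_one n) x hf hM,
      hreal _ hgi] at h2
    rw [pot, hcplx _ hri]
    congr 1
    have h3 : ∀ y, regKernel (radius n) y x * g y =
        green (radius n) x y * g y + 1 / 2 * log 2 * g y := by
      intro y
      rw [he]
      ring
    have hgint : Integrable g m := integrable_of_bounded_density hgm.stronglyMeasurable hg1
    simp_rw [h3]
    rw [integral_add (hgi.mul_bdd (c := 1) hgm.aestronglyMeasurable (Eventually.of_forall hg1))
      (hgint.const_mul _), ← h2, integral_const_mul, hC]
    ring
  -- `σc` is not known to be admissible. Its regularized energies are still bounded, because Poisson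
  -- averages of f are bounded by sup |f|.
  have hEσ : ∃ D : ℝ, ∀ n, (form (regKernel (radius n)) σc σc).re ≤ D := by
    have : IsFiniteMeasure (Adelic.conjMeasure σc).variation := by rwa [variation_conjMeasure]
    refine ⟨_, fun n => (Complex.re_le_norm _).trans
      (VectorMeasure.norm_integral_le_of_norm_le_const (C := M + |C|)
        (Eventually.of_forall fun x => ?_))⟩
    rw [hpot, Complex.norm_real]
    exact (abs_sub _ _).trans (by gcongr; exact abs_poisson_le x hM)
  obtain ⟨D, hD⟩ := hEσ
  refine ⟨C, D, fun μ hμ => ?_⟩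
  have := hμ.fin
  obtain ⟨h, hhm, hhb, hhu, hh1, -, hh3⟩ := exists_integral_eq μ
  have hPm : ∀ n, Measurable (poisson f (radius n)) := by
    intro n
    have h2 := ((isPSDKernel_regKernel (radius_nonneg n) (radius_lt_one n)).isGood hσf).measurable
    have h3 : poisson f (radius n) = fun x => (pot (regKernel (radius n)) σc x).re + C := by
      ext x
      rw [hpot, Complex.ofReal_re]
      ring
    rw [h3]
    exact (Complex.measurable_re.comp h2).add_const C
  have hPi : ∀ n, Integrable (poisson f (radius n)) μ.variation := fun n =>
    Integrable.of_bound (hPm n).aestronglyMeasurable M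
      (Eventually.of_forall fun x => abs_poisson_le x hM)
  -- Cauchy–Schwarz is applied to the bounded kernels; only afterwards n → ∞, where the Poisson
  -- averages tend to f and the energies of μ converge.
  have key : ∀ n, ‖∫ᵛ x, poisson f (radius n) x ∂•μ - C * μ univ‖ ^ 2 ≤
      D * (form (regKernel (radius n)) μ μ).re := by
    intro n
    have hP := isPSDKernel_regKernel (radius_nonneg n) (radius_lt_one n)
    have h2 : ∫ᵛ x, poisson f (radius n) x ∂•μ - C * μ univ =
        ∫ᵛ x, (poisson f (radius n) x - C) ∂•μ := by
      rw [VectorMeasure.integral_fun_sub (hPi n) (integrable_const _), VectorMeasure.integral_const]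
      simp
    have hui : Integrable (fun x => poisson f (radius n) x - C) μ.variation :=
      (hPi n).sub (integrable_const _)
    have h3 : ‖∫ᵛ x, (poisson f (radius n) x - C) ∂•μ‖ =
        ‖form (regKernel (radius n)) σc μ‖ := by
      have h4 : Integrable (fun x => ((poisson f (radius n) x - C : ℝ) : ℂ)) μ.variation :=
        hui.ofReal
      simp_rw [form, hpot]
      rw [hh3 _ h4, hh1 _ hui, ← RCLike.norm_conj, ← integral_conj]
      simp
    rw [h2, h3]
    refine (hP.norm_form_sq_le hσf hμ.fin).trans ?_
    exact mul_le_mul_of_nonneg_right (hD n) (hP.form_nonneg hμ.fin)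
  refine le_of_tendsto_of_tendsto' (((Tendsto.sub_const ?_ _).norm).pow 2)
    ((isRegularization.tendsto_form_re hμ).const_mul D) key
  rw [hh1 _ (integrable_of_continuous hf _)]
  simp_rw [fun n => hh1 _ (hPi n)]
  refine tendsto_integral_of_dominated_convergence (fun _ => M * 2)
    (fun n => ((Complex.measurable_ofReal.comp (hPm n)).mul hhm).aestronglyMeasurable)
    (integrable_const _) (fun n => Eventually.of_forall fun x => ?_)
    (Eventually.of_forall fun x => ?_)
  · rw [norm_mul, Complex.norm_real]
    exact mul_le_mul (abs_poisson_le x hM) (hhb x) (norm_nonneg _) hM0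
  · exact ((Complex.continuous_ofReal.tendsto _).comp (tendsto_poisson hf hM x)).mul_const _

end RiemannSphere
end

noncomputable section

/-! ### Kernels of rooted real trees -/

/-- The properties of the spherical kernel of a compact real tree rooted at `G`. -/
structure IsTreeKernel {X : Type*} [TopologicalSpace X] (κ : X → X → ℝ) (G : X) : Prop where
  nonneg : ∀ x y, 0 ≤ κ x y
  symm : ∀ x y, κ x y = κ y x
  ultra : ∀ x y z, κ x z ≤ max (κ x y) (κ y z)
  root : ∀ y, κ G y = 1
  path : ∀ y s, κ y y < s → s ≤ 1 → ∃ p, κ p p = s ∧ κ p y = s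
  continuous : ∀ x, Continuous (κ x)
  sep : ∀ x y, κ x x = κ x y → κ y y = κ x y → x = y

namespace IsTreeKernel

variable {X : Type*} [TopologicalSpace X] {κ : X → X → ℝ} {G : X}

/-- The point `p` lies on the path from the root to `x`. -/
def Anc (κ : X → X → ℝ) (p x : X) : Prop := κ p x = κ p p

open Classical in
/-- The point of diameter at least `s` closest to `x`. -/
def trunc (κ : X → X → ℝ) (s : ℝ) (x : X) : X :=
  if h : ∃ p, κ p p = s ∧ κ p x = s ∧ κ x x < s then h.choose else x

variable (h : IsTreeKernel κ G)

include h

theorem self_le (x y : X) : κ x x ≤ κ x y := by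
  simpa [h.symm y x] using h.ultra x y x

theorem self_le' (x y : X) : κ y y ≤ κ x y := h.symm x y ▸ h.self_le y x

theorem le_one (x y : X) : κ x y ≤ 1 := by
  simpa [h.symm x G, h.root] using h.ultra x G y

theorem anc_root (x : X) : Anc κ G x := by rw [Anc, h.root, h.root]

theorem anc_of_le {p x : X} (hp : κ p x ≤ κ p p) : Anc κ p x := le_antisymm hp (h.self_le p x)

theorem Anc.self_le {p x : X} (hp : Anc κ p x) : κ x x ≤ κ p p := hp ▸ h.self_le' p x

theorem Anc.trans {p q x : X} (hp : Anc κ p q) (hq : Anc κ q x) : Anc κ p x := by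
  refine h.anc_of_le ((h.ultra p q x).trans (max_le hp.le ?_))
  rw [hq]
  exact Anc.self_le h hp

theorem Anc.antisymm {p q : X} (hp : Anc κ p q) (hq : Anc κ q p) : p = q :=
  h.sep p q hp.symm (by rw [h.symm p q]; exact hq.symm)

/-- By the strong triangle inequality the ancestors of a point form a chain ordered by κ p p. This
is the tree property. -/
theorem Anc.of_anc_of_le {p q x : X} (hp : Anc κ p x) (hq : Anc κ q x) (hle : κ q q ≤ κ p p) :
    Anc κ p q := by
  refine h.anc_of_le ((h.ultra p x q).trans (max_le hp.le ?_))
  rw [h.symm x q, hq]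
  exact hle

theorem Anc.total {p q x : X} (hp : Anc κ p x) (hq : Anc κ q x) : Anc κ p q ∨ Anc κ q p := by
  rcases le_total (κ q q) (κ p p) with hle | hle
  · exact Or.inl (hp.of_anc_of_le h hq hle)
  · exact Or.inr (hq.of_anc_of_le h hp hle)

theorem Anc.eq_of_self_eq {p x : X} (hp : Anc κ p x) (he : κ x x = κ p p) : p = x :=
  h.sep p x hp.symm (he.trans hp.symm)

theorem Anc.eq_root {p : X} (hp : Anc κ p G) : p = G := hp.antisymm h (h.anc_root p)

theorem Anc.self_lt {p x : X} (hp : Anc κ p x) (hne : p ≠ x) : κ x x < κ p p :=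
  lt_of_le_of_ne (hp.self_le h) fun he => hne (hp.eq_of_self_eq h he)

theorem Anc.le_left {p x : X} (hp : Anc κ p x) (y : X) : κ x y ≤ κ p y := by
  refine (h.ultra x p y).trans (max_le ?_ le_rfl)
  rw [h.symm x p, hp]
  exact h.self_le p y

/-- Moving from x up to an ancestor p changes κ(·, y) only by raising it to at least κ p p. Most
computations below rest on this rule. -/
theorem Anc.eq_max {p x : X} (hp : Anc κ p x) (y : X) : κ p y = max (κ x y) (κ p p) := by
  refine le_antisymm ?_ (max_le (hp.le_left h y) (h.self_le p y))
  rw [max_comm, ← hp]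
  exact h.ultra p x y

section Trunc

variable {s : ℝ} (hs : s ≤ 1)

include hs

/-- The field `path` supplies the point when κ x x < s; otherwise x is kept, whence the maximum. -/
theorem trunc_spec (x : X) :
    κ (trunc κ s x) (trunc κ s x) = max (κ x x) s ∧ Anc κ (trunc κ s x) x := by
  rcases lt_or_ge (κ x x) s with hx | hx
  · have he : ∃ p, κ p p = s ∧ κ p x = s ∧ κ x x < s := by
      obtain ⟨p, h1, h2⟩ := h.path x s hx hs
      exact ⟨p, h1, h2, hx⟩
    have h2 : trunc κ s x = he.choose := dif_pos he
    have h3 := he.choose_spec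
    rw [← h2] at h3
    rw [Anc, h3.1, h3.2.1, max_eq_right hx.le]
    exact ⟨rfl, rfl⟩
  · have h2 : trunc κ s x = x := dif_neg fun ⟨p, _, _, h3⟩ => h3.not_ge hx
    rw [h2, max_eq_left hx]
    exact ⟨rfl, rfl⟩

theorem trunc_self (x : X) : κ (trunc κ s x) (trunc κ s x) = max (κ x x) s := (h.trunc_spec hs x).1

theorem anc_trunc (x : X) : Anc κ (trunc κ s x) x := (h.trunc_spec hs x).2

theorem trunc_left (x y : X) : κ (trunc κ s x) y = max (κ x y) s := by
  rw [(h.anc_trunc hs x).eq_max h, h.trunc_self hs, ← max_assoc, max_eq_left (h.self_le x y)]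

theorem trunc_right (x y : X) : κ x (trunc κ s y) = max (κ x y) s := by
  rw [h.symm, h.trunc_left hs, h.symm]

/-- The paths from x and y to the root have merged at level s: all kernel values between the two
truncations equal s, and `sep` identifies them. -/
theorem trunc_eq_trunc {x y : X} (hxy : κ x y ≤ s) : trunc κ s x = trunc κ s y := by
  have h1 := (h.self_le x y).trans hxy
  have h2 := (h.self_le' x y).trans hxy
  refine h.sep _ _ ?_ ?_ <;>
  simp [h.trunc_self hs, h.trunc_left hs, h.trunc_right hs, h1, h2, hxy]

theorem trunc_eq_self {x : X} (hx : s ≤ κ x x) : trunc κ s x = x :=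
  (h.anc_trunc hs x).eq_of_self_eq h (by rw [h.trunc_self hs, max_eq_left hx])

end Trunc

/-- The truncation of x at level κ x y, which by `trunc_eq_trunc` is also that of y. -/
theorem exists_meet (x y : X) : ∃ m, Anc κ m x ∧ Anc κ m y ∧ κ m m = κ x y := by
  have hs := h.le_one x y
  refine ⟨trunc κ (κ x y) x, h.anc_trunc hs x, ?_, ?_⟩
  · rw [h.trunc_eq_trunc hs le_rfl]
    exact h.anc_trunc hs y
  · rw [h.trunc_self hs, max_eq_right (h.self_le x y)]

/-- The meet of `u` and an ancestor `t` of `r`. -/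
theorem meet_anc {m u r t : X} (h2 : Anc κ m r) (h3 : κ m m = κ u r)
    (ht : Anc κ t r) : (Anc κ m t ∧ κ m m = κ u t) ∨ (Anc κ t u ∧ κ t t = κ u t) := by
  have he : κ u t = max (κ u r) (κ t t) := by
    rw [h.symm u t, ht.eq_max h, h.symm r u]
  rcases le_total (κ t t) (κ m m) with hle | hle
  · exact Or.inl ⟨h2.of_anc_of_le h ht hle, by rw [he, ← h3, max_eq_left hle]⟩
  · have : κ u t = κ t t := by rw [he, ← h3, max_eq_right hle]
    exact Or.inr ⟨by rw [Anc, h.symm, this], this.symm⟩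

theorem anc_meet {m x y p : X} (h1 : Anc κ m x) (h3 : κ m m = κ x y)
    (hx : Anc κ p x) (hy : Anc κ p y) : Anc κ p m := by
  refine hx.of_anc_of_le h h1 ?_
  rw [h3]
  refine (h.ultra x p y).trans (max_le ?_ hy.le)
  rw [h.symm, hx]

/-- The functions κ(q, ·) are continuous and separate points, so they embed the compact space in a
product of lines. -/
theorem tendsto_of_forall [CompactSpace X] {ι : Type*} {l : Filter ι} {u : ι → X} {x : X}
    (hu : ∀ q, Tendsto (fun i => κ q (u i)) l (𝓝 (κ q x))) : Tendsto u l (𝓝 x) := by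
  have hinj : Function.Injective fun (y : X) (q : X) => κ q y := by
    intro y z hyz
    have h1 : ∀ q, κ q y = κ q z := fun q => congrFun hyz q
    exact h.sep y z (h1 y) ((h1 z).symm.trans (h.symm z y))
  have hemb := ((continuous_pi fun q => h.continuous q).isClosedEmbedding hinj).isEmbedding
  rw [hemb.tendsto_nhds_iff]
  exact tendsto_pi_nhds.2 hu

theorem tendsto_trunc [CompactSpace X] {ι : Type*} {l : Filter ι} {s : ι → ℝ} {t : ℝ} (ht : t ≤ 1)
    (hs : ∀ i, s i ≤ 1) (hlim : Tendsto s l (𝓝 t)) (x : X) :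
    Tendsto (fun i => trunc κ (s i) x) l (𝓝 (trunc κ t x)) := by
  refine h.tendsto_of_forall fun q => ?_
  simp_rw [fun i => h.trunc_right (hs i) q x, h.trunc_right ht q x]
  exact tendsto_const_nhds.max hlim

/-! ### Finite vertex sets -/

omit h in
/-- A finite set of points of positive diameter that contains the root and is closed under meets. -/
structure IsMeetClosed (κ : X → X → ℝ) (G : X) (V : Finset X) : Prop where
  root_mem : G ∈ V
  pos : ∀ p ∈ V, 0 < κ p p
  meet : ∀ p ∈ V, ∀ q ∈ V, ∃ m ∈ V, Anc κ m p ∧ Anc κ m q ∧ κ m m = κ p q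

open Classical in
-- Adjoining the root and all pairwise meets once is enough: in a tree, the meet of two pairwise
-- meets is again a pairwise meet.
theorem exists_isMeetClosed (F : Finset X) {s : ℝ} (h0 : 0 < s) (h1 : s ≤ 1)
    (hF : ∀ p ∈ F, s ≤ κ p p) :
    ∃ V : Finset X, IsMeetClosed κ G V ∧ F ⊆ V ∧ ∀ p ∈ V, s ≤ κ p p := by
  set F' := insert G F with hF'
  have hF2 : ∀ p ∈ F', s ≤ κ p p := by
    intro p hp
    rcases Finset.mem_insert.1 hp with rfl | hp
    · rwa [h.root]
    · exact hF p hp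
  have hle := h.le_one
  have hself : ∀ p q, κ (trunc κ (κ p q) p) (trunc κ (κ p q) p) = κ p q := fun p q => by
    rw [h.trunc_self (hle p q), max_eq_right (h.self_le p q)]
  set V := (F' ×ˢ F').image fun z => trunc κ (κ z.1 z.2) z.1 with hV
  have hmem : ∀ p ∈ F', ∀ q ∈ F', trunc κ (κ p q) p ∈ V := fun p hp q hq =>
    Finset.mem_image.2 ⟨(p, q), Finset.mem_product.2 ⟨hp, hq⟩, rfl⟩
  have hsub : F' ⊆ V := fun p hp => by
    simpa [h.trunc_eq_self (hle p p) le_rfl] using hmem p hp p hp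
  have hge : ∀ p ∈ V, s ≤ κ p p := by
    intro p hp
    obtain ⟨⟨a, b⟩, hab, rfl⟩ := Finset.mem_image.1 hp
    obtain ⟨ha, hb⟩ := Finset.mem_product.1 hab
    simp only at ha hb ⊢
    rw [hself]
    exact (hF2 a ha).trans (h.self_le a b)
  refine ⟨V, ⟨hsub (Finset.mem_insert_self _ _), fun p hp => h0.trans_le (hge p hp), ?_⟩,
    (Finset.subset_insert _ _).trans hsub, hge⟩
  intro u hu v hv
  obtain ⟨⟨p, q⟩, hpq, rfl⟩ := Finset.mem_image.1 hu
  obtain ⟨⟨r, t⟩, hrt, rfl⟩ := Finset.mem_image.1 hv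
  obtain ⟨hp, hq⟩ := Finset.mem_product.1 hpq
  obtain ⟨hr, ht⟩ := Finset.mem_product.1 hrt
  simp only at hp hq hr ht ⊢
  -- The largest of these three values decides which pairwise meet occurs.
  have he : κ (trunc κ (κ p q) p) (trunc κ (κ r t) r) = max (max (κ p r) (κ r t)) (κ p q) := by
    rw [h.trunc_left (hle p q), h.trunc_right (hle r t)]
  rcases le_total (κ p q) (max (κ p r) (κ r t)) with h2 | h2
  · rcases le_total (κ r t) (κ p r) with h3 | h3
    · rw [max_eq_left h3] at h2
      refine ⟨trunc κ (κ p r) p, hmem p hp r hr, ?_, ?_, ?_⟩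
      · exact (h.anc_trunc (hle p r) p).of_anc_of_le h (h.anc_trunc (hle p q) p)
          (by rw [hself, hself]; exact h2)
      · rw [h.trunc_eq_trunc (hle p r) le_rfl]
        refine (h.anc_trunc (hle p r) r).of_anc_of_le h (h.anc_trunc (hle r t) r) ?_
        rw [hself, h.trunc_self (hle p r), max_eq_right (h.self_le' p r)]
        exact h3
      · rw [he, hself, max_eq_left h3, max_eq_left h2]
    · rw [max_eq_right h3] at h2
      refine ⟨trunc κ (κ r t) r, hmem r hr t ht, ?_, rfl, ?_⟩
      · rw [← h.trunc_eq_trunc (hle r t) h3]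
        refine (h.anc_trunc (hle r t) p).of_anc_of_le h (h.anc_trunc (hle p q) p) ?_
        rw [hself, h.trunc_self (hle r t)]
        exact h2.trans (le_max_right _ _)
      · rw [he, hself, max_eq_right h3, max_eq_left h2]
  · refine ⟨trunc κ (κ p q) p, hmem p hp q hq, rfl, ?_, ?_⟩
    · rw [Anc, he, hself, max_eq_right h2]
    · rw [he, hself, max_eq_right h2]

end IsTreeKernel
end

/-! ### Finite rooted trees: parents, retractions and tree kernels -/

noncomputable section

namespace IsTreeKernel

variable {X : Type*} [TopologicalSpace X] {κ : X → X → ℝ} {G : X}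

/-- The distance from the root. -/
def depth (κ : X → X → ℝ) (p : X) : ℝ := -Real.log (κ p p)

/-- `p` is the parent of `q` in the finite tree with vertex set `V`. -/
def IsParent (κ : X → X → ℝ) (V : Finset X) (p q : X) : Prop :=
  p ∈ V ∧ Anc κ p q ∧ p ≠ q ∧ ∀ z ∈ V, Anc κ z q → z ≠ q → Anc κ z p

open Classical in
/-- The parent of a vertex. -/
def parent (κ : X → X → ℝ) (V : Finset X) (q : X) : X :=
  if h : ∃ p, IsParent κ V p q then h.choose else q

open Classical in
/-- The last vertex on the path from the root to `x`. -/
def proj (κ : X → X → ℝ) (V : Finset X) (x : X) : X :=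
  if h : ∃ p ∈ V, Anc κ p x ∧ ∀ z ∈ V, Anc κ z x → Anc κ z p then h.choose else x

variable (h : IsTreeKernel κ G) {V : Finset X} (hV : IsMeetClosed κ G V)

include h hV

open Classical in
-- The proper ancestors in V form a chain containing the root; the parent is the one with the
-- smallest κ z z.
theorem exists_isParent {q : X} (hne : q ≠ G) : ∃ p, IsParent κ V p q := by
  obtain ⟨p, hp, hmin⟩ := Finset.exists_min_image {z ∈ V | Anc κ z q ∧ z ≠ q} (fun z => κ z z)
    ⟨G, Finset.mem_filter.2 ⟨hV.root_mem, h.anc_root q, hne.symm⟩⟩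
  obtain ⟨hpV, hpq, hne'⟩ := Finset.mem_filter.1 hp
  exact ⟨p, hpV, hpq, hne', fun z hz hzq hzne => hzq.of_anc_of_le h hpq
    (hmin z (Finset.mem_filter.2 ⟨hz, hzq, hzne⟩))⟩

theorem isParent_parent {q : X} (hne : q ≠ G) : IsParent κ V (parent κ V q) q := by
  have he := h.exists_isParent hV hne
  rw [parent, dif_pos he]
  exact he.choose_spec

omit hV in
theorem IsParent.unique {p p' q : X} (hp : IsParent κ V p q) (hp' : IsParent κ V p' q) :
    p = p' :=
  Anc.antisymm h (hp'.2.2.2 p hp.1 hp.2.1 hp.2.2.1) (hp.2.2.2 p' hp'.1 hp'.2.1 hp'.2.2.1)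

omit hV in
theorem IsParent.depth_lt {p q : X} (hp : IsParent κ V p q) (hq : 0 < κ q q) :
    depth κ p < depth κ q :=
  neg_lt_neg (Real.log_lt_log hq (hp.2.1.self_lt h hp.2.2.1))

open Classical in
theorem proj_spec (x : X) : proj κ V x ∈ V ∧ Anc κ (proj κ V x) x ∧
    ∀ z ∈ V, Anc κ z x → Anc κ z (proj κ V x) := by
  have he : ∃ p ∈ V, Anc κ p x ∧ ∀ z ∈ V, Anc κ z x → Anc κ z p := by
    obtain ⟨p, hp, hmin⟩ := Finset.exists_min_image {z ∈ V | Anc κ z x} (fun z => κ z z)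
      ⟨G, Finset.mem_filter.2 ⟨hV.root_mem, h.anc_root x⟩⟩
    obtain ⟨hpV, hpx⟩ := Finset.mem_filter.1 hp
    exact ⟨p, hpV, hpx, fun z hz hzx => hzx.of_anc_of_le h hpx
      (hmin z (Finset.mem_filter.2 ⟨hz, hzx⟩))⟩
  rw [proj, dif_pos he]
  exact he.choose_spec

theorem proj_mem (x : X) : proj κ V x ∈ V := (h.proj_spec hV x).1

theorem anc_proj (x : X) : Anc κ (proj κ V x) x := (h.proj_spec hV x).2.1

theorem anc_proj_iff {p : X} (hp : p ∈ V) (x : X) : Anc κ p (proj κ V x) ↔ Anc κ p x :=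
  ⟨fun h1 => h1.trans h (h.anc_proj hV x), fun h1 => (h.proj_spec hV x).2.2 p hp h1⟩

open Classical in
/-- A function on the vertices as a sum over the edges of the path from the root. -/
theorem sum_sub_parent (f : X → ℝ) {z : X} (hz : z ∈ V) :
    ∑ p ∈ (V.erase G).filter (fun p => Anc κ p z), (f p - f (parent κ V p)) = f z - f G := by
  -- The sum telescopes, by induction on the number of vertices between the root and z.
  induction hn : (V.filter fun p => Anc κ p z).card using Nat.strong_induction_on generalizing z with
  | _ n ih =>
  by_cases hG : z = G
  · subst hG
    rw [sub_self, Finset.sum_eq_zero]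
    intro p hp
    obtain ⟨h1, h2⟩ := Finset.mem_filter.1 hp
    exact absurd (h2.eq_root h) (Finset.ne_of_mem_erase h1)
  · have hP := h.isParent_parent hV hG
    set p := parent κ V z with hp
    have hlt : (V.filter fun w => Anc κ w p).card < n := by
      rw [← hn]
      refine Finset.card_lt_card ((Finset.ssubset_iff_of_subset ?_).2 ⟨z, ?_, ?_⟩)
      · intro w hw
        obtain ⟨h1, h2⟩ := Finset.mem_filter.1 hw
        exact Finset.mem_filter.2 ⟨h1, h2.trans h hP.2.1⟩
      · exact Finset.mem_filter.2 ⟨hz, rfl⟩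
      · intro hw
        exact hP.2.2.1 (hP.2.1.antisymm h (Finset.mem_filter.1 hw).2)
    have h1 := ih _ hlt hP.1 rfl
    have hset : (V.erase G).filter (fun w => Anc κ w z) =
        insert z ((V.erase G).filter fun w => Anc κ w p) := by
      ext w
      simp only [Finset.mem_filter, Finset.mem_insert, Finset.mem_erase]
      constructor
      · rintro ⟨⟨h2, h3⟩, h4⟩
        by_cases hwz : w = z
        · exact Or.inl hwz
        · exact Or.inr ⟨⟨h2, h3⟩, hP.2.2.2 w h3 h4 hwz⟩
      · rintro (rfl | ⟨h2, h3⟩)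
        · exact ⟨⟨hG, hz⟩, rfl⟩
        · exact ⟨h2, h3.trans h hP.2.1⟩
    rw [hset, Finset.sum_insert, h1]
    · ring
    · intro hw
      exact hP.2.2.1 (hP.2.1.antisymm h (Finset.mem_filter.1 hw).2)

/-- The indicator function of the points beyond `p`. -/
def beyond (κ : X → X → ℝ) (p x : X) : ℝ := {y | Anc κ p y}.indicator 1 x

omit [TopologicalSpace X] h hV in
theorem beyond_of_anc {p x : X} (hx : Anc κ p x) : beyond κ p x = 1 :=
  indicator_of_mem (s := {y | Anc κ p y}) hx _

omit [TopologicalSpace X] h hV in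
theorem beyond_of_not_anc {p x : X} (hx : ¬Anc κ p x) : beyond κ p x = 0 :=
  indicator_of_notMem (s := {y | Anc κ p y}) hx _

omit [TopologicalSpace X] h hV in
theorem beyond_nonneg (p x : X) : 0 ≤ beyond κ p x := indicator_nonneg (fun _ _ => zero_le_one) x

omit [TopologicalSpace X] h hV in
theorem abs_beyond_le (p x : X) : |beyond κ p x| ≤ 1 := by
  rw [abs_of_nonneg (beyond_nonneg p x)]
  exact indicator_le_self' (fun _ _ => zero_le_one) x

omit hV in
theorem measurable_beyond [MeasurableSpace X] [BorelSpace X] (p : X) : Measurable (beyond κ p) :=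
  measurable_one.indicator (isClosed_eq (h.continuous p) continuous_const).measurableSet

/-- The length of the edge above `p`. -/
def edgeLength (κ : X → X → ℝ) (V : Finset X) (p : X) : ℝ := depth κ p - depth κ (parent κ V p)

open Classical in
/-- The kernel of the finite tree with vertex set `V`. -/
def treeKernel (κ : X → X → ℝ) (G : X) (V : Finset X) (x y : X) : ℝ :=
  ∑ p ∈ V.erase G, edgeLength κ V p * (beyond κ p x * beyond κ p y)

open Classical in
theorem edgeLength_pos {p : X} (hp : p ∈ V.erase G) : 0 < edgeLength κ V p := by
  obtain ⟨h1, h2⟩ := Finset.mem_erase.1 hp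
  exact sub_pos.2 ((h.isParent_parent hV h1).depth_lt h (hV.pos p h2))

open Classical in
-- The edges with x beyond them form the path from the root to the projection of x, so the sum
-- telescopes. Functions of the projection thus become combinations of indicators of branches, with
-- the increments along edges as coefficients.
theorem sum_mul_beyond (f : X → ℝ) (x : X) :
    ∑ p ∈ V.erase G, (f p - f (parent κ V p)) * beyond κ p x = f (proj κ V x) - f G := by
  rw [← h.sum_sub_parent hV f (h.proj_mem hV x), Finset.sum_filter]
  refine Finset.sum_congr rfl fun p hp => ?_
  have hp' := Finset.mem_of_mem_erase hp
  by_cases hx : Anc κ p x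
  · rw [if_pos ((h.anc_proj_iff hV hp' x).2 hx), beyond_of_anc hx, mul_one]
  · rw [if_neg (mt (h.anc_proj_iff hV hp' x).1 hx), beyond_of_not_anc hx, mul_zero]

/-- The edges counted are common to the paths to both projections. They form the path to the meet,
and their lengths add up to its depth. -/
theorem treeKernel_eq (x y : X) :
    treeKernel κ G V x y = -Real.log (κ (proj κ V x) (proj κ V y)) := by
  classical
  obtain ⟨m, hm, h1, h2, h3⟩ := hV.meet _ (h.proj_mem hV x) _ (h.proj_mem hV y)
  have h4 := h.sum_mul_beyond hV (depth κ) m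
  have hpm : proj κ V m = m := Anc.antisymm h (h.anc_proj hV m)
    ((h.anc_proj_iff hV hm m).2 rfl)
  rw [hpm, depth, depth, h.root, Real.log_one, h3] at h4
  rw [treeKernel, ← sub_zero (-Real.log _), ← neg_zero, ← h4]
  refine Finset.sum_congr rfl fun p hp => ?_
  have hp' := Finset.mem_of_mem_erase hp
  rw [edgeLength]
  congr 1
  have h5 : Anc κ p m ↔ Anc κ p x ∧ Anc κ p y := by
    rw [← h.anc_proj_iff hV hp' x, ← h.anc_proj_iff hV hp' y]
    exact ⟨fun h6 => ⟨h6.trans h h1, h6.trans h h2⟩, fun h6 => h.anc_meet h1 h3 h6.1 h6.2⟩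
  simp only [beyond, indicator, mem_ofPred_eq, h5, Pi.one_apply]
  split_ifs <;> simp_all

theorem isPSDKernel_treeKernel [MeasurableSpace X] [BorelSpace X] :
    EnergyForm.IsPSDKernel (treeKernel κ G V) := by
  classical
  exact EnergyForm.IsPSDKernel.sum _ fun p hp => (EnergyForm.isPSDKernel_mul
    (h.measurable_beyond p) (abs_beyond_le p)).const_mul (h.edgeLength_pos hV hp).le

theorem treeKernel_le {s : ℝ} (h0 : 0 < s) (hs : ∀ p ∈ V, s ≤ κ p p) (x y : X) :
    |treeKernel κ G V x y| ≤ -Real.log s := by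
  have h1 : s ≤ κ (proj κ V x) (proj κ V y) := (hs _ (h.proj_mem hV x)).trans (h.self_le _ _)
  rw [h.treeKernel_eq hV, abs_of_nonneg]
  · exact neg_le_neg (Real.log_le_log h0 h1)
  · exact neg_nonneg.2 (Real.log_nonpos (h0.le.trans h1) (h.le_one _ _))

end IsTreeKernel
end

/-! ### Rank-one energies, and approximation by finite trees -/

noncomputable section

namespace EnergyForm

open Adelic ComplexConjugate

variable {X : Type*} [MeasurableSpace X] {μ : ComplexMeasure X}

theorem norm_integral_smul_le [IsFiniteMeasure μ.variation] {f : X → ℝ} {C : ℝ} (hC0 : 0 ≤ C)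
    (hC : ∀ x, |f x| ≤ C) : ‖∫ᵛ x, f x ∂•μ‖ ≤ C * μ.variation.real univ := by
  have h1 : ‖(ContinuousLinearMap.lsmul ℝ ℝ : ℝ →L[ℝ] ℂ →L[ℝ] ℂ)‖ ≤ 1 :=
    ContinuousLinearMap.opNorm_lsmul_le
  refine (VectorMeasure.norm_integral_le_of_norm_le_const (C := C)
    (Eventually.of_forall hC)).trans ?_
  calc _ ≤ C * 1 * μ.variation.real univ := by gcongr
    _ = _ := by ring

/-- The energy form of a sum of kernels of rank one. -/
theorem form_sum_mul {ι : Type*} (s : Finset ι) (c : ι → ℝ) {φ : ι → X → ℝ}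
    (hφ : ∀ i, Measurable (φ i)) {B : ℝ} (hB : ∀ i x, |φ i x| ≤ B)
    [IsFiniteMeasure μ.variation] :
    form (fun x y => ∑ i ∈ s, c i * (φ i x * φ i y)) μ μ =
      ((∑ i ∈ s, c i * ‖∫ᵛ x, φ i x ∂•μ‖ ^ 2 : ℝ) : ℂ) := by
  obtain ⟨h, hm, hb, -, h1, -, h3⟩ := exists_integral_eq μ
  have hφi : ∀ i, Integrable (φ i) μ.variation := fun i =>
    Integrable.of_bound (hφ i).aestronglyMeasurable B (Eventually.of_forall (hB i))
  have hφh : ∀ i, Integrable (fun x => (φ i x : ℂ) * h x) μ.variation := fun i =>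
    (hφi i).ofReal.mul_bdd (c := 2) hm.aestronglyMeasurable (Eventually.of_forall hb)
  have hφc : ∀ i, Integrable (fun x => (φ i x : ℂ) * conj (h x)) μ.variation := fun i =>
    (hφi i).ofReal.mul_bdd (c := 2) (Complex.continuous_conj.measurable.comp hm).aestronglyMeasurable
      (Eventually.of_forall fun x => by simpa using hb x)
  have hpot : ∀ y, pot (fun x y => ∑ i ∈ s, c i * (φ i x * φ i y)) μ y =
      ∑ i ∈ s, (c i : ℂ) * (∫ᵛ x, φ i x ∂•μ) * φ i y := by
    intro y
    rw [pot, h1]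
    · have e : ∀ x, ((∑ i ∈ s, c i * (φ i x * φ i y) : ℝ) : ℂ) * h x =
          ∑ i ∈ s, ((c i : ℂ) * φ i y) * ((φ i x : ℂ) * h x) := by
        intro x
        push_cast
        rw [Finset.sum_mul]
        exact Finset.sum_congr rfl fun i _ => by ring
      simp_rw [e]
      rw [integral_finsetSum _ fun i _ => (hφh i).const_mul _]
      refine Finset.sum_congr rfl fun i _ => ?_
      rw [integral_const_mul, h1 _ (hφi i)]
      ring
    · exact integrable_finsetSum _ fun i _ => ((hφi i).mul_const _).const_mul _
  have hc : ∀ i, ∫ x, (φ i x : ℂ) * conj (h x) ∂μ.variation = conj (∫ᵛ x, φ i x ∂•μ) := by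
    intro i
    rw [h1 _ (hφi i), ← integral_conj]
    simp
  simp_rw [form, hpot]
  rw [h3]
  · simp_rw [Finset.sum_mul, mul_assoc]
    rw [integral_finsetSum _ fun i _ => ((hφc i).const_mul _).const_mul _]
    push_cast
    refine Finset.sum_congr rfl fun i _ => ?_
    rw [integral_const_mul, integral_const_mul, hc, Complex.mul_conj, Complex.normSq_eq_norm_sq]
    push_cast
    ring
  · exact integrable_finsetSum _ fun i _ => (hφi i).ofReal.const_mul _

theorem conjMeasure_dirac_one (p : X) :
    conjMeasure (VectorMeasure.dirac p (1 : ℂ)) = VectorMeasure.dirac p (1 : ℂ) := by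
  ext s hs
  by_cases hp : p ∈ s
  · simp [conjMeasure, VectorMeasure.mapRange_apply, VectorMeasure.dirac_apply_of_mem hs hp]
  · simp [conjMeasure, VectorMeasure.mapRange_apply, VectorMeasure.dirac_apply_of_notMem hp]

theorem form_dirac_one [MeasurableSingletonClass X] (k : X → X → ℝ) (p : X) :
    form k μ (VectorMeasure.dirac p 1) = pot k μ p := by
  rw [form, conjMeasure_dirac_one, VectorMeasure.integral_dirac]
  simp

end EnergyForm

namespace IsTreeKernel

open EnergyForm

variable {X : Type*} [TopologicalSpace X] {κ : X → X → ℝ} {G : X} (h : IsTreeKernel κ G)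

include h

section Approximation

variable [SecondCountableTopology X]

/-- Lindelöf: for rational t, countably many of the sets {κ x · < t} have the same union as all of
them, and truncation at level t is constant on each. -/
theorem exists_countable_trunc : ∃ D : Set X, D.Countable ∧
    ∀ (x : X) (t : ℚ), κ x x < t → (t : ℝ) ≤ 1 → trunc κ t x ∈ D := by
  choose T hTc hT using fun t : ℚ => TopologicalSpace.isOpen_iUnion_countable
    (fun x : X => {y | κ x y < t}) fun x => isOpen_lt (h.continuous x) continuous_const
  refine ⟨⋃ t : ℚ, (trunc κ t) '' T t, countable_iUnion fun t => (hTc t).image _, ?_⟩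
  intro x t hx ht
  have h1 : x ∈ ⋃ i, {y | κ i y < t} := mem_iUnion.2 ⟨x, hx⟩
  rw [← hT t] at h1
  obtain ⟨a, ha, hax⟩ := mem_iUnion₂.1 h1
  exact mem_iUnion.2 ⟨t, a, ha, h.trunc_eq_trunc ht (le_of_lt hax)⟩

omit h in
/-- A sequence of vertex sets that exhausts the points of diameter at least `s`. -/
structure IsExhausting (κ : X → X → ℝ) (G : X) (s : ℝ) (V : ℕ → Finset X) : Prop where
  isMeetClosed : ∀ n, IsMeetClosed κ G (V n)
  le_self : ∀ n, ∀ p ∈ V n, s ≤ κ p p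
  mem : ∀ (x : X) (t : ℚ), κ x x < t → s ≤ t → (t : ℝ) ≤ 1 → ∀ᶠ n in atTop, trunc κ t x ∈ V n

theorem exists_isExhausting {s : ℝ} (h0 : 0 < s) (h1 : s ≤ 1) :
    ∃ V, IsExhausting κ G s V := by
  classical
  obtain ⟨D, hDc, hD⟩ := h.exists_countable_trunc
  have hne : ({p ∈ insert G D | s ≤ κ p p} : Set X).Nonempty :=
    ⟨G, mem_insert _ _, by rwa [h.root]⟩
  obtain ⟨e, he⟩ := ((hDc.insert G).mono (sep_subset _ _)).exists_eq_range hne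
  have hes : ∀ i, s ≤ κ (e i) (e i) := fun i => (he.symm ▸ mem_range_self i : e i ∈
    {p ∈ insert G D | s ≤ κ p p}).2
  choose V hV using fun n : ℕ => h.exists_isMeetClosed ((Finset.range (n + 1)).image e) h0 h1
    (fun p hp => by
      obtain ⟨i, -, rfl⟩ := Finset.mem_image.1 hp
      exact hes i)
  refine ⟨V, fun n => (hV n).1, fun n => (hV n).2.2, fun x t hx hst ht => ?_⟩
  have hmem : trunc κ t x ∈ {p ∈ insert G D | s ≤ κ p p} :=
    ⟨mem_insert_of_mem _ (hD x t hx ht), by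
      rw [h.trunc_self ht]
      exact hst.trans (le_max_right _ _)⟩
  rw [he] at hmem
  obtain ⟨i, hi⟩ := hmem
  filter_upwards [eventually_ge_atTop i] with n hn
  rw [← hi]
  exact (hV n).2.1 (Finset.mem_image_of_mem _ (Finset.mem_range.2 (by omega)))

variable {s : ℝ} {V : ℕ → Finset X} (hV : IsExhausting κ G s V)

include hV

omit [SecondCountableTopology X] in
-- The projection is an ancestor of x of diameter at least s, whence the lower bound. For the upper
-- bound, the truncation of x at a rational level just above the limit is eventually a vertex, and
-- the projection then lies beyond it.
theorem tendsto_proj_right (q x : X) :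
    Tendsto (fun n => κ q (proj κ (V n) x)) atTop (𝓝 (max (κ q x) s)) := by
  have hlow : ∀ n, max (κ q x) s ≤ κ q (proj κ (V n) x) := by
    intro n
    have hp := h.anc_proj (hV.isMeetClosed n) x
    refine max_le ?_ ((hV.le_self n _ (h.proj_mem (hV.isMeetClosed n) x)).trans (h.self_le' _ _))
    rw [h.symm q x, h.symm q]
    exact hp.le_left h q
  refine tendsto_order.2 ⟨fun a ha => Eventually.of_forall fun n => ha.trans_le (hlow n),
    fun b hb => ?_⟩
  rcases lt_or_ge 1 b with hb1 | hb1
  · exact Eventually.of_forall fun n => (h.le_one _ _).trans_lt hb1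
  obtain ⟨t, ht1, ht2⟩ := exists_rat_btwn hb
  have ht : (t : ℝ) ≤ 1 := ht2.le.trans hb1
  have hqx := (le_max_left _ _).trans_lt ht1
  filter_upwards [hV.mem x t ((h.self_le' q x).trans_lt hqx) ((le_max_right _ _).trans ht1.le) ht]
    with n hn
  have hp := (h.proj_spec (hV.isMeetClosed n) x).2.2 _ hn (h.anc_trunc ht x)
  refine (h.ultra q (trunc κ t x) _).trans_lt (max_lt ?_ ?_)
  · rwa [h.trunc_right ht, max_eq_right hqx.le]
  · rwa [hp, h.trunc_self ht, max_eq_right ((h.self_le' q x).trans hqx.le)]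

omit [SecondCountableTopology X] in
theorem tendsto_proj_proj (x y : X) :
    Tendsto (fun n => κ (proj κ (V n) x) (proj κ (V n) y)) atTop (𝓝 (max (κ x y) s)) := by
  have hlow : ∀ n, max (κ x y) s ≤ κ (proj κ (V n) x) (proj κ (V n) y) := by
    intro n
    have hx := h.anc_proj (hV.isMeetClosed n) x
    have hy := h.anc_proj (hV.isMeetClosed n) y
    refine max_le ?_ ((hV.le_self n _ (h.proj_mem (hV.isMeetClosed n) x)).trans (h.self_le _ _))
    refine (hx.le_left h y).trans ?_
    rw [h.symm _ y, h.symm _ (proj κ (V n) y)]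
    exact hy.le_left h _
  refine tendsto_order.2 ⟨fun a ha => Eventually.of_forall fun n => ha.trans_le (hlow n),
    fun b hb => ?_⟩
  rcases lt_or_ge 1 b with hb1 | hb1
  · exact Eventually.of_forall fun n => (h.le_one _ _).trans_lt hb1
  obtain ⟨t, ht1, ht2⟩ := exists_rat_btwn hb
  have ht : (t : ℝ) ≤ 1 := ht2.le.trans hb1
  have hxy := (le_max_left _ _).trans_lt ht1
  have hxx := (h.self_le x y).trans_lt hxy
  filter_upwards [hV.mem x t hxx ((le_max_right _ _).trans ht1.le) ht] with n hn
  have hx := (h.proj_spec (hV.isMeetClosed n) x).2.2 _ hn (h.anc_trunc ht x)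
  have hy := (h.proj_spec (hV.isMeetClosed n) y).2.2 _ hn
    (h.trunc_eq_trunc ht hxy.le ▸ h.anc_trunc ht y)
  have hself : κ (trunc κ t x) (trunc κ t x) = t := by rw [h.trunc_self ht, max_eq_right hxx.le]
  refine (h.ultra _ (trunc κ t x) _).trans_lt (max_lt ?_ ?_)
  · rwa [h.symm, hx, hself]
  · rwa [hy, hself]

omit [SecondCountableTopology X] in
theorem tendsto_proj [CompactSpace X] (hs : s ≤ 1) (x : X) :
    Tendsto (fun n => proj κ (V n) x) atTop (𝓝 (trunc κ s x)) := by
  refine h.tendsto_of_forall fun q => ?_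
  rw [h.trunc_right hs]
  exact h.tendsto_proj_right hV q x

end Approximation

/-- The truncated logarithmic kernel. -/
def truncKernel (κ : X → X → ℝ) (s : ℝ) (x y : X) : ℝ := -Real.log (max (κ x y) s)

variable [SecondCountableTopology X] [MeasurableSpace X] [BorelSpace X] {s : ℝ}

omit [SecondCountableTopology X] [MeasurableSpace X] [BorelSpace X] in
theorem tendsto_treeKernel (h0 : 0 < s) {V : ℕ → Finset X} (hV : IsExhausting κ G s V) (x y : X) :
    Tendsto (fun n => treeKernel κ G (V n) x y) atTop (𝓝 (truncKernel κ s x y)) := by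
  simp_rw [fun n => h.treeKernel_eq (hV.isMeetClosed n) x y]
  exact ((h.tendsto_proj_proj hV x y).log (h0.trans_le (le_max_right _ _)).ne').neg

/-- A limit of kernels of finite trees, which are uniformly bounded by −log s. -/
theorem isPSDKernel_truncKernel (h0 : 0 < s) (h1 : s ≤ 1) : IsPSDKernel (truncKernel κ s) := by
  obtain ⟨V, hV⟩ := h.exists_isExhausting h0 h1
  exact IsPSDKernel.of_tendsto (fun n => h.isPSDKernel_treeKernel (hV.isMeetClosed n))
    (fun n => h.treeKernel_le (hV.isMeetClosed n) h0 (hV.le_self n)) (h.tendsto_treeKernel h0 hV)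

omit [SecondCountableTopology X] [BorelSpace X] in
-- Truncating the kernel amounts to moving one argument up to level s. Bounds for the potential are
-- inherited without loss; this plays the role of the Poisson averages on the sphere.
theorem pot_truncKernel (h1 : s ≤ 1) (μ : ComplexMeasure X) (y : X) :
    pot (truncKernel κ s) μ y = pot (logKernel κ) μ (trunc κ s y) := by
  rw [pot, pot]
  congr with x
  rw [truncKernel, logKernel, h.trunc_right h1, one_div, Real.log_inv]

omit h in
theorem exp_neg_le_one (n : ℕ) : Real.exp (-n) ≤ 1 :=
  Real.exp_le_one_iff.2 (neg_nonpos.2 n.cast_nonneg)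

omit h in
theorem tendsto_exp_neg : Tendsto (fun n : ℕ => Real.exp (-n)) atTop (𝓝 0) :=
  Real.tendsto_exp_neg_atTop_nhds_zero.comp tendsto_natCast_atTop_atTop

/-- Truncation only decreases the nonnegative kernel −log κ, so it is dominated with constant 0. -/
theorem isRegularization [CompactSpace X] :
    IsRegularization κ fun n : ℕ => truncKernel κ (Real.exp (-n)) where
  symm := h.symm
  psd n := h.isPSDKernel_truncKernel (Real.exp_pos _) (exp_neg_le_one n)
  le := by
    refine ⟨0, fun n x y hxy => ?_⟩
    have hpos : 0 < κ x y := lt_of_le_of_ne (h.nonneg x y) hxy.symm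
    have h1 : max (κ x y) (Real.exp (-n)) ≤ 1 := max_le (h.le_one x y) (exp_neg_le_one n)
    have h2 := Real.log_nonpos (h.nonneg x y) (h.le_one x y)
    have h3 := Real.log_nonpos (hpos.le.trans (le_max_left _ (Real.exp (-n)))) h1
    rw [truncKernel, logKernel, one_div, Real.log_inv, abs_neg, abs_neg, abs_of_nonpos h2,
      abs_of_nonpos h3, add_zero]
    exact neg_le_neg (Real.log_le_log hpos (le_max_left _ _))
  lim x y hxy := by
    have h1 : Tendsto (fun n : ℕ => max (κ x y) (Real.exp (-n))) atTop (𝓝 (max (κ x y) 0)) :=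
      tendsto_const_nhds.max tendsto_exp_neg
    rw [max_eq_left (h.nonneg x y)] at h1
    rw [logKernel, one_div, Real.log_inv]
    exact (h1.log hxy).neg
  bdd μ hμ := by
    obtain ⟨D, hD⟩ := (hμ.isGood h.symm).bdd
    refine ⟨D, fun n y => ?_⟩
    rw [h.pot_truncKernel (exp_neg_le_one n)]
    exact hD _

end IsTreeKernel
end

noncomputable section

namespace IsTreeKernel

open EnergyForm

variable {X : Type*} [TopologicalSpace X] {κ : X → X → ℝ} {G : X} (h : IsTreeKernel κ G)

include h

/-! ### Logarithmic kernels of points of positive diameter -/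

theorem continuous_logKernel {p : X} (hp : 0 < κ p p) : Continuous fun y => logKernel κ y p := by
  simp_rw [logKernel, h.symm _ p, one_div, Real.log_inv]
  exact ((h.continuous p).log fun y => (hp.trans_le (h.self_le p y)).ne').neg

/-- The function `- log κ(p, ·)`. -/
def potMap {p : X} (hp : 0 < κ p p) : C(X, ℝ) := ⟨_, h.continuous_logKernel hp⟩

/-- Since −log reverses the order, truncations of p realize the functions min(−log κ(p, ·), τ). -/
theorem logKernel_trunc {s : ℝ} (hs : s ≤ 1) (h0 : 0 < s) {p : X} (hp : 0 < κ p p) (y : X) :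
    logKernel κ y (trunc κ s p) = min (logKernel κ y p) (-Real.log s) := by
  have h1 : 0 < κ y p := hp.trans_le (h.self_le' y p)
  rw [logKernel, logKernel, h.trunc_right hs, one_div, Real.log_inv, one_div, Real.log_inv]
  rcases le_total (κ y p) s with h2 | h2
  · rw [max_eq_right h2, min_eq_right (neg_le_neg (Real.log_le_log h1 h2))]
  · rw [max_eq_left h2, min_eq_left (neg_le_neg (Real.log_le_log h0 h2))]

theorem logKernel_nonneg {p : X} (y : X) : 0 ≤ logKernel κ y p := by
  rw [logKernel, one_div, Real.log_inv]
  exact neg_nonneg.2 (Real.log_nonpos (h.nonneg _ _) (h.le_one _ _))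

omit h in
/-- The square as an approximate sum of truncations. -/
theorem abs_sq_sub_sum_le {c L : ℝ} (h0 : 0 ≤ c) (hL : c ≤ L) {N : ℕ} (hN : 0 < N) :
    |c ^ 2 - 2 * (L / N) * ∑ j ∈ Finset.range N, (c - min c (j * (L / N)))| ≤ 2 * (L / N) * L := by
  set δ := L / N with hδ
  have hδ0 : 0 ≤ δ := div_nonneg (h0.trans hL) N.cast_nonneg
  -- A Riemann sum for c² = 2 ∫₀ᴸ (c − min(c, τ)) dτ. The `a j` descend from c to 0 in steps of at
  -- most δ, and 2 δ `a j` exceeds the difference of consecutive squares by at most 2 δ times the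
  -- step.
  set a : ℕ → ℝ := fun j => c - min c (j * δ) with ha
  have ha0 : a 0 = c := by simp [ha, h0]
  have haN : a N = 0 := by
    have : (N : ℝ) * δ = L := by rw [hδ]; field_simp
    simp [ha, this, hL]
  have hnn : ∀ j, 0 ≤ a j := fun j => sub_nonneg.2 (min_le_left _ _)
  have hstep : ∀ j, a (j + 1) ≤ a j ∧ a j - a (j + 1) ≤ δ ∧
      (a (j + 1) = 0 ∨ a j - a (j + 1) = δ) := by
    intro j
    simp only [ha]
    push_cast
    rcases le_total c (j * δ) with h1 | h1 <;> rcases le_total c ((j + 1) * δ) with h2 | h2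
    · simp [h1, h2, hδ0]
    · rw [min_eq_left h1, min_eq_right h2]
      exact ⟨by linarith, by linarith, Or.inl (by linarith)⟩
    · rw [min_eq_right h1, min_eq_left h2]
      exact ⟨by linarith, by linarith, Or.inl (by ring)⟩
    · rw [min_eq_right h1, min_eq_right h2]
      exact ⟨by linarith, by linarith, Or.inr (by ring)⟩
  have hterm : ∀ j, a j ^ 2 - a (j + 1) ^ 2 ≤ 2 * δ * a j ∧
      2 * δ * a j - (a j ^ 2 - a (j + 1) ^ 2) ≤ 2 * δ * (a j - a (j + 1)) := by
    intro j
    obtain ⟨h1, h2, h3⟩ := hstep j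
    have := hnn j
    have := hnn (j + 1)
    constructor
    · nlinarith
    · rcases h3 with h3 | h3
      · rw [h3]; nlinarith
      · nlinarith
  have e1 : ∑ j ∈ Finset.range N, (a j ^ 2 - a (j + 1) ^ 2) = c ^ 2 := by
    rw [Finset.sum_range_sub', ha0, haN]; ring
  have e2 : ∑ j ∈ Finset.range N, (2 * δ * (a j - a (j + 1))) = 2 * δ * c := by
    rw [← Finset.mul_sum, Finset.sum_range_sub', ha0, haN]; ring
  have s1 := Finset.sum_le_sum fun j (_ : j ∈ Finset.range N) => (hterm j).1
  have s2 := Finset.sum_le_sum fun j (_ : j ∈ Finset.range N) => (hterm j).2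
  rw [e1, ← Finset.mul_sum] at s1
  rw [e2, Finset.sum_sub_distrib, e1, ← Finset.mul_sum] at s2
  rw [abs_le]
  have := mul_le_mul_of_nonneg_left hL (mul_nonneg zero_le_two hδ0)
  constructor <;> linarith

section Density

variable [CompactSpace X]

/-- The closure of the space spanned by the constants and the functions `- log κ(p, ·)`. -/
def potSpan : Submodule ℝ C(X, ℝ) :=
  (Submodule.span ℝ (insert 1 (range fun p : {p : X // 0 < κ p p} =>
    h.potMap p.2))).topologicalClosure

theorem potMap_mem {p : X} (hp : 0 < κ p p) : h.potMap hp ∈ h.potSpan :=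
  Submodule.le_topologicalClosure _ (Submodule.subset_span (mem_insert_of_mem _ ⟨⟨p, hp⟩, rfl⟩))

theorem one_mem_potSpan : (1 : C(X, ℝ)) ∈ h.potSpan :=
  Submodule.le_topologicalClosure _ (Submodule.subset_span (mem_insert _ _))

/-- For u = −log κ(p, ·), with values in [0, L], one has u² = 2 ∫₀ᴸ (u − min(u, τ)) dτ, and min(u,
τ) belongs to the truncation of p at level exp(−τ). The Riemann sums lie in the span and converge
uniformly. -/
theorem sq_mem_potSpan {p : X} (hp : 0 < κ p p) : h.potMap hp * h.potMap hp ∈ h.potSpan := by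
  have hcl : IsClosed (h.potSpan : Set C(X, ℝ)) := Submodule.isClosed_topologicalClosure _
  set L := logKernel κ p p with hL
  have hL0 : 0 ≤ L := h.logKernel_nonneg p
  have hle : ∀ y, logKernel κ y p ≤ L := by
    intro y
    rw [hL, logKernel, logKernel, one_div, Real.log_inv, one_div, Real.log_inv]
    exact neg_le_neg (Real.log_le_log hp (h.self_le' y p))
  have htr : ∀ t : ℝ, 0 ≤ t → 0 < κ (trunc κ (Real.exp (-t)) p) (trunc κ (Real.exp (-t)) p) := by
    intro t ht
    rw [h.trunc_self (Real.exp_le_one_iff.2 (neg_nonpos.2 ht))]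
    exact hp.trans_le (le_max_left _ _)
  have hj : ∀ N j : ℕ, (0 : ℝ) ≤ j * (L / N) := fun N j => by positivity
  set g : ℕ → C(X, ℝ) := fun N => (2 * (L / N)) • ∑ j ∈ Finset.range N,
    (h.potMap hp - h.potMap (htr _ (hj N j))) with hg
  have hgm : ∀ N, g N ∈ h.potSpan := fun N => Submodule.smul_mem _ _ (Submodule.sum_mem _
    fun j _ => Submodule.sub_mem _ (h.potMap_mem hp) (h.potMap_mem _))
  refine hcl.mem_of_tendsto (f := g) (b := atTop) ?_ (Eventually.of_forall hgm)
  rw [tendsto_iff_dist_tendsto_zero]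
  have hlim : Tendsto (fun N : ℕ => 2 * (L / N) * L) atTop (𝓝 0) := by
    have := ((tendsto_const_div_atTop_nhds_zero_nat L).const_mul 2).mul_const L
    simpa using this
  refine squeeze_zero' (Eventually.of_forall fun N => dist_nonneg) ?_ hlim
  filter_upwards [eventually_gt_atTop 0] with N hN
  rw [ContinuousMap.dist_le (by positivity)]
  intro y
  rw [dist_comm, Real.dist_eq]
  have e : g N y = 2 * (L / N) * ∑ j ∈ Finset.range N,
      (logKernel κ y p - min (logKernel κ y p) (j * (L / N))) := by
    simp only [hg, ContinuousMap.smul_apply, ContinuousMap.sum_apply, smul_eq_mul]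
    congr 1
    refine Finset.sum_congr rfl fun j _ => ?_
    change logKernel κ y p - logKernel κ y (trunc κ _ p) = _
    rw [h.logKernel_trunc (Real.exp_le_one_iff.2 (neg_nonpos.2 (hj N j))) (Real.exp_pos _) hp,
      Real.log_exp, neg_neg]
  rw [e]
  have : (h.potMap hp * h.potMap hp) y = logKernel κ y p ^ 2 := by
    rw [sq]; rfl
  rw [this]
  exact abs_sq_sub_sum_le (h.logKernel_nonneg y) (hle y) hN

/-- Let m be the meet of p and q and c = −log κ(m, m). At each point at most one of u_p, u_q differs
from u_m, and where one does, u_m = c. Hence u_p u_q = c (u_p − u_m) + c (u_q − u_m) + u_m², which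
reduces products to squares. -/
theorem mul_mem_potSpan {p q : X} (hp : 0 < κ p p) (hq : 0 < κ q q) :
    h.potMap hp * h.potMap hq ∈ h.potSpan := by
  obtain ⟨m, hmp, hmq, hm⟩ := h.exists_meet p q
  have hm0 : 0 < κ m m := by rw [hm]; exact hp.trans_le (h.self_le p q)
  set c := logKernel κ m m with hc
  have e : h.potMap hp * h.potMap hq = c • (h.potMap hp - h.potMap hm0) +
      c • (h.potMap hq - h.potMap hm0) + h.potMap hm0 * h.potMap hm0 := by
    ext y
    change logKernel κ y p * logKernel κ y q = c * (logKernel κ y p - logKernel κ y m) +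
      c * (logKernel κ y q - logKernel κ y m) + logKernel κ y m * logKernel κ y m
    have h1 : κ y m = max (κ y p) (κ m m) := by rw [h.symm y m, hmp.eq_max h, h.symm p y]
    have h2 : κ y m = max (κ y q) (κ m m) := by rw [h.symm y m, hmq.eq_max h, h.symm q y]
    rw [hc]
    simp only [logKernel]
    rcases le_total (κ y p) (κ m m) with h3 | h3
    · rw [max_eq_right h3] at h1
      rw [h1]
      rcases le_total (κ y q) (κ m m) with h4 | h4
      · have h5 := h.ultra p y q
        rw [h.symm p y, ← hm] at h5
        rcases le_max_iff.1 h5 with h6 | h6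
        · rw [le_antisymm h3 h6]; ring
        · rw [le_antisymm h4 h6]; ring
      · rw [max_eq_left h4] at h2
        rw [← h2, h1]; ring
    · rw [max_eq_left h3] at h1
      rcases le_total (κ y q) (κ m m) with h4 | h4
      · rw [max_eq_right h4] at h2
        rw [← h1, h2]; ring
      · rw [max_eq_left h4] at h2
        rw [← h1, ← h2]; ring
  rw [e]
  exact add_mem (add_mem (Submodule.smul_mem _ _ (sub_mem (h.potMap_mem _) (h.potMap_mem _)))
    (Submodule.smul_mem _ _ (sub_mem (h.potMap_mem _) (h.potMap_mem _)))) (h.sq_mem_potSpan hm0)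

theorem potMap_mul_mem {p : X} (hp : 0 < κ p p) {f : C(X, ℝ)} (hf : f ∈ h.potSpan) :
    h.potMap hp * f ∈ h.potSpan := by
  have hcl : IsClosed (h.potSpan : Set C(X, ℝ)) := Submodule.isClosed_topologicalClosure _
  have hsub : Submodule.span ℝ (insert 1 (range fun p : {p : X // 0 < κ p p} => h.potMap p.2)) ≤
      h.potSpan.comap (LinearMap.mulLeft ℝ (h.potMap hp)) := by
    rw [Submodule.span_le]
    rintro g (rfl | ⟨⟨q, hq⟩, rfl⟩)
    · simpa using h.potMap_mem hp
    · exact h.mul_mem_potSpan hp hq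
  have hcl' : IsClosed ((h.potSpan.comap (LinearMap.mulLeft ℝ (h.potMap hp)) :
      Submodule ℝ C(X, ℝ)) : Set C(X, ℝ)) :=
    hcl.preimage (continuous_const.mul continuous_id)
  exact closure_minimal hsub hcl' hf

/-- The closed span is stable under multiplication by its generators, hence contains the algebra
they generate, and Stone–Weierstrass applies. -/
theorem potSpan_eq_top : h.potSpan = ⊤ := by
  have hcl : IsClosed (h.potSpan : Set C(X, ℝ)) := Submodule.isClosed_topologicalClosure _
  set S : Set C(X, ℝ) := range fun p : {p : X // 0 < κ p p} => h.potMap p.2 with hS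
  have hsub : Subalgebra.toSubmodule (Algebra.adjoin ℝ S) ≤ h.potSpan := by
    rw [Algebra.adjoin_eq_span, Submodule.span_le]
    intro f hf
    induction hf using Submonoid.closure_induction_left with
    | one => exact h.one_mem_potSpan
    | mul_left a ha b _ ih =>
      obtain ⟨⟨p, hp⟩, rfl⟩ := ha
      exact h.potMap_mul_mem hp ih
  have htop : (Algebra.adjoin ℝ S).topologicalClosure = ⊤ := by
    refine ContinuousMap.subalgebra_topologicalClosure_eq_top_of_separatesPoints _ ?_
    intro x y hxy
    -- The truncation of x at a level strictly between κ x x and κ x y separates x from y.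
    have key : ∀ x y : X, κ x x < κ x y → ∃ p, ∃ hp : 0 < κ p p,
        h.potMap hp x ≠ h.potMap hp y := by
      intro x y hlt
      obtain ⟨s, hs1, hs2⟩ := exists_between hlt
      have hs0 : 0 < s := (h.nonneg x x).trans_lt hs1
      have hs : s ≤ 1 := hs2.le.trans (h.le_one x y)
      have hp : 0 < κ (trunc κ s x) (trunc κ s x) := by
        rw [h.trunc_self hs]
        exact hs0.trans_le (le_max_right _ _)
      refine ⟨trunc κ s x, hp, fun he => ?_⟩
      change logKernel κ x (trunc κ s x) = logKernel κ y (trunc κ s x) at he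
      rw [logKernel, logKernel, h.trunc_right hs, h.trunc_right hs, max_eq_right hs1.le, h.symm y x,
        max_eq_left hs2.le, one_div, one_div, Real.log_inv, Real.log_inv, neg_inj] at he
      exact hs2.ne (Real.log_injOn_pos hs0 (hs0.trans hs2) he)
    rcases (h.self_le x y).lt_or_eq with h1 | h1
    · obtain ⟨p, hp, hne⟩ := key x y h1
      exact ⟨_, ⟨h.potMap hp, Algebra.subset_adjoin ⟨⟨p, hp⟩, rfl⟩, rfl⟩, hne⟩
    · rcases (h.self_le y x).lt_or_eq with h2 | h2
      · obtain ⟨p, hp, hne⟩ := key y x h2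
        exact ⟨_, ⟨h.potMap hp, Algebra.subset_adjoin ⟨⟨p, hp⟩, rfl⟩, rfl⟩, hne.symm⟩
      · exact absurd (h.sep x y h1 (h2.trans (h.symm y x))) hxy
  refine top_le_iff.1 fun f _ => ?_
  have hf : f ∈ (Algebra.adjoin ℝ S).topologicalClosure := by rw [htop]; trivial
  exact closure_minimal hsub hcl hf

end Density

section Convergence

variable [CompactSpace X] [T2Space X] [SecondCountableTopology X] [MeasurableSpace X]
  [BorelSpace X] {μ : ComplexMeasure X}

omit [CompactSpace X] [SecondCountableTopology X] in
theorem isAdmissible_dirac {p : X} (hp : 0 < κ p p) :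
    IsAdmissible κ (VectorMeasure.dirac p (1 : ℂ)) where
  fin := inferInstance
  ae_ne_zero x := by
    rw [VectorMeasure.variation_dirac, enorm_one, one_smul, ae_dirac_eq]
    exact (hp.trans_le (h.self_le' x p)).ne'
  integrable x := by
    rw [VectorMeasure.variation_dirac, enorm_one, one_smul]
    exact integrable_dirac (by simp)
  continuous := by
    simp_rw [VectorMeasure.integral_dirac]
    have := Complex.continuous_ofReal.comp (h.continuous_logKernel hp)
    refine this.congr fun x => ?_
    simp [logKernel]

/-- Cauchy–Schwarz with the point mass at p, whose energy −log κ(p, p) is finite because p has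
positive diameter. -/
theorem norm_pot_sq_le (hμ : IsAdmissible κ μ) {p : X} (hp : 0 < κ p p) :
    ‖pot (logKernel κ) μ p‖ ^ 2 ≤ logKernel κ p p * (form (logKernel κ) μ μ).re := by
  have h1 := h.isRegularization.norm_form_sq_le hμ (h.isAdmissible_dirac hp)
  rw [form_dirac_one, form_dirac_one] at h1
  have h2 : (pot (logKernel κ) (VectorMeasure.dirac p 1) p).re = logKernel κ p p := by
    rw [pot, VectorMeasure.integral_dirac]
    simp
  rwa [h2, mul_comm] at h1

/-- The potentials at points of positive diameter tend to zero, and the functions −log κ(p, ·) are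
dense together with the constants. The mass needs its own hypothesis: the point mass at the root has
energy zero. -/
theorem nullFunctions_eq_top {μs : ℕ → ComplexMeasure X}
    (hμ : ∀ n, IsAdmissible κ (μs n)) {V : ℝ} (hV : ∀ n, (μs n).variation.real univ ≤ V)
    (hE : Tendsto (fun n => (form (logKernel κ) (μs n) (μs n)).re) atTop (𝓝 0))
    (hm : Tendsto (fun n => μs n univ) atTop (𝓝 0)) :
    nullFunctions μs (fun n => (hμ n).fin) = ⊤ := by
  have hcl := isClosed_nullFunctions μs (fun n => (hμ n).fin) hV
  have hsub : Submodule.span ℝ (insert 1 (range fun p : {p : X // 0 < κ p p} => h.potMap p.2)) ≤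
      nullFunctions μs (fun n => (hμ n).fin) := by
    rw [Submodule.span_le]
    rintro g (rfl | ⟨⟨p, hp⟩, rfl⟩)
    · change Tendsto (fun n => ∫ᵛ x, (1 : C(X, ℝ)) x ∂•(μs n)) atTop (𝓝 0)
      refine hm.congr fun n => ?_
      have := (hμ n).fin
      simp [VectorMeasure.integral_const]
    · change Tendsto (fun n => pot (logKernel κ) (μs n) p) atTop (𝓝 0)
      have h2 : Tendsto (fun n => ‖pot (logKernel κ) (μs n) p‖ ^ 2) atTop (𝓝 0) := by
        refine squeeze_zero (fun n => by positivity) (fun n => h.norm_pot_sq_le (hμ n) hp) ?_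
        simpa using hE.const_mul (logKernel κ p p)
      rw [tendsto_zero_iff_norm_tendsto_zero]
      simpa using h2.sqrt
  refine top_le_iff.1 fun f _ => ?_
  have hf : f ∈ h.potSpan := by rw [h.potSpan_eq_top]; trivial
  exact closure_minimal hsub hcl hf

theorem eq_zero_of_form_eq_zero [HasOuterApproxClosed X] (hμ : IsAdmissible κ μ)
    (hE : (form (logKernel κ) μ μ).re = 0) (hm : μ univ = 0) : μ = 0 := by
  have := hμ.fin
  refine eq_zero_of_forall_integral_eq_zero fun f hf => ?_
  have h1 := h.nullFunctions_eq_top (μs := fun _ => μ) (fun _ => hμ) (fun _ => le_rfl)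
    (by rw [hE]; exact tendsto_const_nhds) (by rw [hm]; exact tendsto_const_nhds)
  have h2 : (⟨f, hf⟩ : C(X, ℝ)) ∈ nullFunctions (fun _ : ℕ => μ) (fun _ => hμ.fin) :=
    h1 ▸ Submodule.mem_top
  exact tendsto_nhds_unique tendsto_const_nhds h2

end Convergence

end IsTreeKernel
end

/-! ### Dirichlet energy and Cauchy–Schwarz over the edges of finite trees -/

noncomputable section

namespace IsTreeKernel

open EnergyForm

variable {X : Type*} [TopologicalSpace X] {κ : X → X → ℝ} {G : X} (h : IsTreeKernel κ G)

open Classical in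
/-- The Dirichlet energy of a function on the finite tree with vertex set `V`. -/
def dirichlet (κ : X → X → ℝ) (G : X) (V : Finset X) (f : X → ℝ) : ℝ :=
  ∑ p ∈ V.erase G, (f p - f (parent κ V p)) ^ 2 / edgeLength κ V p

include h

variable [CompactSpace X] [T2Space X] [SecondCountableTopology X] [MeasurableSpace X]
  [BorelSpace X] {μ : ComplexMeasure X}

omit [CompactSpace X] [T2Space X] [SecondCountableTopology X] in
theorem measurable_comp_proj {V : Finset X} (hV : IsMeetClosed κ G V) (f : X → ℝ) :
    Measurable fun x => f (proj κ V x) := by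
  classical
  have : (fun x => f (proj κ V x)) = fun x =>
      ∑ p ∈ V.erase G, (f p - f (parent κ V p)) * beyond κ p x + f G := by
    ext x
    rw [h.sum_mul_beyond hV]
    ring
  rw [this]
  exact (Finset.measurable_fun_sum _ fun p _ => (h.measurable_beyond p).const_mul _).add_const _

omit [CompactSpace X] [T2Space X] [SecondCountableTopology X] in
-- The integral is the sum over edges of the increment of f times the mass of the branch below, and
-- the energy is the sum of the edge lengths times the squared masses; Cauchy–Schwarz separates the
-- two.
theorem norm_integral_proj_sq_le {V : Finset X} (hV : IsMeetClosed κ G V) (f : X → ℝ)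
    [IsFiniteMeasure μ.variation] :
    ‖∫ᵛ x, (f (proj κ V x) - f G) ∂•μ‖ ^ 2 ≤
      dirichlet κ G V f * (form (treeKernel κ G V) μ μ).re := by
  classical
  have hφi : ∀ p, Integrable (beyond κ p) μ.variation := fun p =>
    Integrable.of_bound (h.measurable_beyond p).aestronglyMeasurable 1
      (Eventually.of_forall (abs_beyond_le p))
  have e1 : form (treeKernel κ G V) μ μ = ((∑ p ∈ V.erase G, edgeLength κ V p *
      ‖∫ᵛ x, beyond κ p x ∂•μ‖ ^ 2 : ℝ) : ℂ) := by
    have := form_sum_mul (μ := μ) (V.erase G) (edgeLength κ V) (φ := fun p => beyond κ p)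
      h.measurable_beyond (B := 1) abs_beyond_le
    rw [← this]
    congr with x y
  have e2 : ∫ᵛ x, (f (proj κ V x) - f G) ∂•μ =
      ∑ p ∈ V.erase G, (f p - f (parent κ V p)) • ∫ᵛ x, beyond κ p x ∂•μ := by
    simp_rw [← h.sum_mul_beyond hV f]
    rw [VectorMeasure.integral_finsetSum]
    · refine Finset.sum_congr rfl fun p _ => ?_
      exact VectorMeasure.integral_fun_smul μ _ (f p - f (parent κ V p)) (beyond κ p)
    · exact fun p _ => (hφi p).const_mul _
  rw [e1, Complex.ofReal_re, e2, dirichlet]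
  refine (pow_le_pow_left₀ (norm_nonneg _) (norm_sum_le _ _) 2).trans ?_
  refine Finset.sum_sq_le_sum_mul_sum_of_sq_le_mul _ (fun p hp => ?_) (fun p hp => ?_)
    fun p hp => ?_
  · have := h.edgeLength_pos hV hp
    positivity
  · have := h.edgeLength_pos hV hp
    positivity
  · have := (h.edgeLength_pos hV hp).ne'
    rw [norm_smul, mul_pow, Real.norm_eq_abs, sq_abs]
    refine le_of_eq ?_
    field_simp

omit [T2Space X] in
/-- A continuous function of bounded Dirichlet energy is controlled by the energy. -/
theorem norm_integral_sq_le {f : X → ℝ} (hf : Continuous f) {D : ℝ}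
    (hD : ∀ V : Finset X, IsMeetClosed κ G V → dirichlet κ G V f ≤ D) (hμ : IsAdmissible κ μ) :
    ‖∫ᵛ x, f x ∂•μ - f G * μ univ‖ ^ 2 ≤ D * (form (logKernel κ) μ μ).re := by
  have := hμ.fin
  obtain ⟨M, hM⟩ := (isCompact_range hf).isBounded.exists_norm_le
  replace hM : ∀ x, |f x| ≤ M := fun x => hM _ ⟨x, rfl⟩
  have hM2 : ∀ x, |f x - f G| ≤ M + M := fun x =>
    (abs_sub _ _).trans (add_le_add (hM x) (hM G))
  have hmeas : ∀ s : ℝ, 0 < s → s ≤ 1 → Measurable fun x => f (trunc κ s x) - f G := by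
    intro s h0 h1
    obtain ⟨V, hV⟩ := h.exists_isExhausting h0 h1
    refine Measurable.sub_const (measurable_of_tendsto_metrizable
      (fun n => h.measurable_comp_proj (hV.isMeetClosed n) f) (tendsto_pi_nhds.2 fun x => ?_)) _
    exact (hf.tendsto _).comp (h.tendsto_proj hV h1 x)
  have step : ∀ s : ℝ, 0 < s → s ≤ 1 → ‖∫ᵛ x, (f (trunc κ s x) - f G) ∂•μ‖ ^ 2 ≤
      D * (form (truncKernel κ s) μ μ).re := by
    intro s h0 h1
    obtain ⟨V, hV⟩ := h.exists_isExhausting h0 h1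
    have hP := h.isPSDKernel_truncKernel h0 h1
    have hPn := fun n => h.isPSDKernel_treeKernel (hV.isMeetClosed n)
    have hlog : 0 ≤ -Real.log s := neg_nonneg.2 (Real.log_nonpos h0.le h1)
    have hle := fun n => h.treeKernel_le (hV.isMeetClosed n) h0 (hV.le_self n)
    have hE : Tendsto (fun n => (form (treeKernel κ G (V n)) μ μ).re) atTop
        (𝓝 (form (truncKernel κ s) μ μ).re) := by
      refine (Complex.continuous_re.tendsto _).comp (EnergyForm.tendsto_form (C := -Real.log s)
        (hP.isGood hμ.fin) hμ.fin (fun n => (hPn n).isGood hμ.fin)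
        (fun n y => Eventually.of_forall fun x => ?_)
        (fun y => Eventually.of_forall fun x => h.tendsto_treeKernel h0 hV x y)
        (D := -Real.log s * μ.variation.real univ) fun n y => ?_)
      · exact (hle n x y).trans (le_add_of_nonneg_left (abs_nonneg _))
      · exact norm_integral_smul_le hlog fun x => hle n x y
    refine le_of_tendsto_of_tendsto' ((VectorMeasure.tendsto_integral_of_dominated_convergence
      (fun _ => M + M) (fun n => ?_) (integrable_const _) (fun n => Eventually.of_forall fun x => ?_)
      (Eventually.of_forall fun x => ?_)).norm.pow 2) (hE.const_mul D)
      (fun n => ?_) (f := fun n => ‖∫ᵛ x, (f (proj κ (V n) x) - f G) ∂•μ‖ ^ 2)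
    · exact ((h.measurable_comp_proj (hV.isMeetClosed n) f).sub_const _).aestronglyMeasurable
    · exact hM2 _
    · exact ((hf.tendsto _).comp (h.tendsto_proj hV h1 x)).sub_const _
    · exact (h.norm_integral_proj_sq_le (hV.isMeetClosed n) f).trans
        (mul_le_mul_of_nonneg_right (hD _ (hV.isMeetClosed n)) ((hPn n).form_nonneg hμ.fin))
  have e : ∫ᵛ x, f x ∂•μ - f G * μ univ = ∫ᵛ x, (f x - f G) ∂•μ := by
    rw [VectorMeasure.integral_fun_sub (integrable_of_continuous hf _) (integrable_const _),
      VectorMeasure.integral_const]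
    simp
  rw [e]
  refine le_of_tendsto_of_tendsto' ((VectorMeasure.tendsto_integral_of_dominated_convergence
      (fun _ => M + M) (fun n => ?_) (integrable_const _) (fun n => Eventually.of_forall fun x => ?_)
      (Eventually.of_forall fun x => ?_)).norm.pow 2)
      ((h.isRegularization.tendsto_form_re hμ).const_mul D)
      (fun n : ℕ => step (Real.exp (-n)) (Real.exp_pos _) (exp_neg_le_one n))
  · exact (hmeas _ (Real.exp_pos _) (exp_neg_le_one n)).aestronglyMeasurable
  · exact hM2 _
  · have h1 := h.tendsto_trunc zero_le_one exp_neg_le_one tendsto_exp_neg x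
    rw [h.trunc_eq_self zero_le_one (h.nonneg x x)] at h1
    exact ((hf.tendsto _).comp h1).sub_const _

end IsTreeKernel
end

noncomputable section

namespace Berkovich

/-! ### The spherical kernel -/

/-- Otherwise (a / b)ⁿ would grow geometrically, against the linear factor n + 1. -/
theorem le_of_forall_pow_le {a b : ℝ} (hb : 0 < b) (h : ∀ n : ℕ, a ^ n ≤ (n + 1) * b ^ n) :
    a ≤ b := by
  by_contra! hlt
  have hr : 1 < a / b := (one_lt_div hb).2 hlt
  have h1 := tendsto_pow_const_div_const_pow_of_one_lt 1 hr
  obtain ⟨n, hn, hn1⟩ := ((h1.eventually_lt_const (show (0 : ℝ) < 1 / 2 by norm_num)).and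
    (eventually_ge_atTop 1)).exists
  have hp : 0 < (a / b) ^ n := by positivity
  rw [pow_one, div_lt_iff₀ hp] at hn
  have h2 := h n
  rw [← div_le_iff₀ (by positivity), ← div_pow] at h2
  have : (1 : ℝ) ≤ n := by exact_mod_cast hn1
  linarith

variable {C : Type*} [NormedField C]

namespace AffineLine

/-- The value of `|T - a|` at a point of the affine line. -/
def val (x : AffineLine C) (a : C) : ℝ := x.1 (Polynomial.X - Polynomial.C a)

theorem val_nonneg (x : AffineLine C) (a : C) : 0 ≤ x.val a := apply_nonneg _ _

theorem val_zero (x : AffineLine C) : x.val 0 = x.1 Polynomial.X := by simp [val]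

theorem continuous_val (a : C) : Continuous fun x : AffineLine C => x.val a :=
  AffineLine.continuous_apply _

section Ultrametric

variable [IsUltrametricDist C]

/-- Integers have norm at most 1, so the binomial theorem bounds |f + g|ⁿ by (n + 1) max(|f|, |g|)ⁿ,
and n-th roots remove the factor. The strong triangle inequality is therefore not part of the
definition of a point. -/
theorem add_le_max (x : AffineLine C) (f g : C[X]) : x.1 (f + g) ≤ max (x.1 f) (x.1 g) := by
  set M := max (x.1 f) (x.1 g) with hM
  have hM0 : 0 ≤ M := (apply_nonneg x.1 f).trans (le_max_left _ _)
  rcases hM0.eq_or_lt with h0 | hpos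
  · have := map_add_le_add x.1 f g
    have h1 : x.1 f ≤ M := le_max_left _ _
    have h2 : x.1 g ≤ M := le_max_right _ _
    linarith
  refine le_of_forall_pow_le hpos fun n => ?_
  rw [← map_pow, add_pow]
  refine (Finset.le_sum_of_subadditive x.1 (map_zero x.1).le (map_add_le_add x.1) _ _).trans ?_
  refine (Finset.sum_le_card_nsmul _ _ (M ^ n) fun k hk => ?_).trans ?_
  · rw [map_mul, map_mul, map_pow, map_pow]
    have h1 : x.1 ((n.choose k : ℕ) : C[X]) ≤ 1 := by
      rw [← Polynomial.C_eq_natCast, x.2]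
      exact IsUltrametricDist.norm_natCast_le_one C _
    have h2 : x.1 f ^ k * x.1 g ^ (n - k) ≤ M ^ n := by
      have hk' : k ≤ n := Nat.lt_succ_iff.1 (Finset.mem_range.1 hk)
      calc x.1 f ^ k * x.1 g ^ (n - k) ≤ M ^ k * M ^ (n - k) := by
            gcongr
            · exact le_max_left _ _
            · exact le_max_right _ _
        _ = M ^ n := by rw [← pow_add, Nat.add_sub_cancel' hk']
    calc _ ≤ M ^ n * 1 := by
          gcongr
      _ = _ := mul_one _
  · simp

theorem val_le_max (x : AffineLine C) (a b : C) : x.val a ≤ max (x.val b) ‖b - a‖ := by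
  have : (Polynomial.X - Polynomial.C a : C[X]) =
      (Polynomial.X - Polynomial.C b) + Polynomial.C (b - a) := by
    rw [Polynomial.C_sub]; ring
  rw [val, this]
  refine (x.add_le_max _ _).trans ?_
  rw [x.2]
  rfl

theorem norm_sub_le_max (x : AffineLine C) (a b : C) : ‖a - b‖ ≤ max (x.val a) (x.val b) := by
  have : (Polynomial.C (b - a) : C[X]) =
      (Polynomial.X - Polynomial.C a) + -(Polynomial.X - Polynomial.C b) := by
    rw [Polynomial.C_sub]; ring
  rw [norm_sub_rev, ← x.2, this]
  refine (x.add_le_max _ _).trans ?_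
  rw [map_neg_eq_map]
  rfl

end Ultrametric

end AffineLine

open AffineLine

section Hsia

theorem hsia_bddBelow (x y : AffineLine C) :
    BddBelow (range fun a : C => max (x.val a) (y.val a)) :=
  ⟨0, by rintro _ ⟨a, rfl⟩; exact (x.val_nonneg a).trans (le_max_left _ _)⟩

theorem hsia_le (x y : AffineLine C) (a : C) : hsia x y ≤ max (x.val a) (y.val a) :=
  ciInf_le (hsia_bddBelow x y) a

theorem hsia_nonneg (x y : AffineLine C) : 0 ≤ hsia x y :=
  le_ciInf fun a => (x.val_nonneg a).trans (le_max_left _ _)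

theorem exists_lt_of_hsia_lt {x y : AffineLine C} {t : ℝ} (h : hsia x y < t) :
    ∃ a, x.val a < t ∧ y.val a < t := by
  obtain ⟨a, ha⟩ := exists_lt_of_ciInf_lt h
  exact ⟨a, max_lt_iff.1 ha⟩

theorem hsia_comm (x y : AffineLine C) : hsia x y = hsia y x := by
  simp only [hsia, max_comm]

variable [IsUltrametricDist C]

theorem hsia_ultra (x y z : AffineLine C) : hsia x z ≤ max (hsia x y) (hsia y z) := by
  refine le_of_forall_gt_imp_ge_of_dense fun t ht => ?_
  obtain ⟨h1, h2⟩ := max_lt_iff.1 ht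
  obtain ⟨a, ha1, ha2⟩ := exists_lt_of_hsia_lt h1
  obtain ⟨b, hb1, hb2⟩ := exists_lt_of_hsia_lt h2
  have hab : ‖a - b‖ ≤ t := (y.norm_sub_le_max a b).trans (max_le ha2.le hb1.le)
  exact (hsia_le x z b).trans
    (max_le ((x.val_le_max b a).trans (max_le ha1.le hab)) hb2.le)

/-- If x lies within t of the centre a, then above the scale t the distance of y from x is its
distance from a. This makes the infimum over centres computable. -/
theorem max_hsia (x y : AffineLine C) {a : C} {t : ℝ} (ht : x.val a ≤ t) :
    max t (hsia x y) = max t (y.val a) := by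
  refine le_antisymm (max_le (le_max_left _ _) ((hsia_le x y a).trans (max_le_max_right _ ht)))
    (max_le (le_max_left _ _) ?_)
  refine le_of_forall_gt_imp_ge_of_dense fun u hu => ?_
  obtain ⟨h1, h2⟩ := max_lt_iff.1 hu
  obtain ⟨b, hb1, hb2⟩ := exists_lt_of_hsia_lt h2
  refine (y.val_le_max a b).trans (max_le hb2.le ?_)
  rw [norm_sub_rev]
  exact (x.norm_sub_le_max a b).trans (max_le (ht.trans h1.le) hb1.le)

omit [IsUltrametricDist C] in
theorem hsia_self_le_val (x : AffineLine C) (a : C) : hsia x x ≤ x.val a := by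
  simpa using hsia_le x x a

theorem hsia_self_le (x y : AffineLine C) : hsia x x ≤ hsia x y := by
  simpa [hsia_comm y x] using hsia_ultra x y x

/-- By `max_hsia` it is a uniform limit of functions max(t, |T − a|), with t slightly above the
diameter of x and a the centre of a nearly minimal disc. -/
theorem continuous_hsia (x : AffineLine C) : Continuous (hsia x) := by
  refine continuous_of_uniform_approx_of_continuous fun u hu => ?_
  obtain ⟨ε, hε, hεu⟩ := Metric.mem_uniformity_dist.1 hu
  obtain ⟨a, ha, -⟩ := exists_lt_of_hsia_lt (lt_add_of_pos_right (hsia x x) (half_pos hε))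
  refine ⟨fun y => max (hsia x x + ε / 2) (y.val a), continuous_const.max (continuous_val a),
    fun y => hεu ?_⟩
  change dist (hsia x y) (max (hsia x x + ε / 2) (y.val a)) < ε
  rw [← max_hsia x y ha.le, Real.dist_eq, abs_sub_comm]
  have h1 := hsia_self_le x y
  rw [abs_of_nonneg (sub_nonneg.2 (le_max_right _ _))]
  rcases le_total (hsia x x + ε / 2) (hsia x y) with h2 | h2
  · rw [max_eq_right h2]; linarith
  · rw [max_eq_left h2]; linarith

/-- With Hsia kernels for a, b, c and sizes for u, v, w, this is the strong triangle inequality of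
the spherical kernel with denominators cleared. -/
theorem ultrametric_ptolemy {a b c u v w : ℝ} (hb : 0 ≤ b) (hc : 0 ≤ c) (hu : 0 ≤ u) (hv : 0 ≤ v)
    (hw : 0 ≤ w) (h1 : a ≤ max b c) (h2 : v ≤ max u b) (h3 : v ≤ max w c) (h4 : a ≤ max u w) :
    a * v ≤ max (b * w) (c * u) := by
  rcases le_total c b with hcb | hcb
  · rw [max_eq_left hcb] at h1
    rcases le_max_iff.1 h3 with h5 | h5
    · exact le_max_of_le_left (mul_le_mul h1 h5 hv hb)
    · rcases le_max_iff.1 h4 with h6 | h6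
      · exact le_max_of_le_right (by rw [mul_comm c u]; exact mul_le_mul h6 h5 hv hu)
      · refine le_max_of_le_left ?_
        rw [mul_comm b w]
        exact mul_le_mul h6 (h5.trans hcb) hv hw
  · rw [max_eq_right hcb] at h1
    rcases le_max_iff.1 h2 with h5 | h5
    · exact le_max_of_le_right (mul_le_mul h1 h5 hv hc)
    · rcases le_max_iff.1 h4 with h6 | h6
      · refine le_max_of_le_right ?_
        rw [mul_comm c u]
        exact mul_le_mul h6 (h5.trans hcb) hv hu
      · exact le_max_of_le_left (by rw [mul_comm b w]; exact mul_le_mul h6 h5 hv hw)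

end Hsia

section Points

/-- The quantity `max(1, |T|)` at a point. -/
def size (x : AffineLine C) : ℝ := max 1 (x.val 0)

theorem one_le_size (x : AffineLine C) : 1 ≤ size x := le_max_left _ _

theorem size_pos (x : AffineLine C) : 0 < size x := zero_lt_one.trans_le (one_le_size x)

theorem continuous_size : Continuous (size : AffineLine C → ℝ) :=
  continuous_const.max (continuous_val 0)

variable [IsUltrametricDist C]

theorem size_le_max (x y : AffineLine C) : size y ≤ max (size x) (hsia x y) := by
  have h := max_hsia x y (le_max_right 1 (x.val 0))
  change max (size x) (hsia x y) = max (size x) (y.val 0) at h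
  rw [h]
  exact max_le (le_max_of_le_left (one_le_size x)) (le_max_right _ _)

omit [IsUltrametricDist C] in
theorem hsia_le_size (x y : AffineLine C) : hsia x y ≤ max (size x) (size y) :=
  (hsia_le x y 0).trans (max_le_max (le_max_right _ _) (le_max_right _ _))

theorem hsia_eq_size {x y : AffineLine C} (h : size x < size y) : hsia x y = size y := by
  refine le_antisymm ((hsia_le_size x y).trans (max_le h.le le_rfl)) ?_
  rcases le_max_iff.1 (size_le_max x y) with h1 | h1
  · exact absurd h1 h.not_ge
  · exact h1

/-- The point of the affine line that corresponds to the disc of centre `a` and radius `r`. -/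
def discPoint (a : C) (r : ℝ) (hr : 0 < r) : AffineLine C :=
  have hna : IsNonarchimedean (NormedField.toAbsoluteValue C) :=
    fun x y => IsUltrametricDist.norm_add_le_max x y
  ⟨{ toFun := fun f => (f.comp (Polynomial.X + Polynomial.C a)).gaussNorm
       (NormedField.toAbsoluteValue C) r
     map_zero' := by simp
     map_one' := by
       rw [Polynomial.one_comp, ← Polynomial.C_1, Polynomial.gaussNorm_C]; simp
     add_le' := fun f g => by
       rw [Polynomial.add_comp]
       exact (Polynomial.isNonarchimedean_gaussNorm _ hna hr.le _ _).trans
         (max_le_add_of_nonneg (Polynomial.gaussNorm_nonneg _ _ hr.le)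
           (Polynomial.gaussNorm_nonneg _ _ hr.le))
     neg' := fun f => by
       rw [Polynomial.neg_comp]
       have := Polynomial.gaussNorm_isAbsoluteValue hna hr
       exact IsAbsoluteValue.abv_neg _ _
     map_mul' := fun f g => by
       rw [Polynomial.mul_comp]
       exact Polynomial.gaussNorm_mul hna hr _ _ },
   fun c => by
     change ((Polynomial.C c).comp _).gaussNorm _ _ = _
     rw [Polynomial.C_comp]
     exact Polynomial.gaussNorm_C _ _ c⟩

theorem gaussNorm_X_add_C (b : C) {r : ℝ} (hr : 0 < r) :
    (Polynomial.X + Polynomial.C b : C[X]).gaussNorm (NormedField.toAbsoluteValue C) r =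
      max r ‖b‖ := by
  have hna : IsNonarchimedean (NormedField.toAbsoluteValue C) :=
    fun x y => IsUltrametricDist.norm_add_le_max x y
  refine le_antisymm ?_ (max_le ?_ ?_)
  · refine (Polynomial.isNonarchimedean_gaussNorm _ hna hr.le _ _).trans (max_le_max ?_ ?_)
    · rw [← Polynomial.monomial_one_one_eq_X, Polynomial.gaussNorm_monomial]
      simp
    · rw [Polynomial.gaussNorm_C]
      rfl
  · have := Polynomial.le_gaussNorm (NormedField.toAbsoluteValue C)
      (Polynomial.X + Polynomial.C b : C[X]) hr.le 1
    simpa [Polynomial.coeff_C] using this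
  · have := Polynomial.le_gaussNorm (NormedField.toAbsoluteValue C)
      (Polynomial.X + Polynomial.C b : C[X]) hr.le 0
    have e : (Polynomial.X + Polynomial.C b : C[X]).coeff 0 = b := by simp
    rw [e, pow_zero, mul_one] at this
    exact this

theorem val_discPoint (a : C) {r : ℝ} (hr : 0 < r) (b : C) :
    (discPoint a r hr).val b = max r ‖a - b‖ := by
  have : (Polynomial.X - Polynomial.C b : C[X]).comp (Polynomial.X + Polynomial.C a) =
      Polynomial.X + Polynomial.C (a - b) := by
    simp only [Polynomial.sub_comp, Polynomial.X_comp, Polynomial.C_comp, Polynomial.C_sub]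
    ring
  change ((Polynomial.X - Polynomial.C b : C[X]).comp (Polynomial.X + Polynomial.C a)).gaussNorm
    _ _ = _
  rw [this, gaussNorm_X_add_C _ hr]

theorem val_gaussPoint (b : C) : (gaussPoint : AffineLine C).val b = max 1 ‖b‖ := by
  change (Polynomial.X - Polynomial.C b : C[X]).gaussNorm _ _ = _
  rw [sub_eq_add_neg, ← Polynomial.C_neg, gaussNorm_X_add_C _ one_pos, norm_neg]

theorem hsia_discPoint_self (a : C) {r : ℝ} (hr : 0 < r) :
    hsia (discPoint a r hr) (discPoint a r hr) = r := by
  refine le_antisymm ?_ (le_ciInf fun b => ?_)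
  · refine (hsia_self_le_val _ a).trans ?_
    rw [val_discPoint, sub_self, norm_zero, max_eq_left hr.le]
  · change r ≤ max ((discPoint a r hr).val b) _
    rw [val_discPoint]
    exact le_max_of_le_left (le_max_left _ _)

theorem hsia_discPoint (a : C) {r : ℝ} (hr : 0 < r) (y : AffineLine C) :
    hsia (discPoint a r hr) y = max r (y.val a) := by
  have h1 := hsia_self_le (discPoint a r hr) y
  rw [hsia_discPoint_self] at h1
  rw [← max_hsia (discPoint a r hr) y (a := a) (t := r), max_eq_right h1]
  rw [val_discPoint, sub_self, norm_zero, max_eq_left hr.le]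

theorem size_discPoint (a : C) {r : ℝ} (hr : 0 < r) :
    size (discPoint a r hr) = max 1 (max r ‖a‖) := by
  rw [size, val_discPoint, sub_zero]

theorem size_gaussPoint : size (gaussPoint : AffineLine C) = 1 := by
  rw [size, val_gaussPoint, norm_zero]
  simp

theorem hsia_gaussPoint (y : AffineLine C) : hsia gaussPoint y = size y := by
  have h1 : (1 : ℝ) ≤ hsia gaussPoint y := by
    refine le_ciInf fun b => ?_
    change 1 ≤ max ((gaussPoint : AffineLine C).val b) _
    rw [val_gaussPoint]
    exact le_max_of_le_left (le_max_left _ _)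
  rw [size, ← max_hsia gaussPoint y (a := 0) (t := 1), max_eq_right h1]
  rw [val_gaussPoint, norm_zero, max_eq_left zero_le_one]

/-- The points of the affine line that come from the field. -/
def evalPoint (a : C) : AffineLine C :=
  ⟨{ toFun := fun f => ‖f.eval a‖
     map_zero' := by simp
     map_one' := by simp
     add_le' := fun f g => by rw [Polynomial.eval_add]; exact norm_add_le _ _
     neg' := fun f => by simp
     map_mul' := fun f g => by simp },
   fun c => by change ‖(Polynomial.C c).eval a‖ = _; simp⟩

omit [IsUltrametricDist C] in
theorem val_evalPoint (a b : C) : (evalPoint a).val b = ‖a - b‖ := by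
  change ‖(Polynomial.X - Polynomial.C b).eval a‖ = _
  simp

theorem hsia_evalPoint (a : C) (y : AffineLine C) : hsia (evalPoint a) y = y.val a := by
  have := max_hsia (evalPoint a) y (a := a) (t := 0) (by rw [val_evalPoint]; simp)
  rwa [max_eq_right (hsia_nonneg _ _), max_eq_right (y.val_nonneg a)] at this

omit [IsUltrametricDist C] in
-- Over an algebraically closed field polynomials split, so a multiplicative seminorm is determined
-- by its values on the T − a.
theorem eq_of_val_eq [IsAlgClosed C] {x y : AffineLine C} (h : ∀ a, x.val a = y.val a) : x = y := by
  refine Subtype.ext (DFunLike.coe_injective (funext fun f => ?_))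
  have hs := (IsAlgClosed.splits f).eq_prod_roots
  rw [hs, map_mul, map_mul, x.2, y.2, map_multiset_prod, map_multiset_prod, Multiset.map_map,
    Multiset.map_map]
  congr 2
  exact Multiset.map_congr rfl fun a _ => h a

end Points

end Berkovich
end

/-! ### The Berkovich projective line as a rooted tree -/

noncomputable section

namespace Berkovich

open AffineLine

variable {C : Type*} [NormedField C]

theorem sphericalKernel_coe_coe (x y : AffineLine C) :
    sphericalKernel (x : OnePoint (AffineLine C)) (y : OnePoint (AffineLine C)) =
      hsia x y / (size x * size y) := by
  change hsia x y * (1 / max 1 (x.1 Polynomial.X)) * (1 / max 1 (y.1 Polynomial.X)) = _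
  rw [← val_zero, ← val_zero]
  change hsia x y * (1 / size x) * (1 / size y) = _
  have := size_pos x
  have := size_pos y
  field_simp

theorem sphericalKernel_coe_infty (x : AffineLine C) :
    sphericalKernel (x : OnePoint (AffineLine C)) OnePoint.infty = 1 / size x := by
  rw [size, val_zero]
  rfl

theorem sphericalKernel_infty_coe (x : AffineLine C) :
    sphericalKernel OnePoint.infty (x : OnePoint (AffineLine C)) = 1 / size x := by
  rw [size, val_zero]
  rfl

theorem sphericalKernel_infty_infty :
    sphericalKernel (OnePoint.infty : OnePoint (AffineLine C)) OnePoint.infty = 0 := rfl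

theorem sphericalKernel_nonneg (x y : OnePoint (AffineLine C)) : 0 ≤ sphericalKernel x y := by
  induction x using OnePoint.rec with
  | infty =>
    induction y using OnePoint.rec with
    | infty => exact le_rfl
    | coe y =>
      have := size_pos y
      rw [sphericalKernel_infty_coe]
      positivity
  | coe x =>
    have := size_pos x
    induction y using OnePoint.rec with
    | infty =>
      rw [sphericalKernel_coe_infty]
      positivity
    | coe y =>
      have := size_pos y
      have := hsia_nonneg x y
      rw [sphericalKernel_coe_coe]
      positivity

theorem sphericalKernel_comm (x y : OnePoint (AffineLine C)) :
    sphericalKernel x y = sphericalKernel y x := by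
  induction x using OnePoint.rec <;> induction y using OnePoint.rec
  · rfl
  · rw [sphericalKernel_infty_coe, sphericalKernel_coe_infty]
  · rw [sphericalKernel_infty_coe, sphericalKernel_coe_infty]
  · rw [sphericalKernel_coe_coe, sphericalKernel_coe_coe, hsia_comm, mul_comm (size _)]

theorem tendsto_size_infty : Tendsto (size : AffineLine C → ℝ) (coclosedCompact _) atTop := by
  refine tendsto_atTop.2 fun R => ?_
  have hc := AffineLine.isCompact_le (C := C) R
  filter_upwards [hc.compl_mem_coclosedCompact_of_isClosed hc.isClosed] with y hy
  have : R < y.1 Polynomial.X := not_le.1 hy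
  rw [← val_zero] at this
  exact this.le.trans (le_max_right _ _)

variable [IsUltrametricDist C]

theorem sphericalKernel_ultra (x y z : OnePoint (AffineLine C)) :
    sphericalKernel x z ≤ max (sphericalKernel x y) (sphericalKernel y z) := by
  induction x using OnePoint.rec with
  | infty =>
    induction z using OnePoint.rec with
    | infty => exact le_max_of_le_left (sphericalKernel_nonneg _ _)
    | coe z =>
      induction y using OnePoint.rec with
      | infty => exact le_max_right _ _
      | coe y =>
        have hy := size_pos y
        have hz := size_pos z
        rw [sphericalKernel_infty_coe, sphericalKernel_infty_coe, sphericalKernel_coe_coe]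
        rcases le_max_iff.1 (size_le_max z y) with h | h
        · exact le_max_of_le_left (one_div_le_one_div_of_le hy h)
        · refine le_max_of_le_right ?_
          rw [hsia_comm] at h
          rw [div_le_div_iff₀ hz (by positivity), one_mul]
          exact mul_le_mul_of_nonneg_right h hz.le
  | coe x =>
    have hx := size_pos x
    induction z using OnePoint.rec with
    | infty =>
      induction y using OnePoint.rec with
      | infty => exact le_max_left _ _
      | coe y =>
        have hy := size_pos y
        rw [sphericalKernel_coe_infty, sphericalKernel_coe_infty, sphericalKernel_coe_coe]
        rcases le_max_iff.1 (size_le_max x y) with h | h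
        · exact le_max_of_le_right (one_div_le_one_div_of_le hy h)
        · refine le_max_of_le_left ?_
          rw [div_le_div_iff₀ hx (by positivity), one_mul, mul_comm (size x)]
          exact mul_le_mul_of_nonneg_right h hx.le
    | coe z =>
      have hz := size_pos z
      induction y using OnePoint.rec with
      | infty =>
        rw [sphericalKernel_coe_infty, sphericalKernel_infty_coe, sphericalKernel_coe_coe]
        rcases le_max_iff.1 (hsia_le_size x z) with h | h
        · refine le_max_of_le_right ?_
          rw [div_le_div_iff₀ (by positivity) hz, one_mul]
          exact mul_le_mul_of_nonneg_right h hz.le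
        · refine le_max_of_le_left ?_
          rw [div_le_div_iff₀ (by positivity) hx, one_mul, mul_comm (size x)]
          exact mul_le_mul_of_nonneg_right h hx.le
      | coe y =>
        have hy := size_pos y
        simp only [sphericalKernel_coe_coe]
        have hp := ultrametric_ptolemy (hsia_nonneg x y) (hsia_nonneg y z) hx.le hy.le hz.le
          (hsia_ultra x y z) (size_le_max x y) (hsia_comm z y ▸ size_le_max z y) (hsia_le_size x z)
        rcases le_max_iff.1 hp with h | h
        · refine le_max_of_le_left ?_
          rw [div_le_div_iff₀ (by positivity) (by positivity)]
          nlinarith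
        · refine le_max_of_le_right ?_
          rw [div_le_div_iff₀ (by positivity) (by positivity)]
          nlinarith

theorem sphericalKernel_gaussPoint (y : OnePoint (AffineLine C)) :
    sphericalKernel ((gaussPoint : AffineLine C) : OnePoint (AffineLine C)) y = 1 := by
  induction y using OnePoint.rec with
  | infty => rw [sphericalKernel_coe_infty, size_gaussPoint, div_one]
  | coe y =>
    rw [sphericalKernel_coe_coe, hsia_gaussPoint, size_gaussPoint, one_mul, div_self (size_pos y).ne']

/-- If s · size y ≤ 1, a disc of radius s (size y)² about a centre near y has the size of y and
works. Otherwise, and for y = ∞, the point lies on the path from the Gauss point to ∞: the disc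
about 0 of radius 1 / s. -/
theorem sphericalKernel_path (y : OnePoint (AffineLine C)) (s : ℝ) (h0 : sphericalKernel y y < s)
    (h1 : s ≤ 1) : ∃ p : OnePoint (AffineLine C), sphericalKernel p p = s ∧
      sphericalKernel p y = s := by
  have hs : 0 < s := (sphericalKernel_nonneg y y).trans_lt h0
  have hR : 0 < 1 / s := by positivity
  have hR1 : 1 ≤ 1 / s := (one_le_div hs).2 h1
  have hsize : size (discPoint (0 : C) (1 / s) hR) = 1 / s := by
    rw [size_discPoint, norm_zero, max_eq_left hR.le, max_eq_right hR1]
  have hself : sphericalKernel (discPoint (0 : C) (1 / s) hR : OnePoint (AffineLine C))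
      (discPoint (0 : C) (1 / s) hR) = s := by
    rw [sphericalKernel_coe_coe, hsia_discPoint_self, hsize]
    field_simp
  induction y using OnePoint.rec with
  | infty =>
    refine ⟨_, hself, ?_⟩
    rw [sphericalKernel_coe_infty, hsize, one_div_one_div]
  | coe y =>
    have hy := size_pos y
    rcases le_or_gt (s * size y) 1 with hle | hgt
    · have hr : 0 < s * size y ^ 2 := by positivity
      have hlt : hsia y y < s * size y ^ 2 := by
        rw [sphericalKernel_coe_coe, div_lt_iff₀ (by positivity)] at h0
        rwa [sq]
      obtain ⟨a, ha, -⟩ := exists_lt_of_hsia_lt hlt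
      have hry : s * size y ^ 2 ≤ size y := by nlinarith
      have hsz : size (discPoint a (s * size y ^ 2) hr) = size y := by
        rw [size_discPoint]
        refine le_antisymm (max_le (one_le_size y) (max_le hry ?_)) ?_
        · have := y.norm_sub_le_max a 0
          rw [sub_zero] at this
          exact this.trans (max_le (ha.le.trans hry) (le_max_right _ _))
        · refine max_le (le_max_left _ _) (le_max_of_le_right ?_)
          have := y.val_le_max 0 a
          rw [sub_zero] at this
          exact this.trans (max_le_max_right _ ha.le)
      refine ⟨discPoint a (s * size y ^ 2) hr, ?_, ?_⟩
      · rw [sphericalKernel_coe_coe, hsia_discPoint_self, hsz]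
        field_simp
      · rw [sphericalKernel_coe_coe, hsia_discPoint, max_eq_left ha.le, hsz]
        field_simp
    · have hlt : 1 / s < size y := by rw [div_lt_iff₀ hs, mul_comm]; exact hgt
      refine ⟨_, hself, ?_⟩
      rw [sphericalKernel_coe_coe, hsia_eq_size (by rwa [hsize]), hsize]
      field_simp

theorem continuous_sphericalKernel (x : OnePoint (AffineLine C)) :
    Continuous (sphericalKernel x) := by
  have hsz : Continuous (size : AffineLine C → ℝ) := continuous_size
  induction x using OnePoint.rec with
  | infty =>
    rw [OnePoint.continuous_iff]
    constructor
    · rw [sphericalKernel_infty_infty]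
      simp_rw [sphericalKernel_infty_coe]
      exact tendsto_size_infty.const_div_atTop 1
    · simp_rw [sphericalKernel_infty_coe]
      exact continuous_const.div hsz fun y => (size_pos y).ne'
  | coe x =>
    have hx := size_pos x
    rw [OnePoint.continuous_iff]
    constructor
    · rw [sphericalKernel_coe_infty]
      simp_rw [sphericalKernel_coe_coe]
      refine tendsto_const_nhds.congr' ?_
      filter_upwards [tendsto_size_infty.eventually_gt_atTop (size x)] with y hy
      have := size_pos y
      rw [hsia_eq_size hy]
      field_simp
    · simp_rw [sphericalKernel_coe_coe]
      exact (continuous_hsia x).div (continuous_const.mul hsz)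
        fun y => (mul_pos hx (size_pos y)).ne'

/-- For finite points, both diameters must equal hsia x y; unless that is 0, the sizes are first
shown to agree. Then `max_hsia` gives x and y the same value at every T − a. -/
theorem sphericalKernel_sep [IsAlgClosed C] (x y : OnePoint (AffineLine C))
    (h1 : sphericalKernel x x = sphericalKernel x y)
    (h2 : sphericalKernel y y = sphericalKernel x y) : x = y := by
  induction x using OnePoint.rec with
  | infty =>
    induction y using OnePoint.rec with
    | infty => rfl
    | coe y =>
      have := size_pos y
      rw [sphericalKernel_infty_infty, sphericalKernel_infty_coe] at h1
      exact absurd h1.symm (by positivity)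
  | coe x =>
    induction y using OnePoint.rec with
    | infty =>
      have := size_pos x
      rw [sphericalKernel_infty_infty, sphericalKernel_coe_infty] at h2
      exact absurd h2.symm (by positivity)
    | coe y =>
      have hx := size_pos x
      have hy := size_pos y
      rw [sphericalKernel_coe_coe, sphericalKernel_coe_coe,
        div_eq_div_iff (by positivity) (by positivity)] at h1 h2
      have e1 : hsia x x * size y = hsia x y * size x := by
        refine mul_right_cancel₀ hx.ne' ?_
        linarith
      have e2 : hsia y y * size x = hsia x y * size y := by
        refine mul_right_cancel₀ hy.ne' ?_
        linarith
      have l1 := hsia_self_le x y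
      have l2 : hsia y y ≤ hsia x y := hsia_comm x y ▸ hsia_self_le y x
      have key : hsia x x = hsia x y ∧ hsia y y = hsia x y := by
        rcases (hsia_nonneg x y).eq_or_lt with h0 | hpos
        · have := hsia_nonneg x x
          have := hsia_nonneg y y
          constructor <;> linarith
        · have hs : size x = size y := by
            refine le_antisymm ?_ ?_
            · have := mul_le_mul_of_nonneg_right l1 hy.le
              exact le_of_mul_le_mul_left (e1 ▸ this) hpos
            · have := mul_le_mul_of_nonneg_right l2 hx.le
              exact le_of_mul_le_mul_left (e2 ▸ this) hpos
          rw [hs] at e1 e2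
          exact ⟨mul_right_cancel₀ hy.ne' e1, mul_right_cancel₀ hy.ne' e2⟩
      congr 1
      refine eq_of_val_eq fun a => le_antisymm ?_ ?_
      · have h3 := max_hsia y x (le_refl (y.val a))
        have h4 : hsia y x ≤ y.val a := by
          rw [hsia_comm, ← key.2]
          exact hsia_self_le_val y a
        rw [max_eq_left h4] at h3
        exact (le_max_right _ _).trans h3.ge
      · have h3 := max_hsia x y (le_refl (x.val a))
        have h4 : hsia x y ≤ x.val a := by
          rw [← key.1]
          exact hsia_self_le_val x a
        rw [max_eq_left h4] at h3
        exact (le_max_right _ _).trans h3.ge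

theorem isTreeKernel_sphericalKernel [IsAlgClosed C] :
    IsTreeKernel (sphericalKernel (C := C)) ((gaussPoint : AffineLine C) : OnePoint _) where
  nonneg := sphericalKernel_nonneg
  symm := sphericalKernel_comm
  ultra := sphericalKernel_ultra
  root := sphericalKernel_gaussPoint
  path := sphericalKernel_path
  continuous := continuous_sphericalKernel
  sep := sphericalKernel_sep

/-! ### Second countability -/

theorem continuous_val_left (x : AffineLine C) : Continuous x.val := by
  refine Metric.continuous_iff.2 fun b ε hε => ⟨ε, hε, fun a hab => ?_⟩
  rw [dist_eq_norm] at hab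
  rw [Real.dist_eq]
  have h1 : ∀ a b : C, x.val a ≤ x.val b + ‖a - b‖ := fun a b =>
    (x.val_le_max a b).trans (max_le (le_add_of_nonneg_right (norm_nonneg _))
      (by rw [norm_sub_rev]; exact le_add_of_nonneg_left (x.val_nonneg b)))
  have h2 := h1 a b
  have h3 := h1 b a
  rw [norm_sub_rev] at h3
  rw [abs_lt]
  constructor <;> linarith

/-- The kernels against ∞ and against a dense sequence of points of C separate points, and so embed
the compact space in a countable product of lines. -/
instance [IsAlgClosed C] [TopologicalSpace.SeparableSpace C] :
    SecondCountableTopology (OnePoint (AffineLine C)) := by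
  set D := TopologicalSpace.denseSeq C with hD
  have hDd := TopologicalSpace.denseRange_denseSeq C
  let F : OnePoint (AffineLine C) → Option ℕ → ℝ := fun y i =>
    i.elim (sphericalKernel OnePoint.infty y)
      fun n => sphericalKernel (evalPoint (D n) : OnePoint (AffineLine C)) y
  have hc : Continuous F := by
    refine continuous_pi fun i => ?_
    cases i with
    | none => exact continuous_sphericalKernel _
    | some n => exact continuous_sphericalKernel _
  have hinj : Function.Injective F := by
    intro x y hxy
    have h0 : sphericalKernel OnePoint.infty x = sphericalKernel OnePoint.infty y :=
      congrFun hxy none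
    have h1 : ∀ n, sphericalKernel (evalPoint (D n) : OnePoint (AffineLine C)) x =
      sphericalKernel (evalPoint (D n) : OnePoint (AffineLine C)) y := fun n => congrFun hxy (some n)
    induction x using OnePoint.rec with
    | infty =>
      induction y using OnePoint.rec with
      | infty => rfl
      | coe y =>
        have := size_pos y
        rw [sphericalKernel_infty_infty, sphericalKernel_infty_coe] at h0
        exact absurd h0.symm (by positivity)
    | coe x =>
      have hx := size_pos x
      induction y using OnePoint.rec with
      | infty =>
        rw [sphericalKernel_infty_infty, sphericalKernel_infty_coe] at h0
        exact absurd h0 (by positivity)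
      | coe y =>
        rw [sphericalKernel_infty_coe, sphericalKernel_infty_coe] at h0
        have hs : size x = size y := by
          have := size_pos y
          rw [div_eq_div_iff (by positivity) (by positivity)] at h0
          linarith
        have h2 : ∀ n, x.val (D n) = y.val (D n) := by
          intro n
          have h3 := h1 n
          have := size_pos (evalPoint (D n))
          have := size_pos y
          rw [sphericalKernel_coe_coe, sphericalKernel_coe_coe, hsia_evalPoint, hsia_evalPoint,
            hs] at h3
          exact (div_left_inj' (by positivity)).1 h3
        congr 1
        refine eq_of_val_eq fun a => ?_
        exact congrFun (hDd.equalizer (continuous_val_left x) (continuous_val_left y)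
          (funext h2)) a
  exact (hc.isClosedEmbedding hinj).isEmbedding.secondCountableTopology

end Berkovich

/-! ### Separability of ℂ_p -/

section Padic

variable (p : ℕ) [Fact p.Prime]

/-- The algebraic numbers are dense in an algebraic closure of the `p`-adic numbers. -/
theorem dense_isAlgebraic_padicAlgCl : Dense {b : PadicAlgCl p | IsAlgebraic ℚ b} := by
  intro α
  refine Metric.mem_closure_iff.2 fun ε hε => ?_
  have hα : IsIntegral ℚ_[p] α := (Algebra.IsAlgebraic.isAlgebraic α).isIntegral
  set P := minpoly ℚ_[p] α with hP
  set n := P.natDegree with hn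
  have hn0 : n ≠ 0 := (minpoly.natDegree_pos hα).ne'
  have hPm : P.Monic := minpoly.monic hα
  have hα1 : 0 < 1 + ‖α‖ := by positivity
  -- Chosen so that n coefficient errors, each multiplied by a power of α of norm at most (1 +
  -- ‖α‖)ⁿ, add up to less than εⁿ.
  set η : ℝ := ε ^ n / (n * (1 + ‖α‖) ^ n) with hη
  have hη0 : 0 < η := by positivity
  have hq : ∀ i : ℕ, ∃ q : ℚ, ‖P.coeff i - (q : ℚ_[p])‖ < η := fun i => by
    obtain ⟨q, hq⟩ := Padic.rat_dense p (P.coeff i) hη0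
    exact ⟨q, hq⟩
  choose q hq using hq
  set R : ℚ[X] := ∑ i ∈ Finset.range n, Polynomial.C (q i) * Polynomial.X ^ i with hR
  have hRd : R.degree < n := by
    refine (Polynomial.degree_sum_le _ _).trans_lt ((Finset.sup_lt_iff (WithBot.bot_lt_coe n)).2
      fun i hi => ?_)
    exact (Polynomial.degree_C_mul_X_pow_le _ _).trans_lt
      (WithBot.coe_lt_coe.2 (Finset.mem_range.1 hi))
  set Q : ℚ[X] := Polynomial.X ^ n + R with hQ
  have hQm : Q.Monic := Polynomial.monic_X_pow_add hRd
  have hQn : Q.natDegree = n := by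
    refine Polynomial.natDegree_eq_of_degree_eq_some ?_
    rw [hQ, Polynomial.degree_add_eq_left_of_degree_lt (by rwa [Polynomial.degree_X_pow]),
      Polynomial.degree_X_pow]
  have hPα : α ^ n + ∑ i ∈ Finset.range n, algebraMap ℚ_[p] (PadicAlgCl p) (P.coeff i) * α ^ i
      = 0 := by
    have := minpoly.aeval ℚ_[p] α
    rw [← hP, hPm.as_sum] at this
    simpa [Polynomial.aeval_def, Polynomial.eval₂_finsetSum] using this
  have hQα : Polynomial.aeval α Q =
      ∑ i ∈ Finset.range n, algebraMap ℚ_[p] (PadicAlgCl p) (q i - P.coeff i) * α ^ i := by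
    simp only [map_sub, sub_mul, Finset.sum_sub_distrib]
    rw [eq_neg_of_add_eq_zero_right hPα, hQ, hR]
    simp
    ring
  have hlt : ‖Polynomial.aeval α Q‖ < ε ^ n := by
    rw [hQα]
    calc _ ≤ ∑ i ∈ Finset.range n,
          ‖algebraMap ℚ_[p] (PadicAlgCl p) (q i - P.coeff i) * α ^ i‖ := norm_sum_le _ _
      _ < ∑ i ∈ Finset.range n, η * (1 + ‖α‖) ^ n := by
          refine Finset.sum_lt_sum_of_nonempty (Finset.nonempty_range_iff.2 hn0) fun i hi => ?_
          rw [norm_mul, norm_pow, norm_algebraMap', norm_sub_rev]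
          have h1 : ‖α‖ ^ i ≤ (1 + ‖α‖) ^ n :=
            (pow_le_pow_left₀ (norm_nonneg _) (by linarith) i).trans
              (pow_le_pow_right₀ (by linarith [norm_nonneg α]) (Finset.mem_range.1 hi).le)
          have h2 : 0 < (1 + ‖α‖) ^ n := by positivity
          exact (mul_le_mul_of_nonneg_left h1 (norm_nonneg _)).trans_lt
            (mul_lt_mul_of_pos_right (hq i) h2)
      _ = ε ^ n := by
          rw [Finset.sum_const, Finset.card_range, nsmul_eq_mul, hη]
          have : (n : ℝ) ≠ 0 := by exact_mod_cast hn0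
          field_simp
  set S : (PadicAlgCl p)[X] := Q.map (algebraMap ℚ (PadicAlgCl p)) with hS
  have hsp : S.Splits := IsAlgClosed.splits S
  have hprod : Polynomial.aeval α Q = (S.roots.map fun β => α - β).prod := by
    rw [← Polynomial.eval_map_algebraMap, ← hS]
    conv_lhs => rw [hsp.eq_prod_roots_of_monic (hQm.map _)]
    rw [Polynomial.eval_multiset_prod, Multiset.map_map]
    simp
  have hcard : S.roots.card = n := by
    rw [← hsp.natDegree_eq_card_roots, hS, hQm.natDegree_map, hQn]
  -- Q(α) is a product of n differences α − β over the roots; were they all of norm at least ε, it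
  -- would have norm at least εⁿ.
  by_contra! hcon
  have hfar : ∀ β ∈ S.roots, ε ≤ ‖α - β‖ := by
    intro β hβ
    have hr : Polynomial.aeval β Q = 0 := by
      rw [← Polynomial.eval_map_algebraMap]
      exact (Polynomial.mem_roots'.1 hβ).2
    have := hcon β ⟨Q, hQm.ne_zero, hr⟩
    rwa [dist_eq_norm] at this
  have hge : ε ^ n ≤ ‖Polynomial.aeval α Q‖ := by
    rw [hprod, ← hcard]
    have key : ∀ s : Multiset (PadicAlgCl p), (∀ β ∈ s, ε ≤ ‖α - β‖) →
        ε ^ s.card ≤ ‖(s.map fun β => α - β).prod‖ := by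
      intro s
      induction s using Multiset.induction with
      | empty => simp
      | cons a s ih =>
        intro h
        rw [Multiset.map_cons, Multiset.prod_cons, norm_mul, Multiset.card_cons, pow_succ']
        exact mul_le_mul (h a (by simp)) (ih fun β hβ => h β (by simp [hβ])) (by positivity)
          (norm_nonneg _)
    exact key _ hfar
  exact absurd hlt (not_lt.2 hge)

instance : TopologicalSpace.SeparableSpace (PadicAlgCl p) :=
  ⟨_, Algebraic.countable ℚ (PadicAlgCl p), dense_isAlgebraic_padicAlgCl p⟩

instance : TopologicalSpace.SeparableSpace ℂ_[p] :=
  UniformSpace.Completion.separableSpace_completion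

end Padic
end

noncomputable section

/-! ### Subdivision of finite trees -/

namespace IsTreeKernel

variable {X : Type*} [TopologicalSpace X] {κ : X → X → ℝ} {G : X} (h : IsTreeKernel κ G)
  {V : Finset X} (hV : IsMeetClosed κ G V)

theorem IsParent.ne_root {p q : X} (h : IsTreeKernel κ G) (hp : IsParent κ V p q) : q ≠ G := by
  rintro rfl
  exact hp.2.2.1 (hp.2.1.eq_root h)

/-- The choice of an interior point on each edge of the tree with vertex set `V`. -/
structure IsSubdivision (κ : X → X → ℝ) (G : X) (V : Finset X) (t : X → X) : Prop where
  left : ∀ q ∈ V, q ≠ G → Anc κ (parent κ V q) (t q)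
  right : ∀ q ∈ V, q ≠ G → Anc κ (t q) q
  left_ne : ∀ q ∈ V, q ≠ G → parent κ V q ≠ t q
  right_ne : ∀ q ∈ V, q ≠ G → t q ≠ q

open Classical in
/-- The vertex set of the subdivided tree. -/
def subdivide (G : X) (V : Finset X) (t : X → X) : Finset X := V ∪ (V.erase G).image t

omit [TopologicalSpace X] in
theorem mem_subdivide {t : X → X} {z : X} :
    z ∈ subdivide G V t ↔ z ∈ V ∨ ∃ q ∈ V, q ≠ G ∧ t q = z := by
  simp only [subdivide, Finset.mem_union, Finset.mem_image, Finset.mem_erase]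
  constructor
  · rintro (hz | ⟨q, ⟨h1, h2⟩, h3⟩)
    exacts [Or.inl hz, Or.inr ⟨q, h2, h1, h3⟩]
  · rintro (hz | ⟨q, h1, h2, h3⟩)
    exacts [Or.inl hz, Or.inr ⟨q, ⟨h2, h1⟩, h3⟩]

variable {t : X → X} (ht : IsSubdivision κ G V t)

include h hV ht

theorem IsSubdivision.notMem {q : X} (hq : q ∈ V) (hne : q ≠ G) : t q ∉ V := fun hmem =>
  ht.left_ne q hq hne ((ht.left q hq hne).antisymm h
    ((h.isParent_parent hV hne).2.2.2 _ hmem (ht.right q hq hne) (ht.right_ne q hq hne)))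

/-- The meet of r and q is a vertex beyond the interior point t r. The open edge above r contains no
vertex, so this meet is r. -/
theorem IsSubdivision.anc_of_anc {q r : X} (hq : q ∈ V) (hr : r ∈ V) (hne : r ≠ G)
    (hrq : Anc κ (t r) q) : Anc κ r q := by
  obtain ⟨m, hm, hmr, hmq, he⟩ := hV.meet r hr q hq
  have h1 : Anc κ (t r) m := h.anc_meet hmr he (ht.right r hr hne) hrq
  by_cases hmr' : m = r
  · rwa [← hmr']
  · have h2 := (h.isParent_parent hV hne).2.2.2 m hm hmr hmr'
    exact absurd ((ht.left r hr hne).antisymm h (h1.trans h h2)) (ht.left_ne r hr hne)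

theorem IsSubdivision.injOn {q r : X} (hq : q ∈ V) (hq0 : q ≠ G) (hr : r ∈ V) (hr0 : r ≠ G)
    (he : t q = t r) : q = r :=
  Anc.antisymm h
    (ht.anc_of_anc h hV hr hq hq0 (he ▸ ht.right r hr hr0))
    (ht.anc_of_anc h hV hq hr hr0 (he ▸ ht.right q hq hq0))

theorem IsSubdivision.isMeetClosed : IsMeetClosed κ G (subdivide G V t) := by
  -- If the meet of u and q is not an ancestor of t q, then t q is an ancestor of u and is itself
  -- the meet.
  have one : ∀ u q, q ∈ V → q ≠ G →
      (∃ m ∈ subdivide G V t, Anc κ m u ∧ Anc κ m q ∧ κ m m = κ u q) →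
      ∃ m ∈ subdivide G V t, Anc κ m u ∧ Anc κ m (t q) ∧ κ m m = κ u (t q) := by
    rintro u q hq hne ⟨m, hm, hmu, hmq, he⟩
    rcases h.meet_anc hmq he (ht.right q hq hne) with ⟨h1, h2⟩ | ⟨h1, h2⟩
    · exact ⟨m, hm, hmu, h1, h2⟩
    · exact ⟨t q, mem_subdivide.2 (Or.inr ⟨q, hq, hne, rfl⟩), h1, rfl, h2⟩
  have two : ∀ u ∈ V, ∀ r ∈ subdivide G V t,
      ∃ m ∈ subdivide G V t, Anc κ m u ∧ Anc κ m r ∧ κ m m = κ u r := by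
    intro u hu r hr
    have base : ∀ q ∈ V, ∃ m ∈ subdivide G V t, Anc κ m u ∧ Anc κ m q ∧ κ m m = κ u q := by
      intro q hq
      obtain ⟨m, hm, h1⟩ := hV.meet u hu q hq
      exact ⟨m, mem_subdivide.2 (Or.inl hm), h1⟩
    rcases mem_subdivide.1 hr with hr | ⟨q, hq, hne, rfl⟩
    · exact base r hr
    · exact one u q hq hne (base q hq)
  refine ⟨mem_subdivide.2 (Or.inl hV.root_mem), fun p hp => ?_, fun u hu r hr => ?_⟩
  · rcases mem_subdivide.1 hp with hp | ⟨q, hq, hne, rfl⟩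
    · exact hV.pos p hp
    · exact (hV.pos q hq).trans_le ((ht.right q hq hne).self_le h)
  · rcases mem_subdivide.1 hr with hr | ⟨q, hq, hne, rfl⟩
    · obtain ⟨m, hm, h1, h2, h3⟩ := two r hr u hu
      exact ⟨m, hm, h2, h1, h3.trans (h.symm _ _)⟩
    · refine one u q hq hne ?_
      obtain ⟨m, hm, h1, h2, h3⟩ := two q hq u hu
      exact ⟨m, hm, h2, h1, h3.trans (h.symm _ _)⟩

theorem IsSubdivision.isParent_right {q : X} (hq : q ∈ V) (hne : q ≠ G) :
    IsParent κ (subdivide G V t) (t q) q := by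
  have hP := h.isParent_parent hV hne
  refine ⟨mem_subdivide.2 (Or.inr ⟨q, hq, hne, rfl⟩), ht.right q hq hne, ht.right_ne q hq hne,
    fun z hz hzq hzne => ?_⟩
  rcases mem_subdivide.1 hz with hz | ⟨r, hr, hr0, rfl⟩
  · exact (hP.2.2.2 z hz hzq hzne).trans h (ht.left q hq hne)
  · by_cases hrq : r = q
    · rw [hrq]; rfl
    · exact ((ht.right r hr hr0).trans h (hP.2.2.2 r hr (ht.anc_of_anc h hV hq hr hr0 hzq) hrq)).trans
        h (ht.left q hq hne)

theorem IsSubdivision.isParent_left {q : X} (hq : q ∈ V) (hne : q ≠ G) :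
    IsParent κ (subdivide G V t) (parent κ V q) (t q) := by
  have hP := h.isParent_parent hV hne
  refine ⟨mem_subdivide.2 (Or.inl hP.1), ht.left q hq hne, ht.left_ne q hq hne,
    fun z hz hzt hzne => ?_⟩
  have hzq := hzt.trans h (ht.right q hq hne)
  rcases mem_subdivide.1 hz with hz | ⟨r, hr, hr0, rfl⟩
  · refine hP.2.2.2 z hz hzq ?_
    rintro rfl
    exact ht.right_ne z hq hne ((ht.right z hq hne).antisymm h hzt)
  · have hrq : r ≠ q := fun he => hzne (he ▸ rfl)
    exact (ht.right r hr hr0).trans h (hP.2.2.2 r hr (ht.anc_of_anc h hV hq hr hr0 hzq) hrq)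

theorem IsSubdivision.isParent_iff {p q : X} (hq : q ∈ subdivide G V t) :
    IsParent κ (subdivide G V t) p q ↔
      (q ∈ V ∧ q ≠ G ∧ p = t q) ∨ ∃ r ∈ V, r ≠ G ∧ q = t r ∧ p = parent κ V r := by
  constructor
  · intro hp
    rcases mem_subdivide.1 hq with hq | ⟨r, hr, hne, rfl⟩
    · exact Or.inl ⟨hq, hp.ne_root h, hp.unique h (ht.isParent_right h hV hq (hp.ne_root h))⟩
    · exact Or.inr ⟨r, hr, hne, rfl, hp.unique h (ht.isParent_left h hV hr hne)⟩
  · rintro (⟨hq, hne, rfl⟩ | ⟨r, hr, hne, rfl, rfl⟩)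
    · exact ht.isParent_right h hV hq hne
    · exact ht.isParent_left h hV hr hne

end IsTreeKernel

/-! ### Summation by parts on a finite tree -/

/-- The Dirichlet energy of a function on a rooted tree is bounded by the total variation of its
Laplacian on the tree subdivided by points `t q` of the edges `[π q, q]`. -/
theorem sum_slope_mul_le {α : Type*} [DecidableEq α] {V : Finset α} {G : α} (hG : G ∈ V)
    {π t : α → α} (hπ : ∀ q ∈ V.erase G, π q ∈ V) (f s l : α → ℝ) (d : α → α → ℝ) {M : ℝ}
    (hM : ∀ p, |f p| ≤ M) (hl : ∀ q ∈ V.erase G, l q ∈ Icc (0 : ℝ) 1)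
    (hs : ∀ q ∈ V.erase G, s q = d (t q) q - l q * (d (t q) q + d (t q) (π q))) :
    ∑ q ∈ V.erase G, s q * (f q - f (π q)) ≤
      M * (∑ p ∈ V, |(if p = G then 0 else d p (t p)) + ∑ q ∈ V.erase G with π q = p, d p (t q)| +
        ∑ q ∈ V.erase G, (|d (t q) q + d (t q) (π q)| + |d (π q) (t q) + d (t q) (π q)| +
          |d q (t q) + d (t q) q|)) := by
  have hM0 : 0 ≤ M := (abs_nonneg _).trans (hM G)
  -- The coefficient of f p after summation by parts: the slope above p minus the slopes below. It
  -- is compared with the mass at p of the Laplacian.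
  set a : α → ℝ := fun p => (if p = G then 0 else s p) - ∑ q ∈ V.erase G with π q = p, s q with ha
  have h1 : ∑ q ∈ V.erase G, s q * (f q - f (π q)) = ∑ p ∈ V, f p * a p := by
    simp only [mul_sub, Finset.sum_sub_distrib, ha]
    congr 1
    · rw [← Finset.add_sum_erase V _ hG]
      simp only [if_true, mul_zero, zero_add]
      refine Finset.sum_congr rfl fun q hq => ?_
      rw [if_neg (Finset.ne_of_mem_erase hq), mul_comm]
    · rw [← Finset.sum_fiberwise_of_maps_to hπ]
      refine Finset.sum_congr rfl fun p _ => ?_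
      rw [Finset.mul_sum]
      refine Finset.sum_congr rfl fun q hq => ?_
      rw [(Finset.mem_filter.1 hq).2, mul_comm]
  -- The slope is the convex combination (1 − l) d(t q, q) − l d(t q, π q). Comparing it with the
  -- derivative at q costs `A`, at π q costs `B`; the mass at t q enters with total weight l + (1 −
  -- l) = 1.
  set A : α → ℝ := fun q => |d q (t q) + d (t q) q| + l q * |d (t q) q + d (t q) (π q)| with hA
  set B : α → ℝ := fun q =>
    |d (π q) (t q) + d (t q) (π q)| + (1 - l q) * |d (t q) q + d (t q) (π q)| with hB
  have hup : ∀ q ∈ V.erase G, |s q + d q (t q)| ≤ A q := fun q hq => by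
    have : s q + d q (t q) =
        (d q (t q) + d (t q) q) - l q * (d (t q) q + d (t q) (π q)) := by rw [hs q hq]; ring
    rw [this]
    refine (abs_sub _ _).trans ?_
    rw [abs_mul, abs_of_nonneg (hl q hq).1]
  have hdown : ∀ q ∈ V.erase G, |s q - d (π q) (t q)| ≤ B q := fun q hq => by
    have : s q - d (π q) (t q) = (1 - l q) * (d (t q) q + d (t q) (π q)) -
        (d (π q) (t q) + d (t q) (π q)) := by rw [hs q hq]; ring
    rw [this, abs_sub_comm]
    refine (abs_sub _ _).trans ?_
    rw [abs_mul, abs_of_nonneg (sub_nonneg.2 (hl q hq).2)]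
  have h2 : ∀ p ∈ V, |a p| ≤
      |(if p = G then 0 else d p (t p)) + ∑ q ∈ V.erase G with π q = p, d p (t q)| +
        ((if p = G then 0 else A p) + ∑ q ∈ V.erase G with π q = p, B q) := fun p hp => by
    have e : a p = -((if p = G then 0 else d p (t p)) +
        ∑ q ∈ V.erase G with π q = p, d p (t q)) + ((if p = G then 0 else s p + d p (t p)) -
          ∑ q ∈ V.erase G with π q = p, (s q - d (π q) (t q))) := by
      have : ∑ q ∈ V.erase G with π q = p, (s q - d (π q) (t q)) =
          ∑ q ∈ V.erase G with π q = p, s q - ∑ q ∈ V.erase G with π q = p, d p (t q) := by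
        rw [← Finset.sum_sub_distrib]
        refine Finset.sum_congr rfl fun q hq => ?_
        rw [(Finset.mem_filter.1 hq).2]
      rw [this]
      simp only [ha]
      split_ifs <;> ring
    rw [e]
    refine (abs_add_le _ _).trans ?_
    rw [abs_neg]
    gcongr
    refine (abs_sub _ _).trans (add_le_add ?_ ((Finset.abs_sum_le_sum_abs _ _).trans
      (Finset.sum_le_sum fun q hq => hdown q (Finset.mem_filter.1 hq).1)))
    split_ifs with hpG
    · simp
    · exact hup p (Finset.mem_erase.2 ⟨hpG, hp⟩)
  rw [h1]
  calc ∑ p ∈ V, f p * a p ≤ ∑ p ∈ V, M * |a p| := Finset.sum_le_sum fun p _ =>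
        (le_abs_self _).trans (by rw [abs_mul]; exact mul_le_mul_of_nonneg_right (hM p) (abs_nonneg _))
    _ = M * ∑ p ∈ V, |a p| := (Finset.mul_sum _ _ _).symm
    _ ≤ _ := ?_
  refine mul_le_mul_of_nonneg_left ((Finset.sum_le_sum h2).trans ?_) hM0
  rw [Finset.sum_add_distrib]
  refine add_le_add_right (le_of_eq ?_) _
  rw [Finset.sum_add_distrib, Finset.sum_fiberwise_of_maps_to hπ, ← Finset.add_sum_erase V _ hG]
  simp only [if_true, zero_add]
  rw [← Finset.sum_add_distrib]
  refine Finset.sum_congr rfl fun q hq => ?_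
  rw [if_neg (Finset.ne_of_mem_erase hq), hA, hB]
  ring

end

noncomputable section

/-! ### Hyperbolic space as a rooted tree -/

namespace Berkovich

open IsTreeKernel

variable {C : Type*} [NormedField C]

/-- The inclusion of hyperbolic space into the projective line. -/
def Hyp.toProj (p : Hyp C) : OnePoint (AffineLine C) := (p.1 : AffineLine C)

theorem Hyp.toProj_injective : Function.Injective (Hyp.toProj : Hyp C → _) := fun _ _ h =>
  Subtype.ext (OnePoint.coe_injective h)

instance : TopologicalSpace (Hyp C) := TopologicalSpace.induced Hyp.toProj inferInstance

/-- The spherical kernel on hyperbolic space. -/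
def hypKernel (p q : Hyp C) : ℝ := sphericalKernel p.toProj q.toProj

theorem hypKernel_eq (p q : Hyp C) : hypKernel p q = hsia p.1 q.1 / (size p.1 * size q.1) :=
  sphericalKernel_coe_coe p.1 q.1

theorem hypKernel_self_pos (p : Hyp C) : 0 < hypKernel p p := by
  rw [hypKernel_eq]
  have := size_pos p.1
  have := p.2
  positivity

theorem exists_toProj_eq {x : OnePoint (AffineLine C)} (hx : 0 < sphericalKernel x x) :
    ∃ p : Hyp C, p.toProj = x := by
  induction x using OnePoint.rec with
  | infty => rw [sphericalKernel_infty_infty] at hx; exact absurd hx (lt_irrefl 0)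
  | coe x =>
    rw [sphericalKernel_coe_coe] at hx
    have hs := size_pos x
    exact ⟨⟨x, by
      by_contra hcon
      exact absurd hx (not_lt.2 (div_nonpos_of_nonpos_of_nonneg (not_lt.1 hcon) (by positivity)))⟩,
      rfl⟩

variable [IsUltrametricDist C]

theorem hypKernel_pos (p q : Hyp C) : 0 < hypKernel p q := by
  rw [hypKernel_eq]
  have := size_pos p.1
  have := size_pos q.1
  have := p.2.trans_le (hsia_self_le p.1 q.1)
  positivity

/-- The size factors cancel, so distances can be computed with the spherical kernel, for which
hyperbolic space is a tree rooted at the Gauss point. -/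
theorem pathDist_eq (p q : Hyp C) : pathDist p q =
    2 * Real.log (hypKernel p q) - Real.log (hypKernel p p) - Real.log (hypKernel q q) := by
  have h1 := size_pos p.1
  have h2 := size_pos q.1
  have h3 := p.2.trans_le (hsia_self_le p.1 q.1)
  rw [hypKernel_eq, hypKernel_eq, hypKernel_eq, pathDist, Real.log_div h3.ne' (by positivity),
    Real.log_div p.2.ne' (by positivity), Real.log_div q.2.ne' (by positivity),
    Real.log_mul h1.ne' h2.ne', Real.log_mul h1.ne' h1.ne', Real.log_mul h2.ne' h2.ne']
  ring

theorem mem_segment_iff {p q z : Hyp C} : z ∈ segment p q ↔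
    hypKernel p z * hypKernel z q = hypKernel z z * hypKernel p q := by
  have h1 := hypKernel_pos p z
  have h2 := hypKernel_pos z q
  have h3 := hypKernel_pos z z
  have h4 := hypKernel_pos p q
  rw [← Real.log_injOn_pos.eq_iff (mul_pos h1 h2) (mul_pos h3 h4), Real.log_mul h1.ne' h2.ne',
    Real.log_mul h3.ne' h4.ne']
  change pathDist p z + pathDist z q = pathDist p q ↔ _
  rw [pathDist_eq, pathDist_eq, pathDist_eq]
  constructor <;> intro h <;> linarith

variable [IsAlgClosed C]

variable (C) in
/-- The Gauss point of hyperbolic space. -/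
def gaussHyp : Hyp C := ⟨gaussPoint, by rw [hsia_gaussPoint]; exact size_pos _⟩

theorem isTreeKernel_hypKernel : IsTreeKernel (hypKernel (C := C)) (gaussHyp C) where
  nonneg _ _ := sphericalKernel_nonneg _ _
  symm _ _ := sphericalKernel_comm _ _
  ultra _ _ _ := sphericalKernel_ultra _ _ _
  root _ := sphericalKernel_gaussPoint _
  path y s h0 h1 := by
    obtain ⟨x, h2, h3⟩ := sphericalKernel_path y.toProj s h0 h1
    obtain ⟨p, rfl⟩ := exists_toProj_eq (h2 ▸ (hypKernel_self_pos y).trans h0)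
    exact ⟨p, h2, h3⟩
  continuous x := (continuous_sphericalKernel _).comp continuous_induced_dom
  sep x y h1 h2 := Hyp.toProj_injective (sphericalKernel_sep _ _ h1 h2)

theorem mem_segment_comm {p q z : Hyp C} : z ∈ segment p q ↔ z ∈ segment q p := by
  have h := isTreeKernel_hypKernel (C := C)
  rw [mem_segment_iff, mem_segment_iff, h.symm z q, h.symm p z, h.symm p q, mul_comm]

theorem mem_segment_iff_of_anc {p q z : Hyp C} (hpq : Anc hypKernel p q) :
    z ∈ segment p q ↔ Anc hypKernel p z ∧ Anc hypKernel z q := by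
  have h := isTreeKernel_hypKernel (C := C)
  rw [mem_segment_iff, hpq]
  have h1 := hypKernel_pos p p
  have h2 := hypKernel_pos z z
  constructor
  · intro he
    have h3 := h.self_le p z
    have h4 := h.self_le z q
    constructor
    · refine h.anc_of_le ?_
      by_contra! hcon
      nlinarith
    · refine h.anc_of_le ?_
      by_contra! hcon
      nlinarith
  · rintro ⟨h3, h4⟩
    rw [h3, h4, mul_comm]

theorem mem_segment_of_meet {m p q : Hyp C} (h1 : Anc hypKernel m p) (h2 : Anc hypKernel m q)
    (he : hypKernel m m = hypKernel p q) : m ∈ segment p q := by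
  have h := isTreeKernel_hypKernel (C := C)
  rw [mem_segment_iff, h.symm p m, h1, h2, he]

theorem mem_segment_of_meet_of_le {m q r : Hyp C} (h1 : Anc hypKernel m q)
    (he : hypKernel m m ≤ hypKernel q r) : m ∈ segment q r := by
  have h := isTreeKernel_hypKernel (C := C)
  rw [mem_segment_iff, h.symm q m, h1, h1.eq_max h r, max_eq_left he]

/-- In a rooted tree the median of three points is the deepest of their pairwise meets, that of the
pair with the smallest kernel. -/
theorem isVertexSet {V : Finset (Hyp C)}
    (hV : IsMeetClosed hypKernel (gaussHyp C) V) : IsVertexSet V := by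
  have h := isTreeKernel_hypKernel (C := C)
  have key : ∀ p ∈ V, ∀ q ∈ V, ∀ r ∈ V, hypKernel p q ≤ hypKernel q r →
      hypKernel p q ≤ hypKernel p r → ∃ m ∈ V, m ∈ segment p q ∧ m ∈ segment q r ∧
        m ∈ segment p r := by
    intro p hp q hq r hr h1 h2
    obtain ⟨m, hm, hmp, hmq, he⟩ := hV.meet p hp q hq
    exact ⟨m, hm, mem_segment_of_meet hmp hmq he, mem_segment_of_meet_of_le hmq (he ▸ h1),
      mem_segment_of_meet_of_le hmp (he ▸ h2)⟩
  intro p hp q hq r hr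
  have s1 := h.symm p q
  have s2 := h.symm q r
  have s3 := h.symm p r
  rcases le_total (hypKernel p q) (hypKernel q r) with h1 | h1
  · rcases le_total (hypKernel p q) (hypKernel p r) with h2 | h2
    · exact key p hp q hq r hr h1 h2
    · obtain ⟨m, hm, m1, m2, m3⟩ := key p hp r hr q hq (by linarith) h2
      exact ⟨m, hm, m3, mem_segment_comm.1 m2, m1⟩
  · rcases le_total (hypKernel q r) (hypKernel p r) with h2 | h2
    · obtain ⟨m, hm, m1, m2, m3⟩ := key q hq r hr p hp (by linarith) (by linarith)
      exact ⟨m, hm, mem_segment_comm.1 m3, m1, mem_segment_comm.1 m2⟩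
    · obtain ⟨m, hm, m1, m2, m3⟩ := key p hp r hr q hq (by linarith) (by linarith)
      exact ⟨m, hm, m3, mem_segment_comm.1 m2, m1⟩

/-- An edge has no vertex in its interior, so the meet of its ends is one of them: the ends are
parent and child. -/
theorem mem_neighbours_iff {V : Finset (Hyp C)} (hV : IsMeetClosed hypKernel (gaussHyp C) V)
    {p q : Hyp C} (hp : p ∈ V) : q ∈ neighbours V p ↔
      (q ∈ V ∧ IsParent hypKernel V p q) ∨ IsParent hypKernel V q p := by
  have h := isTreeKernel_hypKernel (C := C)
  have down : ∀ {p q : Hyp C}, p ∈ V → Anc hypKernel p q → p ≠ q →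
      (∀ z ∈ V, z ∈ segment p q → z = p ∨ z = q) → IsParent hypKernel V p q := by
    intro p q hp hpq hne hz
    refine ⟨hp, hpq, hne, fun z hzV hzq hzne => ?_⟩
    rcases hzq.total h hpq with h1 | h1
    · exact h1
    · rcases hz z hzV ((mem_segment_iff_of_anc hpq).2 ⟨h1, hzq⟩) with rfl | rfl
      · rfl
      · exact absurd rfl hzne
  have up : ∀ {p q z : Hyp C}, IsParent hypKernel V p q → z ∈ V → z ∈ segment p q →
      z = p ∨ z = q := by
    intro p q z hP hzV hz
    obtain ⟨h1, h2⟩ := (mem_segment_iff_of_anc hP.2.1).1 hz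
    by_cases hzq : z = q
    · exact Or.inr hzq
    · exact Or.inl ((hP.2.2.2 z hzV h2 hzq).antisymm h h1)
  simp only [neighbours, Finset.mem_filter]
  constructor
  · rintro ⟨hq, hne, hz⟩
    obtain ⟨m, hm, hmp, hmq, he⟩ := hV.meet p hp q hq
    rcases hz m hm (mem_segment_of_meet hmp hmq he) with rfl | rfl
    · exact Or.inl ⟨hq, down hp hmq hne.symm hz⟩
    · refine Or.inr (down hq hmp hne fun z hzV hzs => ?_)
      exact (hz z hzV (mem_segment_comm.1 hzs)).symm
  · rintro (⟨hq, hP⟩ | hP)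
    · exact ⟨hq, hP.2.2.1.symm, fun z hz => up hP hz⟩
    · exact ⟨hP.1, hP.2.2.1, fun z hz hzs => (up hP hz (mem_segment_comm.1 hzs)).symm⟩

/-! ### The Laplacian on a subdivided tree -/

section Subdivision

variable {V : Finset (Hyp C)} (hV : IsMeetClosed hypKernel (gaussHyp C) V) {t : Hyp C → Hyp C}
  (ht : IsSubdivision hypKernel (gaussHyp C) V t)

include hV ht

open Classical in
theorem neighbours_subdivide {p : Hyp C} (hp : p ∈ V) :
    neighbours (subdivide (gaussHyp C) V t) p =
      (if p = gaussHyp C then ∅ else {t p}) ∪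
        (V.erase (gaussHyp C) |>.filter fun q => parent hypKernel V q = p).image t := by
  have h := isTreeKernel_hypKernel (C := C)
  have hV' := ht.isMeetClosed h hV
  have hp' : p ∈ subdivide (gaussHyp C) V t := mem_subdivide.2 (Or.inl hp)
  ext z
  rw [mem_neighbours_iff hV' hp', ht.isParent_iff h hV hp', Finset.mem_union, Finset.mem_image]
  have e1 : z ∈ (if p = gaussHyp C then ∅ else {t p} : Finset (Hyp C)) ↔
      p ≠ gaussHyp C ∧ z = t p := by
    split_ifs with h1 <;> simp [h1]
  rw [e1]
  constructor
  · rintro (⟨hz, hP⟩ | ⟨-, h1, h2⟩ | ⟨r, hr, hne, rfl, rfl⟩)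
    · rcases (ht.isParent_iff h hV hz).1 hP with ⟨h1, h2, rfl⟩ | ⟨r, hr, hne, rfl, rfl⟩
      · exact absurd hp (ht.notMem h hV h1 h2)
      · exact Or.inr ⟨r, by simp [hr, hne], rfl⟩
    · exact Or.inl ⟨h1, h2⟩
    · exact absurd hp (ht.notMem h hV hr hne)
  · rintro (⟨h1, h2⟩ | ⟨q, hq, rfl⟩)
    · exact Or.inr (Or.inl ⟨hp, h1, h2⟩)
    · obtain ⟨hq1, rfl⟩ := Finset.mem_filter.1 hq
      obtain ⟨hne, hq2⟩ := Finset.mem_erase.1 hq1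
      exact Or.inl ⟨mem_subdivide.2 (Or.inr ⟨q, hq2, hne, rfl⟩), ht.isParent_left h hV hq2 hne⟩

open Classical in
theorem sum_neighbours_subdivide {p : Hyp C} (hp : p ∈ V) (g : Hyp C → ℝ) :
    ∑ z ∈ neighbours (subdivide (gaussHyp C) V t) p, g z =
      (if p = gaussHyp C then 0 else g (t p)) +
        ∑ q ∈ V.erase (gaussHyp C) with parent hypKernel V q = p, g (t q) := by
  have h := isTreeKernel_hypKernel (C := C)
  rw [neighbours_subdivide hV ht hp, Finset.sum_union, Finset.sum_image]
  · split_ifs <;> simp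
  · intro q hq r hr he
    obtain ⟨q0, hq⟩ := Finset.mem_erase.1 (Finset.mem_filter.1 hq).1
    obtain ⟨r0, hr⟩ := Finset.mem_erase.1 (Finset.mem_filter.1 hr).1
    exact ht.injOn h hV hq q0 hr r0 he
  · split_ifs with hpG
    · simp
    · rw [Finset.disjoint_singleton_left, Finset.mem_image]
      rintro ⟨q, hq, he⟩
      obtain ⟨hq1, hq2⟩ := Finset.mem_filter.1 hq
      obtain ⟨q0, hq⟩ := Finset.mem_erase.1 hq1
      have := ht.injOn h hV hq q0 hp hpG he
      subst this
      exact (h.isParent_parent hV q0).2.2.1 hq2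

theorem sum_neighbours_subdivide_apply {q : Hyp C} (hq : q ∈ V) (hne : q ≠ gaussHyp C)
    (g : Hyp C → ℝ) : ∑ z ∈ neighbours (subdivide (gaussHyp C) V t) (t q), g z =
      g q + g (parent hypKernel V q) := by
  classical
  have h := isTreeKernel_hypKernel (C := C)
  have hV' := ht.isMeetClosed h hV
  have hp' : t q ∈ subdivide (gaussHyp C) V t := mem_subdivide.2 (Or.inr ⟨q, hq, hne, rfl⟩)
  have hP := h.isParent_parent hV hne
  have : neighbours (subdivide (gaussHyp C) V t) (t q) = {q, parent hypKernel V q} := by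
    ext z
    rw [mem_neighbours_iff hV' hp', Finset.mem_insert, Finset.mem_singleton]
    constructor
    · rintro (⟨hz, hP'⟩ | hP')
      · rcases (ht.isParent_iff h hV hz).1 hP' with ⟨h1, h2, h3⟩ | ⟨r, hr, r0, rfl, h3⟩
        · exact Or.inl (ht.injOn h hV h1 h2 hq hne h3.symm)
        · exact absurd (h3 ▸ (h.isParent_parent hV r0).1) (ht.notMem h hV hq hne)
      · exact Or.inr (hP'.unique h (ht.isParent_left h hV hq hne))
    · rintro (rfl | rfl)
      · exact Or.inl ⟨mem_subdivide.2 (Or.inl hq), ht.isParent_right h hV hq hne⟩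
      · exact Or.inr (ht.isParent_left h hV hq hne)
  rw [this, Finset.sum_pair hP.2.2.1.symm]

open Classical in
theorem sum_subdivide (g : Hyp C → ℝ) : ∑ p ∈ subdivide (gaussHyp C) V t, g p =
    ∑ p ∈ V, g p + ∑ q ∈ V.erase (gaussHyp C), g (t q) := by
  have h := isTreeKernel_hypKernel (C := C)
  have e : subdivide (gaussHyp C) V t = V ∪ (V.erase (gaussHyp C)).image t := by
    ext z
    rw [mem_subdivide, Finset.mem_union, Finset.mem_image]
    simp [and_assoc, and_left_comm]
  rw [e, Finset.sum_union, Finset.sum_image]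
  · intro q hq r hr he
    obtain ⟨q0, hq⟩ := Finset.mem_erase.1 hq
    obtain ⟨r0, hr⟩ := Finset.mem_erase.1 hr
    exact ht.injOn h hV hq q0 hr r0 he
  · rw [Finset.disjoint_right]
    intro z hz
    obtain ⟨q, hq, rfl⟩ := Finset.mem_image.1 hz
    obtain ⟨q0, hq⟩ := Finset.mem_erase.1 hq
    exact ht.notMem h hV hq q0

open Classical in
-- Each edge of the subdivision joins V to an interior point, so it is counted once from either side
-- and the factor 1/2 disappears. The result is the bound in `sum_slope_mul_le`.
theorem graphVariation_subdivide (d : Hyp C → Hyp C → ℝ) :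
    graphVariation d (subdivide (gaussHyp C) V t) =
      ∑ p ∈ V, |(if p = gaussHyp C then 0 else d p (t p)) +
          ∑ q ∈ V.erase (gaussHyp C) with parent hypKernel V q = p, d p (t q)| +
        ∑ q ∈ V.erase (gaussHyp C), (|d (t q) q + d (t q) (parent hypKernel V q)| +
          |d (parent hypKernel V q) (t q) + d (t q) (parent hypKernel V q)| +
          |d q (t q) + d (t q) q|) := by
  have h := isTreeKernel_hypKernel (C := C)
  rw [graphVariation, sum_subdivide hV ht, sum_subdivide hV ht]
  have e1 : ∀ p ∈ V, |-∑ q ∈ neighbours (subdivide (gaussHyp C) V t) p, d p q| =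
      |(if p = gaussHyp C then 0 else d p (t p)) +
          ∑ q ∈ V.erase (gaussHyp C) with parent hypKernel V q = p, d p (t q)| := fun p hp => by
    rw [abs_neg, sum_neighbours_subdivide hV ht hp]
  have e2 : ∀ q ∈ V.erase (gaussHyp C),
      |-∑ z ∈ neighbours (subdivide (gaussHyp C) V t) (t q), d (t q) z| =
        |d (t q) q + d (t q) (parent hypKernel V q)| := fun q hq => by
    obtain ⟨q0, hq⟩ := Finset.mem_erase.1 hq
    rw [abs_neg, sum_neighbours_subdivide_apply hV ht hq q0]
  have e3 : ∑ p ∈ V, ∑ q ∈ neighbours (subdivide (gaussHyp C) V t) p, |d p q + d q p| =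
      ∑ q ∈ V.erase (gaussHyp C), (|d (parent hypKernel V q) (t q) + d (t q) (parent hypKernel V q)| +
          |d q (t q) + d (t q) q|) := by
    rw [Finset.sum_congr rfl fun p hp => sum_neighbours_subdivide hV ht hp _,
      Finset.sum_add_distrib, Finset.sum_add_distrib, add_comm]
    congr 1
    · rw [← Finset.sum_fiberwise_of_maps_to (s := V.erase (gaussHyp C)) (t := V)
        (g := parent hypKernel V)
        fun q hq => (h.isParent_parent hV (Finset.ne_of_mem_erase hq)).1]
      refine Finset.sum_congr rfl fun p _ => Finset.sum_congr rfl fun q hq => ?_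
      rw [(Finset.mem_filter.1 hq).2]
    · rw [← Finset.add_sum_erase V _ hV.root_mem]
      simp only [if_true, zero_add]
      exact Finset.sum_congr rfl fun q hq => if_neg (Finset.ne_of_mem_erase hq)
  have e4 : ∑ q ∈ V.erase (gaussHyp C),
      ∑ z ∈ neighbours (subdivide (gaussHyp C) V t) (t q), |d (t q) z + d z (t q)| =
      ∑ q ∈ V.erase (gaussHyp C), (|d (parent hypKernel V q) (t q) + d (t q) (parent hypKernel V q)| +
          |d q (t q) + d (t q) q|) := by
    refine Finset.sum_congr rfl fun q hq => ?_
    obtain ⟨q0, hq⟩ := Finset.mem_erase.1 hq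
    rw [sum_neighbours_subdivide_apply hV ht hq q0, add_comm, add_comm (d (t q) q),
      add_comm (d (t q) (parent hypKernel V q))]
  rw [Finset.sum_congr rfl e1, Finset.sum_congr rfl e2, e3, e4]
  simp only [Finset.sum_add_distrib]
  ring

end Subdivision

end Berkovich
end

noncomputable section

namespace Berkovich

open IsTreeKernel

variable {C : Type*} [NormedField C] [IsUltrametricDist C] [IsAlgClosed C]

/-! ### Directional derivatives along a path -/

omit [IsAlgClosed C] in
theorem pathDist_of_anc {p q : Hyp C} (hpq : Anc hypKernel p q) :
    pathDist p q = depth hypKernel q - depth hypKernel p := by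
  rw [pathDist_eq, hpq, depth, depth]
  ring

theorem pathDist_comm (p q : Hyp C) : pathDist p q = pathDist q p := by
  rw [pathDist_eq, pathDist_eq, isTreeKernel_hypKernel.symm p q]
  ring

/-- A function which has directional derivatives satisfies a mean value theorem on `[p, q]`. -/
theorem exists_slope_eq {f : Hyp C → ℝ} {d : Hyp C → Hyp C → ℝ}
    (hd : ∀ p q, p ≠ q → HasDirDeriv f p q (d p q)) {p q : Hyp C} (hpq : Anc hypKernel p q)
    (hne : p ≠ q) : ∃ t, Anc hypKernel p t ∧ Anc hypKernel t q ∧ p ≠ t ∧ t ≠ q ∧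
      ∃ l ∈ Icc (0 : ℝ) 1, (f q - f p) / (depth hypKernel q - depth hypKernel p) =
        d t q - l * (d t q + d t p) := by
  have h := isTreeKernel_hypKernel (C := C)
  set a := depth hypKernel p with ha
  set b := depth hypKernel q with hb
  have hab : a < b := neg_lt_neg (Real.log_lt_log (hypKernel_self_pos q) (hpq.self_lt h hne))
  -- The path from p to q parametrized by depth.
  set γ : ℝ → Hyp C := fun τ => trunc hypKernel (Real.exp (-τ)) q with hγ
  have ha0 : 0 ≤ a := neg_nonneg.2 (Real.log_nonpos (h.nonneg _ _) (h.le_one _ _))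
  have he1 : ∀ τ ∈ Icc a b, Real.exp (-τ) ≤ 1 := fun τ hτ =>
    Real.exp_le_one_iff.2 (by linarith [hτ.1])
  have hanc : ∀ τ ∈ Icc a b, Anc hypKernel (γ τ) q := fun τ hτ => h.anc_trunc (he1 τ hτ) q
  have hself : ∀ τ ∈ Icc a b, hypKernel (γ τ) (γ τ) = Real.exp (-τ) := fun τ hτ => by
    rw [hγ, h.trunc_self (he1 τ hτ), max_eq_right]
    rw [← Real.log_le_iff_le_exp (hypKernel_self_pos q)]
    linarith [hτ.2, show b = -Real.log (hypKernel q q) from rfl]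
  have hdepth : ∀ τ ∈ Icc a b, depth hypKernel (γ τ) = τ := fun τ hτ => by
    rw [depth, hself τ hτ, Real.log_exp, neg_neg]
  have hmono : ∀ σ ∈ Icc a b, ∀ τ ∈ Icc a b, σ ≤ τ → Anc hypKernel (γ σ) (γ τ) :=
    fun σ hσ τ hτ hle => (hanc σ hσ).of_anc_of_le h (hanc τ hτ) (by
      rw [hself σ hσ, hself τ hτ]
      exact Real.exp_le_exp.2 (by linarith))
  have hexp : ∀ x : Hyp C, Real.exp (-depth hypKernel x) = hypKernel x x := fun x => by
    rw [depth, neg_neg, Real.exp_log (hypKernel_self_pos x)]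
  have hA : a ∈ Icc a b := ⟨le_rfl, hab.le⟩
  have hB : b ∈ Icc a b := ⟨hab.le, le_rfl⟩
  have hγa : γ a = p := by
    refine ((hanc a hA).of_anc_of_le h hpq ?_).antisymm h (hpq.of_anc_of_le h (hanc a hA) ?_) <;>
      rw [hself a hA, hexp]
  have hγb : γ b = q := (hanc b hB).eq_of_self_eq h (by rw [hself b hB, hexp])
  have hinj : ∀ σ ∈ Icc a b, ∀ τ ∈ Icc a b, σ ≠ τ → γ σ ≠ γ τ := fun σ hσ τ hτ hne he =>
    hne (by rw [← hdepth σ hσ, he, hdepth τ hτ])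
  set F : ℝ → ℝ := fun τ => f (γ τ) with hF
  have hright : ∀ τ ∈ Ico a b, HasDerivWithinAt F (d (γ τ) q) (Ioi τ) τ := by
    intro τ hτ
    have hτ' : τ ∈ Icc a b := ⟨hτ.1, hτ.2.le⟩
    rw [hasDerivWithinAt_iff_tendsto_slope' (by simp)]
    have hev : ∀ᶠ σ in 𝓝[>] τ, σ ∈ Ioo τ b := Ioo_mem_nhdsGT hτ.2
    have hdist : ∀ σ ∈ Ioo τ b, pathDist (γ τ) (γ σ) = σ - τ := fun σ hσ => by
      have hσ' : σ ∈ Icc a b := ⟨hτ.1.trans hσ.1.le, hσ.2.le⟩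
      rw [pathDist_of_anc (hmono τ hτ' σ hσ' hσ.1.le), hdepth σ hσ', hdepth τ hτ']
    have hlim : Tendsto γ (𝓝[>] τ)
        (comap (pathDist (γ τ)) (𝓝[>] 0) ⊓ 𝓟 (segment (γ τ) q)) := by
      refine tendsto_inf.2 ⟨tendsto_comap_iff.2 ?_, tendsto_principal.2 ?_⟩
      · have h1 : Tendsto (fun σ => σ - τ) (𝓝[>] τ) (𝓝[>] 0) := by
          refine tendsto_nhdsWithin_iff.2 ⟨?_, ?_⟩
          · have := ((continuous_id.sub continuous_const).tendsto (f := fun σ => σ - τ) τ)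
            simp only [sub_self] at this
            exact this.mono_left nhdsWithin_le_nhds
          · filter_upwards [self_mem_nhdsWithin] with σ hσ using mem_Ioi.2 (sub_pos.2 hσ)
        refine h1.congr' ?_
        filter_upwards [hev] with σ hσ using (hdist σ hσ).symm
      · filter_upwards [hev] with σ hσ
        have hσ' : σ ∈ Icc a b := ⟨hτ.1.trans hσ.1.le, hσ.2.le⟩
        exact (mem_segment_iff_of_anc (hanc τ hτ')).2
          ⟨hmono τ hτ' σ hσ' hσ.1.le, hanc σ hσ'⟩
    have hne' : γ τ ≠ q := by
      rw [← hγb]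
      exact hinj τ hτ' b hB hτ.2.ne
    refine ((hd _ _ hne').comp hlim).congr' ?_
    filter_upwards [hev] with σ hσ
    rw [Function.comp_apply, hdist σ hσ, slope_def_field]
  have hleft : ∀ τ ∈ Ioc a b, HasDerivWithinAt F (-d (γ τ) p) (Iio τ) τ := by
    intro τ hτ
    have hτ' : τ ∈ Icc a b := ⟨hτ.1.le, hτ.2⟩
    rw [hasDerivWithinAt_iff_tendsto_slope' (by simp)]
    have hev : ∀ᶠ σ in 𝓝[<] τ, σ ∈ Ioo a τ := Ioo_mem_nhdsLT hτ.1
    have hdist : ∀ σ ∈ Ioo a τ, pathDist (γ τ) (γ σ) = τ - σ := fun σ hσ => by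
      have hσ' : σ ∈ Icc a b := ⟨hσ.1.le, hσ.2.le.trans hτ.2⟩
      rw [pathDist_comm, pathDist_of_anc (hmono σ hσ' τ hτ' hσ.2.le), hdepth σ hσ', hdepth τ hτ']
    have hlim : Tendsto γ (𝓝[<] τ)
        (comap (pathDist (γ τ)) (𝓝[>] 0) ⊓ 𝓟 (segment (γ τ) p)) := by
      refine tendsto_inf.2 ⟨tendsto_comap_iff.2 ?_, tendsto_principal.2 ?_⟩
      · have h1 : Tendsto (fun σ => τ - σ) (𝓝[<] τ) (𝓝[>] 0) := by
          refine tendsto_nhdsWithin_iff.2 ⟨?_, ?_⟩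
          · have := ((continuous_const.sub continuous_id).tendsto (f := fun σ => τ - σ) τ)
            simp only [sub_self] at this
            exact this.mono_left nhdsWithin_le_nhds
          · filter_upwards [self_mem_nhdsWithin] with σ hσ using mem_Ioi.2 (sub_pos.2 hσ)
        refine h1.congr' ?_
        filter_upwards [hev] with σ hσ using (hdist σ hσ).symm
      · filter_upwards [hev] with σ hσ
        have hσ' : σ ∈ Icc a b := ⟨hσ.1.le, hσ.2.le.trans hτ.2⟩
        rw [mem_segment_comm, mem_segment_iff_of_anc (hγa ▸ hmono a hA τ hτ' hτ.1.le)]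
        exact ⟨hγa ▸ hmono a hA σ hσ' hσ.1.le, hmono σ hσ' τ hτ' hσ.2.le⟩
    have hne' : γ τ ≠ p := by
      rw [← hγa]
      exact hinj τ hτ' a hA hτ.1.ne'
    refine ((hd _ _ hne').comp hlim).neg.congr' ?_
    filter_upwards [hev] with σ hσ
    rw [Function.comp_apply, hdist σ hσ, slope_def_field, ← div_neg, neg_sub]
  set s : ℝ := (f q - f p) / (b - a) with hs
  -- Rolle's argument. At an interior extremum of F minus its chord, the one-sided derivatives d(γ
  -- τ, q) and −d(γ τ, p) lie on opposite sides of s, so s is a convex combination of them.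
  set g : ℝ → ℝ := fun τ => F τ - s * τ with hg
  have hcont : ContinuousOn g (Icc a b) := by
    refine ContinuousOn.sub (fun τ hτ => ?_) (by fun_prop)
    have hl : ContinuousWithinAt F (Icc a b ∩ Iio τ) τ := by
      rcases hτ.1.eq_or_lt with heq | hlt
      · have : Icc a b ∩ Iio τ = ∅ := by
          ext x; simp only [mem_inter_iff, mem_Icc, mem_Iio, mem_empty_iff_false, iff_false]
          intro hx; linarith [hx.1.1, hx.2]
        rw [this]
        simp [ContinuousWithinAt]
      · exact (hleft τ ⟨hlt, hτ.2⟩).continuousWithinAt.mono inter_subset_right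
    have hr : ContinuousWithinAt F (Icc a b ∩ Ioi τ) τ := by
      rcases hτ.2.eq_or_lt with heq | hlt
      · have : Icc a b ∩ Ioi τ = ∅ := by
          ext x; simp only [mem_inter_iff, mem_Icc, mem_Ioi, mem_empty_iff_false, iff_false]
          intro hx; linarith [hx.1.2, hx.2]
        rw [this]
        simp [ContinuousWithinAt]
      · exact (hright τ ⟨hτ.1, hlt⟩).continuousWithinAt.mono inter_subset_right
    have := (hl.union hr).insert
    refine this.mono fun x hx => ?_
    rcases lt_trichotomy x τ with h1 | h1 | h1
    · exact Or.inr (Or.inl ⟨hx, h1⟩)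
    · exact Or.inl h1
    · exact Or.inr (Or.inr ⟨hx, h1⟩)
  have hgab : g a = g b := by
    have : s * (b - a) = f q - f p := div_mul_cancel₀ _ (sub_ne_zero.2 hab.ne')
    simp only [hg, hF, hγa, hγb]
    linarith
  obtain ⟨τ, hτ, hext⟩ := exists_isLocalExtr_Ioo hab hcont hgab
  have hτ' : τ ∈ Icc a b := ⟨hτ.1.le, hτ.2.le⟩
  have hgr : Tendsto (slope g τ) (𝓝[>] τ) (𝓝 (d (γ τ) q - s)) := by
    have := (hright τ ⟨hτ.1.le, hτ.2⟩).sub (((hasDerivAt_id τ).const_mul s).hasDerivWithinAt)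
    rw [mul_one] at this
    exact (hasDerivWithinAt_iff_tendsto_slope' (by simp)).1 this
  have hgl : Tendsto (slope g τ) (𝓝[<] τ) (𝓝 (-d (γ τ) p - s)) := by
    have := (hleft τ ⟨hτ.1, hτ.2.le⟩).sub (((hasDerivAt_id τ).const_mul s).hasDerivWithinAt)
    rw [mul_one] at this
    exact (hasDerivWithinAt_iff_tendsto_slope' (by simp)).1 this
  refine ⟨γ τ, hγa ▸ hmono a hA τ hτ' hτ.1.le, hanc τ hτ', hγa ▸ hinj a hA τ hτ' hτ.1.ne,
    hγb ▸ hinj τ hτ' b hB hτ.2.ne, ?_⟩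
  have hsgn : (0 ≤ d (γ τ) q - s ∧ -d (γ τ) p - s ≤ 0) ∨
      (d (γ τ) q - s ≤ 0 ∧ 0 ≤ -d (γ τ) p - s) := by
    rcases hext with hmin | hmax
    · left
      constructor
      · refine ge_of_tendsto hgr ?_
        filter_upwards [self_mem_nhdsWithin, hmin.filter_mono nhdsWithin_le_nhds] with σ h1 h2
        rw [slope_def_field]
        exact div_nonneg (sub_nonneg.2 h2) (sub_nonneg.2 (le_of_lt h1))
      · refine le_of_tendsto hgl ?_
        filter_upwards [self_mem_nhdsWithin, hmin.filter_mono nhdsWithin_le_nhds] with σ h1 h2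
        rw [slope_def_field]
        exact div_nonpos_of_nonneg_of_nonpos (sub_nonneg.2 h2) (sub_nonpos.2 (le_of_lt h1))
    · right
      constructor
      · refine le_of_tendsto hgr ?_
        filter_upwards [self_mem_nhdsWithin, hmax.filter_mono nhdsWithin_le_nhds] with σ h1 h2
        rw [slope_def_field]
        exact div_nonpos_of_nonpos_of_nonneg (sub_nonpos.2 h2) (sub_nonneg.2 (le_of_lt h1))
      · refine ge_of_tendsto hgl ?_
        filter_upwards [self_mem_nhdsWithin, hmax.filter_mono nhdsWithin_le_nhds] with σ h1 h2
        rw [slope_def_field]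
        exact div_nonneg_of_nonpos (sub_nonpos.2 h2) (sub_nonpos.2 (le_of_lt h1))
  set x := d (γ τ) q
  set y := d (γ τ) p
  -- If the one-sided derivatives agree, both equal s and the weight 0 will do; otherwise one solves
  -- for the weight.
  by_cases hxy : x + y = 0
  · refine ⟨0, ⟨le_rfl, zero_le_one⟩, ?_⟩
    rw [zero_mul, sub_zero]
    rcases hsgn with ⟨h1, h2⟩ | ⟨h1, h2⟩ <;> linarith
  · refine ⟨(x - s) / (x + y), ⟨?_, ?_⟩, ?_⟩
    · rcases hsgn with ⟨h1, h2⟩ | ⟨h1, h2⟩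
      · exact div_nonneg h1 (by linarith)
      · exact div_nonneg_of_nonpos h1 (by linarith)
    · rcases hsgn with ⟨h1, h2⟩ | ⟨h1, h2⟩
      · exact div_le_one_of_le₀ (by linarith) (by linarith)
      · exact div_le_one_of_ge (by linarith) (by linarith)
    · rw [div_mul_cancel₀ _ hxy]
      ring

/-! ### Functions of bounded differential variation have bounded Dirichlet energy -/

open Classical in
-- Each edge is subdivided at a mean value point. The Dirichlet energy is a sum of slopes times
-- increments, and summation by parts trades the increments for sup |f| and the slopes for the
-- Laplacian on the subdivided graph.
theorem dirichlet_hypKernel_le {f : Hyp C → ℝ} {d : Hyp C → Hyp C → ℝ}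
    (hd : ∀ p q, p ≠ q → HasDirDeriv f p q (d p q)) {B : ℝ}
    (hB : ∀ V : Finset (Hyp C), IsVertexSet V → graphVariation d V ≤ B) {M : ℝ}
    (hM : ∀ p, |f p| ≤ M) {V : Finset (Hyp C)} (hV : IsMeetClosed hypKernel (gaussHyp C) V) :
    dirichlet hypKernel (gaussHyp C) V f ≤ M * B := by
  have h := isTreeKernel_hypKernel (C := C)
  have hM0 : 0 ≤ M := (abs_nonneg _).trans (hM (gaussHyp C))
  have hex : ∀ q : Hyp C, ∃ t, ∃ l : ℝ, q ≠ gaussHyp C →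
      (Anc hypKernel (parent hypKernel V q) t ∧ Anc hypKernel t q ∧ parent hypKernel V q ≠ t ∧
        t ≠ q) ∧ l ∈ Icc (0 : ℝ) 1 ∧ (f q - f (parent hypKernel V q)) / edgeLength hypKernel V q =
          d t q - l * (d t q + d t (parent hypKernel V q)) := by
    intro q
    by_cases hq : q = gaussHyp C
    · exact ⟨q, 0, fun hne => absurd hq hne⟩
    · have hP := h.isParent_parent hV hq
      obtain ⟨t, h1, h2, h3, h4, l, hl, he⟩ := exists_slope_eq hd hP.2.1 hP.2.2.1
      exact ⟨t, l, fun _ => ⟨⟨h1, h2, h3, h4⟩, hl, he⟩⟩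
  choose t l htl using hex
  have ht : IsSubdivision hypKernel (gaussHyp C) V t :=
    ⟨fun q _ hne => (htl q hne).1.1, fun q _ hne => (htl q hne).1.2.1,
      fun q _ hne => (htl q hne).1.2.2.1, fun q _ hne => (htl q hne).1.2.2.2⟩
  have key := sum_slope_mul_le hV.root_mem (π := parent hypKernel V) (t := t)
    (fun q hq => (h.isParent_parent hV (Finset.ne_of_mem_erase hq)).1) f
    (fun q => (f q - f (parent hypKernel V q)) / edgeLength hypKernel V q) l d hM
    (fun q hq => (htl q (Finset.ne_of_mem_erase hq)).2.1)
    (fun q hq => (htl q (Finset.ne_of_mem_erase hq)).2.2)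
  rw [← graphVariation_subdivide hV ht d] at key
  calc dirichlet hypKernel (gaussHyp C) V f = _ := by
        rw [dirichlet]
        refine Finset.sum_congr rfl fun q _ => ?_
        rw [sq, mul_div_right_comm]
    _ ≤ _ := key
    _ ≤ M * B := mul_le_mul_of_nonneg_left (hB _ (isVertexSet (ht.isMeetClosed h hV))) hM0

/-- Vertices have positive diameter, hence lie in hyperbolic space, where the directional
derivatives are defined; parents and edge lengths agree in both spaces. -/
theorem exists_dirichlet_eq {V : Finset (OnePoint (AffineLine C))}
    (hV : IsMeetClosed sphericalKernel ((gaussPoint : AffineLine C) : OnePoint _) V)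
    (f : OnePoint (AffineLine C) → ℝ) :
    ∃ W : Finset (Hyp C), IsMeetClosed hypKernel (gaussHyp C) W ∧
      dirichlet sphericalKernel ((gaussPoint : AffineLine C) : OnePoint _) V f =
        dirichlet hypKernel (gaussHyp C) W fun p => f p.toProj := by
  classical
  have h := isTreeKernel_sphericalKernel (C := C)
  have h' := isTreeKernel_hypKernel (C := C)
  set W : Finset (Hyp C) := V.preimage Hyp.toProj Hyp.toProj_injective.injOn with hW
  have hmem : ∀ {p : Hyp C}, p ∈ W ↔ p.toProj ∈ V := Finset.mem_preimage
  have hlift : ∀ x ∈ V, ∃ p ∈ W, p.toProj = x := fun x hx => by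
    obtain ⟨p, rfl⟩ := exists_toProj_eq (hV.pos x hx)
    exact ⟨p, hmem.2 hx, rfl⟩
  have hWm : IsMeetClosed hypKernel (gaussHyp C) W := by
    refine ⟨hmem.2 hV.root_mem, fun p _ => hypKernel_self_pos p, fun p hp q hq => ?_⟩
    obtain ⟨m, hm, h1⟩ := hV.meet _ (hmem.1 hp) _ (hmem.1 hq)
    obtain ⟨m, hmW, rfl⟩ := hlift m hm
    exact ⟨m, hmW, h1⟩
  have hpar : ∀ p : Hyp C, p ≠ gaussHyp C →
      parent sphericalKernel V p.toProj = (parent hypKernel W p).toProj := by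
    intro p hp
    have hp' : p.toProj ≠ ((gaussPoint : AffineLine C) : OnePoint _) := fun he =>
      hp (Hyp.toProj_injective he)
    refine (h.isParent_parent hV hp').unique h ?_
    obtain ⟨h1, h2, h3, h4⟩ := h'.isParent_parent hWm hp
    refine ⟨hmem.1 h1, h2, fun he => h3 (Hyp.toProj_injective he), fun z hz hzp hzne => ?_⟩
    obtain ⟨z, hzW, rfl⟩ := hlift z hz
    exact h4 z hzW hzp fun he => hzne (he ▸ rfl)
  refine ⟨W, hWm, ?_⟩
  rw [dirichlet, dirichlet]
  symm
  refine Finset.sum_nbij Hyp.toProj (fun p hp => ?_) Hyp.toProj_injective.injOn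
    (fun x hx => ?_) fun p hp => ?_
  · obtain ⟨hne, hp⟩ := Finset.mem_erase.1 hp
    exact Finset.mem_erase.2 ⟨fun he => hne (Hyp.toProj_injective he), hmem.1 hp⟩
  · obtain ⟨hne, hx⟩ := Finset.mem_erase.1 (Finset.mem_coe.1 hx)
    obtain ⟨p, hp, rfl⟩ := hlift x hx
    exact ⟨p, Finset.mem_coe.2 (Finset.mem_erase.2 ⟨fun he => hne (he ▸ rfl), hp⟩), rfl⟩
  · rw [edgeLength, edgeLength, hpar p (Finset.ne_of_mem_erase hp)]
    rfl

/-- The integral of a continuous function of bounded differential variation is controlled by the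
energy. -/
theorem IsBDV.exists_bound [TopologicalSpace.SeparableSpace C] {f : OnePoint (AffineLine C) → ℝ}
    (hf : Continuous f) (hB : IsBDV f) : ∃ c D : ℝ, ∀ μ : ComplexMeasure (OnePoint (AffineLine C)),
      EnergyForm.IsAdmissible sphericalKernel μ →
      ‖∫ᵛ x, f x ∂•μ - c * μ univ‖ ^ 2 ≤
        D * (EnergyForm.form (EnergyForm.logKernel sphericalKernel) μ μ).re := by
  obtain ⟨d, hd, B, hB⟩ := hB
  obtain ⟨M, hM⟩ := isCompact_univ.exists_bound_of_continuousOn hf.continuousOn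
  refine ⟨_, M * B, fun μ hμ => isTreeKernel_sphericalKernel.norm_integral_sq_le hf
    (fun V hV => ?_) hμ⟩
  obtain ⟨W, hW, he⟩ := exists_dirichlet_eq hV f
  rw [he]
  exact dirichlet_hypKernel_le hd hB (fun p => hM _ (mem_univ _)) hW

end Berkovich
end

noncomputable section

/-! ### Local degrees -/

/-- The completion of a number field at a nontrivial absolute value is a finite extension of the
closure of the rational numbers. -/
theorem finite_topologicalClosure_rat {K L : Type*} [Field K] [NumberField K] [NormedField L]
    [CompleteSpace L] [Algebra K L] (hd : DenseRange (algebraMap K L)) (φ : ℚ →+* L)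
    (hn : ∃ x : ℚ, x ≠ 0 ∧ ‖φ x‖ ≠ 1) : Module.Finite φ.fieldRange.topologicalClosure L := by
  set F := φ.fieldRange.topologicalClosure with hF
  have hmem : ∀ x : ℚ, φ x ∈ F := fun x =>
    Subfield.le_topologicalClosure _ ⟨x, rfl⟩
  obtain ⟨x, hx, hx1⟩ := hn
  -- Over a complete nontrivially normed field finite-dimensional subspaces are closed. The span of
  -- a ℚ-basis of K contains the dense image of K, hence is everything.
  let : NontriviallyNormedField F := NontriviallyNormedField.ofNormNeOne
    ⟨⟨φ x, hmem x⟩, fun h => hx (by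
      exact φ.injective ((congrArg Subtype.val h).trans (map_zero φ).symm)), hx1⟩
  have hclosed : IsClosed (F : Set L) := Subfield.isClosed_topologicalClosure _
  have : CompleteSpace F := hclosed.completeSpace_coe
  have : ContinuousSMul F L := ⟨(continuous_subtype_val.comp continuous_fst).mul continuous_snd⟩
  set b := Module.finBasis ℚ K
  set M : Submodule F L := Submodule.span F (range fun i => algebraMap K L (b i)) with hM
  have hfin : Module.Finite F M := Module.Finite.span_of_finite F (finite_range _)
  have hMc : IsClosed (M : Set L) := M.closed_of_finiteDimensional
  have hsub : range (algebraMap K L) ⊆ M := by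
    rintro _ ⟨y, rfl⟩
    rw [← b.sum_repr y, map_sum]
    refine M.sum_mem fun i _ => ?_
    rw [Algebra.smul_def, map_mul, ← RingHom.comp_apply,
      Subsingleton.elim ((algebraMap K L).comp (algebraMap ℚ K)) φ]
    exact M.smul_mem (⟨_, hmem _⟩ : F) (Submodule.subset_span ⟨i, rfl⟩)
  have htop : M = ⊤ := by
    refine SetLike.coe_injective ?_
    exact (hMc.closure_eq.symm.trans (hd.mono hsub).closure_eq)
  exact ⟨htop ▸ Module.Finite.iff_fg.1 hfin⟩

theorem finite_topologicalClosure_rat_of_valued {K L Γ : Type*} [Field K] [NumberField K] [Field L]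
    [LinearOrderedCommGroupWithZero Γ] [hL : Valued L Γ] [hL.v.RankOne] [CompleteSpace L]
    [Algebra K L] (hd : DenseRange (algebraMap K L)) (φ : ℚ →+* L)
    (hn : ∃ x : ℚ, x ≠ 0 ∧ hL.v (φ x) < 1) : Module.Finite φ.fieldRange.topologicalClosure L := by
  let : NormedField L := Valued.toNormedField L Γ
  obtain ⟨x, hx, hx1⟩ := hn
  exact finite_topologicalClosure_rat hd φ ⟨x, hx, (Valued.toNormedField.norm_lt_one_iff.2 hx1).ne⟩

namespace Adelic

variable {K : Type*} [Field K] [NumberField K]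

/-- `Module.finrank` is 0 for infinite extensions, so finiteness over the closure of ℚ has to be
shown. The residue characteristic is a rational number of valuation less than 1. -/
theorem localDegree_pos (v : Place K) : 0 < localDegree v := by
  cases v with
  | inl w => exact w.mult_pos
  | inr v =>
    have hfin : Module.Finite
        (algebraMap ℚ (v.adicCompletion K)).fieldRange.topologicalClosure (v.adicCompletion K) := by
      refine finite_topologicalClosure_rat_of_valued
        (HeightOneSpectrum.denseRange_algebraMap K v) _
        ⟨residueChar v, by exact_mod_cast (residueChar_prime v).out.ne_zero, ?_⟩
      have hp : (residueChar v : 𝓞 K) ∈ v.asIdeal := by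
        rw [← Ideal.Quotient.eq_zero_iff_mem, map_natCast]
        exact ringChar.Nat.cast_ringChar
      have h1 := (v.valuation_lt_one_iff_mem (K := K) _).2 hp
      rw [← v.valuedAdicCompletion_eq_valuation'] at h1
      rw [map_natCast]
      have h2 : algebraMap K (v.adicCompletion K) (algebraMap (𝓞 K) K (residueChar v)) =
          (residueChar v : v.adicCompletion K) := by
        rw [map_natCast, map_natCast]
      rw [← h2]
      exact h1
    exact Module.finrank_pos

theorem weight_pos (v : Place K) : 0 < weight v :=
  div_pos (Nat.cast_pos.2 (localDegree_pos v)) (Nat.cast_pos.2 Module.finrank_pos)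

end Adelic
end

noncomputable section

/-! ### The local pairings at the places of a number field -/

namespace Adelic

open EnergyForm

local notation "conj" => starRingEnd ℂ

variable {K : Type*} [Field K] [NumberField K] (v : Place K)

theorem localPairing_eq_form (μ ν : ComplexMeasure (ProjLine v)) :
    localPairing v μ ν = form (logKernel (kernel v)) μ ν := rfl

theorem exists_isRegularization : ∃ kn, IsRegularization (kernel v) kn := by
  cases v with
  | inl w => exact ⟨_, RiemannSphere.isRegularization⟩
  | inr v => exact ⟨_, (Berkovich.isTreeKernel_sphericalKernel (C := ℂ_[residueChar v])).isRegularization⟩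

variable {v}

theorem mul_norm_mass_sq_le {w : InfinitePlace K} {μ : ComplexMeasure (ProjLine (.inl w : Place K))}
    (hμ : IsAdmissible (kernel (.inl w)) μ) :
    1 / 2 * Real.log 2 * ‖μ univ‖ ^ 2 ≤ (localPairing (.inl w) μ μ).re :=
  RiemannSphere.mul_norm_mass_sq_le hμ

theorem eq_zero_of_localPairing_eq_zero {μ : ComplexMeasure (ProjLine v)}
    (hμ : IsAdmissible (kernel v) μ) (hE : (localPairing v μ μ).re = 0) (hm : μ univ = 0) :
    μ = 0 := by
  cases v with
  | inl w => exact RiemannSphere.eq_zero_of_form_eq_zero hμ hE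
  | inr v =>
    -- A compatible metric provides the instance `HasOuterApproxClosed`.
    let : MetricSpace (OnePoint (Berkovich.AffineLine ℂ_[residueChar v])) :=
      TopologicalSpace.metrizableSpaceMetric _
    exact (Berkovich.isTreeKernel_sphericalKernel (C := ℂ_[residueChar v])).eq_zero_of_form_eq_zero
      hμ hE hm

theorem nullFunctions_eq_top {μs : ℕ → ComplexMeasure (ProjLine v)}
    (hμ : ∀ n, IsAdmissible (kernel v) (μs n)) {V : ℝ} (hV : ∀ n, (μs n).variation.real univ ≤ V)
    (hE : Tendsto (fun n => (localPairing v (μs n) (μs n)).re) atTop (𝓝 0))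
    (hm : Tendsto (fun n => μs n univ) atTop (𝓝 0)) :
    nullFunctions μs (fun n => (hμ n).fin) = ⊤ := by
  cases v with
  | inl w => exact RiemannSphere.nullFunctions_eq_top hμ hV hE
  | inr v =>
    let νs : ℕ → ComplexMeasure (OnePoint (Berkovich.AffineLine ℂ_[residueChar v])) := μs
    exact (Berkovich.isTreeKernel_sphericalKernel (C := ℂ_[residueChar v])).nullFunctions_eq_top
      (μs := νs) hμ hV hE hm

theorem IsBDV.exists_bound {f : ProjLine v → ℝ} (hf : Continuous f) (hB : IsBDV v f) :
    ∃ C D : ℝ, ∀ μ : ComplexMeasure (ProjLine v), IsAdmissible (kernel v) μ →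
      ‖∫ᵛ x, f x ∂•μ - C * μ univ‖ ^ 2 ≤ D * (localPairing v μ μ).re := by
  cases v with
  | inl w => exact RiemannSphere.IsBDV.exists_bound hf hB
  | inr v => exact Berkovich.IsBDV.exists_bound (C := ℂ_[residueChar v]) hf hB

/-- The spherical kernel against the Gauss point is 1, and log 1 = 0. -/
theorem localPairing_dirac (v : HeightOneSpectrum (𝓞 K)) (c : ℂ)
    (ν : ComplexMeasure (ProjLine (.inr v : Place K))) :
    localPairing (.inr v) (VectorMeasure.dirac (gauss v) c) ν = 0 := by
  have h : ∀ y, ∫ᵛ x, Real.log (1 / kernel (.inr v) x y) ∂•(VectorMeasure.dirac (gauss v) c) = 0 := by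
    intro y
    rw [VectorMeasure.integral_dirac]
    have : kernel (.inr v : Place K) (gauss v) y = 1 :=
      Berkovich.sphericalKernel_gaussPoint (C := ℂ_[residueChar v]) y
    simp [this]
  simp only [localPairing, h]
  exact VectorMeasure.integral_zero ..

/-! ### The adelic pairing -/

theorem isAdmissible (μ : space K) (v : Place K) : IsAdmissible (kernel v) (μ.1 v) :=
  ⟨(μ.2.1.isRadon v).1, (μ.2.2.2 v).ae_ne_zero, (μ.2.2.2 v).integrable, (μ.2.2.2 v).continuous⟩

theorem mass_eq (μ : space K) (v w : Place K) : μ.1 v univ = μ.1 w univ := by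
  obtain ⟨c, hc⟩ := μ.2.1.mass
  rw [hc, hc]

theorem finite_localPairing_ne_zero (μ ν : space K) :
    {v : Place K | localPairing v (μ.1 v) (ν.1 v) ≠ 0}.Finite := by
  refine ((finite_range Sum.inl).union (μ.2.2.1.image Sum.inr)).subset fun v hv => ?_
  cases v with
  | inl w => exact Or.inl ⟨w, rfl⟩
  | inr v =>
    refine Or.inr ⟨v, fun he => hv ?_, rfl⟩
    rw [he]
    exact localPairing_dirac v _ _

theorem finite_support (μ ν : space K) :
    (Function.support fun v : Place K => (weight v : ℂ) * localPairing v (μ.1 v) (ν.1 v)).Finite :=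
  (finite_localPairing_ne_zero μ ν).subset fun _ hv => right_ne_zero_of_mul hv

theorem conj_pairing (μ ν : space K) : conj (pairing μ ν) = pairing ν μ := by
  rw [pairing, pairing]
  change (starRingEnd ℂ).toAddMonoidHom _ = _
  rw [AddMonoidHom.map_finsum _ (finite_support μ ν)]
  refine finsum_congr fun v => ?_
  obtain ⟨kn, hk⟩ := exists_isRegularization v
  change conj _ = _
  rw [map_mul, Complex.conj_ofReal, localPairing_eq_form,
    hk.conj_form (isAdmissible ν v) (isAdmissible μ v)]
  rfl

theorem pairing_add_left (μ ν ρ : space K) : pairing (μ + ν) ρ = pairing μ ρ + pairing ν ρ := by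
  rw [pairing, pairing, pairing, ← finsum_add_distrib (finite_support μ ρ) (finite_support ν ρ)]
  refine finsum_congr fun v => ?_
  obtain ⟨kn, hk⟩ := exists_isRegularization v
  rw [← mul_add]
  congr 1
  exact form_add_left ((isAdmissible μ v).isGood hk.symm) ((isAdmissible ν v).isGood hk.symm)
    (isAdmissible ρ v).fin

theorem pairing_smul_left (c : ℂ) (μ ρ : space K) : pairing (c • μ) ρ = c * pairing μ ρ := by
  rw [pairing, pairing, mul_finsum]
  refine finsum_congr fun v => ?_
  obtain ⟨kn, hk⟩ := exists_isRegularization v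
  rw [mul_left_comm]
  congr 1
  exact form_smul_left c ((isAdmissible μ v).isGood hk.symm) (isAdmissible ρ v).fin

theorem localPairing_nonneg (μ : space K) (v : Place K) :
    0 ≤ (localPairing v (μ.1 v) (μ.1 v)).re := by
  obtain ⟨kn, hk⟩ := exists_isRegularization v
  exact hk.form_nonneg (isAdmissible μ v)

theorem pairing_re (μ : space K) :
    (pairing μ μ).re = ∑ᶠ v : Place K, weight v * (localPairing v (μ.1 v) (μ.1 v)).re := by
  rw [pairing]
  change Complex.reLm.toAddMonoidHom _ = _
  rw [AddMonoidHom.map_finsum _ (finite_support μ μ)]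
  refine finsum_congr fun v => ?_
  exact Complex.re_ofReal_mul _ _

/-- All terms of the finite sum are nonnegative. Local conclusions are drawn from the global norm
through this inequality. -/
theorem weight_mul_localPairing_le (μ : space K) (v : Place K) :
    weight v * (localPairing v (μ.1 v) (μ.1 v)).re ≤ (pairing μ μ).re := by
  rw [pairing_re]
  refine single_le_finsum v ?_ fun w => mul_nonneg (weight_pos w).le (localPairing_nonneg μ w)
  refine (finite_localPairing_ne_zero μ μ).subset fun w hw h0 => hw ?_
  simp only [h0, Complex.zero_re, mul_zero]

theorem pairing_nonneg (μ : space K) : 0 ≤ (pairing μ μ).re := by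
  rw [pairing_re]
  exact finsum_nonneg fun w => mul_nonneg (weight_pos w).le (localPairing_nonneg μ w)

/-- All local energies vanish. An archimedean place then gives mass zero, the mass is the same
everywhere, and each local form is definite on measures of mass zero. -/
theorem eq_zero_of_pairing_eq_zero {μ : space K} (h : pairing μ μ = 0) : μ = 0 := by
  have hE : ∀ v, (localPairing v (μ.1 v) (μ.1 v)).re = 0 := fun v => by
    have h1 := weight_mul_localPairing_le μ v
    rw [h, Complex.zero_re] at h1
    exact le_antisymm (nonpos_of_mul_nonpos_right h1 (weight_pos v)) (localPairing_nonneg μ v)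
  obtain ⟨w⟩ := (inferInstance : Nonempty (InfinitePlace K))
  have hm : μ.1 (.inl w) univ = 0 := by
    have h1 := mul_norm_mass_sq_le (isAdmissible μ (.inl w))
    rw [hE] at h1
    have h2 : 0 < 1 / 2 * Real.log 2 := by have := Real.log_pos one_lt_two; positivity
    have h3 := nonpos_of_mul_nonpos_right h1 h2
    exact norm_eq_zero.1 (pow_eq_zero_iff two_ne_zero |>.1 (le_antisymm h3 (sq_nonneg _)))
  refine Subtype.ext (funext fun v => ?_)
  exact eq_zero_of_localPairing_eq_zero (isAdmissible μ v) (hE v) ((mass_eq μ v (.inl w)).trans hm)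

variable (K) in
/-- The adelic pairing as an inner product. -/
@[reducible]
def innerProductCore : InnerProductSpace.Core ℂ (space K) where
  inner ν μ := pairing μ ν
  conj_inner_symm μ ν := conj_pairing μ ν
  re_inner_nonneg μ := pairing_nonneg μ
  add_left μ ν ρ := by
    rw [← conj_pairing, pairing_add_left, map_add, conj_pairing, conj_pairing]
  smul_left μ ν c := by
    rw [← conj_pairing, pairing_smul_left, map_mul, conj_pairing]
  definite _ h := eq_zero_of_pairing_eq_zero h

/-! ### Convergence in norm -/

section Convergence

variable {δ : ℕ → space K} (hδ : Tendsto (fun n => adelicNorm (δ n)) atTop (𝓝 0))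

include hδ

theorem tendsto_localPairing (v : Place K) :
    Tendsto (fun n => (localPairing v ((δ n).1 v) ((δ n).1 v)).re) atTop (𝓝 0) := by
  have h1 : Tendsto (fun n => (pairing (δ n) (δ n)).re / weight v) atTop (𝓝 0) := by
    have := (hδ.pow 2).div_const (weight v)
    rw [zero_pow two_ne_zero, zero_div] at this
    refine this.congr fun n => ?_
    rw [adelicNorm, Real.sq_sqrt (pairing_nonneg _)]
  refine squeeze_zero (fun n => localPairing_nonneg _ _) (fun n => ?_) h1
  rw [le_div_iff₀' (weight_pos v)]
  exact weight_mul_localPairing_le _ _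

/-- The mass does not depend on the place and is controlled at an archimedean one; this supplies
what the non-archimedean energies do not see. -/
theorem tendsto_mass (v : Place K) : Tendsto (fun n => (δ n).1 v univ) atTop (𝓝 0) := by
  obtain ⟨w⟩ := (inferInstance : Nonempty (InfinitePlace K))
  have h2 : 0 < 1 / 2 * Real.log 2 := by have := Real.log_pos one_lt_two; positivity
  have h3 : Tendsto (fun n => ‖(δ n).1 (.inl w) univ‖ ^ 2) atTop (𝓝 0) := by
    have := (tendsto_localPairing hδ (.inl w)).div_const (1 / 2 * Real.log 2)
    rw [zero_div] at this
    refine squeeze_zero (fun n => sq_nonneg _) (fun n => ?_) this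
    rw [le_div_iff₀' h2]
    exact mul_norm_mass_sq_le (isAdmissible (δ n) (.inl w))
  have h4 : Tendsto (fun n => ‖(δ n).1 (.inl w) univ‖) atTop (𝓝 0) := by
    have := h3.sqrt
    simpa using this
  simp_rw [fun n => mass_eq (δ n) v (.inl w)]
  exact tendsto_zero_iff_norm_tendsto_zero.2 h4

/-- The local energy controls the integral up to a fixed multiple of the mass, and both tend to
zero. -/
theorem tendsto_integral_of_isBDV {v : Place K} {f : ProjLine v → ℝ} (hf : Continuous f)
    (hB : IsBDV v f) : Tendsto (fun n => ∫ᵛ x, f x ∂•((δ n).1 v)) atTop (𝓝 0) := by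
  obtain ⟨C, D, hCD⟩ := hB.exists_bound hf
  have h1 : Tendsto (fun n => ‖∫ᵛ x, f x ∂•((δ n).1 v) - C * (δ n).1 v univ‖ ^ 2) atTop (𝓝 0) := by
    have := (tendsto_localPairing hδ v).const_mul D
    rw [mul_zero] at this
    exact squeeze_zero (fun n => sq_nonneg _) (fun n => hCD _ (isAdmissible (δ n) v)) this
  have h2 : Tendsto (fun n => ∫ᵛ x, f x ∂•((δ n).1 v) - C * (δ n).1 v univ) atTop (𝓝 0) := by
    refine tendsto_zero_iff_norm_tendsto_zero.2 ?_
    have := h1.sqrt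
    simpa using this
  simpa using h2.add ((tendsto_mass hδ v).const_mul (C : ℂ))

theorem tendsto_integral_of_continuous {v : Place K} {V : ℝ}
    (hV : ∀ n, ((δ n).1 v).variation.real univ ≤ V) {f : ProjLine v → ℂ} (hf : Continuous f) :
    Tendsto (fun n => ∫ᵛ x, f x ∂[ContinuousLinearMap.mul ℝ ℂ; (δ n).1 v]) atTop (𝓝 0) :=
  tendsto_integral_mul _ (fun n => (isAdmissible (δ n) v).fin)
    (nullFunctions_eq_top (fun n => isAdmissible (δ n) v) hV (tendsto_localPairing hδ v)
      (tendsto_mass hδ v)) hf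

end Convergence

end Adelic

theorem theorem1p1 (K : Type*) [Field K] [NumberField K] :
    -- only finitely many terms of the sum `⟨μ, ν⟩` are non-zero
    (∀ μ ν : Adelic.space K,
      {v : Adelic.Place K | Adelic.localPairing v (μ.1 v) (ν.1 v) ≠ 0}.Finite) ∧
    -- `⟨·, ·⟩` is an inner product, linear in the first variable
    -- (inner products of the library are linear in the second variable)
    (∃ core : InnerProductSpace.Core ℂ (Adelic.space K),
      ∀ μ ν : Adelic.space K, core.inner ν μ = Adelic.pairing μ ν) ∧
    -- convergence in norm
    (∀ (μs : ℕ → Adelic.space K) (μ : Adelic.space K),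
      Tendsto (fun n => Adelic.adelicNorm (μs n - μ)) atTop (𝓝 0) →
      ∀ v : Adelic.Place K,
        (∀ f : Adelic.ProjLine v → ℝ, Continuous f → Adelic.IsBDV v f →
          Tendsto (fun n => ∫ᵛ x, f x ∂•((μs n).1 v)) atTop (𝓝 (∫ᵛ x, f x ∂•(μ.1 v)))) ∧
        ((⨆ n, ((μs n).1 v).variation univ) < ⊤ →
          ∀ f : Adelic.ProjLine v → ℂ, Continuous f →
            Tendsto (fun n => ∫ᵛ x, f x ∂[ContinuousLinearMap.mul ℝ ℂ; (μs n).1 v]) atTop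
              (𝓝 (∫ᵛ x, f x ∂[ContinuousLinearMap.mul ℝ ℂ; μ.1 v])))) := by
  refine ⟨Adelic.finite_localPairing_ne_zero, ⟨Adelic.innerProductCore K, fun _ _ => rfl⟩,
    fun μs μ h v => ?_⟩
  have hfin : ∀ ν : Adelic.space K, IsFiniteMeasure (ν.1 v).variation := fun ν =>
    (Adelic.isAdmissible ν v).fin
  have := hfin μ
  have := fun n => hfin (μs n)
  refine ⟨fun f hf hB => ?_, fun hV f hf => ?_⟩
  · have h1 := (Adelic.tendsto_integral_of_isBDV h hf hB).add_const (∫ᵛ x, f x ∂•(μ.1 v))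
    rw [zero_add] at h1
    refine h1.congr fun n => ?_
    have h2 : ∫ᵛ x, f x ∂•((μs n - μ).1 v) = ∫ᵛ x, f x ∂•((μs n).1 v) - ∫ᵛ x, f x ∂•(μ.1 v) :=
      VectorMeasure.integral_sub_vectorMeasure (EnergyForm.integrable_of_continuous hf _)
        (EnergyForm.integrable_of_continuous hf _)
    rw [h2, sub_add_cancel]
  -- The weak convergence argument runs on the differences; their total variations are bounded by
  -- subadditivity.
  · have hbd : ∀ n, ((μs n - μ).1 v).variation.real univ ≤
        (⨆ n, ((μs n).1 v).variation univ).toReal + (μ.1 v).variation.real univ := fun n => by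
      have h1 : ((μs n - μ).1 v).variation univ ≤
          ((μs n).1 v).variation univ + (μ.1 v).variation univ :=
        VectorMeasure.variation_sub_le univ
      have h2 : ((μs n).1 v).variation univ ≤ ⨆ n, ((μs n).1 v).variation univ :=
        le_iSup (fun n => ((μs n).1 v).variation univ) n
      rw [Measure.real, Measure.real, ← ENNReal.toReal_add hV.ne (measure_ne_top _ _)]
      exact ENNReal.toReal_mono (ENNReal.add_ne_top.2 ⟨hV.ne, measure_ne_top _ _⟩)
        (h1.trans (add_le_add_left h2 _))
    have h1 := (Adelic.tendsto_integral_of_continuous h hbd hf).add_const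
      (∫ᵛ x, f x ∂[ContinuousLinearMap.mul ℝ ℂ; μ.1 v])
    rw [zero_add] at h1
    refine h1.congr fun n => ?_
    have h2 : ∫ᵛ x, f x ∂[ContinuousLinearMap.mul ℝ ℂ; (μs n - μ).1 v] =
        ∫ᵛ x, f x ∂[ContinuousLinearMap.mul ℝ ℂ; (μs n).1 v] -
          ∫ᵛ x, f x ∂[ContinuousLinearMap.mul ℝ ℂ; μ.1 v] :=
      VectorMeasure.integral_sub_vectorMeasure (EnergyForm.integrable_of_continuous hf _)
        (EnergyForm.integrable_of_continuous hf _)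
    rw [h2, sub_add_cancel]

end
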